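/- **Setting.** Let $d\ge 0$, $g>0$, and let $\omega\in\mathbb R^d$ be Diophantine: $|\omega\cdot q|\ge a|q|^{-\nu}$ for all $q\in\mathbb Z^d\setminus\{0\}$, with some $a,\nu>0$. Let $f:\mathbb R\times\mathbb R^d\to\mathbb R$, $(\phi,\psi)\mapsto f(\phi,\psi)$, be real-analytic, $2\pi$-periodic in each variable, even, $f(-\phi,-\psi)=f(\phi,\psi)$, and a trigonometric polynomial in $\psi$. Write $\varphi=(\phi,\psi)$, $\partial=\partial_\varphi$, $\lambda=\epsilon g^2$, $\Phi^0(z)=4\arctan z$, and $\Omega(X)(z,\theta)=(g^2\sin\Phi,0)+\lambda\,\partial f(X(z,\theta)+(0,\theta))$ for $X=(\Phi,\Psi)$. Let $\gamma=\gamma(\epsilon)$ and $X=X(\epsilon;z,\theta)\in\mathbb R\times\mathbb R^d$ ($|\epsilon|<\epsilon_0$, $z\in\mathbb R$, $\theta\in\mathbb R^d$) be a parametrized unstable manifold: they are real-analytic (jointly in all variables), $X$ is $2\pi$-periodic in $\theta$, $\gamma(0)=g$, $X(0;z,\theta)=(\Phi^0(z),0)$, $$\mathcal L^2X=\Omega(X),\qquad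 \mathcal L=\omega\cdot\partial_\theta+\gamma z\partial_z ,$$ and $X(\epsilon;1,0)=(\pi,0)$. Take $z=1$ throughout and put $$X^u(t;\theta)=X(e^{\gamma t},\theta+\omega t),\qquad X^s(t;\theta)=(2\pi,0)-X^u(-t;-\theta),\qquad Y^{s,u}=\partial_tX^{s,u},$$ $f^{s,u}(t;\theta)=f(X^{s,u}(t;\theta)+(0,\theta+\omega t))$, with subscripts $\psi,\varphi$ denoting partial derivatives of $f$ evaluated at the same point. The homoclinic trajectory is $(z,\theta)=(1,0)$, and the splitting matrix is $\Upsilon(t)=\partial_\theta(Y^u_\Psi-Y^s_\Psi)(t;\theta)|_{\theta=0}$. Put $$M^{s}=\begin{pmatrix}g^2\cos\Phi^s-\gamma^2\cos\Phi^0(e^{\gamma t})&0\\0&0\end{pmatrix}+\lambda f^s_{\varphi\varphi},\qquad \mathfrak A^u=\Omega(X^u)-\begin{pmatrix}\gamma^2\cos\Phi^0(e^{\gamma t})&0\\0&0\end{pmatrix}X^u .$$ With $P(t)=e^{\gamma t}/(e^{2\gamma t}+1)$ and $Q(t)=e^{-\gamma t}(e^{2\gamma t}-1)$, let $K(t,\tau)=\sum_{i=0}^1\sum_{j=1}^2(t-\tau)^iK_{ij}(t)\bar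 K_{ij}(\tau)$, where, in the block form $\mathbb R\oplus\mathbb R^d$, $$K_{01}=\tfrac1{2\gamma}\,\mathrm{diag}(Q,0),\quad K_{02}=-\tfrac1{2\gamma}\,\mathrm{diag}(P,0),\quad K_{11}=2\,\mathrm{diag}(P,0),\quad \bar K_{01}=\bar K_{11}=\mathrm{diag}(P,0),\quad \bar K_{02}=\mathrm{diag}(Q,0),\quad K_{12}=\bar K_{12}=\mathrm{diag}(0,\mathbf 1).$$ **Regularized integrals** (written $\mathrm{R}\!\!\int$). For $h(\tau;\theta)$ and $S=(-\infty,t]$ or $[t,\infty)$, let $$\mathrm{R}\!\!\int_Sh(\tau;\theta)\,d\tau=\lim_{N\to\infty}\operatorname*{res}_{R=0}\frac1R\int_Se^{-R|\tau|}\,T_Nh(\tau;\theta)\,d\tau,\qquad T_Nh=\sum_{|q|\le N}\hat h(\tau;q)e^{iq\cdot\theta},$$ where the integral converges absolutely for large $\operatorname{Re}R$ and the residue is that of its meromorphic continuation to some half-plane $\operatorname{Re}R>-\delta$, $\delta>0$. Put $\mathrm{R}\!\!\int_{\infty}^t=-\mathrm{R}\!\!\int_t^\infty$, $\mathrm{R}\!\!\int_{-\infty}^\infty=\mathrm{R}\!\!\int_{-\infty}^0+\mathrm{R}\!\!\int_0^\infty$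 and $\mathrm{R}\!\!\int_\infty^{-\infty}=-\mathrm{R}\!\!\int_{-\infty}^\infty$. All expressions containing regularized integrals are formal power series in $\epsilon$: for fixed $(t,\theta)$ every factor (including its dependence on $\epsilon$ through $\gamma(\epsilon)$) is replaced by its Taylor series at $\epsilon=0$, products are Cauchy products, and $\mathrm{R}\!\!\int$ acts on each coefficient (on each entry of a matrix). In this sense let $$Bh(t;\theta)=\mathrm{R}\!\!\int_\infty^tK(t,\tau)h(\tau;\theta)\,d\tau,\qquad \mathcal E(t;\theta)=\mathrm{R}\!\!\int_\infty^{-\infty}K(t,\tau)\,\partial_\theta\mathfrak A^u(\tau;\theta)\,d\tau,$$ and, for $0\le p\le i\le1$ and $j\in\{1,2\}$, let $K^p_{ij}(t)=t^pK_{ij}(t)$ and, on the homoclinic trajectory $\theta=0$, $$\mathcal E^p_{ij}=-\mathrm{R}\!\!\int_{-\infty}^\infty(-\tau)^{i-p}\bar K_{ij}(\tau)\,\partial_\theta\mathfrak A^u(\tau)\,d\tau,\qquad c^p_{ij}(t)=\mathrm{R}\!\!\int_t^\infty\Bigl[f^s_{\psi\varphi}\sum_{l=0}^\infty(BM^s)^lK^p_{ij}\Bigr](\tau)\,d\tau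 .$$ Thus the $\mathcal E_{ij}^p$ do not depend on $t$. **Claim.** At every order in $\epsilon$ all regularized integrals occurring in $\lambda\,\mathrm{R}\!\!\int_{-\infty}^\infty\partial_\theta f^u_\psi$, $\mathcal E$, $\mathcal E^p_{ij}$, $c^p_{ij}(t)$, in the terms $(BM^s)^lK^p_{ij}$ and $(BM^s)^l\mathcal E$, and in $\mathrm{R}\!\!\int_t^\infty f^s_{\psi\varphi}\sum_l(BM^s)^l\mathcal E$ exist; the terms $(BM^s)^lK^p_{ij}$ and $(BM^s)^l\mathcal E$ vanish at all orders below $\epsilon^l$, so the Neumann series are finite sums at each order. For every $t\in\mathbb R$, $\Upsilon(t)$ is analytic in $\epsilon$ near $0$ and has, on the homoclinic trajectory, the asymptotic expansions $$\Upsilon(t)=\mathrm{R}\!\!\int_{-\infty}^\infty\lambda\,\partial_\theta f^u_\psi(\tau)\,d\tau+\lambda\,\mathrm{R}\!\!\int_t^\infty\Bigl[f^s_{\psi\varphi}\sum_{l=0}^\infty(BM^s)^l\mathcal E\Bigr](\tau)\,d\tau$$ and $$\Upsilon(t)=\mathrm{R}\!\!\int_{-\infty}^\infty\lambda\,\partial_\theta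 f^u_\psi(\tau)\,d\tau+\lambda\sum_{i=0}^1\sum_{p=0}^i\sum_{j=1}^2c^p_{ij}(t)\,\mathcal E^p_{ij},$$ in the sense that for each $\ell$ the coefficient of $\epsilon^\ell$ in the Taylor series of $\Upsilon(t)$ equals the coefficient of $\epsilon^\ell$ on the right-hand side and, for each $k$, $\Upsilon(t)$ minus the right-hand side truncated after $\epsilon^k$ is $O(\epsilon^{k+1})$ as $\epsilon\to0$. -/

import Mathlib

noncomputable section

namespace HomoclinicSplitting

/-! ### Regularized integrals -/

section Regularized

variable {d : ℕ}

/-- The Fourier coefficient `ĥ(q)` of a function of `θ ∈ ℝ^d` that is `2π`-periodic in each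
variable. -/
def fourierCoefficient (h : (Fin d → ℝ) → ℂ) (q : Fin d → ℤ) : ℂ :=
  ((2 * Real.pi : ℝ) : ℂ)⁻¹ ^ d *
    ∫ θ in Set.pi Set.univ (fun _ : Fin d => Set.Ioc (0 : ℝ) (2 * Real.pi)),
      h θ * Complex.exp (-(Complex.I * ((∑ i, (q i : ℝ) * θ i : ℝ) : ℂ)))

/-- The finite set `{q ∈ ℤ^d : |q| ≤ N}`, where `|q| = ∑ |q_i|`. -/
def freqBall (d N : ℕ) : Finset (Fin d → ℤ) :=
  (Fintype.piFinset fun _ : Fin d => Finset.Icc (-(N : ℤ)) N).filter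
    fun q => ∑ i, (q i).natAbs ≤ N

/-- The truncation `T_N h(θ) = ∑_{|q| ≤ N} ĥ(q) e^{i q·θ}`. -/
def truncation (N : ℕ) (h : (Fin d → ℝ) → ℂ) (θ : Fin d → ℝ) : ℂ :=
  ∑ q ∈ freqBall d N,
    fourierCoefficient h q * Complex.exp (Complex.I * ((∑ i, (q i : ℝ) * θ i : ℝ) : ℂ))

/-- `a` is the residue at `R = 0` of `R⁻¹ ∫_S e^{-R|τ|} h(τ) dτ`: the integral converges absolutely
on a half-plane `Re R > c`, it continues to a function `G` which is meromorphic on a half-plane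
`Re R > -δ` containing the origin, and `a` is the residue at the origin of `R⁻¹ G(R)`
(the normalized integral over all sufficiently small circles). -/
def HasRegResidue (S : Set ℝ) (h : ℝ → ℂ) (a : ℂ) : Prop :=
  ∃ (G : ℂ → ℂ) (c δ : ℝ), 0 < δ ∧
    MeromorphicOn G {R : ℂ | -δ < R.re} ∧
    (∀ R : ℂ, c < R.re →
      MeasureTheory.IntegrableOn (fun τ : ℝ => Complex.exp (-(R * ((|τ| : ℝ) : ℂ))) * h τ) S ∧
      G R = ∫ τ in S, Complex.exp (-(R * ((|τ| : ℝ) : ℂ))) * h τ) ∧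
    ∀ᶠ r in nhdsWithin (0 : ℝ) (Set.Ioi 0),
      (2 * (Real.pi : ℂ) * Complex.I)⁻¹ * (∮ R in C(0, r), R⁻¹ * G R) = a

/-- `a` is the regularized integral over `S` of `h(τ, θ)`, at the parameter `θ`:
the limit as `N → ∞` of `res_{R = 0} R⁻¹ ∫_S e^{-R|τ|} T_N h(τ, θ) dτ`. -/
def HasRegIntegral (S : Set ℝ) (h : ℝ → (Fin d → ℝ) → ℂ) (θ : Fin d → ℝ) (a : ℂ) : Prop :=
  ∃ ρ : ℕ → ℂ,
    (∀ N, HasRegResidue S (fun τ => truncation N (h τ) θ) (ρ N)) ∧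
    Filter.Tendsto ρ Filter.atTop (nhds a)

def RegIntegrable (S : Set ℝ) (h : ℝ → (Fin d → ℝ) → ℂ) (θ : Fin d → ℝ) : Prop :=
  ∃ a, HasRegIntegral S h θ a

open Classical in
/-- The regularized integral (with the value `0` when it does not exist). -/
def regIntegral (S : Set ℝ) (h : ℝ → (Fin d → ℝ) → ℂ) (θ : Fin d → ℝ) : ℂ :=
  if hh : RegIntegrable S h θ then Classical.choose hh else 0

variable {m n : Type}

/-- Existence of the regularized integrals of all entries of a matrix-valued function. -/
def MatRegIntegrable (S : Set ℝ) (H : ℝ → (Fin d → ℝ) → Matrix m n ℂ) (θ : Fin d → ℝ) : Prop :=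
  ∀ a b, RegIntegrable S (fun τ θ' => H τ θ' a b) θ

/-- The regularized integral of a matrix-valued function, entry by entry. -/
def matRegIntegral (S : Set ℝ) (H : ℝ → (Fin d → ℝ) → Matrix m n ℂ) (θ : Fin d → ℝ) :
    Matrix m n ℂ :=
  Matrix.of fun a b => regIntegral S (fun τ θ' => H τ θ' a b) θ

/-- Existence of the regularized integral over the whole line: both halves exist, for every
splitting point. -/
def LineRegIntegrable (H : ℝ → (Fin d → ℝ) → Matrix m n ℂ) (θ : Fin d → ℝ) : Prop :=
  ∀ t, MatRegIntegrable (Set.Iic t) H θ ∧ MatRegIntegrable (Set.Ici t) H θ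

/-- The regularized integral over the whole line, the sum of the regularized integrals over
`(-∞, 0]` and `[0, ∞)`. -/
def lineRegIntegral (H : ℝ → (Fin d → ℝ) → Matrix m n ℂ) (θ : Fin d → ℝ) : Matrix m n ℂ :=
  matRegIntegral (Set.Iic 0) H θ + matRegIntegral (Set.Ici 0) H θ

end Regularized

/-! ### Power series in `ε` -/

section Series

/-- The coefficient of `ε^ℓ` in the Taylor expansion at `ε = 0`. -/
def taylorCoeff (F : ℝ → ℝ) (ℓ : ℕ) : ℝ := iteratedDeriv ℓ F 0 / (ℓ.factorial : ℝ)

/-- Power series in `ε` whose coefficients are matrix-valued functions of `(t, θ)`. -/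
abbrev Ser (d : ℕ) (m n : Type) : Type := ℕ → ℝ → (Fin d → ℝ) → Matrix m n ℂ

variable {d : ℕ} {m k n : Type}

/-- The Taylor series in `ε` of a family of matrix-valued functions of `(t, θ)`. -/
def series (F : ℝ → ℝ → (Fin d → ℝ) → Matrix m n ℝ) : Ser d m n :=
  fun ℓ t θ => Matrix.of fun a b => ((taylorCoeff (fun ε => F ε t θ a b) ℓ : ℝ) : ℂ)

/-- The Cauchy product of power series with matrix coefficients. -/
def cauchyMul [Fintype k] (A : ℕ → Matrix m k ℂ) (B : ℕ → Matrix k n ℂ) : ℕ → Matrix m n ℂ :=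
  fun ℓ => ∑ x ∈ Finset.HasAntidiagonal.antidiagonal ℓ, A x.1 * B x.2

/-- The product of two power series whose coefficients are functions of `(t, θ)`. -/
def Ser.mul [Fintype k] (A : Ser d m k) (B : Ser d k n) : Ser d m n :=
  fun ℓ t θ => cauchyMul (fun r => A r t θ) (fun r => B r t θ) ℓ

/-- Multiplication of a power series in `ε` by `λ = ε g²`. -/
def lamMul {V : Type} [AddCommGroup V] [Module ℂ V] (g : ℝ) (A : ℕ → V) : ℕ → V
  | 0 => 0
  | ℓ + 1 => ((g ^ 2 : ℝ) : ℂ) • A ℓ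

/-- `A` is the asymptotic expansion of `F` in powers of `ε`, as `ε → 0`. -/
def IsAsymptoticExpansion (F : ℝ → ℂ) (A : ℕ → ℂ) : Prop :=
  ∀ k : ℕ, (fun ε : ℝ => F ε - ∑ ℓ ∈ Finset.range (k + 1), (ε : ℂ) ^ ℓ * A ℓ)
    =O[nhds 0] fun ε : ℝ => ε ^ (k + 1)

end Series

/-! ### The model -/

/-- Partial derivative with respect to the `i`-th coordinate. -/
def pd {n : ℕ} (F : (Fin n → ℝ) → ℝ) (i : Fin n) (x : Fin n → ℝ) : ℝ :=
  fderiv ℝ F x (Pi.single i 1)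

/-- The data of the quasiperiodically forced pendulum. A point `φ = (φ, ψ)` of `ℝ × ℝ^d` is a
vector indexed by `Fin (d + 1)`: the entry `0` is the pendulum angle and the entries `a.succ` are
the angles `ψ_a` of the rotators. The forcing potential `f` is real-analytic, `2π`-periodic in
every angle, even, and a trigonometric polynomial in `ψ`; `ω` is Diophantine. -/
structure ForcedPendulum (d : ℕ) where
  ω : Fin d → ℝ
  g : ℝ
  f : (Fin (d + 1) → ℝ) → ℝ
  g_pos : 0 < g
  diophantine : ∃ a ν : ℝ, 0 < a ∧ 0 < ν ∧ ∀ q : Fin d → ℤ, q ≠ 0 →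
    a * (∑ i, |(q i : ℝ)|) ^ (-ν) ≤ |∑ i, ω i * (q i : ℝ)|
  f_analytic : AnalyticOnNhd ℝ f Set.univ
  f_periodic : ∀ (x : Fin (d + 1) → ℝ) (k : Fin (d + 1) → ℤ),
    f (fun α => x α + 2 * Real.pi * (k α : ℝ)) = f x
  f_even : ∀ x, f (-x) = f x
  f_trigonometric : ∃ (Q : Finset (Fin d → ℤ)) (c : (Fin d → ℤ) → ℝ → ℂ),
    ∀ (x : ℝ) (ψ : Fin d → ℝ), (f (Fin.cons x ψ) : ℂ) =
      ∑ q ∈ Q, c q x * Complex.exp (Complex.I * ((∑ i, (q i : ℝ) * ψ i : ℝ) : ℂ))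

namespace ForcedPendulum

variable {d : ℕ}

/-- `Ω(X)(θ) = (g² sin Φ, 0) + λ ∂f(X + (0, θ))` with `λ = ε g²`, as a function of the value
`X = (Φ, Ψ)`. -/
def Omega (S : ForcedPendulum d) (ε : ℝ) (X : Fin (d + 1) → ℝ) (θ : Fin d → ℝ) :
    Fin (d + 1) → ℝ :=
  fun α => (if α = 0 then S.g ^ 2 * Real.sin (X 0) else 0) +
    ε * S.g ^ 2 * pd S.f α (X + Fin.cons 0 θ)

/-- The differential operator `ℒ = ω·∂_θ + γ z ∂_z`. -/
def flowDeriv (S : ForcedPendulum d) (γ : ℝ) (h : ℝ → (Fin d → ℝ) → (Fin (d + 1) → ℝ)) (z : ℝ)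
    (θ : Fin d → ℝ) : Fin (d + 1) → ℝ :=
  fderiv ℝ (fun p : ℝ × (Fin d → ℝ) => h p.1 p.2) (z, θ) (γ * z, S.ω)

end ForcedPendulum

/-- The parametrized unstable manifold of the invariant torus of the pendulum forced with strength
`λ = ε g²`, for `ε` near `0`: the Lyapunov exponent `γ(ε)` and the map `X(ε; z, θ)`, analytic,
`2π`-periodic in `θ`, equal to `(4 arctan z, 0)` for `ε = 0`, such that
`t ↦ X(ε; z e^{γ t}, θ + ω t) + (0, θ + ω t)` solves the equations of motion, i.e.
`ℒ² X = Ω(X)`. The freedom of rescaling `z` and translating `θ` is fixed by `X(ε; 1, 0) = (π, 0)`,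
so that `(z, θ) = (1, 0)` lies on the homoclinic trajectory. -/
structure UnstableManifold {d : ℕ} (S : ForcedPendulum d) where
  ε₀ : ℝ
  γ : ℝ → ℝ
  X : ℝ → ℝ → (Fin d → ℝ) → (Fin (d + 1) → ℝ)
  ε₀_pos : 0 < ε₀
  γ_analytic : ∀ ε, |ε| < ε₀ → AnalyticAt ℝ γ ε
  γ_zero : γ 0 = S.g
  X_analytic : ∀ ε z θ, |ε| < ε₀ →
    AnalyticAt ℝ (fun p : ℝ × ℝ × (Fin d → ℝ) => X p.1 p.2.1 p.2.2) (ε, z, θ)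
  X_periodic : ∀ ε z θ (k : Fin d → ℤ), |ε| < ε₀ →
    X ε z (fun i => θ i + 2 * Real.pi * (k i : ℝ)) = X ε z θ
  X_zero : ∀ z θ, X 0 z θ = Fin.cons (4 * Real.arctan z) 0
  X_equation : ∀ ε z θ, |ε| < ε₀ →
    S.flowDeriv (γ ε) (S.flowDeriv (γ ε) (X ε)) z θ = S.Omega ε (X ε z θ) θ
  X_normalized : ∀ ε, |ε| < ε₀ → X ε 1 0 = Fin.cons Real.pi 0

namespace UnstableManifold

variable {d : ℕ} {S : ForcedPendulum d} (U : UnstableManifold S)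

/-! All functions of `(t; z, θ)` below are taken at `z = 1`; the homoclinic trajectory is
then `θ = 0`. -/

/-- `X^u(t; 1, θ) = X(e^{γ t}, θ + ω t)`. -/
def Xu (ε t : ℝ) (θ : Fin d → ℝ) : Fin (d + 1) → ℝ :=
  U.X ε (Real.exp (U.γ ε * t)) (θ + t • S.ω)

/-- `X^s(t; 1, θ) = (2π, 0) - X^u(-t; 1, -θ)`. -/
def Xs (ε t : ℝ) (θ : Fin d → ℝ) : Fin (d + 1) → ℝ :=
  Fin.cons (2 * Real.pi) 0 - U.Xu ε (-t) (-θ)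

/-- `Δ = Y^u_Ψ - Y^s_Ψ` with `Y = ∂_t X`. -/
def Delta (ε t : ℝ) (θ : Fin d → ℝ) (a : Fin d) : ℝ :=
  deriv (fun s => U.Xu ε s θ a.succ) t - deriv (fun s => U.Xs ε s θ a.succ) t

/-- The splitting matrix `Υ(t) = ∂_θ Δ(t; 1, 0)`. -/
def Upsilon (ε t : ℝ) : Matrix (Fin d) (Fin d) ℝ :=
  Matrix.of fun a b => pd (fun θ => U.Delta ε t θ a) b 0

/-- The family `∂_θ f^u_ψ`, where `f^u_ψ(t; θ) = ∂_ψ f(X^u(t; θ) + (0, θ + ω t))`. -/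
def dThetaFu (ε t : ℝ) (θ : Fin d → ℝ) : Matrix (Fin d) (Fin d) ℝ :=
  Matrix.of fun a b =>
    pd (fun θ' => pd S.f a.succ (U.Xu ε t θ' + Fin.cons 0 (θ' + t • S.ω))) b θ

/-- The family `f^s_{ψφ}`: the mixed second derivatives of `f` along `X^s`. -/
def fs (ε t : ℝ) (θ : Fin d → ℝ) : Matrix (Fin d) (Fin (d + 1)) ℝ :=
  Matrix.of fun a β => pd (pd S.f β) a.succ (U.Xs ε t θ + Fin.cons 0 (θ + t • S.ω))

/-- The family
`M^s = diag(g² cos Φ^s - γ² cos Φ^0(e^{γ t}), 0) + λ f^s_{φφ}`, with `Φ^0(z) = 4 arctan z`. -/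
def Ms (ε t : ℝ) (θ : Fin d → ℝ) : Matrix (Fin (d + 1)) (Fin (d + 1)) ℝ :=
  Matrix.of fun α β =>
    (if α = 0 ∧ β = 0 then
      S.g ^ 2 * Real.cos (U.Xs ε t θ 0) -
        U.γ ε ^ 2 * Real.cos (4 * Real.arctan (Real.exp (U.γ ε * t)))
    else 0) +
    ε * S.g ^ 2 * pd (pd S.f β) α (U.Xs ε t θ + Fin.cons 0 (θ + t • S.ω))

/-- `𝔄^u = Ω(X^u) - diag(γ² cos Φ^0(e^{γ t}), 0) X^u`. -/
def Au (ε t : ℝ) (θ : Fin d → ℝ) (α : Fin (d + 1)) : ℝ :=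
  S.Omega ε (U.Xu ε t θ) (θ + t • S.ω) α -
    (if α = 0 then
      U.γ ε ^ 2 * Real.cos (4 * Real.arctan (Real.exp (U.γ ε * t))) * U.Xu ε t θ 0
    else 0)

/-- The family `∂_θ 𝔄^u`. -/
def dThetaAu (ε t : ℝ) (θ : Fin d → ℝ) : Matrix (Fin (d + 1)) (Fin d) ℝ :=
  Matrix.of fun α b => pd (fun θ' => U.Au ε t θ' α) b θ

/-- The block matrix `(x, 0; 0, 0)`. -/
def pendulumBlock (d : ℕ) (x : ℝ) : Matrix (Fin (d + 1)) (Fin (d + 1)) ℝ :=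
  Matrix.of fun α β => if α = 0 ∧ β = 0 then x else 0

/-- The block matrix `(0, 0; 0, 1)`. -/
def rotatorBlock (d : ℕ) : Matrix (Fin (d + 1)) (Fin (d + 1)) ℝ :=
  Matrix.of fun α β => if α = β ∧ α ≠ 0 then 1 else 0

def kernelP (γ t : ℝ) : ℝ := Real.exp (γ * t) / (Real.exp (2 * γ * t) + 1)

def kernelQ (γ t : ℝ) : ℝ := Real.exp (-(γ * t)) * (Real.exp (2 * γ * t) - 1)

/-- The kernel pieces `K_{ij}(t)`, `i ∈ {0, 1}`, `j ∈ {1, 2}`. -/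
def Kij (d : ℕ) (γ : ℝ) : ℕ → ℕ → ℝ → Matrix (Fin (d + 1)) (Fin (d + 1)) ℝ
  | 0, 1, t => pendulumBlock d (1 / (2 * γ) * kernelQ γ t)
  | 0, 2, t => pendulumBlock d (-(1 / (2 * γ)) * kernelP γ t)
  | 1, 1, t => pendulumBlock d (2 * kernelP γ t)
  | 1, 2, _ => rotatorBlock d
  | _, _, _ => 0

/-- The kernel pieces `K̄_{ij}(τ)`, `i ∈ {0, 1}`, `j ∈ {1, 2}`. -/
def Kbar (d : ℕ) (γ : ℝ) : ℕ → ℕ → ℝ → Matrix (Fin (d + 1)) (Fin (d + 1)) ℝ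
  | 0, 1, τ => pendulumBlock d (kernelP γ τ)
  | 0, 2, τ => pendulumBlock d (kernelQ γ τ)
  | 1, 1, τ => pendulumBlock d (kernelP γ τ)
  | 1, 2, _ => rotatorBlock d
  | _, _, _ => 0

/-- The kernel `K(t, τ) = ∑_{i = 0}^1 ∑_{j = 1}^2 (t - τ)^i K_{ij}(t) K̄_{ij}(τ)`. -/
def kernel (d : ℕ) (γ t τ : ℝ) : Matrix (Fin (d + 1)) (Fin (d + 1)) ℝ :=
  ∑ i ∈ Finset.range 2, ∑ j ∈ Finset.Icc 1 2,
    (t - τ) ^ i • (Kij d γ i j t * Kbar d γ i j τ)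

/-- The integrand `τ ↦ K(t, τ) h(τ)`, as a power series in `ε`. -/
def kernelMul {n : Type} (t : ℝ) (h : Ser d (Fin (d + 1)) n) : Ser d (Fin (d + 1)) n :=
  Ser.mul (series fun ε τ _ => kernel d (U.γ ε) t τ) h

/-- The operator `B h(t) = ⨍_∞^t K(t, τ) h(τ) dτ = -⨍_t^∞ K(t, τ) h(τ) dτ`, order by order
in `ε`. -/
def B {n : Type} (h : Ser d (Fin (d + 1)) n) : Ser d (Fin (d + 1)) n :=
  fun ℓ t θ => -matRegIntegral (Set.Ici t) (U.kernelMul t h ℓ) θ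

/-- The product `M^s h`. -/
def MsMul {n : Type} (h : Ser d (Fin (d + 1)) n) : Ser d (Fin (d + 1)) n :=
  Ser.mul (series U.Ms) h

/-- The term `(B M^s)^l h` of the Neumann series. -/
def neumannTerm {n : Type} (h : Ser d (Fin (d + 1)) n) (l : ℕ) : Ser d (Fin (d + 1)) n :=
  (fun h' => U.B (U.MsMul h'))^[l] h

/-- The Neumann series `∑_l (B M^s)^l h`: at order `ε^ℓ` only the terms with `l ≤ ℓ` are
added, the others being `0` at that order because `M^s = O(ε)`. -/
def neumannSum {n : Type} (h : Ser d (Fin (d + 1)) n) : Ser d (Fin (d + 1)) n :=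
  fun ℓ => ∑ l ∈ Finset.range (ℓ + 1), U.neumannTerm h l ℓ

/-- `K_{ij}^p(t) = t^p K_{ij}(t)`, as a power series in `ε`. -/
def Kp (i j p : ℕ) : Ser d (Fin (d + 1)) (Fin (d + 1)) :=
  series fun ε t _ => t ^ p • Kij d (U.γ ε) i j t

/-- The integrand `f^s_{ψφ} ∑_l (B M^s)^l h`. -/
def tailIntegrand {n : Type} (h : Ser d (Fin (d + 1)) n) : Ser d (Fin d) n :=
  Ser.mul (series U.fs) (U.neumannSum h)

/-- The integral `⨍_t^∞ [f^s_{ψφ} ∑_l (B M^s)^l h](τ) dτ`. -/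
def tailIntegral {n : Type} (h : Ser d (Fin (d + 1)) n) : Ser d (Fin d) n :=
  fun ℓ t θ => matRegIntegral (Set.Ici t) (U.tailIntegrand h ℓ) θ

/-- The coefficient `c_{ij}^p(t) = ⨍_t^∞ [f^s_{ψφ} ∑_l (B M^s)^l K_{ij}^p](τ) dτ` on the homoclinic
trajectory, as a power series in `ε`. -/
def c (i j p : ℕ) (t : ℝ) : ℕ → Matrix (Fin d) (Fin (d + 1)) ℂ :=
  fun ℓ => U.tailIntegral (U.Kp i j p) ℓ t 0

/-- The integrand `(-τ)^{i - p} K̄_{ij}(τ) ∂_θ 𝔄^u(τ)` (for `p ≤ i`). -/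
def EpIntegrand (i j p : ℕ) : Ser d (Fin (d + 1)) (Fin d) :=
  series fun ε τ θ => (-τ) ^ (i - p) • (Kbar d (U.γ ε) i j τ * U.dThetaAu ε τ θ)

/-- The factor `ℰ_{ij}^p = -⨍_{-∞}^∞ (-τ)^{i - p} K̄_{ij}(τ) ∂_θ 𝔄^u(τ) dτ` on the homoclinic
trajectory, as a power series in `ε`. It does not depend on `t`. -/
def Ep (i j p : ℕ) : ℕ → Matrix (Fin (d + 1)) (Fin d) ℂ :=
  fun ℓ => -lineRegIntegral (U.EpIntegrand i j p ℓ) 0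

/-- The integrand `K(t, τ) ∂_θ 𝔄^u(τ)`. -/
def EIntegrand (t : ℝ) : Ser d (Fin (d + 1)) (Fin d) :=
  U.kernelMul t (series U.dThetaAu)

/-- `ℰ(t) = ⨍_∞^{-∞} K(t, τ) ∂_θ 𝔄^u(τ) dτ`, as a power series in `ε`. -/
def E : Ser d (Fin (d + 1)) (Fin d) :=
  fun ℓ t θ => -lineRegIntegral (U.EIntegrand t ℓ) θ

/-- The integrand `λ ∂_θ f^u_ψ`, as a power series in `ε`. -/
def mainIntegrand : Ser d (Fin d) (Fin d) := lamMul S.g (series U.dThetaFu)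

/-- The integral `⨍_{-∞}^∞ λ ∂_θ f^u_ψ(τ) dτ` on the homoclinic trajectory, as a power series
in `ε`. -/
def mainIntegral : ℕ → Matrix (Fin d) (Fin d) ℂ :=
  fun ℓ => lineRegIntegral (U.mainIntegrand ℓ) 0

/-- The power series `⨍_{-∞}^∞ λ ∂_θ f^u_ψ dτ + λ ⨍_t^∞ [f^s_{ψφ} ∑_l (B M^s)^l ℰ](τ) dτ`. -/
def neumannExpansion (t : ℝ) : ℕ → Matrix (Fin d) (Fin d) ℂ :=
  U.mainIntegral + lamMul S.g (fun ℓ => U.tailIntegral U.E ℓ t 0)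

/-- The power series
`⨍_{-∞}^∞ λ ∂_θ f^u_ψ dτ + λ ∑_{i = 0}^1 ∑_{p = 0}^i ∑_{j = 1}^2 c_{ij}^p(t) ℰ_{ij}^p`. -/
def splittingExpansion (t : ℝ) : ℕ → Matrix (Fin d) (Fin d) ℂ :=
  U.mainIntegral +
    lamMul S.g (∑ i ∈ Finset.range 2, ∑ p ∈ Finset.range (i + 1), ∑ j ∈ Finset.Icc 1 2,
      cauchyMul (U.c i j p t) (U.Ep i j p))

/-- Every order of the Neumann series `∑_l (B M^s)^l h` and of the integral
`⨍_t^∞ [f^s_{ψφ} ∑_l (B M^s)^l h] dτ` is well defined: all regularized integrals exist, and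
`(B M^s)^l h` contributes only to the orders `≥ l`. -/
def NeumannWellDefined {n : Type} (h : Ser d (Fin (d + 1)) n) : Prop :=
  (∀ l ℓ t θ, MatRegIntegrable (Set.Ici t) (U.kernelMul t (U.MsMul (U.neumannTerm h l)) ℓ) θ) ∧
  (∀ l ℓ t θ, ℓ < l → U.neumannTerm h l ℓ t θ = 0) ∧
  (∀ ℓ t θ, MatRegIntegrable (Set.Ici t) (U.tailIntegrand h ℓ) θ)

/-- The power series `A` is the asymptotic expansion of the splitting matrix `Υ(t)`: `Υ(t)` is
analytic in `ε` near `0`, each order is an exact identity, and the remainder after the order `k` is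
`O(ε^{k + 1})`. -/
def IsSplittingExpansion (t : ℝ) (A : ℕ → Matrix (Fin d) (Fin d) ℂ) : Prop :=
  ∀ a b, AnalyticAt ℝ (fun ε => U.Upsilon ε t a b) 0 ∧
    (∀ ℓ, ((taylorCoeff (fun ε => U.Upsilon ε t a b) ℓ : ℝ) : ℂ) = A ℓ a b) ∧
    IsAsymptoticExpansion (fun ε => (U.Upsilon ε t a b : ℂ)) (fun ℓ => A ℓ a b)

end UnstableManifold

end HomoclinicSplitting

end

/-!
The coefficients of the Taylor series in `ε` of `X^u` and of everything built from it are functions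
of `(t, θ)` that are trigonometric polynomials in `θ` and whose time dependence has, at both ends
`t → ±∞`, asymptotic expansions in exponential polynomials `t^k e^{a t}` with an error smaller than
any exponential (`TrigClass`, `TwoSided`). Such a function `h` has a primitive of the same type, and
the regularized integral of `h` over `[t, ∞)` is `c - H(t)`, where `H` is any primitive and `c` is
the coefficient of `t^0 e^0` in its expansion (`hasRegResidue_of_primitive`,
`TrigClass.regIntegral_Ici`). Regularized integrals are therefore finite parts, linear, stable
inside the class, and compute primitives up to a constant. All existence claims follow.

That the coefficients of `X^u` belong to the class is shown by induction on the order in `ε`.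
For functions of the form `W(ε, e^{γ t}, θ + ω t)` with `W` analytic and periodic, the Fourier
coefficient of frequency `q` is `e^{i (q·ω) t}` times an expansion in nonnegative powers of
`t` and of `e^{g t}` at `-∞` (`FlowClass`, `FlowGen.flowLift_mem`). The linearized equation
`x'' = k x + 𝔄` has the solutions `u = P` and `v = Q/(2γ) + 2 t P` for the pendulum, `1` and `t`
for the rotators, and `K(t, τ) = v(t) u(τ) - u(t) v(τ)` (`kernel_apply`). The Wronskians
`N_w = w ∂_t X - w' X` satisfy `N_w' = w 𝔄`, and a frequency `q ≠ 0` which is absent from `w 𝔄`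
contributes to `N_w` a multiple of `e^{i q·θ}` constant in time, which the form of the expansion at
`-∞` forbids, because `q·ω ≠ 0` (`FlowClass.mem_trigClass`). So each `N_w`, and
`X = v N_u - u N_v`, is a trigonometric polynomial in `θ` (`coefC_XFam_mem`). For the same reason
`∂_θ N_w` has no constant term at `-∞` (`hasConst_dirTheta`): it equals the regularized integral of
`w ∂_θ 𝔄` from `-∞` to `t`.

On the homoclinic trajectory `θ = 0` the stable and the unstable trajectories coincide, by
uniqueness of the solutions of the equation of motion (`Xs_eq_Xu`). Hence `W = ∂_θ (X^u - X^s)`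
satisfies `∂_θ 𝔄^u - ∂_θ 𝔄^s = M^s W`. Subtracting the representations of `∂_θ X^u` by integrals
from `-∞` and of `∂_θ X^s`, its time reversal, by integrals to `+∞` gives `W = -ℰ + B (M^s W)`
(`splitSer_eq`). Since `M^s = O(ε)`, the operator `B M^s` raises the order in `ε`, the equation has
a single solution as a power series, and `W = -∑_l (B M^s)^l ℰ` (`splitSer_eq_neumannSum`).
In the same way the velocities of the rotators are primitives of `λ ∂_ψ f`, and the difference of
their variations is `Υ = ⨍ λ ∂_θ f^u_ψ - ⨍_t^∞ λ f^s_{ψφ} W` (`coeff_velFam`), which is the first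
expansion. The second one follows by separating `t` and `τ` in the kernel: at `θ = 0` one
has `ℰ = ∑ K_{ij}^p ℰ_{ij}^p`, with factors `ℰ_{ij}^p` independent of `t`, and all operators involved
are linear over such factors (`slice_E_eq_sum`, `tailIntegral_E`).
-/

noncomputable section

namespace HomoclinicSplitting

open Filter Asymptotics Topology MeasureTheory

/-! ### Residues of Laplace transforms -/

/-- The Laplace weight times `h`. -/
abbrev laplaceIntegrand (h : ℝ → ℂ) (R : ℂ) (τ : ℝ) : ℂ :=
  Complex.exp (-(R * ((|τ| : ℝ) : ℂ))) * h τ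

lemma norm_laplaceIntegrand (h : ℝ → ℂ) (R : ℂ) (τ : ℝ) :
    ‖laplaceIntegrand h R τ‖ = Real.exp (-(R.re * |τ|)) * ‖h τ‖ := by
  simp [laplaceIntegrand, Complex.norm_exp]

lemma integrable_exp_neg_mul_abs {η : ℝ} (hη : 0 < η) :
    Integrable fun τ : ℝ => Real.exp (-(η * |τ|)) := by
  have h1 : IntegrableOn (fun τ : ℝ => Real.exp (-(η * |τ|))) (Set.Ioi 0) := by
    refine (exp_neg_integrableOn_Ioi 0 hη).congr_fun (fun x hx => ?_) measurableSet_Ioi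
    simp [abs_of_pos (Set.mem_Ioi.1 hx)]
  have h2 : IntegrableOn (fun τ : ℝ => Real.exp (-(η * |τ|))) (Set.Iic 0) := by
    have h3 := (integrableOn_exp_mul_Iic hη 0)
    refine h3.congr_fun (fun x hx => ?_) measurableSet_Iic
    simp [abs_of_nonpos (Set.mem_Iic.1 hx)]
  rw [← integrableOn_univ, ← Set.Iic_union_Ioi (a := (0 : ℝ))]
  exact h2.union h1

lemma laplace_integrableOn {s : Set ℝ} (hs : MeasurableSet s) {h : ℝ → ℂ} (hc : Continuous h)
    {b δ : ℝ} (hb : ∀ τ ∈ s, ‖h τ‖ ≤ b * Real.exp (-(δ * |τ|))) {R : ℂ} (hR : -δ < R.re) :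
    IntegrableOn (laplaceIntegrand h R) s := by
  have hη : 0 < R.re + δ := by linarith
  refine Integrable.mono' (((integrable_exp_neg_mul_abs hη).const_mul b).integrableOn)
    ?_ ?_
  · exact Continuous.aestronglyMeasurable (by unfold laplaceIntegrand; fun_prop)
  · refine (ae_restrict_iff' hs).2 (Eventually.of_forall fun τ hτ => ?_)
    rw [norm_laplaceIntegrand]
    calc _ ≤ Real.exp (-(R.re * |τ|)) * (b * Real.exp (-(δ * |τ|))) := by
          gcongr; exact hb τ hτ
      _ = b * (Real.exp (-(R.re * |τ|)) * Real.exp (-(δ * |τ|))) := by ring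
      _ = b * Real.exp (-((R.re + δ) * |τ|)) := by rw [← Real.exp_add]; ring_nf

/-- The Laplace transform over `s` of a function bounded by `b e^{-δ |τ|}` is holomorphic in the
half-plane `-δ < Re R`. -/
lemma laplace_differentiableOn {s : Set ℝ} (hs : MeasurableSet s) {h : ℝ → ℂ} (hc : Continuous h)
    {b δ : ℝ} (hb : ∀ τ ∈ s, ‖h τ‖ ≤ b * Real.exp (-(δ * |τ|))) :
    DifferentiableOn ℂ (fun R => ∫ τ in s, laplaceIntegrand h R τ) {R : ℂ | -δ < R.re} := by
  intro R₀ hR₀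
  have hR₀' : -δ < R₀.re := hR₀
  set η : ℝ := (R₀.re + δ) / 2 with hη
  have hη0 : 0 < η := by rw [hη]; linarith
  have hopen : IsOpen {R : ℂ | -δ + η < R.re} := isOpen_lt continuous_const Complex.continuous_re
  have hmem : R₀ ∈ {R : ℂ | -δ + η < R.re} := by
    show -δ + η < R₀.re
    rw [hη]; linarith
  -- Differentiation under the integral on `-δ + η < Re R`, where `η` is half the distance of
  -- `R₀` from the boundary line: the factor `|τ|` of the derivative is at most
  -- `(2 / η) e^{η |τ| / 2}`, which leaves the integrable bound `e^{-η |τ| / 2}`.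
  refine (hasDerivAt_integral_of_dominated_loc_of_deriv_le
    (F := fun R τ => laplaceIntegrand h R τ)
    (F' := fun R τ => -((|τ| : ℝ) : ℂ) * laplaceIntegrand h R τ)
    (bound := fun τ => 2 / η * b * Real.exp (-(η / 2 * |τ|)))
    (hopen.mem_nhds hmem) ?_ ?_ ?_ ?_ ?_ ?_).2.differentiableAt.differentiableWithinAt
  · exact Eventually.of_forall fun R =>
      Continuous.aestronglyMeasurable (by unfold laplaceIntegrand; fun_prop)
  · exact laplace_integrableOn hs hc hb hR₀'
  · exact Continuous.aestronglyMeasurable (by unfold laplaceIntegrand; fun_prop)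
  · refine (ae_restrict_iff' hs).2 (Eventually.of_forall fun τ hτ R hR => ?_)
    have hR' : -δ + η < R.re := hR
    rw [norm_mul, norm_laplaceIntegrand, norm_neg, Complex.norm_real, Real.norm_eq_abs, abs_abs]
    have hb0 : 0 ≤ b := by
      have := (norm_nonneg _).trans (hb τ hτ)
      exact nonneg_of_mul_nonneg_left this (Real.exp_pos _)
    have h1 : |τ| ≤ 2 / η * Real.exp (η / 2 * |τ|) := by
      have := Real.add_one_le_exp (η / 2 * |τ|)
      rw [div_mul_eq_mul_div, le_div_iff₀ hη0]
      nlinarith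
    calc |τ| * (Real.exp (-(R.re * |τ|)) * ‖h τ‖)
        ≤ (2 / η * Real.exp (η / 2 * |τ|)) *
          (Real.exp (-((-δ + η) * |τ|)) * (b * Real.exp (-(δ * |τ|)))) := by
          gcongr
          exact hb τ hτ
      _ = 2 / η * b * (Real.exp (η / 2 * |τ|) * Real.exp (-((-δ + η) * |τ|)) *
          Real.exp (-(δ * |τ|))) := by ring
      _ = _ := by
          rw [← Real.exp_add, ← Real.exp_add]; ring_nf
  · exact (((integrable_exp_neg_mul_abs (half_pos hη0)).const_mul _).integrableOn)
  · refine Eventually.of_forall fun τ R _ => ?_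
    have : HasDerivAt (fun R : ℂ => Complex.exp (-(R * ((|τ| : ℝ) : ℂ))))
        (Complex.exp (-(R * ((|τ| : ℝ) : ℂ))) * -(1 * ((|τ| : ℝ) : ℂ))) R :=
      ((hasDerivAt_id R).mul_const _).neg.cexp
    refine (this.mul_const (h τ)).congr_deriv ?_
    simp only [laplaceIntegrand]; ring

lemma exists_exp_bound {h : ℝ → ℂ} (hc : Continuous h) {δ : ℝ}
    (hO : h =O[atTop] fun t : ℝ => Real.exp (-(δ * t))) :
    ∃ b, ∀ τ ∈ Set.Ioi (0 : ℝ), ‖h τ‖ ≤ b * Real.exp (-(δ * |τ|)) := by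
  obtain ⟨c, hc0⟩ := hO.bound
  obtain ⟨T, hT⟩ := eventually_atTop.1 hc0
  obtain ⟨b, hb⟩ := (isCompact_Icc (a := (0 : ℝ)) (b := T)).exists_bound_of_continuousOn
    (f := fun t => h t * ((Real.exp (δ * t) : ℝ) : ℂ)) (by fun_prop)
  refine ⟨max b c, fun τ hτ => ?_⟩
  have hτ' : 0 < τ := hτ
  rw [abs_of_pos hτ']
  rcases le_total τ T with h1 | h1
  · have h2 := hb τ ⟨hτ'.le, h1⟩
    rw [norm_mul, Complex.norm_real, Real.norm_eq_abs, abs_of_pos (Real.exp_pos _)] at h2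
    calc ‖h τ‖ = ‖h τ‖ * Real.exp (δ * τ) * Real.exp (-(δ * τ)) := by
          rw [mul_assoc, ← Real.exp_add]; simp
      _ ≤ max b c * Real.exp (-(δ * τ)) := by gcongr; exact h2.trans (le_max_left _ _)
  · have h2 := hT τ h1
    rw [Real.norm_eq_abs, abs_of_pos (Real.exp_pos _)] at h2
    exact h2.trans (by gcongr; exact le_max_right _ _)

lemma MeromorphicAt.circleIntegrable_inv_mul {G : ℂ → ℂ} (hG : MeromorphicAt G 0) :
    ∀ᶠ r in 𝓝[>] (0 : ℝ), CircleIntegrable (fun R => R⁻¹ * G R) 0 r := by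
  have h := hG.eventually_analyticAt
  rw [eventually_nhdsWithin_iff, Metric.eventually_nhds_iff] at h
  obtain ⟨ρ, hρ, h⟩ := h
  filter_upwards [Ioo_mem_nhdsGT hρ] with r hr
  refine ContinuousOn.circleIntegrable hr.1.le fun z hz => ?_
  have hz' : dist z 0 = r := hz
  have hz0 : z ≠ 0 := by
    rintro rfl
    simp at hz'; exact hr.1.ne hz'
  have := h (y := z) (by rw [hz']; exact hr.2) hz0
  exact ((continuousAt_inv₀ hz0).mul this.continuousAt).continuousWithinAt

section

variable {S : Set ℝ} {h k : ℝ → ℂ} {a b : ℂ}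

lemma isConnected_halfPlane {δ : ℝ} : IsPreconnected {R : ℂ | -δ < R.re} :=
  (convex_halfSpace_re_gt (-δ)).isPreconnected

/-- Two meromorphic continuations of the same Laplace transform agree on a right half-plane, hence
near `0` by the identity theorem, and so have the same residue. -/
theorem HasRegResidue.unique (ha : HasRegResidue S h a) (hb : HasRegResidue S h b) : a = b := by
  obtain ⟨G, c, δ, hδ, hG, hI, hr⟩ := ha
  obtain ⟨G', c', δ', hδ', hG', hI', hr'⟩ := hb
  set ρ := min δ δ' with hρ
  have hρ0 : 0 < ρ := lt_min hδ hδ'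
  have hm : MeromorphicOn (G - G') {R : ℂ | -ρ < R.re} := by
    refine (hG.mono_set fun R hR => ?_).sub (hG'.mono_set fun R hR => ?_)
    · exact lt_of_le_of_lt (neg_le_neg (min_le_left δ δ')) (show -min δ δ' < R.re from hR)
    · exact lt_of_le_of_lt (neg_le_neg (min_le_right δ δ')) (show -min δ δ' < R.re from hR)
  have h0 : (0 : ℂ) ∈ {R : ℂ | -ρ < R.re} := by simpa using hρ0
  have hconn : IsConnected {R : ℂ | -ρ < R.re} := ⟨⟨0, h0⟩, isConnected_halfPlane⟩
  have key := hm.exists_meromorphicOrderAt_ne_top_iff_forall hconn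
  have htop : meromorphicOrderAt (G - G') 0 = ⊤ := by
    -- The order of `G - G'` is infinite everywhere or nowhere on the half-plane; it is infinite
    -- at the real point `x`, near which both functions are the Laplace integral.
    by_contra hne
    have hall := key.1 ⟨⟨0, h0⟩, hne⟩
    set x : ℝ := max 0 (max c c') + 1 with hx
    have hx0 : 0 < x := by rw [hx]; positivity
    have hxm : ((x : ℝ) : ℂ) ∈ {R : ℂ | -ρ < R.re} := by
      show -ρ < ((x : ℝ) : ℂ).re
      simp; linarith
    refine hall ⟨_, hxm⟩ ?_
    rw [meromorphicOrderAt_eq_top_iff]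
    refine eventually_nhdsWithin_of_eventually_nhds ?_
    have hop : IsOpen {R : ℂ | max c c' < R.re} := isOpen_lt continuous_const Complex.continuous_re
    have hmx : ((x : ℝ) : ℂ) ∈ {R : ℂ | max c c' < R.re} := by
      show max c c' < ((x : ℝ) : ℂ).re
      rw [Complex.ofReal_re, hx]
      have := le_max_right 0 (max c c')
      linarith
    filter_upwards [hop.mem_nhds hmx] with R hR
    have hR' : max c c' < R.re := hR
    simp [(hI R ((le_max_left _ _).trans_lt hR')).2, (hI' R ((le_max_right _ _).trans_lt hR')).2]
  rw [meromorphicOrderAt_eq_top_iff, eventually_nhdsWithin_iff, Metric.eventually_nhds_iff] at htop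
  obtain ⟨ρ', hρ', htop⟩ := htop
  obtain ⟨r, h1, h2, h3⟩ := (hr.and (hr'.and (Ioo_mem_nhdsGT hρ'))).exists
  rw [← h1, ← h2]
  congr 1
  refine circleIntegral.integral_congr h3.1.le fun z hz => ?_
  have hz' : dist z 0 = r := hz
  have hz0 : z ≠ 0 := by
    rintro rfl
    simp at hz'; exact h3.1.ne hz'
  have := htop (y := z) (by rw [hz']; exact h3.2) hz0
  rw [sub_eq_zero.1 this]

theorem HasRegResidue.add (ha : HasRegResidue S h a) (hb : HasRegResidue S k b) :
    HasRegResidue S (h + k) (a + b) := by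
  obtain ⟨G, c, δ, hδ, hG, hI, hr⟩ := ha
  obtain ⟨G', c', δ', hδ', hG', hI', hr'⟩ := hb
  refine ⟨G + G', max c c', min δ δ', lt_min hδ hδ', ?_, fun R hR => ?_, ?_⟩
  · refine (hG.mono_set fun R hR => ?_).add (hG'.mono_set fun R hR => ?_)
    · exact lt_of_le_of_lt (neg_le_neg (min_le_left δ δ')) (show -min δ δ' < R.re from hR)
    · exact lt_of_le_of_lt (neg_le_neg (min_le_right δ δ')) (show -min δ δ' < R.re from hR)
  · obtain ⟨i1, e1⟩ := hI R ((le_max_left _ _).trans_lt hR)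
    obtain ⟨i2, e2⟩ := hI' R ((le_max_right _ _).trans_lt hR)
    have e : (fun τ : ℝ => Complex.exp (-(R * ((|τ| : ℝ) : ℂ))) * (h + k) τ) =
        fun τ : ℝ => Complex.exp (-(R * ((|τ| : ℝ) : ℂ))) * h τ +
          Complex.exp (-(R * ((|τ| : ℝ) : ℂ))) * k τ := by
      ext τ; simp [mul_add]
    rw [e, integral_add i1 i2, Pi.add_apply, e1, e2]
    exact ⟨i1.add i2, rfl⟩
  · have m1 := MeromorphicAt.circleIntegrable_inv_mul (hG 0 (by simpa using hδ))
    have m2 := MeromorphicAt.circleIntegrable_inv_mul (hG' 0 (by simpa using hδ'))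
    filter_upwards [hr, hr', m1, m2] with r h1 h2 h3 h4
    rw [← h1, ← h2, ← mul_add, ← circleIntegral.integral_add h3 h4]
    simp only [Pi.add_apply, mul_add]

theorem HasRegResidue.smul (x : ℂ) (ha : HasRegResidue S h a) :
    HasRegResidue S (x • h) (x * a) := by
  obtain ⟨G, c, δ, hδ, hG, hI, hr⟩ := ha
  refine ⟨fun R => x * G R, c, δ, hδ, ?_, fun R hR => ?_, ?_⟩
  · exact (MeromorphicOn.const x).mul hG
  · obtain ⟨i1, e1⟩ := hI R hR
    have e : (fun τ : ℝ => Complex.exp (-(R * ((|τ| : ℝ) : ℂ))) * (x • h) τ) =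
        fun τ : ℝ => x * (Complex.exp (-(R * ((|τ| : ℝ) : ℂ))) * h τ) := by
      ext τ; simp only [Pi.smul_apply, smul_eq_mul]; ring
    rw [e, integral_const_mul, ← e1]
    exact ⟨i1.const_mul x, rfl⟩
  · filter_upwards [hr] with r h1
    rw [← h1]
    have : (fun R : ℂ => R⁻¹ * (x * G R)) = fun R => x * (R⁻¹ * G R) := by ext; ring
    rw [this, circleIntegral.integral_const_mul]
    ring

/-- Reflection of the time axis. -/
theorem HasRegResidue.reflect {t : ℝ} (ha : HasRegResidue (Set.Ici (-t)) (fun τ => h (-τ)) a) :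
    HasRegResidue (Set.Iic t) h a := by
  obtain ⟨G, c, δ, hδ, hG, hI, hr⟩ := ha
  refine ⟨G, c, δ, hδ, hG, fun R hR => ?_, hr⟩
  obtain ⟨i1, e1⟩ := hI R hR
  constructor
  · have := (Measure.measurePreserving_neg (volume : Measure ℝ)).integrableOn_comp_preimage
      (Homeomorph.neg ℝ).measurableEmbedding
      (f := fun τ : ℝ => Complex.exp (-(R * ((|τ| : ℝ) : ℂ))) * h (-τ)) (s := Set.Ici (-t))
    have h2 := this.2 i1
    refine (h2.mono_set ?_).congr_fun ?_ measurableSet_Iic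
    · intro x hx; simpa using hx
    · intro x _; simp
  · rw [e1, integral_Ici_eq_integral_Ioi, ← integral_comp_neg_Iic]
    simp

/-- Moving the endpoint of the half-line `[0, ∞)`. -/
theorem HasRegResidue.Ici_of_zero (hc : Continuous h) (ha : HasRegResidue (Set.Ici 0) h a) (t : ℝ) :
    HasRegResidue (Set.Ici t) h (a - ∫ τ in (0 : ℝ)..t, h τ) := by
  obtain ⟨G, c, δ, hδ, hG, hI, hr⟩ := ha
  have hlc : ∀ R, Continuous (laplaceIntegrand h R) := fun R => by
    unfold laplaceIntegrand; fun_prop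
  -- `J` is entire, so removing it from the Laplace transform changes the residue of `R⁻¹ G` by
  -- `J 0`, the integral of `h` over `[0, t]`.
  set J : ℂ → ℂ := fun R => ∫ τ in (0 : ℝ)..t, laplaceIntegrand h R τ with hJ
  have hJd : DifferentiableOn ℂ J {R : ℂ | -1 < R.re} ∧
      Differentiable ℂ J := by
    have hgen : ∀ (x y δ : ℝ), DifferentiableOn ℂ
        (fun R => ∫ τ in Set.Ioc x y, laplaceIntegrand h R τ) {R : ℂ | -δ < R.re} := by
      intro x y δ
      obtain ⟨b, hb⟩ := (isCompact_Icc (a := x) (b := y)).exists_bound_of_continuousOn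
        (f := fun t => h t * ((Real.exp (δ * |t|) : ℝ) : ℂ)) (by fun_prop)
      refine laplace_differentiableOn measurableSet_Ioc hc (b := b) fun τ hτ => ?_
      have h2 := hb τ ⟨hτ.1.le, hτ.2⟩
      rw [norm_mul, Complex.norm_real, Real.norm_eq_abs, abs_of_pos (Real.exp_pos _)] at h2
      calc ‖h τ‖ = ‖h τ‖ * Real.exp (δ * |τ|) * Real.exp (-(δ * |τ|)) := by
            rw [mul_assoc, ← Real.exp_add]; simp
        _ ≤ b * Real.exp (-(δ * |τ|)) := by gcongr
    have hd : ∀ δ, DifferentiableOn ℂ J {R : ℂ | -δ < R.re} := by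
      intro δ
      simp only [hJ, intervalIntegral]
      exact (hgen _ _ _).sub (hgen _ _ _)
    refine ⟨hd 1, fun R => ?_⟩
    have hop : IsOpen {R' : ℂ | -(1 - R.re) < R'.re} :=
      isOpen_lt continuous_const Complex.continuous_re
    exact (hd (1 - R.re)).differentiableAt (hop.mem_nhds (by simp))
  refine ⟨fun R => G R - J R, c, δ, hδ, ?_, fun R hR => ?_, ?_⟩
  · refine hG.sub fun R _ => ?_
    exact (hJd.2.analyticAt R).meromorphicAt
  · obtain ⟨i1, e1⟩ := hI R hR
    have i0 : IntegrableOn (laplaceIntegrand h R) (Set.Ioi 0) := i1.mono_set Set.Ioi_subset_Ici_self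
    have i2 : IntegrableOn (laplaceIntegrand h R) (Set.Ici t) := by
      have i3 : IntegrableOn (laplaceIntegrand h R) (Set.Icc t 0) := (hlc R).integrableOn_Icc
      refine (i3.union i1).mono_set fun x hx => ?_
      rcases le_total x 0 with h | h
      · exact Or.inl ⟨hx, h⟩
      · exact Or.inr h
    refine ⟨i2, ?_⟩
    show G R - J R = _
    rw [e1, integral_Ici_eq_integral_Ioi, integral_Ici_eq_integral_Ioi,
      ← intervalIntegral.integral_interval_add_Ioi i0 (i2.mono_set Set.Ioi_subset_Ici_self)]
    simp [hJ, laplaceIntegrand]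
  · have hJ0 : J 0 = ∫ τ in (0 : ℝ)..t, h τ := by simp [hJ, laplaceIntegrand]
    have m1 := MeromorphicAt.circleIntegrable_inv_mul (hG 0 (by simpa using hδ))
    have m2 := MeromorphicAt.circleIntegrable_inv_mul (hJd.2.analyticAt 0).meromorphicAt
    filter_upwards [hr, m1, m2, self_mem_nhdsWithin] with r h1 h2 h3 h4
    have h5 : (∮ R in C(0, r), R⁻¹ * J R) = (2 * Real.pi * Complex.I) • J 0 := by
      have := (hJd.2.diffContOnCl (s := Metric.ball 0 r)).circleIntegral_sub_inv_smul
        (w := 0) (by simpa using h4)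
      simpa using this
    simp only [mul_sub]
    rw [circleIntegral.integral_sub h2 h3, mul_sub, h1, h5, hJ0]
    congr 1
    have : (2 * (Real.pi : ℂ) * Complex.I) ≠ 0 := by simp [Real.pi_ne_zero]
    rw [smul_eq_mul, inv_mul_cancel_left₀ this]

end

/-! ### Exponential polynomials and the constant term at infinity -/

/-- The exponential monomial `t^k e^{a t}`. -/
def expMono (a : ℂ) (k : ℕ) (t : ℝ) : ℂ := (t : ℂ) ^ k * Complex.exp (a * t)

@[fun_prop]
lemma continuous_expMono (a : ℂ) (k : ℕ) : Continuous (expMono a k) := by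
  unfold expMono; fun_prop

lemma hasDerivAt_expMono (a : ℂ) (k : ℕ) (t : ℝ) :
    HasDerivAt (expMono a k) (k * expMono a (k - 1) t + a * expMono a k t) t := by
  have h1 : HasDerivAt (fun t : ℝ => (t : ℂ)) 1 t := Complex.ofRealCLM.hasDerivAt
  have h2 := (h1.pow k).mul ((h1.const_mul a).cexp)
  refine h2.congr_deriv ?_
  simp only [expMono, Pi.pow_apply]; ring

lemma expMono_mul (a b : ℂ) (k l : ℕ) : expMono a k * expMono b l = expMono (a + b) (k + l) := by
  ext t
  simp only [expMono, Pi.mul_apply, add_mul, Complex.exp_add, pow_add]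
  ring

lemma norm_expMono (a : ℂ) (k : ℕ) (t : ℝ) : ‖expMono a k t‖ = |t| ^ k * Real.exp (a.re * t) := by
  simp [expMono, Complex.norm_exp]

lemma expMono_isBigO (a : ℂ) (k : ℕ) {b : ℝ} (hb : a.re < b) :
    expMono a k =O[atTop] fun t : ℝ => Real.exp (b * t) := by
  have h := (isLittleO_pow_exp_pos_mul_atTop k (sub_pos.2 hb)).isBigO
  have h2 := h.mul (isBigO_refl (fun t : ℝ => Real.exp (a.re * t)) atTop)
  refine (IsBigO.of_norm_eventuallyLE (g := fun t : ℝ => t ^ k * Real.exp (a.re * t)) ?_).trans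
    (h2.trans (isBigO_of_le _ fun t => ?_))
  · filter_upwards [eventually_ge_atTop 0] with t ht
    rw [norm_expMono, abs_of_nonneg ht]
  · rw [← Real.exp_add]; apply le_of_eq; congr 2; ring

lemma exp_isBigO_exp {a b : ℝ} (hab : a ≤ b) :
    (fun t : ℝ => Real.exp (a * t)) =O[atTop] fun t : ℝ => Real.exp (b * t) := by
  refine IsBigO.of_norm_eventuallyLE ?_
  filter_upwards [eventually_ge_atTop 0] with t ht
  rw [Real.norm_eq_abs, abs_of_pos (Real.exp_pos _)]
  gcongr

section ByParts

variable {f f' : ℝ → ℂ} {c : ℝ}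

lemma laplace_integrableOn_of_isBigO (hf : Continuous f)
    (hO : f =O[atTop] fun t : ℝ => Real.exp (c * t)) {R : ℂ} (hR : c < R.re) :
    IntegrableOn (laplaceIntegrand f R) (Set.Ici 0) := by
  obtain ⟨b, hb⟩ := exists_exp_bound (δ := -c) hf (by simpa using hO)
  rw [integrableOn_Ici_iff_integrableOn_Ioi]
  exact laplace_integrableOn measurableSet_Ioi hf hb (by simpa using hR)

/-- Integration by parts in the Laplace transform. -/
lemma laplace_deriv (hd : ∀ t, HasDerivAt f (f' t) t) (hf' : Continuous f')
    (hO : f =O[atTop] fun t : ℝ => Real.exp (c * t))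
    (hO' : f' =O[atTop] fun t : ℝ => Real.exp (c * t)) {R : ℂ} (hR : c < R.re) :
    ∫ τ in Set.Ici (0 : ℝ), laplaceIntegrand f' R τ =
      R * (∫ τ in Set.Ici (0 : ℝ), laplaceIntegrand f R τ) - f 0 := by
  have hf : Continuous f := continuous_iff_continuousAt.2 fun t => (hd t).continuousAt
  have i1 := laplace_integrableOn_of_isBigO hf hO hR
  have i2 := laplace_integrableOn_of_isBigO hf' hO' hR
  have hder : ∀ x ∈ Set.Ioi (0 : ℝ), HasDerivAt (fun t : ℝ => Complex.exp (-(R * t)) * f t)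
      (laplaceIntegrand f' R x - R * laplaceIntegrand f R x) x := by
    intro x hx
    have h1 : HasDerivAt (fun t : ℝ => (t : ℂ)) 1 x := Complex.ofRealCLM.hasDerivAt
    have h2 := ((h1.const_mul R).neg.cexp).mul (hd x)
    refine h2.congr_deriv ?_
    have hx' : (-fun y : ℝ => R * (y : ℂ)) x = -(R * x) := rfl
    simp only [laplaceIntegrand, abs_of_pos (Set.mem_Ioi.1 hx), hx']; ring
  -- The boundary term at infinity vanishes because `c < Re R`.
  have hlim : Tendsto (fun t : ℝ => Complex.exp (-(R * t)) * f t) atTop (𝓝 0) := by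
    have h3 : (fun t : ℝ => Complex.exp (-(R * t)) * f t) =O[atTop]
        fun t : ℝ => Real.exp (-(R.re - c) * t) := by
      have h4 : (fun t : ℝ => Complex.exp (-(R * t))) =O[atTop]
          fun t : ℝ => Real.exp (-R.re * t) :=
        isBigO_of_le _ fun t => by simp [Complex.norm_exp]
      refine (h4.mul hO).trans (isBigO_of_le _ fun t => ?_)
      rw [← Real.exp_add]; apply le_of_eq; congr 2; ring
    refine h3.trans_tendsto ?_
    have : Tendsto (fun t : ℝ => -(R.re - c) * t) atTop atBot :=
      tendsto_id.const_mul_atTop_of_neg (by linarith)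
    exact Real.tendsto_exp_atBot.comp this
  have key := integral_Ioi_of_hasDerivAt_of_tendsto (a := 0)
    (Continuous.continuousWithinAt (by fun_prop)) hder
    (((i2.mono_set Set.Ioi_subset_Ici_self)).sub
      ((i1.mono_set Set.Ioi_subset_Ici_self).const_mul R)) hlim
  rw [integral_sub (i2.mono_set Set.Ioi_subset_Ici_self)
    ((i1.mono_set Set.Ioi_subset_Ici_self).const_mul R), integral_const_mul,
    ← integral_Ici_eq_integral_Ioi, ← integral_Ici_eq_integral_Ioi] at key
  simp only [Complex.ofReal_zero, mul_zero, neg_zero, Complex.exp_zero, one_mul] at key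
  linear_combination key

/-- The residue of the Laplace transform of `f` gives the regularized integral of `f'`. -/
lemma hasRegResidue_deriv (hd : ∀ t, HasDerivAt f (f' t) t) (hf' : Continuous f')
    (hO : f =O[atTop] fun t : ℝ => Real.exp (c * t))
    (hO' : f' =O[atTop] fun t : ℝ => Real.exp (c * t)) {L : ℂ → ℂ} {δ : ℝ} (hδ : 0 < δ)
    (hL : MeromorphicOn L {R : ℂ | -δ < R.re})
    (hLf : ∀ R : ℂ, c < R.re → L R = ∫ τ in Set.Ici (0 : ℝ), laplaceIntegrand f R τ) {ρ : ℂ}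
    (hρ : ∀ᶠ r in 𝓝[>] (0 : ℝ), (2 * (Real.pi : ℂ) * Complex.I)⁻¹ * (∮ R in C(0, r), L R) = ρ) :
    HasRegResidue (Set.Ici 0) f' (ρ - f 0) := by
  -- The Laplace transform of `f'` is `R L - f 0`, and after division by `R` the two terms have
  -- residues `ρ` and `f 0`.
  refine ⟨fun R => R * L R - f 0, c, δ, hδ, ?_, fun R hR => ⟨?_, ?_⟩, ?_⟩
  · exact (MeromorphicOn.id.mul hL).sub (MeromorphicOn.const _)
  · exact laplace_integrableOn_of_isBigO hf' hO' hR
  · show R * L R - f 0 = _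
    rw [hLf R hR, ← laplace_deriv hd hf' hO hO' hR]
  · have m0 : MeromorphicAt (fun R => R * L R) 0 :=
      (MeromorphicAt.id 0).mul (hL 0 (by simpa using hδ))
    have m1 := MeromorphicAt.circleIntegrable_inv_mul m0
    filter_upwards [hρ, m1, self_mem_nhdsWithin] with r h1 h2 h3
    have hr : (0 : ℝ) < r := h3
    have hne : ∀ z ∈ Metric.sphere (0 : ℂ) r, z ≠ 0 := by
      rintro z hz rfl
      simp at hz; exact hr.ne hz
    have h4 : CircleIntegrable (fun R : ℂ => R⁻¹ * f 0) 0 r := by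
      refine ContinuousOn.circleIntegrable hr.le fun z hz => ?_
      exact ((continuousAt_inv₀ (hne z hz)).mul continuousAt_const).continuousWithinAt
    have h5 : (∮ R in C(0, r), R⁻¹ * f 0) = 2 * Real.pi * Complex.I * f 0 := by
      have := circleIntegral.integral_sub_center_inv (0 : ℂ) hr.ne'
      simp only [sub_zero] at this
      simp_rw [mul_comm _ (f 0)]
      rw [circleIntegral.integral_const_mul, this]
    simp only [mul_sub]
    rw [circleIntegral.integral_sub h2 h4, mul_sub, h5]
    congr 1
    · rw [← h1]
      congr 1
      refine circleIntegral.integral_congr hr.le fun z hz => ?_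
      exact inv_mul_cancel_left₀ (hne z hz) _
    · have : (2 * (Real.pi : ℂ) * Complex.I) ≠ 0 := by simp [Real.pi_ne_zero]
      rw [inv_mul_cancel_left₀ this]

end ByParts

lemma deriv_expMono_isBigO (a : ℂ) (k : ℕ) {b : ℝ} (hb : a.re < b) :
    (fun t => k * expMono a (k - 1) t + a * expMono a k t) =O[atTop]
      fun t : ℝ => Real.exp (b * t) :=
  ((expMono_isBigO a (k - 1) hb).const_mul_left _).add ((expMono_isBigO a k hb).const_mul_left _)

/-- The Laplace transform of `t^k e^{a t}`. -/
lemma laplace_expMono (a : ℂ) (k : ℕ) {R : ℂ} (hR : a.re < R.re) :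
    ∫ τ in Set.Ici (0 : ℝ), laplaceIntegrand (expMono a k) R τ =
      k.factorial / (R - a) ^ (k + 1) := by
  obtain ⟨b, hb, hbR⟩ := exists_between hR
  have hne : R - a ≠ 0 := by
    intro h
    rw [sub_eq_zero.1 h] at hR
    exact lt_irrefl _ hR
  have hi : ∀ k, IntegrableOn (laplaceIntegrand (expMono a k) R) (Set.Ici 0) := fun k =>
    laplace_integrableOn_of_isBigO (continuous_expMono a k) (expMono_isBigO a k hb) hbR
  -- Integration by parts gives a recursion in `k`, with the boundary term `0^k`.
  have step : ∀ k : ℕ, (k : ℂ) * (∫ τ in Set.Ici (0 : ℝ), laplaceIntegrand (expMono a (k - 1)) R τ) +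
      a * (∫ τ in Set.Ici (0 : ℝ), laplaceIntegrand (expMono a k) R τ) =
      R * (∫ τ in Set.Ici (0 : ℝ), laplaceIntegrand (expMono a k) R τ) - expMono a k 0 := by
    intro k
    rw [← laplace_deriv (hasDerivAt_expMono a k) (by fun_prop) (expMono_isBigO a k hb)
      (deriv_expMono_isBigO a k hb) hbR, ← integral_const_mul, ← integral_const_mul,
      ← integral_add ((hi (k - 1)).const_mul _) ((hi k).const_mul _)]
    congr 1; ext τ; simp only [laplaceIntegrand]; ring
  induction k with
  | zero =>
    have := step 0
    simp [expMono] at this ⊢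
    refine eq_inv_of_mul_eq_one_left ?_
    linear_combination -this
  | succ k ih =>
    have := step (k + 1)
    rw [Nat.add_sub_cancel, ih] at this
    have h0 : expMono a (k + 1) 0 = 0 := by simp [expMono]
    rw [h0] at this
    rw [eq_div_iff (pow_ne_zero _ hne), pow_succ, ← mul_assoc, mul_right_comm]
    have h2 : (∫ τ in Set.Ici (0 : ℝ), laplaceIntegrand (expMono a (k + 1)) R τ) * (R - a) =
      ((k + 1 : ℕ) : ℂ) * (k.factorial / (R - a) ^ (k + 1)) := by linear_combination -this
    rw [h2, mul_assoc, div_mul_cancel₀ _ (pow_ne_zero _ hne), Nat.factorial_succ]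
    push_cast; ring

/-- The pole `k! / (R - a)^{k + 1}` has no residue at `0` unless `a = 0` and `k = 0`, so the
regularized integral over `[0, ∞)` of the derivative of `t^k e^{a t}` has no contribution from
infinity. -/
lemma hasRegResidue_deriv_expMono (a : ℂ) (k : ℕ) (hak : ¬(a = 0 ∧ k = 0)) :
    HasRegResidue (Set.Ici 0) (fun t => k * expMono a (k - 1) t + a * expMono a k t)
      (-expMono a k 0) := by
  obtain ⟨b, hb⟩ := exists_gt a.re
  have := hasRegResidue_deriv (hasDerivAt_expMono a k) (by fun_prop) (expMono_isBigO a k hb)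
    (deriv_expMono_isBigO a k hb) (L := fun R => k.factorial / (R - a) ^ (k + 1)) (δ := 1)
    one_pos ?_ (fun R hR => (laplace_expMono a k (hb.trans hR)).symm) (ρ := 0) ?_
  · simpa using this
  · intro R _; fun_prop
  -- For `a = 0` the pole at `0` has order `k + 1 ≥ 2`; for `a ≠ 0` there is no pole in a small
  -- disc.
  · by_cases ha : a = 0
    · have hk : k ≠ 0 := fun h => hak ⟨ha, h⟩
      subst ha
      refine Eventually.of_forall fun r => ?_
      have h1 : (fun R : ℂ => (k.factorial : ℂ) / (R - 0) ^ (k + 1)) =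
          fun R => (k.factorial : ℂ) * (R - 0) ^ (-(k + 1 : ℕ) : ℤ) := by
        ext R; rw [zpow_neg, zpow_natCast, div_eq_mul_inv]
      rw [h1, circleIntegral.integral_const_mul, circleIntegral.integral_sub_zpow_of_ne (by omega)]
      simp
    · filter_upwards [Ioo_mem_nhdsGT (norm_pos_iff.2 ha)] with r hr
      have hd : DifferentiableOn ℂ (fun R : ℂ => (k.factorial : ℂ) / (R - a) ^ (k + 1))
          (Metric.closedBall 0 r) := by
        intro R hR
        have hne : R - a ≠ 0 := by
          intro h
          rw [sub_eq_zero.1 h, mem_closedBall_zero_iff] at hR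
          linarith [hr.2]
        have hne' := pow_ne_zero (k + 1) hne
        exact DifferentiableAt.differentiableWithinAt (by fun_prop (disch := assumption))
      rw [(hd.diffContOnCl_ball subset_rfl).circleIntegral_eq_zero hr.1.le, mul_zero]

/-- Exponential polynomials without constant term. -/
def expPolyZero : Submodule ℂ (ℝ → ℂ) :=
  Submodule.span ℂ {h | ∃ a k, ¬(a = 0 ∧ k = 0) ∧ h = expMono a k}

/-- `h` is, up to an exponentially decaying error, an exponential polynomial with constant
term `c`. -/
def HasConst (h : ℝ → ℂ) (c : ℂ) : Prop :=
  ∃ δ : ℝ, 0 < δ ∧ ∃ e ∈ expPolyZero,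
    (fun t => h t - c - e t) =O[atTop] fun t : ℝ => Real.exp (-(δ * t))

/-- Exponentially bounded functions at `+∞`. -/
def ExpBounded (h : ℝ → ℂ) : Prop := ∃ b : ℝ, h =O[atTop] fun t : ℝ => Real.exp (b * t)

/-- The regularized integral over `[0, ∞)` of the derivative of an exponential polynomial `e`
without constant term is `-e 0`. -/
lemma expPolyZero_deriv {e : ℝ → ℂ} (he : e ∈ expPolyZero) :
    ∃ e' : ℝ → ℂ, (∀ t, HasDerivAt e (e' t) t) ∧ Continuous e' ∧ ExpBounded e ∧ ExpBounded e' ∧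
      HasRegResidue (Set.Ici 0) e' (-e 0) := by
  induction he using Submodule.span_induction with
  | mem x hx =>
    obtain ⟨a, k, hak, rfl⟩ := hx
    obtain ⟨b, hb⟩ := exists_gt a.re
    exact ⟨_, hasDerivAt_expMono a k, by fun_prop, ⟨b, expMono_isBigO a k hb⟩,
      ⟨b, deriv_expMono_isBigO a k hb⟩, hasRegResidue_deriv_expMono a k hak⟩
  | zero =>
    refine ⟨0, fun t => hasDerivAt_const t 0, continuous_const, ⟨0, isBigO_zero _ _⟩,
      ⟨0, isBigO_zero _ _⟩, ?_⟩
    have := (hasRegResidue_deriv_expMono 1 0 (by simp)).smul 0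
    simpa using this
  | add x y _ _ hx hy =>
    obtain ⟨x', h1, h2, ⟨b, h3⟩, ⟨b', h3'⟩, h4⟩ := hx
    obtain ⟨y', k1, k2, ⟨c, k3⟩, ⟨c', k3'⟩, k4⟩ := hy
    refine ⟨x' + y', fun t => (h1 t).add (k1 t), h2.add k2, ⟨max b c, ?_⟩, ⟨max b' c', ?_⟩, ?_⟩
    · exact (h3.trans (exp_isBigO_exp (le_max_left _ _))).add
        (k3.trans (exp_isBigO_exp (le_max_right _ _)))
    · exact (h3'.trans (exp_isBigO_exp (le_max_left _ _))).add
        (k3'.trans (exp_isBigO_exp (le_max_right _ _)))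
    · convert h4.add k4 using 1
      simp only [Pi.add_apply]; ring
  | smul z x _ hx =>
    obtain ⟨x', h1, h2, ⟨b, h3⟩, ⟨b', h3'⟩, h4⟩ := hx
    refine ⟨z • x', fun t => (h1 t).const_smul z, h2.const_smul z, ⟨b, h3.const_smul_left z⟩,
      ⟨b', h3'.const_smul_left z⟩, ?_⟩
    convert h4.smul z using 1
    simp

/-- The regularized integral of `H'` over `[t, ∞)` is the constant term of `H` at infinity
minus `H t`. -/
theorem hasRegResidue_of_primitive {H h : ℝ → ℂ} {c : ℂ} (hd : ∀ t, HasDerivAt H (h t) t)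
    (hh : Continuous h) (hO : ExpBounded h) (hH : HasConst H c) (t : ℝ) :
    HasRegResidue (Set.Ici t) h (c - H t) := by
  obtain ⟨δ, hδ, e, he, hr⟩ := hH
  obtain ⟨e', h1, h2, -, ⟨b', h3'⟩, h4⟩ := expPolyZero_deriv he
  obtain ⟨b, hO⟩ := hO
  have hrd : ∀ t, HasDerivAt (fun t => H t - c - e t) (h t - e' t) t := fun t =>
    ((hd t).sub_const c).sub (h1 t)
  have hrc : Continuous fun t => H t - c - e t :=
    continuous_iff_continuousAt.2 fun t => (hrd t).continuousAt
  obtain ⟨B, hB⟩ := exists_exp_bound hrc hr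
  set m := max 0 (max b b') with hm
  have hLd := laplace_differentiableOn measurableSet_Ioi hrc hB
  have hop : IsOpen {R : ℂ | -δ < R.re} := isOpen_lt continuous_const Complex.continuous_re
  -- The Laplace transform of the remainder `H - c - e` is holomorphic near `0`, so its residue
  -- is zero, and only its value at `0` contributes to the integral of `h - e'`.
  have hres : HasRegResidue (Set.Ici 0) (fun t => h t - e' t) (0 - (H 0 - c - e 0)) := by
    refine hasRegResidue_deriv (c := m) hrd (hh.sub h2) ?_ ?_ hδ
      (hLd.analyticOnNhd hop).meromorphicOn (fun R hR => ?_) ?_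
    · refine hr.trans ?_
      simp only [← neg_mul]
      exact exp_isBigO_exp ((neg_nonpos.2 hδ.le).trans (le_max_left _ _))
    · exact (hO.trans (exp_isBigO_exp ((le_max_left _ _).trans (le_max_right _ _)))).sub
        (h3'.trans (exp_isBigO_exp ((le_max_right _ _).trans (le_max_right _ _))))
    · rw [integral_Ici_eq_integral_Ioi]
    · filter_upwards [Ioo_mem_nhdsGT hδ] with r hr
      have hsub : Metric.closedBall (0 : ℂ) r ⊆ {R : ℂ | -δ < R.re} := by
        intro R hR
        rw [mem_closedBall_zero_iff] at hR
        have := (Complex.abs_re_le_norm R).trans hR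
        show -δ < R.re
        linarith [neg_abs_le R.re, hr.2]
      rw [((hLd.mono hsub).diffContOnCl_ball subset_rfl).circleIntegral_eq_zero hr.1.le, mul_zero]
  have h0 : HasRegResidue (Set.Ici 0) h (c - H 0) := by
    convert hres.add h4 using 1
    · ext t; simp
    · ring
  convert h0.Ici_of_zero hh t using 1
  rw [intervalIntegral.integral_eq_sub_of_hasDerivAt (fun x _ => hd x)
    (hh.intervalIntegrable _ _)]
  ring

/-- The constant term of a function is determined, because it can be recovered from the regularized
integral of the derivative. -/
theorem HasConst.unique {H h : ℝ → ℂ} {c c' : ℂ} (hd : ∀ t, HasDerivAt H (h t) t)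
    (hh : Continuous h) (hO : ExpBounded h) (hc : HasConst H c) (hc' : HasConst H c') : c = c' := by
  have := (hasRegResidue_of_primitive hd hh hO hc 0).unique
    (hasRegResidue_of_primitive hd hh hO hc' 0)
  linear_combination this

/-! ### Asymptotic expansions in exponential polynomials -/

section Expansions

/-- Exponential polynomials `∑ c t^k e^{a t}` all of whose exponents have imaginary part in `Λ`. -/
def ExpPoly (Λ : Set ℝ) : Submodule ℂ (ℝ → ℂ) :=
  Submodule.span ℂ {h | ∃ (a : ℂ) (k : ℕ), a.im ∈ Λ ∧ h = expMono a k}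

variable {Λ Λ' Λ'' : Set ℝ} {h k : ℝ → ℂ}

lemma expMono_mem_expPoly {a : ℂ} (n : ℕ) (ha : a.im ∈ Λ) : expMono a n ∈ ExpPoly Λ :=
  Submodule.subset_span ⟨a, n, ha, rfl⟩

lemma ExpPoly.mono (hΛ : Λ ⊆ Λ') : ExpPoly Λ ≤ ExpPoly Λ' :=
  Submodule.span_mono fun _ ⟨a, n, ha, e⟩ => ⟨a, n, hΛ ha, e⟩

lemma ExpPoly.mul_mem (hΛ : ∀ x ∈ Λ, ∀ y ∈ Λ', x + y ∈ Λ'') (hh : h ∈ ExpPoly Λ)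
    (hk : k ∈ ExpPoly Λ') : h * k ∈ ExpPoly Λ'' := by
  have := Submodule.mul_mem_mul hh hk
  rw [ExpPoly, ExpPoly, Submodule.span_mul_span] at this
  refine Submodule.span_mono ?_ this
  rintro _ ⟨_, ⟨a, n, ha, rfl⟩, _, ⟨b, m, hb, rfl⟩, rfl⟩
  exact ⟨a + b, n + m, hΛ _ ha _ hb, expMono_mul a b n m⟩

lemma ExpBounded.add (hh : ExpBounded h) (hk : ExpBounded k) : ExpBounded (h + k) := by
  obtain ⟨b, hb⟩ := hh
  obtain ⟨c, hc⟩ := hk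
  exact ⟨max b c, (hb.trans (exp_isBigO_exp (le_max_left _ _))).add
    (hc.trans (exp_isBigO_exp (le_max_right _ _)))⟩

lemma ExpPoly.expBounded (hh : h ∈ ExpPoly Λ) : ExpBounded h := by
  induction hh using Submodule.span_induction with
  | mem x hx =>
    obtain ⟨a, n, -, rfl⟩ := hx
    obtain ⟨b, hb⟩ := exists_gt a.re
    exact ⟨b, expMono_isBigO a n hb⟩
  | zero => exact ⟨0, isBigO_zero _ _⟩
  | add x y _ _ hx hy => exact hx.add hy
  | smul z x _ hx =>
    obtain ⟨b, hb⟩ := hx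
    exact ⟨b, hb.const_smul_left z⟩

lemma exp_neg_isBigO {M N : ℝ} (h : N ≤ M) :
    (fun t : ℝ => Real.exp (-(M * t))) =O[atTop] fun t : ℝ => Real.exp (-(N * t)) := by
  have := exp_isBigO_exp (neg_le_neg h)
  simpa using this

/-- Functions that have, up to errors decaying faster than any given exponential, expansions at
`+∞` in exponential polynomials whose exponents have imaginary part in `Λ`. -/
def AsyExp (Λ : Set ℝ) : Submodule ℂ (ℝ → ℂ) where
  carrier := {h | ∀ M : ℝ, ∃ e ∈ ExpPoly Λ, (h - e) =O[atTop] fun t : ℝ => Real.exp (-(M * t))}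
  add_mem' := by
    intro h k hh hk M
    obtain ⟨e, he, h1⟩ := hh M
    obtain ⟨f, hf, h2⟩ := hk M
    refine ⟨e + f, Submodule.add_mem _ he hf, ?_⟩
    rw [add_sub_add_comm]
    exact h1.add h2
  zero_mem' := fun M => ⟨0, Submodule.zero_mem _, by
    rw [sub_zero]; exact isBigO_zero _ _⟩
  smul_mem' := by
    intro c h hh M
    obtain ⟨e, he, h1⟩ := hh M
    refine ⟨c • e, Submodule.smul_mem _ c he, ?_⟩
    rw [← smul_sub]
    exact h1.const_smul_left c

lemma AsyExp.mono (hΛ : Λ ⊆ Λ') : AsyExp Λ ≤ AsyExp Λ' := fun _ hh M =>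
  let ⟨e, he, h1⟩ := hh M
  ⟨e, ExpPoly.mono hΛ he, h1⟩

lemma ExpPoly.le_asyExp : ExpPoly Λ ≤ AsyExp Λ := fun e he M =>
  ⟨e, he, by rw [sub_self]; exact isBigO_zero _ _⟩

lemma expMono_mem_asyExp {a : ℂ} (n : ℕ) (ha : a.im ∈ Λ) : expMono a n ∈ AsyExp Λ :=
  ExpPoly.le_asyExp (expMono_mem_expPoly n ha)

lemma AsyExp.expBounded (hh : h ∈ AsyExp Λ) : ExpBounded h := by
  obtain ⟨e, he, h1⟩ := hh 0
  have h2 : ExpBounded (h - e) := ⟨0, by simpa using h1⟩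
  have := h2.add (ExpPoly.expBounded he)
  rwa [sub_add_cancel] at this

lemma AsyExp.mul_mem (hΛ : ∀ x ∈ Λ, ∀ y ∈ Λ', x + y ∈ Λ'') (hh : h ∈ AsyExp Λ)
    (hk : k ∈ AsyExp Λ') : h * k ∈ AsyExp Λ'' := by
  intro M
  obtain ⟨c, hc⟩ := AsyExp.expBounded hk
  -- In `h k - e f = (h - e) k + e (k - f)` the approximation of each factor has to beat the
  -- growth of the other one.
  obtain ⟨e, he, h1⟩ := hh (M + c)
  obtain ⟨b, hb⟩ := ExpPoly.expBounded he
  obtain ⟨f, hf, h2⟩ := hk (M + b)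
  refine ⟨e * f, ExpPoly.mul_mem hΛ he hf, ?_⟩
  have e1 : h * k - e * f = (h - e) * k + e * (k - f) := by ring
  rw [e1]
  refine IsBigO.add ?_ ?_
  · refine (h1.mul hc).trans (isBigO_of_le _ fun t => ?_)
    rw [← Real.exp_add]; apply le_of_eq; congr 2; ring
  · refine (hb.mul h2).trans (isBigO_of_le _ fun t => ?_)
    rw [← Real.exp_add]; apply le_of_eq; congr 2; ring

lemma HasConst.add {c c' : ℂ} (hc : HasConst h c) (hc' : HasConst k c') :
    HasConst (h + k) (c + c') := by
  obtain ⟨δ, hδ, e, he, h1⟩ := hc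
  obtain ⟨δ', hδ', f, hf, h2⟩ := hc'
  refine ⟨min δ δ', lt_min hδ hδ', e + f, Submodule.add_mem _ he hf, ?_⟩
  refine ((h1.trans (exp_neg_isBigO (min_le_left _ _))).add
    (h2.trans (exp_neg_isBigO (min_le_right _ _)))).congr_left fun t => ?_
  simp only [Pi.add_apply]; ring

lemma HasConst.const (c : ℂ) : HasConst (fun _ => c) c :=
  ⟨1, one_pos, 0, Submodule.zero_mem _, by simpa using isBigO_zero _ _⟩

/-- If no exponent is real, the constant term vanishes. -/
lemma AsyExp.hasConst_zero (hΛ : (0 : ℝ) ∉ Λ) (hh : h ∈ AsyExp Λ) : HasConst h 0 := by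
  obtain ⟨e, he, h1⟩ := hh 1
  refine ⟨1, one_pos, e, ?_, h1.congr_left fun t => by simp⟩
  refine Submodule.span_mono ?_ he
  rintro _ ⟨a, n, ha, rfl⟩
  refine ⟨a, n, ?_, rfl⟩
  rintro ⟨rfl, -⟩
  exact hΛ (by simpa using ha)

lemma ExpPoly.exists_const (hh : h ∈ ExpPoly Λ) : ∃ c : ℂ, ∃ e ∈ expPolyZero,
    ∀ t, h t = c + e t := by
  induction hh using Submodule.span_induction with
  | mem x hx =>
    obtain ⟨a, n, -, rfl⟩ := hx
    by_cases h0 : a = 0 ∧ n = 0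
    · obtain ⟨rfl, rfl⟩ := h0
      exact ⟨1, 0, Submodule.zero_mem _, fun t => by simp [expMono]⟩
    · exact ⟨0, expMono a n, Submodule.subset_span ⟨a, n, h0, rfl⟩, fun t => by simp⟩
  | zero => exact ⟨0, 0, Submodule.zero_mem _, fun t => by simp⟩
  | add x y _ _ hx hy =>
    obtain ⟨c, e, he, h1⟩ := hx
    obtain ⟨c', e', he', h1'⟩ := hy
    refine ⟨c + c', e + e', Submodule.add_mem _ he he', fun t => ?_⟩
    simp only [Pi.add_apply, h1, h1']; ring
  | smul z x _ hx =>
    obtain ⟨c, e, he, h1⟩ := hx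
    refine ⟨z * c, z • e, Submodule.smul_mem _ z he, fun t => ?_⟩
    simp only [Pi.smul_apply, h1, smul_eq_mul]; ring

lemma AsyExp.exists_hasConst (hh : h ∈ AsyExp Λ) : ∃ c, HasConst h c := by
  obtain ⟨e, he, h1⟩ := hh 1
  obtain ⟨c, f, hf, h2⟩ := ExpPoly.exists_const he
  refine ⟨c, 1, one_pos, f, hf, h1.congr_left fun t => ?_⟩
  simp only [Pi.sub_apply, h2]; ring

/-- Exponential polynomials have primitives among exponential polynomials. -/
lemma ExpPoly.exists_primitive (hh : h ∈ ExpPoly Λ) :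
    ∃ H ∈ ExpPoly Λ, ∀ t, HasDerivAt H (h t) t := by
  induction hh using Submodule.span_induction with
  | mem x hx =>
    obtain ⟨a, n, ha, rfl⟩ := hx
    by_cases h : a = 0
    · subst h
      refine ⟨((n : ℂ) + 1)⁻¹ • expMono 0 (n + 1),
        Submodule.smul_mem _ _ (expMono_mem_expPoly _ ha), fun t => ?_⟩
      refine ((hasDerivAt_expMono 0 (n + 1) t).const_smul ((n : ℂ) + 1)⁻¹).congr_deriv ?_
      have : (n : ℂ) + 1 ≠ 0 := Nat.cast_add_one_ne_zero n
      simp only [smul_eq_mul, Nat.add_sub_cancel]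
      push_cast
      field_simp; ring
    · induction n with
      | zero =>
        refine ⟨a⁻¹ • expMono a 0, Submodule.smul_mem _ _ (expMono_mem_expPoly _ ha), fun t => ?_⟩
        refine ((hasDerivAt_expMono a 0 t).const_smul a⁻¹).congr_deriv ?_
        simp [h]
      | succ n ih =>
        obtain ⟨H, hH, hd⟩ := ih
        refine ⟨a⁻¹ • expMono a (n + 1) - ((n + 1) / a) • H,
          Submodule.sub_mem _ (Submodule.smul_mem _ _ (expMono_mem_expPoly _ ha))
            (Submodule.smul_mem _ _ hH), fun t => ?_⟩
        refine (((hasDerivAt_expMono a (n + 1) t).const_smul a⁻¹).sub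
          ((hd t).const_smul (((n : ℂ) + 1) / a))).congr_deriv ?_
        simp only [smul_eq_mul, Nat.add_sub_cancel]
        push_cast
        field_simp; ring
  | zero => exact ⟨0, Submodule.zero_mem _, fun t => hasDerivAt_const t 0⟩
  | add x y _ _ hx hy =>
    obtain ⟨X, hX, h1⟩ := hx
    obtain ⟨Y, hY, h2⟩ := hy
    exact ⟨X + Y, Submodule.add_mem _ hX hY, fun t => (h1 t).add (h2 t)⟩
  | smul z x _ hx =>
    obtain ⟨X, hX, h1⟩ := hx
    exact ⟨z • X, Submodule.smul_mem _ z hX, fun t => (h1 t).const_smul z⟩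

/-- A primitive of an exponentially decaying function converges exponentially fast. -/
lemma exists_limit_of_deriv_decay {r r' : ℝ → ℂ} (hd : ∀ t, HasDerivAt r (r' t) t)
    (hc : Continuous r') {M : ℝ} (hM : 0 < M)
    (hO : r' =O[atTop] fun t : ℝ => Real.exp (-(M * t))) :
    ∃ c, (fun t => r t - c) =O[atTop] fun t : ℝ => Real.exp (-(M * t)) := by
  obtain ⟨b, hb⟩ := exists_exp_bound hc hO
  have hexp : ∀ t, IntegrableOn (fun τ : ℝ => b * Real.exp (-M * τ)) (Set.Ioi t) := fun t =>
    (exp_neg_integrableOn_Ioi t hM).const_mul b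
  have hint : ∀ t, 0 ≤ t → IntegrableOn r' (Set.Ioi t) := by
    intro t ht
    refine Integrable.mono' (hexp t) hc.aestronglyMeasurable ?_
    refine (ae_restrict_iff' measurableSet_Ioi).2 (Eventually.of_forall fun τ hτ => ?_)
    have h0 : 0 < τ := ht.trans_lt hτ
    have := hb τ h0
    rwa [abs_of_pos h0, ← neg_mul] at this
  refine ⟨r 0 + ∫ τ in Set.Ioi (0 : ℝ), r' τ, IsBigO.of_bound (b / M) ?_⟩
  filter_upwards [eventually_ge_atTop 0] with t ht
  have h1 : r t - (r 0 + ∫ τ in Set.Ioi (0 : ℝ), r' τ) = -∫ τ in Set.Ioi t, r' τ := by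
    rw [← intervalIntegral.integral_interval_add_Ioi (hint 0 le_rfl) (hint t ht),
      intervalIntegral.integral_eq_sub_of_hasDerivAt (fun x _ => hd x)
        (hc.intervalIntegrable _ _)]
    ring
  rw [h1, norm_neg]
  have h2 : ‖∫ τ in Set.Ioi t, r' τ‖ ≤ ∫ τ in Set.Ioi t, b * Real.exp (-M * τ) := by
    refine norm_integral_le_of_norm_le (hexp t) ?_
    refine (ae_restrict_iff' measurableSet_Ioi).2 (Eventually.of_forall fun τ hτ => ?_)
    have h0 : 0 < τ := ht.trans_lt hτ
    have := hb τ h0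
    rwa [abs_of_pos h0, ← neg_mul] at this
  refine h2.trans (le_of_eq ?_)
  rw [integral_const_mul, integral_exp_mul_Ioi (by linarith), Real.norm_eq_abs,
    abs_of_pos (Real.exp_pos _), neg_mul]
  field_simp

/-- Integration preserves expansions. The constant of integration is an exponential polynomial of
exponent `0`, whence the hypothesis `0 ∈ Λ`. -/
lemma AsyExp.primitive_mem (h0 : (0 : ℝ) ∈ Λ) {H : ℝ → ℂ} (hd : ∀ t, HasDerivAt H (h t) t)
    (hc : Continuous h) (hh : h ∈ AsyExp Λ) : H ∈ AsyExp Λ := by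
  intro M
  -- The accuracy has to be a positive rate, for the remainder to be integrable at infinity.
  obtain ⟨e, he, h1⟩ := hh (max M 1)
  obtain ⟨E, hE, h2⟩ := ExpPoly.exists_primitive he
  have hce : Continuous e := by
    clear h1 h2 hE
    induction he using Submodule.span_induction with
    | mem x hx => obtain ⟨a, n, -, rfl⟩ := hx; fun_prop
    | zero => exact continuous_const
    | add x y _ _ hx hy => exact hx.add hy
    | smul z x _ hx => exact hx.const_smul z
  obtain ⟨c, h3⟩ := exists_limit_of_deriv_decay (r := H - E) (r' := h - e)
    (fun t => (hd t).sub (h2 t)) (hc.sub hce) (M := max M 1) (by positivity) h1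
  refine ⟨E + c • expMono 0 0, Submodule.add_mem _ hE
    (Submodule.smul_mem _ _ (expMono_mem_expPoly _ (by simpa using h0))), ?_⟩
  refine (h3.congr_left fun t => ?_).trans (exp_neg_isBigO (le_max_left _ _))
  simp only [Pi.sub_apply, Pi.add_apply, Pi.smul_apply, expMono, smul_eq_mul]
  simp; ring

/-- `w` has Taylor approximations of all orders at `0+`. -/
def HasTaylor (w : ℝ → ℂ) : Prop :=
  ∀ n : ℕ, ∃ p : Polynomial ℂ, (fun z : ℝ => w z - p.eval (z : ℂ)) =O[𝓝[>] 0] fun z : ℝ => z ^ n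

/-- Substituting `z = e^{-g t}` turns the powers `z^i` of a Taylor expansion at `0` into the
exponentials `e^{-i g t}`. -/
lemma HasTaylor.mem_asyExp {w : ℝ → ℂ} (hw : HasTaylor w) {g : ℝ} (hg : 0 < g) :
    (fun t : ℝ => w (Real.exp (-(g * t)))) ∈ AsyExp {0} := by
  intro M
  obtain ⟨n, hn⟩ := exists_nat_ge (M / g)
  obtain ⟨p, hp⟩ := hw n
  have hlim : Tendsto (fun t : ℝ => Real.exp (-(g * t))) atTop (𝓝[>] 0) := by
    refine tendsto_nhdsWithin_iff.2 ⟨?_, Eventually.of_forall fun t => Real.exp_pos _⟩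
    have : Tendsto (fun t : ℝ => -g * t) atTop atBot :=
      tendsto_id.const_mul_atTop_of_neg (by linarith)
    exact (Real.tendsto_exp_atBot.comp this).congr fun t => by simp
  refine ⟨fun t : ℝ => p.eval ((Real.exp (-(g * t)) : ℝ) : ℂ), ?_, ?_⟩
  · have : (fun t : ℝ => p.eval ((Real.exp (-(g * t)) : ℝ) : ℂ)) =
        ∑ i ∈ Finset.range (p.natDegree + 1), p.coeff i • expMono (-(i * g : ℝ)) 0 := by
      ext t
      rw [Polynomial.eval_eq_sum_range, Finset.sum_apply]
      refine Finset.sum_congr rfl fun i _ => ?_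
      simp only [Pi.smul_apply, expMono, smul_eq_mul, pow_zero, one_mul]
      rw [Complex.ofReal_exp, ← Complex.exp_nat_mul]
      congr 2; push_cast; ring
    rw [this]
    refine Submodule.sum_mem _ fun i _ => Submodule.smul_mem _ _ (expMono_mem_expPoly _ ?_)
    simp
  · refine (hp.comp_tendsto hlim).trans ?_
    have : ((fun z : ℝ => z ^ n) ∘ fun t : ℝ => Real.exp (-(g * t))) =
        fun t : ℝ => Real.exp (-((n * g) * t)) := by
      ext t
      simp only [Function.comp]
      rw [← Real.exp_nat_mul]; congr 1; ring
    rw [this]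
    exact exp_neg_isBigO ((div_le_iff₀ hg).1 hn)

lemma AnalyticAt.hasTaylor {w : ℝ → ℂ} (hw : AnalyticAt ℝ w 0) : HasTaylor w := by
  obtain ⟨p, hp⟩ := hw
  intro n
  have h1 := hp.isBigO_sub_partialSum_pow n
  refine ⟨∑ i ∈ Finset.range n, Polynomial.monomial i (p.coeff i), ?_⟩
  refine ((h1.mono nhdsWithin_le_nhds).congr_left fun z => ?_).trans (isBigO_of_le _ fun z => ?_)
  · rw [zero_add, FormalMultilinearSeries.partialSum, Polynomial.eval_finsetSum]
    congr 1
    refine Finset.sum_congr rfl fun i _ => ?_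
    rw [Polynomial.eval_monomial, FormalMultilinearSeries.apply_eq_pow_smul_coeff]
    rw [Complex.real_smul]; push_cast; ring
  · simp

/-! ### Functions with expansions at both ends -/

/-- Continuous functions with expansions in exponential polynomials both at `+∞` and `-∞`, the
imaginary parts of the exponents lying in `Λ`. -/
def TwoSided (Λ : AddSubmonoid ℝ) : Subalgebra ℂ (ℝ → ℂ) where
  carrier := {h | Continuous h ∧ h ∈ AsyExp Λ ∧ (fun t => h (-t)) ∈ AsyExp Λ}
  mul_mem' := fun ⟨h1, h2, h3⟩ ⟨k1, k2, k3⟩ =>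
    ⟨h1.mul k1, AsyExp.mul_mem (fun _ hx _ hy => Λ.add_mem hx hy) h2 k2,
      AsyExp.mul_mem (fun _ hx _ hy => Λ.add_mem hx hy) h3 k3⟩
  add_mem' := fun ⟨h1, h2, h3⟩ ⟨k1, k2, k3⟩ =>
    ⟨h1.add k1, Submodule.add_mem _ h2 k2, Submodule.add_mem _ h3 k3⟩
  algebraMap_mem' := by
    intro c
    have h1 : (fun _ : ℝ => c) ∈ AsyExp (Λ : Set ℝ) := by
      have : (fun _ : ℝ => c) = c • expMono 0 0 := by ext t; simp [expMono]
      rw [this]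
      exact Submodule.smul_mem _ _ (expMono_mem_asyExp _ (by simp [Λ.zero_mem]))
    exact ⟨continuous_const, h1, h1⟩

lemma TwoSided.mono {Λ Λ' : AddSubmonoid ℝ} (hΛ : Λ ≤ Λ') : TwoSided Λ ≤ TwoSided Λ' :=
  fun _ hh => ⟨hh.1, AsyExp.mono hΛ hh.2.1, AsyExp.mono hΛ hh.2.2⟩

lemma TwoSided.reflect {Λ : AddSubmonoid ℝ} (hh : h ∈ TwoSided Λ) :
    (fun t => h (-t)) ∈ TwoSided Λ :=
  ⟨hh.1.comp continuous_neg, hh.2.2, by simpa using hh.2.1⟩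

lemma TwoSided.const_mem {Λ : AddSubmonoid ℝ} (c : ℂ) : (fun _ => c) ∈ TwoSided Λ :=
  (TwoSided Λ).algebraMap_mem c

lemma TwoSided.expMono_mem {Λ : AddSubmonoid ℝ} {a : ℂ} (n : ℕ) (ha : a.im ∈ Λ)
    (ha' : -a.im ∈ Λ) : expMono a n ∈ TwoSided Λ := by
  refine ⟨continuous_expMono a n, expMono_mem_asyExp n ha, ?_⟩
  have : (fun t => expMono a n (-t)) = (-1) ^ n • expMono (-a) n := by
    ext t
    simp only [expMono, Pi.smul_apply]
    push_cast
    rw [neg_pow]; simp [mul_assoc]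
  rw [this]
  have h2 := Submodule.smul_mem (AsyExp (Λ : Set ℝ)) ((-1 : ℂ) ^ n)
    (expMono_mem_asyExp (Λ := (Λ : Set ℝ)) (a := -a) n (by simpa using ha'))
  convert h2 using 1
  ext t; simp

lemma TwoSided.id_mem {Λ : AddSubmonoid ℝ} : (fun t : ℝ => (t : ℂ)) ∈ TwoSided Λ := by
  have : (fun t : ℝ => (t : ℂ)) = expMono 0 1 := by ext; simp [expMono]
  rw [this]
  exact TwoSided.expMono_mem 1 (by simp [Λ.zero_mem]) (by simp [Λ.zero_mem])

lemma TwoSided.primitive_mem {Λ : AddSubmonoid ℝ} {H : ℝ → ℂ} (hd : ∀ t, HasDerivAt H (h t) t)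
    (hh : h ∈ TwoSided Λ) : H ∈ TwoSided Λ := by
  refine ⟨continuous_iff_continuousAt.2 fun t => (hd t).continuousAt,
    AsyExp.primitive_mem Λ.zero_mem hd hh.1 hh.2.1, ?_⟩
  refine AsyExp.primitive_mem (h := fun t => -h (-t)) Λ.zero_mem (fun t => ?_)
    (hh.1.comp continuous_neg).neg (Submodule.neg_mem _ hh.2.2)
  have h1 : HasDerivAt (fun t : ℝ => -t) (-1) t := (hasDerivAt_id t).neg
  refine ((hd (-t)).scomp t h1).congr_deriv ?_
  simp

/-- Every function with expansions at both ends has a primitive whose constant term at `+∞`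
vanishes. -/
lemma TwoSided.exists_primitive {Λ : AddSubmonoid ℝ} (hh : h ∈ TwoSided Λ) :
    ∃ H ∈ TwoSided Λ, (∀ t, HasDerivAt H (h t) t) ∧ HasConst H 0 := by
  have hd : ∀ t, HasDerivAt (fun t => ∫ τ in (0 : ℝ)..t, h τ) (h t) t := fun t =>
    intervalIntegral.integral_hasDerivAt_right (hh.1.intervalIntegrable _ _)
      (hh.1.stronglyMeasurableAtFilter _ _) hh.1.continuousAt
  have hm := TwoSided.primitive_mem hd hh
  obtain ⟨c, hc⟩ := AsyExp.exists_hasConst hm.2.1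
  refine ⟨fun t => (∫ τ in (0 : ℝ)..t, h τ) + -c,
    (TwoSided Λ).add_mem hm (TwoSided.const_mem (-c)), fun t => (hd t).add_const _, ?_⟩
  have := hc.add (HasConst.const (-c))
  rwa [add_neg_cancel] at this

/-! ### Finite parts of integrals over half-lines -/

open Classical in
/-- The finite part of `∫_t^∞ h`, that is, its regularized integral; `0` if this does not exist. -/
def finInt (t : ℝ) (h : ℝ → ℂ) : ℂ :=
  if hh : ∃ a, HasRegResidue (Set.Ici t) h a then Classical.choose hh else 0

lemma HasRegResidue.finInt_eq {t : ℝ} {a : ℂ} (ha : HasRegResidue (Set.Ici t) h a) :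
    finInt t h = a := by
  have hh : ∃ a, HasRegResidue (Set.Ici t) h a := ⟨a, ha⟩
  rw [finInt, dif_pos hh]
  exact (Classical.choose_spec hh).unique ha

lemma finInt_eq_of_primitive {H : ℝ → ℂ} {c : ℂ} (hd : ∀ t, HasDerivAt H (h t) t)
    (hh : h ∈ TwoSided ⊤) (hH : HasConst H c) (t : ℝ) : finInt t h = c - H t :=
  (hasRegResidue_of_primitive hd hh.1 (AsyExp.expBounded hh.2.1) hH t).finInt_eq

lemma hasRegResidue_finInt (hh : h ∈ TwoSided ⊤) (t : ℝ) :
    HasRegResidue (Set.Ici t) h (finInt t h) := by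
  obtain ⟨H, -, hd, hc⟩ := TwoSided.exists_primitive hh
  have := hasRegResidue_of_primitive hd hh.1 (AsyExp.expBounded hh.2.1) hc t
  rwa [this.finInt_eq]

lemma finInt_add (hh : h ∈ TwoSided ⊤) (hk : k ∈ TwoSided ⊤) (t : ℝ) :
    finInt t (h + k) = finInt t h + finInt t k :=
  ((hasRegResidue_finInt hh t).add (hasRegResidue_finInt hk t)).finInt_eq

lemma finInt_smul (hh : h ∈ TwoSided ⊤) (c : ℂ) (t : ℝ) :
    finInt t (c • h) = c * finInt t h :=
  ((hasRegResidue_finInt hh t).smul c).finInt_eq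

lemma finInt_mem {Λ : AddSubmonoid ℝ} (hh : h ∈ TwoSided Λ) :
    (fun t => finInt t h) ∈ TwoSided Λ := by
  obtain ⟨H, hH, hd, hc⟩ := TwoSided.exists_primitive hh
  have : (fun t => finInt t h) = -H := by
    ext t
    rw [finInt_eq_of_primitive hd (TwoSided.mono le_top hh) hc]
    simp
  rw [this]
  exact (TwoSided Λ).neg_mem hH

end Expansions

/-! ### Trigonometric polynomials in the angles -/

section Trig

variable {d : ℕ}

/-- The character `θ ↦ e^{i q·θ}`. -/
def torusChar (q : Fin d → ℤ) (θ : Fin d → ℝ) : ℂ :=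
  Complex.exp (Complex.I * ((∑ i, (q i : ℝ) * θ i : ℝ) : ℂ))

lemma torusChar_add (q : Fin d → ℤ) (θ θ' : Fin d → ℝ) :
    torusChar q (θ + θ') = torusChar q θ * torusChar q θ' := by
  simp only [torusChar, ← Complex.exp_add, Pi.add_apply, mul_add, Finset.sum_add_distrib]
  push_cast; ring_nf

lemma torusChar_mul (q p : Fin d → ℤ) (θ : Fin d → ℝ) :
    torusChar q θ * torusChar p θ = torusChar (q + p) θ := by
  simp only [torusChar, ← Complex.exp_add, Pi.add_apply]
  congr 1
  rw [← mul_add, ← Complex.ofReal_add, ← Finset.sum_add_distrib]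
  congr 3; ext i; push_cast; ring

lemma torusChar_neg (q : Fin d → ℤ) (θ : Fin d → ℝ) : torusChar q (-θ) = torusChar (-q) θ := by
  simp [torusChar]

@[simp] lemma torusChar_zero (θ : Fin d → ℝ) : torusChar 0 θ = 1 := by simp [torusChar]

@[fun_prop]
lemma continuous_torusChar (q : Fin d → ℤ) : Continuous (torusChar q) := by
  unfold torusChar; fun_prop

lemma torusChar_ne_zero (q : Fin d → ℤ) (θ : Fin d → ℝ) : torusChar q θ ≠ 0 := Complex.exp_ne_zero _

lemma integral_exp_int (n : ℤ) : ∫ x in Set.Ioc (0 : ℝ) (2 * Real.pi),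
    Complex.exp (Complex.I * ((n * x : ℝ) : ℂ)) = if n = 0 then ((2 * Real.pi : ℝ) : ℂ) else 0 := by
  rw [← intervalIntegral.integral_of_le Real.two_pi_pos.le]
  split_ifs with h
  · simp [h]
  · have hne : Complex.I * (n : ℂ) ≠ 0 := mul_ne_zero Complex.I_ne_zero (by exact_mod_cast h)
    have : (fun x : ℝ => Complex.exp (Complex.I * ((n * x : ℝ) : ℂ))) =
        fun x : ℝ => Complex.exp (Complex.I * n * x) := by
      ext x; push_cast; ring_nf
    rw [this, integral_exp_mul_complex hne]
    have h2 : Complex.exp (Complex.I * n * ((2 * Real.pi : ℝ) : ℂ)) = 1 := by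
      rw [Complex.exp_eq_one_iff]; exact ⟨n, by push_cast; ring⟩
    rw [h2]; simp

lemma integral_torusChar (q : Fin d → ℤ) :
    ∫ θ in Set.pi Set.univ (fun _ : Fin d => Set.Ioc (0 : ℝ) (2 * Real.pi)), torusChar q θ =
      if q = 0 then ((2 * Real.pi : ℝ) : ℂ) ^ d else 0 := by
  have h1 : ∀ θ, torusChar q θ = ∏ i, Complex.exp (Complex.I * ((q i * θ i : ℝ) : ℂ)) := by
    intro θ
    rw [← Complex.exp_sum, ← Finset.mul_sum, torusChar]
    push_cast; rfl
  simp_rw [h1]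
  rw [volume_pi, Measure.restrict_pi_pi]
  rw [integral_fintype_prod_eq_prod (𝕜 := ℂ)
    (f := fun i x => Complex.exp (Complex.I * ((q i * x : ℝ) : ℂ)))]
  simp_rw [integral_exp_int]
  split_ifs with h
  · subst h; simp
  · obtain ⟨i, hi⟩ : ∃ i, q i ≠ 0 := by
      by_contra hcon
      push Not at hcon
      exact h (funext hcon)
    exact Finset.prod_eq_zero (Finset.mem_univ i) (by simp [hi])

lemma integrableOn_box {f : (Fin d → ℝ) → ℂ} (hf : Continuous f) :
    IntegrableOn f (Set.pi Set.univ (fun _ : Fin d => Set.Ioc (0 : ℝ) (2 * Real.pi))) := by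
  have : IntegrableOn f (Set.pi Set.univ (fun _ : Fin d => Set.Icc (0 : ℝ) (2 * Real.pi))) :=
    hf.continuousOn.integrableOn_compact (isCompact_univ_pi fun _ => isCompact_Icc)
  exact this.mono_set (Set.pi_mono fun _ _ => Set.Ioc_subset_Icc_self)

/-- Orthogonality of the characters on `[0, 2π]^d`. -/
lemma fourierCoefficient_sum (Q : Finset (Fin d → ℤ)) (c : (Fin d → ℤ) → ℂ) (p : Fin d → ℤ) :
    fourierCoefficient (fun θ => ∑ q ∈ Q, c q * torusChar q θ) p = if p ∈ Q then c p else 0 := by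
  have h1 : ∀ θ, (∑ q ∈ Q, c q * torusChar q θ) *
      Complex.exp (-(Complex.I * ((∑ i, (p i : ℝ) * θ i : ℝ) : ℂ))) =
      ∑ q ∈ Q, c q * torusChar (q - p) θ := by
    intro θ
    rw [Finset.sum_mul]
    refine Finset.sum_congr rfl fun q _ => ?_
    rw [sub_eq_add_neg, ← torusChar_mul, mul_assoc]
    congr 2
    simp [torusChar]
  unfold fourierCoefficient
  simp_rw [h1]
  rw [integral_finsetSum _ fun q _ => integrableOn_box (by fun_prop)]
  simp_rw [integral_const_mul, integral_torusChar, sub_eq_zero]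
  have hpi : ((2 * Real.pi : ℝ) : ℂ) ≠ 0 := by simp [Real.pi_ne_zero]
  have h2 : ∀ q ∈ Q, (c q * if q = p then ((2 * Real.pi : ℝ) : ℂ) ^ d else 0) =
      if p = q then c p * ((2 * Real.pi : ℝ) : ℂ) ^ d else 0 := by
    intro q _
    by_cases h : q = p
    · subst h; simp
    · rw [if_neg h, if_neg (Ne.symm h), mul_zero]
  rw [Finset.sum_congr rfl h2, Finset.sum_ite_eq]
  split_ifs
  · rw [mul_comm (c p), ← mul_assoc, ← mul_pow, inv_mul_cancel₀ hpi, one_pow, one_mul]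
  · simp

/-- `h` is a trigonometric polynomial with frequencies in `Q`. -/
def IsTrig (Q : Finset (Fin d → ℤ)) (h : (Fin d → ℝ) → ℂ) : Prop :=
  ∃ c : (Fin d → ℤ) → ℂ, ∀ θ, h θ = ∑ q ∈ Q, c q * torusChar q θ

lemma IsTrig.mono {Q Q' : Finset (Fin d → ℤ)} (hQ : Q ⊆ Q') {h : (Fin d → ℝ) → ℂ}
    (hh : IsTrig Q h) : IsTrig Q' h := by
  classical
  obtain ⟨c, hc⟩ := hh
  refine ⟨fun q => if q ∈ Q then c q else 0, fun θ => ?_⟩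
  rw [hc, ← Finset.sum_subset hQ (fun q _ hq => by simp [hq])]
  exact Finset.sum_congr rfl fun q hq => by simp [hq]

/-- The linear functional given by a finite combination of evaluations at points of `ℝ^d`. -/
def sampling (α : (Fin d → ℝ) →₀ ℂ) (h : (Fin d → ℝ) → ℂ) : ℂ := α.sum fun x a => a * h x

/-- The coefficients of the trigonometric polynomials with given frequencies are finite
combinations of values at finitely many points. -/
theorem exists_sampling (Q : Finset (Fin d → ℤ)) : ∃ α : (Fin d → ℤ) → ((Fin d → ℝ) →₀ ℂ),
    ∀ c : (Fin d → ℤ) → ℂ, ∀ p ∈ Q,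
      sampling (α p) (fun θ => ∑ q ∈ Q, c q * torusChar q θ) = c p := by
  classical
  -- The vectors of values of the characters at all points span `ℂ^Q`, because a functional that
  -- annihilates them is a vanishing trigonometric polynomial. Hence every coordinate functional
  -- is a finite combination of evaluations.
  set e : (Fin d → ℝ) → (Q → ℂ) := fun θ q => torusChar (q : Fin d → ℤ) θ with he
  have hspan : Submodule.span ℂ (Set.range e) = ⊤ := by
    by_contra hne
    obtain ⟨φ, hφ0, hφ⟩ := Submodule.exists_le_ker_of_lt_top _ (lt_top_iff_ne_top.2 hne)
    apply hφ0
    have h1 : ∀ v : Q → ℂ, φ v = ∑ q : Q, φ (Pi.single q 1) * v q := by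
      intro v
      conv_lhs => rw [LinearMap.pi_apply_eq_sum_univ φ v]
      refine Finset.sum_congr rfl fun q _ => ?_
      rw [smul_eq_mul, mul_comm]
      congr 2
      ext j; simp [Pi.single_apply, eq_comm]
    have h2 : ∀ θ, ∑ q : Q, φ (Pi.single q 1) * torusChar (q : Fin d → ℤ) θ = 0 := by
      intro θ
      have := hφ (Submodule.subset_span ⟨θ, rfl⟩)
      rw [LinearMap.mem_ker, h1] at this
      exact this
    set c : (Fin d → ℤ) → ℂ := fun q => if hq : q ∈ Q then φ (Pi.single ⟨q, hq⟩ 1) else 0 with hc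
    have h3 : (fun θ => ∑ q ∈ Q, c q * torusChar q θ) = fun _ => 0 := by
      ext θ
      rw [← h2 θ, ← Finset.sum_coe_sort Q]
      refine Finset.sum_congr rfl fun q _ => ?_
      simp [hc]
    have h4 : ∀ p ∈ Q, c p = 0 := by
      intro p hp
      have := fourierCoefficient_sum Q c p
      rw [if_pos hp, h3] at this
      rw [← this]
      simp [fourierCoefficient]
    ext q
    have := h4 q q.2
    simpa [hc] using this
  have hex : ∀ q : Q, ∃ α : (Fin d → ℝ) →₀ ℂ, (α.sum fun x a => a • e x) = Pi.single q 1 := by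
    intro q
    have : (Pi.single q 1 : Q → ℂ) ∈ Submodule.span ℂ (Set.range e) := by rw [hspan]; trivial
    exact Finsupp.mem_span_range_iff_exists_finsupp.1 this
  -- `α q` is the combination of points that gives `1` on the character `q` and `0` on the
  -- others.
  choose α hα using hex
  refine ⟨fun q => if hq : q ∈ Q then α ⟨q, hq⟩ else 0, fun c p hp => ?_⟩
  have h5 : ∀ q : Q, (α ⟨p, hp⟩).sum (fun x a => a * torusChar (q : Fin d → ℤ) x) =
      if q = ⟨p, hp⟩ then 1 else 0 := by
    intro q
    have := congrFun (hα ⟨p, hp⟩) q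
    rw [Finsupp.sum_apply'] at this
    simpa [he, Pi.single_apply] using this
  simp only [sampling, dif_pos hp]
  simp_rw [Finset.mul_sum]
  rw [Finsupp.sum, Finset.sum_comm, ← Finset.sum_coe_sort Q]
  have h6 : ∀ q : Q, (∑ x ∈ (α ⟨p, hp⟩).support, (α ⟨p, hp⟩) x * (c q * torusChar (q : Fin d → ℤ) x))
      = if q = ⟨p, hp⟩ then c q else 0 := by
    intro q
    have h7 := h5 q
    rw [Finsupp.sum] at h7
    calc _ = c q * ∑ x ∈ (α ⟨p, hp⟩).support, (α ⟨p, hp⟩) x * torusChar (q : Fin d → ℤ) x := by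
          rw [Finset.mul_sum]; exact Finset.sum_congr rfl fun x _ => by ring
      _ = _ := by rw [h7]; simp
  rw [Finset.sum_congr rfl fun q _ => h6 q]
  simp

/-- Functions of `(t, θ)` that are trigonometric polynomials in `θ` and have expansions in
exponential polynomials of `t` at both ends. -/
def TrigClass (d : ℕ) : Subalgebra ℂ (ℝ → (Fin d → ℝ) → ℂ) where
  carrier := {h | (∃ Q, ∀ t, IsTrig Q (h t)) ∧ ∀ θ, (fun t => h t θ) ∈ TwoSided ⊤}
  add_mem' := by
    classical
    rintro h k ⟨⟨Q, hQ⟩, h1⟩ ⟨⟨Q', hQ'⟩, h2⟩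
    refine ⟨⟨Q ∪ Q', fun t => ?_⟩, fun θ => (TwoSided ⊤).add_mem (h1 θ) (h2 θ)⟩
    obtain ⟨c, hc⟩ := (hQ t).mono (Finset.subset_union_left (s₂ := Q'))
    obtain ⟨c', hc'⟩ := (hQ' t).mono (Finset.subset_union_right (s₁ := Q))
    refine ⟨c + c', fun θ => ?_⟩
    simp only [Pi.add_apply, hc, hc', ← Finset.sum_add_distrib, add_mul]
  mul_mem' := by
    classical
    rintro h k ⟨⟨Q, hQ⟩, h1⟩ ⟨⟨Q', hQ'⟩, h2⟩
    refine ⟨⟨(Q ×ˢ Q').image fun x => x.1 + x.2, fun t => ?_⟩,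
      fun θ => (TwoSided ⊤).mul_mem (h1 θ) (h2 θ)⟩
    obtain ⟨c, hc⟩ := hQ t
    obtain ⟨c', hc'⟩ := hQ' t
    refine ⟨fun p => ∑ x ∈ (Q ×ˢ Q').filter (fun x => x.1 + x.2 = p), c x.1 * c' x.2, fun θ => ?_⟩
    simp only [Pi.mul_apply, hc, hc', Finset.sum_mul_sum, ← Finset.sum_product']
    rw [← Finset.sum_fiberwise_of_maps_to (s := Q ×ˢ Q')
      (t := (Q ×ˢ Q').image fun x => x.1 + x.2) (g := fun x => x.1 + x.2)
      (fun x hx => Finset.mem_image_of_mem _ hx)]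
    refine Finset.sum_congr rfl fun p _ => ?_
    rw [Finset.sum_mul]
    refine Finset.sum_congr rfl fun x hx => ?_
    rw [← (Finset.mem_filter.1 hx).2, ← torusChar_mul]
    ring
  algebraMap_mem' := by
    intro r
    refine ⟨⟨{0}, fun t => ⟨fun _ => r, fun θ => ?_⟩⟩, fun θ => TwoSided.const_mem r⟩
    simp

lemma sampling_mem {Λ : AddSubmonoid ℝ} {h : ℝ → (Fin d → ℝ) → ℂ}
    (hh : ∀ θ, (fun t => h t θ) ∈ TwoSided Λ) (α : (Fin d → ℝ) →₀ ℂ) :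
    (fun t => sampling α (h t)) ∈ TwoSided Λ := by
  have : (fun t => sampling α (h t)) = ∑ x ∈ α.support, (α x) • fun t => h t x := by
    ext t; simp [sampling, Finsupp.sum]
  rw [this]
  exact Subalgebra.sum_mem _ fun x _ => Subalgebra.smul_mem _ (hh x) _

namespace TrigClass

variable {h k : ℝ → (Fin d → ℝ) → ℂ}

/-- The coefficients of a function in `TrigClass` have expansions at both ends, being finite
combinations of values of the function. -/
lemma exists_coeff (hh : h ∈ TrigClass d) : ∃ (Q : Finset (Fin d → ℤ)) (c : (Fin d → ℤ) → ℝ → ℂ),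
    (∀ q, c q ∈ TwoSided ⊤) ∧ ∀ t θ, h t θ = ∑ q ∈ Q, c q t * torusChar q θ := by
  obtain ⟨⟨Q, hQ⟩, h1⟩ := hh
  obtain ⟨α, hα⟩ := exists_sampling Q
  refine ⟨Q, fun q t => sampling (α q) (h t), fun q => sampling_mem h1 _, fun t θ => ?_⟩
  obtain ⟨c, hc⟩ := hQ t
  have : h t = fun θ => ∑ q ∈ Q, c q * torusChar q θ := funext hc
  refine (hc θ).trans (Finset.sum_congr rfl fun q hq => ?_)
  show _ = sampling (α q) (h t) * _
  rw [this, hα c q hq]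

lemma of_coeff (Q : Finset (Fin d → ℤ)) (c : (Fin d → ℤ) → ℝ → ℂ)
    (hc : ∀ q, c q ∈ TwoSided ⊤) : (fun t θ => ∑ q ∈ Q, c q t * torusChar q θ) ∈ TrigClass d := by
  refine ⟨⟨Q, fun t => ⟨fun q => c q t, fun θ => rfl⟩⟩, fun θ => ?_⟩
  have : (fun t => ∑ q ∈ Q, c q t * torusChar q θ) = ∑ q ∈ Q, torusChar q θ • c q := by
    ext t; simp [mul_comm]
  show (fun t => ∑ q ∈ Q, c q t * torusChar q θ) ∈ _
  rw [this]
  exact Subalgebra.sum_mem _ fun q _ => Subalgebra.smul_mem _ (hc q) _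

lemma of_time {c : ℝ → ℂ} (hc : c ∈ TwoSided ⊤) : (fun t (_ : Fin d → ℝ) => c t) ∈ TrigClass d := by
  have := of_coeff (d := d) {0} (fun _ => c) fun _ => hc
  simpa using this

lemma reflect (hh : h ∈ TrigClass d) : (fun t θ => h (-t) (-θ)) ∈ TrigClass d := by
  obtain ⟨Q, c, hc, hh⟩ := exists_coeff hh
  have := of_coeff (Q.image Neg.neg) (fun q t => c (-q) (-t)) fun q => TwoSided.reflect (hc (-q))
  convert this using 3 with t θ
  rw [hh, Finset.sum_image (fun x _ y _ hxy => neg_injective hxy)]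
  exact Finset.sum_congr rfl fun q _ => by rw [torusChar_neg, neg_neg]

lemma reflectTime (hh : h ∈ TrigClass d) : (fun t θ => h (-t) θ) ∈ TrigClass d := by
  obtain ⟨Q, c, hc, hh⟩ := exists_coeff hh
  have := of_coeff Q (fun q t => c q (-t)) fun q => TwoSided.reflect (hc q)
  convert this using 3 with t θ
  rw [hh]

lemma mem_freqBall {N : ℕ} {q : Fin d → ℤ} : q ∈ freqBall d N ↔ ∑ i, (q i).natAbs ≤ N := by
  rw [freqBall, Finset.mem_filter, Fintype.mem_piFinset]
  refine ⟨fun h => h.2, fun h => ⟨fun i => ?_, h⟩⟩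
  have : (q i).natAbs ≤ ∑ i, (q i).natAbs :=
    Finset.single_le_sum (f := fun i => (q i).natAbs) (fun _ _ => Nat.zero_le _) (Finset.mem_univ i)
  rw [Finset.mem_Icc]
  omega

lemma truncation_eq (Q : Finset (Fin d → ℤ)) (c : (Fin d → ℤ) → ℂ) (N : ℕ) (θ : Fin d → ℝ) :
    truncation N (fun θ => ∑ q ∈ Q, c q * torusChar q θ) θ =
      ∑ q ∈ Q with q ∈ freqBall d N, c q * torusChar q θ := by
  classical
  unfold truncation
  simp_rw [fourierCoefficient_sum]
  rw [Finset.filter_mem_eq_inter, Finset.inter_comm, ← Finset.filter_mem_eq_inter,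
    Finset.sum_filter]
  refine Finset.sum_congr rfl fun q _ => ?_
  split_ifs
  · rfl
  · simp

/-- The regularized integral over `[t, ∞)` exists and is the finite part at each `θ`. -/
theorem hasRegIntegral_Ici (hh : h ∈ TrigClass d) (t : ℝ) (θ : Fin d → ℝ) :
    HasRegIntegral (Set.Ici t) h θ (finInt t fun τ => h τ θ) := by
  classical
  obtain ⟨Q, c, hc, he⟩ := exists_coeff hh
  have htr : ∀ N, (fun τ => truncation N (h τ) θ) =
      fun τ => ∑ q ∈ Q with q ∈ freqBall d N, c q τ * torusChar q θ := by
    intro N; ext τ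
    rw [← truncation_eq]
    congr 1; ext θ; exact he τ θ
  have hmem : ∀ N, (fun τ => truncation N (h τ) θ) ∈ TwoSided ⊤ := fun N => by
    rw [htr]; exact (of_coeff _ c hc).2 θ
  refine ⟨fun N => finInt t fun τ => truncation N (h τ) θ,
    fun N => hasRegResidue_finInt (hmem N) t, ?_⟩
  -- The truncations `T_N h` are equal to `h` as soon as `N` exceeds all frequencies of `h`.
  refine tendsto_const_nhds.congr' ?_
  filter_upwards [eventually_ge_atTop (∑ q ∈ Q, ∑ i, (q i).natAbs)] with N hN
  congr 1; ext τ
  rw [congrFun (htr N) τ, he]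
  refine (Finset.sum_congr (Finset.filter_true_of_mem fun q hq => ?_) fun _ _ => rfl).symm
  rw [mem_freqBall]
  exact (Finset.single_le_sum (f := fun q : Fin d → ℤ => ∑ i, (q i).natAbs)
    (fun _ _ => Nat.zero_le _) hq).trans hN

theorem hasRegIntegral_Iic (hh : h ∈ TrigClass d) (t : ℝ) (θ : Fin d → ℝ) :
    HasRegIntegral (Set.Iic t) h θ (finInt (-t) fun τ => h (-τ) θ) := by
  obtain ⟨ρ, h1, h2⟩ := hasRegIntegral_Ici (reflectTime hh) (-t) θ
  exact ⟨ρ, fun N => HasRegResidue.reflect (h := fun τ => truncation N (h τ) θ) (h1 N), h2⟩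

end TrigClass

lemma HasRegIntegral.unique {S : Set ℝ} {h : ℝ → (Fin d → ℝ) → ℂ} {θ : Fin d → ℝ} {a b : ℂ}
    (ha : HasRegIntegral S h θ a) (hb : HasRegIntegral S h θ b) : a = b := by
  obtain ⟨ρ, h1, h2⟩ := ha
  obtain ⟨σ, k1, k2⟩ := hb
  have : ρ = σ := funext fun N => (h1 N).unique (k1 N)
  exact tendsto_nhds_unique h2 (this ▸ k2)

lemma HasRegIntegral.regIntegral_eq {S : Set ℝ} {h : ℝ → (Fin d → ℝ) → ℂ} {θ : Fin d → ℝ} {a : ℂ}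
    (ha : HasRegIntegral S h θ a) : regIntegral S h θ = a := by
  have hh : RegIntegrable S h θ := ⟨a, ha⟩
  rw [regIntegral, dif_pos hh]
  exact (Classical.choose_spec hh).unique ha

namespace TrigClass

variable {h k : ℝ → (Fin d → ℝ) → ℂ}

lemma regIntegral_Ici (hh : h ∈ TrigClass d) (t : ℝ) (θ : Fin d → ℝ) :
    regIntegral (Set.Ici t) h θ = finInt t fun τ => h τ θ :=
  (hasRegIntegral_Ici hh t θ).regIntegral_eq

lemma regIntegral_Iic (hh : h ∈ TrigClass d) (t : ℝ) (θ : Fin d → ℝ) :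
    regIntegral (Set.Iic t) h θ = finInt (-t) fun τ => h (-τ) θ :=
  (hasRegIntegral_Iic hh t θ).regIntegral_eq

lemma regIntegrable_Ici (hh : h ∈ TrigClass d) (t : ℝ) (θ : Fin d → ℝ) :
    RegIntegrable (Set.Ici t) h θ := ⟨_, hasRegIntegral_Ici hh t θ⟩

lemma regIntegrable_Iic (hh : h ∈ TrigClass d) (t : ℝ) (θ : Fin d → ℝ) :
    RegIntegrable (Set.Iic t) h θ := ⟨_, hasRegIntegral_Iic hh t θ⟩

lemma finInt_sum_char (Q : Finset (Fin d → ℤ)) (c : (Fin d → ℤ) → ℝ → ℂ)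
    (hc : ∀ q, c q ∈ TwoSided ⊤) (t : ℝ) (θ : Fin d → ℝ) :
    (finInt t fun τ => ∑ q ∈ Q, c q τ * torusChar q θ) =
      ∑ q ∈ Q, finInt t (c q) * torusChar q θ := by
  classical
  induction Q using Finset.induction_on with
  | empty =>
    have := finInt_smul (TwoSided.const_mem (Λ := ⊤) 0) 0 t
    simp only [zero_mul] at this
    simp only [Finset.sum_empty]
    convert this using 2
    ext; simp
  | insert q Q hq ih =>
    rw [Finset.sum_insert hq, ← ih, mul_comm, ← finInt_smul (hc q), ← finInt_add]
    · congr 1; ext τ; simp [Finset.sum_insert hq, mul_comm]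
    · exact Subalgebra.smul_mem _ (hc q) _
    · exact (of_coeff Q c hc).2 θ

lemma finInt_mem (hh : h ∈ TrigClass d) : (fun t θ => finInt t fun τ => h τ θ) ∈ TrigClass d := by
  obtain ⟨Q, c, hc, he⟩ := exists_coeff hh
  have := of_coeff Q (fun q t => finInt t (c q)) fun q => HomoclinicSplitting.finInt_mem (hc q)
  convert this using 3 with t θ
  simp_rw [he]
  exact finInt_sum_char Q c hc t θ

lemma finInt_const_mem (hh : h ∈ TrigClass d) (s : ℝ) :
    (fun (_ : ℝ) θ => finInt s fun τ => h τ θ) ∈ TrigClass d := by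
  obtain ⟨Q, c, hc, he⟩ := exists_coeff hh
  have := of_coeff Q (fun q _ => finInt s (c q)) fun q => TwoSided.const_mem _
  convert this using 1
  ext t θ
  simp_rw [he]
  exact finInt_sum_char Q c hc s θ

lemma hasFDerivAt_torusChar (q : Fin d → ℤ) (θ : Fin d → ℝ) (b : Fin d) :
    ∃ L : (Fin d → ℝ) →L[ℝ] ℂ, HasFDerivAt (torusChar q) L θ ∧
      L (Pi.single b 1) = Complex.I * q b * torusChar q θ := by
  have h0 : HasFDerivAt (fun θ : Fin d → ℝ => ∑ i, (q i : ℝ) * θ i)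
      (∑ i, (q i : ℝ) • (ContinuousLinearMap.proj i : (Fin d → ℝ) →L[ℝ] ℝ)) θ := by
    refine HasFDerivAt.fun_sum fun i _ => ?_
    exact ((ContinuousLinearMap.proj (R := ℝ) (φ := fun _ : Fin d => ℝ) i).hasFDerivAt).const_mul _
  have h1 := ((Complex.ofRealCLM.hasFDerivAt.comp θ h0).const_mul Complex.I).cexp
  refine ⟨_, h1, ?_⟩
  simp [torusChar, Pi.single_apply]
  ring

/-- The coefficients of the derivative of a real trigonometric polynomial. -/
lemma pd_eq_sum {F : (Fin d → ℝ) → ℝ} (Q : Finset (Fin d → ℤ)) (c : (Fin d → ℤ) → ℂ)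
    (hF : ∀ θ, (F θ : ℂ) = ∑ q ∈ Q, c q * torusChar q θ) (b : Fin d) (θ : Fin d → ℝ) :
    ((pd F b θ : ℝ) : ℂ) = ∑ q ∈ Q, (Complex.I * q b * c q) * torusChar q θ := by
  choose L hL hLb using fun q : Fin d → ℤ => hasFDerivAt_torusChar q θ b
  have h1 : HasFDerivAt (fun θ => (F θ : ℂ)) (∑ q ∈ Q, c q • L q) θ := by
    simp_rw [hF]
    exact HasFDerivAt.fun_sum fun q _ => (hL q).const_mul (c q)
  have h2 : HasFDerivAt F (Complex.reCLM.comp (∑ q ∈ Q, c q • L q)) θ := by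
    have := Complex.reCLM.hasFDerivAt.comp θ h1
    simpa [Function.comp_def] using this
  have h3 := (Complex.ofRealCLM.hasFDerivAt.comp θ h2).unique h1
  rw [pd, h2.fderiv]
  have h4 := congrArg (fun T : (Fin d → ℝ) →L[ℝ] ℂ => T (Pi.single b 1)) h3
  simp only [ContinuousLinearMap.comp_apply] at h4 ⊢
  rw [show ((Complex.reCLM ((∑ q ∈ Q, c q • L q) (Pi.single b 1)) : ℝ) : ℂ) =
    Complex.ofRealCLM (Complex.reCLM ((∑ q ∈ Q, c q • L q) (Pi.single b 1))) from rfl, h4,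
    sum_apply]
  refine Finset.sum_congr rfl fun q _ => ?_
  rw [smul_apply, hLb, smul_eq_mul]
  ring

lemma pd_mem {F : ℝ → (Fin d → ℝ) → ℝ} (hF : (fun t θ => (F t θ : ℂ)) ∈ TrigClass d) (b : Fin d) :
    (fun t θ => ((pd (F t) b θ : ℝ) : ℂ)) ∈ TrigClass d := by
  obtain ⟨Q, c, hc, he⟩ := exists_coeff hF
  have := of_coeff Q (fun q t => Complex.I * q b * c q t)
    fun q => Subalgebra.smul_mem _ (hc q) (Complex.I * q b)
  convert this using 3 with t θ
  exact pd_eq_sum Q (fun q => c q t) (he t) b θ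

/-- Translates of characters along the flow. -/
lemma char_flow_mem (ω : Fin d → ℝ) (q : Fin d → ℤ) :
    (fun t θ => torusChar q (θ + t • ω)) ∈ TrigClass d := by
  have := of_coeff (d := d) {q} (fun q => expMono (((∑ i, q i * ω i : ℝ) : ℂ) * Complex.I) 0)
    fun q => TwoSided.expMono_mem 0 trivial trivial
  convert this using 3 with t θ
  rw [Finset.sum_singleton, torusChar_add, mul_comm]
  congr 1
  simp only [torusChar, expMono, pow_zero, one_mul, Pi.smul_apply, smul_eq_mul]
  congr 1
  push_cast
  rw [Finset.mul_sum, Finset.sum_mul, Finset.sum_mul]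
  exact Finset.sum_congr rfl fun i _ => by ring

end TrigClass

end Trig

/-! ### Directional derivatives of analytic functions -/

section Directional

variable {V : Type*} [NormedAddCommGroup V] [NormedSpace ℝ V]

/-- The directional derivative. -/
def dirD (v : V) (F : V → ℝ) (p : V) : ℝ := fderiv ℝ F p v

lemma AnalyticAt.dirD {F : V → ℝ} {p : V} (hF : AnalyticAt ℝ F p) (v : V) :
    AnalyticAt ℝ (dirD v F) p :=
  ((ContinuousLinearMap.apply ℝ ℝ v).analyticAt _).fun_comp hF.fderiv

lemma dirD_congr {F G : V → ℝ} {p : V} (h : F =ᶠ[𝓝 p] G) (v : V) : dirD v F =ᶠ[𝓝 p] dirD v G :=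
  (h.fderiv (𝕜 := ℝ)).mono fun x hx => by simp only [dirD, hx]

lemma dirD_comm {F : V → ℝ} {p : V} (hF : AnalyticAt ℝ F p) (v w : V) :
    dirD v (dirD w F) p = dirD w (dirD v F) p := by
  have hs : IsSymmSndFDerivAt ℝ F p :=
    (hF.contDiffAt (n := ⊤)).isSymmSndFDerivAt (by simp)
  have h1 : ∀ v w, dirD v (dirD w F) p = fderiv ℝ (fderiv ℝ F) p v w := by
    intro v w
    have hd : DifferentiableAt ℝ (fderiv ℝ F) p := hF.fderiv.differentiableAt
    have : HasFDerivAt (dirD w F) ((ContinuousLinearMap.apply ℝ ℝ w).comp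
        (fderiv ℝ (fderiv ℝ F) p)) p :=
      (ContinuousLinearMap.apply ℝ ℝ w).hasFDerivAt.comp p hd.hasFDerivAt
    rw [dirD, this.fderiv]; rfl
  rw [h1, h1]
  exact hs v w

lemma dirD_comm_eventually {F : V → ℝ} {p : V} (hF : AnalyticAt ℝ F p) (v w : V) :
    dirD v (dirD w F) =ᶠ[𝓝 p] dirD w (dirD v F) :=
  hF.eventually_analyticAt.mono fun _ hx => dirD_comm hx v w

lemma AnalyticAt.iterate_dirD {F : V → ℝ} {p : V} (hF : AnalyticAt ℝ F p) (v : V) (n : ℕ) :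
    AnalyticAt ℝ ((HomoclinicSplitting.dirD v)^[n] F) p := by
  induction n with
  | zero => exact hF
  | succ n ih => rw [Function.iterate_succ_apply']; exact AnalyticAt.dirD ih v

/-- Directional derivatives commute; the Taylor coefficients in `ε` can therefore be differentiated
in `t` and `θ` term by term. -/
lemma dirD_iterate_comm {F : V → ℝ} {p : V} (hF : AnalyticAt ℝ F p) (v w : V) (n : ℕ) :
    dirD v ((dirD w)^[n] F) =ᶠ[𝓝 p] (dirD w)^[n] (dirD v F) := by
  induction n with
  | zero => rfl
  | succ n ih =>
    rw [Function.iterate_succ_apply', Function.iterate_succ_apply']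
    exact (dirD_comm_eventually (AnalyticAt.iterate_dirD hF w n) v w).trans (dirD_congr ih w)

lemma dirD_mul {F G : V → ℝ} {p : V} (hF : DifferentiableAt ℝ F p) (hG : DifferentiableAt ℝ G p)
    (v : V) : dirD v (F * G) p = F p * dirD v G p + G p * dirD v F p := by
  simp only [dirD]
  rw [fderiv_mul hF hG]
  rfl

end Directional

/-! ### Taylor coefficients in one variable -/

section Taylor

variable {f h : ℝ → ℝ}

lemma taylorCoeff_congr (hfh : f =ᶠ[𝓝 0] h) (n : ℕ) : taylorCoeff f n = taylorCoeff h n := by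
  rw [taylorCoeff, taylorCoeff, hfh.iteratedDeriv_eq]

lemma taylorCoeff_succ (f : ℝ → ℝ) (n : ℕ) :
    ((n : ℝ) + 1) * taylorCoeff f (n + 1) = taylorCoeff (deriv f) n := by
  rw [taylorCoeff, taylorCoeff, iteratedDeriv_succ', Nat.factorial_succ]
  have : (n : ℝ) + 1 ≠ 0 := Nat.cast_add_one_ne_zero n
  push_cast
  field_simp

lemma taylorCoeff_zero (f : ℝ → ℝ) : taylorCoeff f 0 = f 0 := by simp [taylorCoeff]

lemma taylorCoeff_add (hf : AnalyticAt ℝ f 0) (hh : AnalyticAt ℝ h 0) (n : ℕ) :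
    taylorCoeff (fun x => f x + h x) n = taylorCoeff f n + taylorCoeff h n := by
  rw [taylorCoeff, taylorCoeff, taylorCoeff, ← add_div]
  congr 1
  exact iteratedDeriv_fun_add hf.contDiffAt hh.contDiffAt

lemma taylorCoeff_mul (hf : AnalyticAt ℝ f 0) (hh : AnalyticAt ℝ h 0) (n : ℕ) :
    taylorCoeff (fun x => f x * h x) n =
      ∑ x ∈ Finset.HasAntidiagonal.antidiagonal n, taylorCoeff f x.1 * taylorCoeff h x.2 := by
  have h1 := iteratedDeriv_mul (n := n) (hf.contDiffAt) (hh.contDiffAt)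
  rw [taylorCoeff, show (fun x => f x * h x) = f * h from rfl, h1,
    Finset.Nat.sum_antidiagonal_eq_sum_range_succ (fun i j => taylorCoeff f i * taylorCoeff h j),
    Finset.sum_div]
  refine Finset.sum_congr rfl fun i hi => ?_
  have hi' : i ≤ n := Nat.lt_succ_iff.1 (Finset.mem_range.1 hi)
  rw [taylorCoeff, taylorCoeff, Nat.cast_choose ℝ hi']
  have := Nat.cast_ne_zero (R := ℝ).2 (Nat.factorial_ne_zero n)
  have := Nat.cast_ne_zero (R := ℝ).2 (Nat.factorial_ne_zero i)
  have := Nat.cast_ne_zero (R := ℝ).2 (Nat.factorial_ne_zero (n - i))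
  field_simp

lemma taylorCoeff_const (c : ℝ) (n : ℕ) :
    taylorCoeff (fun _ => c) n = if n = 0 then c else 0 := by
  rw [taylorCoeff, iteratedDeriv_const]
  split_ifs with hn
  · simp [hn]
  · simp

/-- The Taylor series of an analytic function is its asymptotic expansion. -/
lemma isAsymptoticExpansion_taylor (hf : AnalyticAt ℝ f 0) :
    IsAsymptoticExpansion (fun ε => (f ε : ℂ)) fun n => ((taylorCoeff f n : ℝ) : ℂ) := by
  intro k
  have h1 := hf.hasFPowerSeriesAt.isBigO_sub_partialSum_pow (k + 1)
  have h2 : (fun ε : ℝ => (f ε : ℂ) - ∑ n ∈ Finset.range (k + 1),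
      (ε : ℂ) ^ n * ((taylorCoeff f n : ℝ) : ℂ)) = fun ε => ((f (0 + ε) -
        (FormalMultilinearSeries.ofScalars ℝ
          (fun n => iteratedDeriv n f 0 / (n.factorial : ℝ))).partialSum (k + 1) ε : ℝ) : ℂ) := by
    ext ε
    rw [FormalMultilinearSeries.partialSum, zero_add]
    push_cast
    congr 1
    refine Finset.sum_congr rfl fun n _ => ?_
    rw [FormalMultilinearSeries.apply_eq_pow_smul_coeff]
    simp [taylorCoeff, FormalMultilinearSeries.coeff_ofScalars]
  rw [h2]
  refine (IsBigO.of_norm_left (?_ : (fun ε => ‖_‖) =O[_] _))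
  simp only [Complex.norm_real]
  exact (h1.norm_left).trans (isBigO_of_le _ fun ε => by simp)

end Taylor

/-! ### Taylor coefficients of families -/

section Families

/-- The space of `(ε, t, θ)`. -/
abbrev Par (d : ℕ) : Type := ℝ × ℝ × (Fin d → ℝ)

variable {d : ℕ}

@[fun_prop]
lemma analyticAt_eps (p : Par d) : AnalyticAt ℝ (fun p : Par d => p.1) p := analyticAt_fst

@[fun_prop]
lemma analyticAt_time (p : Par d) : AnalyticAt ℝ (fun p : Par d => p.2.1) p :=
  analyticAt_fst.fun_comp analyticAt_snd

@[fun_prop]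
lemma analyticAt_theta (p : Par d) : AnalyticAt ℝ (fun p : Par d => p.2.2) p :=
  analyticAt_snd.fun_comp analyticAt_snd

/-- Analyticity at all points with `ε = 0`. -/
def AnalyticFam (F : Par d → ℝ) : Prop := ∀ t θ, AnalyticAt ℝ F (0, t, θ)

/-- The coefficient of `ε^n` of a family. -/
def coef (F : Par d → ℝ) (n : ℕ) (t : ℝ) (θ : Fin d → ℝ) : ℝ :=
  taylorCoeff (fun ε => F (ε, t, θ)) n

/-- The coefficient of `ε^n` as a complex function. -/
def coefC (F : Par d → ℝ) (n : ℕ) : ℝ → (Fin d → ℝ) → ℂ := fun t θ => (coef F n t θ : ℂ)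

/-- The direction of `ε`. -/
def dirEps : Par d := (1, 0, 0)
/-- The direction of `t`. -/
def dirTime : Par d := (0, 1, 0)
/-- The direction of `θ_b`. -/
def dirTheta (b : Fin d) : Par d := (0, 0, Pi.single b 1)

lemma AnalyticFam.slice {F : Par d → ℝ} (hF : AnalyticFam F) (t : ℝ) (θ : Fin d → ℝ) :
    AnalyticAt ℝ (fun ε => F (ε, t, θ)) 0 :=
  AnalyticAt.fun_comp (f := fun ε : ℝ => ((ε, t, θ) : Par d)) (x := 0) (hF t θ)
    (analyticAt_id.prod analyticAt_const)

lemma AnalyticFam.dirD {F : Par d → ℝ} (hF : AnalyticFam F) (v : Par d) : AnalyticFam (dirD v F) :=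
  fun t θ => AnalyticAt.dirD (hF t θ) v

lemma AnalyticFam.eventually {F : Par d → ℝ} (hF : AnalyticFam F) (t : ℝ) (θ : Fin d → ℝ) :
    ∀ᶠ ε in 𝓝 (0 : ℝ), AnalyticAt ℝ F (ε, t, θ) := by
  have hc : Continuous fun ε : ℝ => ((ε, t, θ) : Par d) := by fun_prop
  exact (hc.tendsto 0).eventually (hF t θ).eventually_analyticAt

lemma hasDerivAt_slice_eps {F : Par d → ℝ} {ε t : ℝ} {θ : Fin d → ℝ}
    (hF : DifferentiableAt ℝ F (ε, t, θ)) :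
    HasDerivAt (fun ε => F (ε, t, θ)) (dirD dirEps F (ε, t, θ)) ε := by
  have h1 : HasDerivAt (fun ε : ℝ => ((ε, t, θ) : Par d)) dirEps ε :=
    (hasDerivAt_id ε).prodMk (hasDerivAt_const ε _)
  exact hF.hasFDerivAt.comp_hasDerivAt ε h1

lemma hasDerivAt_slice_time {F : Par d → ℝ} {ε t : ℝ} {θ : Fin d → ℝ}
    (hF : DifferentiableAt ℝ F (ε, t, θ)) :
    HasDerivAt (fun t => F (ε, t, θ)) (dirD dirTime F (ε, t, θ)) t := by
  have h1 : HasDerivAt (fun t : ℝ => ((ε, t, θ) : Par d)) dirTime t :=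
    (hasDerivAt_const t ε).prodMk ((hasDerivAt_id t).prodMk (hasDerivAt_const t θ))
  exact hF.hasFDerivAt.comp_hasDerivAt t h1

lemma pd_slice_theta {F : Par d → ℝ} {ε t : ℝ} {θ : Fin d → ℝ}
    (hF : DifferentiableAt ℝ F (ε, t, θ)) (b : Fin d) :
    DifferentiableAt ℝ (fun θ => F (ε, t, θ)) θ ∧
    pd (fun θ => F (ε, t, θ)) b θ = dirD (dirTheta b) F (ε, t, θ) := by
  have h1 : HasFDerivAt (fun θ : Fin d → ℝ => ((ε, t, θ) : Par d))
      ((0 : (Fin d → ℝ) →L[ℝ] ℝ).prod ((0 : (Fin d → ℝ) →L[ℝ] ℝ).prod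
        (ContinuousLinearMap.id ℝ (Fin d → ℝ)))) θ :=
    (hasFDerivAt_const ε θ).prodMk ((hasFDerivAt_const t θ).prodMk (hasFDerivAt_id θ))
  have h2 := hF.hasFDerivAt.comp θ h1
  refine ⟨h2.differentiableAt, ?_⟩
  rw [pd, show (fun θ => F (ε, t, θ)) = F ∘ fun θ => (ε, t, θ) from rfl, h2.fderiv]
  rfl

lemma coef_dirEps {F : Par d → ℝ} (hF : AnalyticFam F) (n : ℕ) (t : ℝ) (θ : Fin d → ℝ) :
    coef (dirD dirEps F) n t θ = ((n : ℝ) + 1) * coef F (n + 1) t θ := by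
  rw [coef, coef, taylorCoeff_succ]
  refine taylorCoeff_congr ?_ n
  filter_upwards [hF.eventually t θ] with ε hε
  exact (hasDerivAt_slice_eps hε.differentiableAt).deriv.symm

lemma coef_eq_iterate {F : Par d → ℝ} (n : ℕ) (hF : AnalyticFam F) (t : ℝ) (θ : Fin d → ℝ) :
    coef F n t θ = (dirD dirEps)^[n] F (0, t, θ) / n.factorial := by
  induction n generalizing F with
  | zero => simp [coef, taylorCoeff_zero]
  | succ n ih =>
    have h1 := coef_dirEps hF n t θ
    rw [ih (hF.dirD _), ← Function.iterate_succ_apply] at h1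
    have : (n : ℝ) + 1 ≠ 0 := Nat.cast_add_one_ne_zero n
    rw [Nat.factorial_succ, ← mul_right_inj' this, ← h1]
    push_cast
    field_simp

lemma coef_dirD {F : Par d → ℝ} (hF : AnalyticFam F) (v : Par d) (n : ℕ) (t : ℝ)
    (θ : Fin d → ℝ) :
    coef (dirD v F) n t θ = dirD v ((dirD dirEps)^[n] F) (0, t, θ) / n.factorial := by
  rw [coef_eq_iterate n (hF.dirD v), (dirD_iterate_comm (hF t θ) v dirEps n).eq_of_nhds]

lemma hasDerivAt_coef {F : Par d → ℝ} (hF : AnalyticFam F) (n : ℕ) (t : ℝ) (θ : Fin d → ℝ) :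
    HasDerivAt (fun t => coef F n t θ) (coef (dirD dirTime F) n t θ) t := by
  have h1 : (fun t => coef F n t θ) =
      fun t => (dirD dirEps)^[n] F (0, t, θ) / n.factorial := by
    ext t; exact coef_eq_iterate n hF t θ
  rw [h1, coef_dirD hF]
  exact (hasDerivAt_slice_time
    (AnalyticAt.iterate_dirD (hF t θ) _ n).differentiableAt).div_const _

lemma pd_coef {F : Par d → ℝ} (hF : AnalyticFam F) (n : ℕ) (t : ℝ) (θ : Fin d → ℝ) (b : Fin d) :
    pd (coef F n t) b θ = coef (dirD (dirTheta b) F) n t θ := by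
  have h1 : coef F n t = fun θ => (n.factorial : ℝ)⁻¹ * (dirD dirEps)^[n] F (0, t, θ) := by
    ext θ; rw [coef_eq_iterate n hF t θ, div_eq_inv_mul]
  have h2 := pd_slice_theta (AnalyticAt.iterate_dirD (hF t θ) dirEps n).differentiableAt b
  rw [h1, coef_dirD hF, ← h2.2, pd, pd, fderiv_const_mul h2.1, div_eq_inv_mul]
  rfl

lemma AnalyticFam.add {F G : Par d → ℝ} (hF : AnalyticFam F) (hG : AnalyticFam G) :
    AnalyticFam (F + G) := fun t θ => (hF t θ).add (hG t θ)

lemma AnalyticFam.mul {F G : Par d → ℝ} (hF : AnalyticFam F) (hG : AnalyticFam G) :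
    AnalyticFam (F * G) := fun t θ => (hF t θ).mul (hG t θ)

lemma AnalyticFam.const (c : ℝ) : AnalyticFam (fun _ : Par d => c) := fun _ _ => analyticAt_const

lemma coef_add {F G : Par d → ℝ} (hF : AnalyticFam F) (hG : AnalyticFam G) (n : ℕ) (t : ℝ)
    (θ : Fin d → ℝ) : coef (F + G) n t θ = coef F n t θ + coef G n t θ :=
  taylorCoeff_add (hF.slice t θ) (hG.slice t θ) n

lemma coef_mul {F G : Par d → ℝ} (hF : AnalyticFam F) (hG : AnalyticFam G) (n : ℕ) (t : ℝ)
    (θ : Fin d → ℝ) : coef (F * G) n t θ =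
      ∑ x ∈ Finset.HasAntidiagonal.antidiagonal n, coef F x.1 t θ * coef G x.2 t θ :=
  taylorCoeff_mul (hF.slice t θ) (hG.slice t θ) n

lemma coefC_add {F G : Par d → ℝ} (hF : AnalyticFam F) (hG : AnalyticFam G) (n : ℕ) :
    coefC (F + G) n = coefC F n + coefC G n := by
  ext t θ; simp [coefC, coef_add hF hG]

lemma coefC_mul {F G : Par d → ℝ} (hF : AnalyticFam F) (hG : AnalyticFam G) (n : ℕ) :
    coefC (F * G) n = ∑ x ∈ Finset.HasAntidiagonal.antidiagonal n, coefC F x.1 * coefC G x.2 := by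
  ext t θ; simp [coefC, coef_mul hF hG, Finset.sum_apply]

lemma coefC_congr {F G : Par d → ℝ} (h : ∀ t θ, ∀ᶠ ε in 𝓝 (0 : ℝ), F (ε, t, θ) = G (ε, t, θ))
    (n : ℕ) : coefC F n = coefC G n := by
  ext t θ
  rw [coefC, coefC, coef, coef, taylorCoeff_congr (h t θ)]

lemma coefC_zero (F : Par d → ℝ) : coefC F 0 = fun t θ => (F (0, t, θ) : ℂ) := by
  ext t θ; rw [coefC, coef, taylorCoeff_zero]

lemma coefC_const (c : ℝ) (n : ℕ) :
    coefC (fun _ : Par d => c) n = fun _ _ => if n = 0 then (c : ℂ) else 0 := by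
  ext t θ; simp only [coefC, coef, taylorCoeff_const]; split_ifs <;> simp

/-- The Taylor coefficients of a class of families whose `ε`-derivatives are combinations of
members of the class belong to any module containing the coefficients of order `0`, provided that
the multipliers have coefficients that operate on the module. -/
theorem coefC_mem_of_deriv {C : Set (Par d → ℝ)} (T : Submodule ℂ (ℝ → (Fin d → ℝ) → ℂ))
    (S : Set (ℝ → (Fin d → ℝ) → ℂ)) (hST : ∀ s ∈ S, ∀ x ∈ T, s * x ∈ T) (L : ℕ)
    (hC : ∀ F ∈ C, AnalyticFam F) (h0 : ∀ F ∈ C, coefC F 0 ∈ T)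
    (hder : ∀ F ∈ C, ∃ (m : ℕ) (G M : Fin m → Par d → ℝ), (∀ i, G i ∈ C) ∧
      (∀ i, AnalyticFam (M i)) ∧ (∀ i n, n < L → coefC (M i) n ∈ S) ∧
      ∀ t θ, ∀ᶠ ε in 𝓝 (0 : ℝ), dirD dirEps F (ε, t, θ) = ∑ i, M i (ε, t, θ) * G i (ε, t, θ)) :
    ∀ n ≤ L, ∀ F ∈ C, coefC F n ∈ T := by
  intro n
  induction n using Nat.strong_induction_on with
  | _ n ih =>
    intro hn F hF
    cases n with
    | zero => exact h0 F hF
    | succ n =>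
      obtain ⟨m, G, M, hG, hMa, hM, heq⟩ := hder F hF
      -- `(n + 1) F_{n+1}` is the coefficient of order `n` of `∂_ε F`, a Cauchy product of
      -- coefficients of the multipliers and of members of the class, of orders at most `n`.
      have h1 : coefC F (n + 1) = ((n : ℂ) + 1)⁻¹ •
          ∑ i, ∑ x ∈ Finset.HasAntidiagonal.antidiagonal n, coefC (M i) x.1 * coefC (G i) x.2 := by
        have hsum : ∀ t θ, coef (dirD dirEps F) n t θ =
            ∑ i, ∑ x ∈ Finset.HasAntidiagonal.antidiagonal n, coef (M i) x.1 t θ * coef (G i) x.2 t θ := by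
          intro t θ
          rw [coef, taylorCoeff_congr (heq t θ)]
          have key : ∀ s : Finset (Fin m), AnalyticAt ℝ
              (fun ε => ∑ i ∈ s, M i (ε, t, θ) * G i (ε, t, θ)) 0 ∧
              taylorCoeff (fun ε => ∑ i ∈ s, M i (ε, t, θ) * G i (ε, t, θ)) n =
              ∑ i ∈ s, ∑ x ∈ Finset.HasAntidiagonal.antidiagonal n, coef (M i) x.1 t θ * coef (G i) x.2 t θ := by
            intro s
            induction s using Finset.induction_on with
            | empty => simpa [taylorCoeff_const] using analyticAt_const
            | insert i s hi ihs =>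
              have ha := ((hMa i).slice t θ).mul ((hC _ (hG i)).slice t θ)
              simp only [Finset.sum_insert hi]
              refine ⟨ha.add ihs.1, ?_⟩
              rw [taylorCoeff_add (by exact ha) ihs.1, ihs.2,
                taylorCoeff_mul ((hMa i).slice t θ) ((hC _ (hG i)).slice t θ)]
              rfl
          exact (key Finset.univ).2
        ext t θ
        have h2 := hsum t θ
        rw [coef_dirEps (hC F hF)] at h2
        have h3 : ((n : ℂ) + 1) ≠ 0 := Nat.cast_add_one_ne_zero n
        simp only [Pi.smul_apply, Finset.sum_apply, Pi.mul_apply, smul_eq_mul]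
        rw [eq_inv_mul_iff_mul_eq₀ h3]
        simp only [coefC]
        exact_mod_cast h2
      rw [h1]
      refine T.smul_mem _ (T.sum_mem fun i _ => T.sum_mem fun x hx => ?_)
      rw [Finset.HasAntidiagonal.mem_antidiagonal] at hx
      exact hST _ (hM i _ (by omega)) _ (ih x.2 (by omega) (by omega) _ (hG i))

/-- Analytic families all of whose Taylor coefficients are in `TrigClass`. -/
def TrigFam (d : ℕ) : Subalgebra ℝ (Par d → ℝ) where
  carrier := {F | AnalyticFam F ∧ ∀ n, coefC F n ∈ TrigClass d}
  add_mem' := fun ⟨h1, h2⟩ ⟨k1, k2⟩ => ⟨h1.add k1, fun n => by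
    rw [coefC_add h1 k1]; exact (TrigClass d).add_mem (h2 n) (k2 n)⟩
  mul_mem' := fun ⟨h1, h2⟩ ⟨k1, k2⟩ => ⟨h1.mul k1, fun n => by
    rw [coefC_mul h1 k1]
    exact (TrigClass d).sum_mem fun x _ => (TrigClass d).mul_mem (h2 _) (k2 _)⟩
  algebraMap_mem' := fun c => ⟨AnalyticFam.const c, fun n => by
    rw [show (algebraMap ℝ (Par d → ℝ)) c = fun _ => c from rfl, coefC_const]
    exact TrigClass.of_time (TwoSided.const_mem _)⟩

/-- Analytic families that do not depend on `θ` and whose Taylor coefficients have expansions at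
both ends with real exponents. -/
def TimeFam (d : ℕ) : Subalgebra ℝ (Par d → ℝ) where
  carrier := {F | AnalyticFam F ∧ ∀ n, ∃ c ∈ TwoSided ⊥, coefC F n = fun t _ => c t}
  add_mem' := fun ⟨h1, h2⟩ ⟨k1, k2⟩ => ⟨h1.add k1, fun n => by
    obtain ⟨c, hc, e⟩ := h2 n
    obtain ⟨c', hc', e'⟩ := k2 n
    refine ⟨c + c', (TwoSided ⊥).add_mem hc hc', ?_⟩
    rw [coefC_add h1 k1, e, e']; rfl⟩
  mul_mem' := fun ⟨h1, h2⟩ ⟨k1, k2⟩ => ⟨h1.mul k1, fun n => by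
    choose c hc e using h2
    choose c' hc' e' using k2
    refine ⟨∑ x ∈ Finset.HasAntidiagonal.antidiagonal n, c x.1 * c' x.2,
      (TwoSided ⊥).sum_mem fun x _ => (TwoSided ⊥).mul_mem (hc _) (hc' _), ?_⟩
    rw [coefC_mul h1 k1]
    ext t θ
    simp [e, e', Finset.sum_apply]⟩
  algebraMap_mem' := fun c => ⟨AnalyticFam.const c, fun n => by
    refine ⟨fun _ => if n = 0 then (c : ℂ) else 0, TwoSided.const_mem _, ?_⟩
    rw [show (algebraMap ℝ (Par d → ℝ)) c = fun _ => c from rfl, coefC_const]⟩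

lemma TimeFam.le_trigFam : TimeFam d ≤ TrigFam d := fun F hF => ⟨hF.1, fun n => by
  obtain ⟨c, hc, e⟩ := hF.2 n
  rw [e]; exact TrigClass.of_time (TwoSided.mono bot_le hc)⟩

lemma AnalyticFam.congr {F G : Par d → ℝ} (hF : AnalyticFam F)
    (h : ∃ ε₀ > 0, ∀ ε, |ε| < ε₀ → ∀ t θ, F (ε, t, θ) = G (ε, t, θ)) : AnalyticFam G := by
  obtain ⟨ε₀, h0, h⟩ := h
  intro t θ
  refine (hF t θ).congr ?_
  have hop : IsOpen {p : Par d | |p.1| < ε₀} := isOpen_lt (by fun_prop) continuous_const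
  filter_upwards [hop.mem_nhds (by simpa using h0)] with p hp
  exact h p.1 hp p.2.1 p.2.2

lemma TrigFam.dirTheta {F : Par d → ℝ} (hF : F ∈ TrigFam d) (b : Fin d) :
    dirD (dirTheta b) F ∈ TrigFam d := by
  refine ⟨hF.1.dirD _, fun n => ?_⟩
  have := TrigClass.pd_mem (hF.2 n) b
  simp only [pd_coef hF.1] at this
  exact this

lemma TrigFam.reflect {F : Par d → ℝ} (hF : F ∈ TrigFam d) :
    (fun p : Par d => F (p.1, -p.2.1, -p.2.2)) ∈ TrigFam d := by
  refine ⟨fun t θ => ?_, fun n => TrigClass.reflect (hF.2 n)⟩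
  refine AnalyticAt.fun_comp (g := F) (f := fun p : Par d => ((p.1, -p.2.1, -p.2.2) : Par d))
    (x := (0, t, θ)) (hF.1 (-t) (-θ)) ?_
  exact (analyticAt_eps _).prod ((analyticAt_time _).neg.prod (analyticAt_theta _).neg)

/-- Freezing the time argument. -/
lemma TimeFam.freeze {F : Par d → ℝ} (hF : F ∈ TimeFam d) (s : ℝ) :
    (fun p : Par d => F (p.1, s, p.2.2)) ∈ TimeFam d := by
  refine ⟨fun t θ => ?_, fun n => ?_⟩
  · refine AnalyticAt.fun_comp (g := F) (f := fun p : Par d => ((p.1, s, p.2.2) : Par d))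
      (x := (0, t, θ)) (hF.1 s θ) ?_
    exact (analyticAt_eps _).prod (analyticAt_const.prod (analyticAt_theta _))
  · obtain ⟨c, hc, e⟩ := hF.2 n
    refine ⟨fun _ => c s, TwoSided.const_mem _, ?_⟩
    ext t θ
    exact congrFun (congrFun e s) θ

lemma TimeFam.time_mem : (fun p : Par d => p.2.1) ∈ TimeFam d := by
  refine ⟨fun t θ => analyticAt_time _, fun n => ⟨fun t => if n = 0 then (t : ℂ) else 0, ?_, ?_⟩⟩
  · split_ifs
    · exact TwoSided.id_mem
    · exact TwoSided.const_mem 0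
  · ext t θ
    simp only [coefC, coef, taylorCoeff_const]; split_ifs <;> simp

lemma TimeFam.eps_mem {a : ℝ → ℝ} (ha : AnalyticAt ℝ a 0) :
    (fun p : Par d => a p.1) ∈ TimeFam d := by
  refine ⟨fun t θ => ?_, fun n => ⟨fun _ => (taylorCoeff a n : ℂ), TwoSided.const_mem _, rfl⟩⟩
  exact AnalyticAt.fun_comp (g := a) (f := fun p : Par d => p.1) (x := (0, t, θ)) ha (analyticAt_eps _)

/-- Functions `G(γ(ε) t)` with `G` in a class closed under differentiation: the `ε`-derivative is
`γ'(ε) t G'(γ(ε) t)`, again of this form up to a factor in `TimeFam`. -/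
lemma TimeFam.comp_mem {γ : ℝ → ℝ} (hγ : AnalyticAt ℝ γ 0) (𝒢 : Set (ℝ → ℝ))
    (hG : ∀ G ∈ 𝒢, (∀ x, AnalyticAt ℝ G x) ∧ deriv G ∈ 𝒢 ∧
      (fun t => (G (γ 0 * t) : ℂ)) ∈ TwoSided ⊥) {G : ℝ → ℝ} (hGm : G ∈ 𝒢) :
    (fun p : Par d => G (γ p.1 * p.2.1)) ∈ TimeFam d := by
  have hA : ∀ G ∈ 𝒢, AnalyticFam (fun p : Par d => G (γ p.1 * p.2.1)) := by
    intro G hGm t θ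
    have h1 : AnalyticAt ℝ (fun p : Par d => γ p.1) (0, t, θ) :=
      AnalyticAt.fun_comp (g := γ) (f := fun p : Par d => p.1) (x := (0, t, θ)) hγ (analyticAt_eps _)
    exact AnalyticAt.fun_comp (g := G) (f := fun p : Par d => γ p.1 * p.2.1) (x := (0, t, θ))
      ((hG G hGm).1 _) (h1.mul (analyticAt_time _))
  refine ⟨hA G hGm, ?_⟩
  set T : Submodule ℂ (ℝ → (Fin d → ℝ) → ℂ) :=
    { carrier := {h | ∃ c ∈ TwoSided ⊥, h = fun t _ => c t}
      add_mem' := by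
        rintro _ _ ⟨c, hc, rfl⟩ ⟨c', hc', rfl⟩
        exact ⟨c + c', (TwoSided ⊥).add_mem hc hc', rfl⟩
      zero_mem' := ⟨0, (TwoSided ⊥).zero_mem, rfl⟩
      smul_mem' := by
        rintro z _ ⟨c, hc, rfl⟩
        exact ⟨z • c, (TwoSided ⊥).smul_mem hc z, rfl⟩ } with hT
  have hm : (fun p : Par d => deriv γ p.1 * p.2.1) ∈ TimeFam d :=
    (TimeFam d).mul_mem (TimeFam.eps_mem hγ.deriv) TimeFam.time_mem
  intro n
  refine coefC_mem_of_deriv (C := {F | ∃ G ∈ 𝒢, F = fun p : Par d => G (γ p.1 * p.2.1)}) T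
    (T : Set _) ?_ n ?_ ?_ ?_ n le_rfl _ ⟨G, hGm, rfl⟩
  · rintro _ ⟨c, hc, rfl⟩ _ ⟨c', hc', rfl⟩
    exact ⟨c * c', (TwoSided ⊥).mul_mem hc hc', rfl⟩
  · rintro _ ⟨G, hG', rfl⟩; exact hA G hG'
  · rintro _ ⟨G, hG', rfl⟩
    rw [coefC_zero]
    exact ⟨_, (hG G hG').2.2, rfl⟩
  · rintro _ ⟨G, hG', rfl⟩
    refine ⟨1, fun _ p => deriv G (γ p.1 * p.2.1), fun _ p => deriv γ p.1 * p.2.1,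
      fun _ => ⟨_, (hG G hG').2.1, rfl⟩, fun _ => hm.1, fun _ n _ => hm.2 n, fun t θ => ?_⟩
    filter_upwards [(hA G hG').eventually t θ, hγ.eventually_analyticAt] with ε hε hγε
    have h1 := (hasDerivAt_slice_eps hε.differentiableAt).deriv
    rw [← h1]
    have h2 : HasDerivAt (fun ε => γ ε * t) (deriv γ ε * t) ε :=
      hγε.differentiableAt.hasDerivAt.mul_const t
    have h3 := ((hG G hG').1 (γ ε * t)).differentiableAt.hasDerivAt.comp ε h2
    simp only [Fin.sum_univ_one]
    rw [mul_comm]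
    exact h3.deriv

end Families

/-! ### Fourier coefficients on the torus -/

section Fourier

variable {d : ℕ}

/-- `2π`-periodicity in every variable. -/
def IsPeriodic {Y : Type*} (h : (Fin d → ℝ) → Y) : Prop :=
  ∀ (θ : Fin d → ℝ) (k : Fin d → ℤ), h (fun i => θ i + 2 * Real.pi * (k i : ℝ)) = h θ

/-- Representatives in `[0, 2π)^d` of the points of the torus. -/
def torusRep (y : UnitAddTorus (Fin d)) : Fin d → ℝ :=
  fun i => 2 * Real.pi * (AddCircle.equivIco (1 : ℝ) 0 (y i) : ℝ)

/-- The projection of `ℝ^d`, in units where the period is `2π`, to the torus. -/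
def toTorus (θ : Fin d → ℝ) : UnitAddTorus (Fin d) := fun i => ((θ i / (2 * Real.pi) : ℝ) : UnitAddCircle)

lemma exists_torusRep_toTorus (θ : Fin d → ℝ) :
    ∃ k : Fin d → ℤ, torusRep (toTorus θ) = fun i => θ i + 2 * Real.pi * (k i : ℝ) := by
  refine ⟨fun i => -⌊θ i / (2 * Real.pi)⌋, ?_⟩
  ext i
  simp only [torusRep, toTorus, AddCircle.coe_equivIco_mk_apply]
  rw [div_one, mul_one, Int.fract]
  push_cast
  field_simp
  ring

lemma toTorus_torusRep (y : UnitAddTorus (Fin d)) : toTorus (torusRep y) = y := by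
  ext i
  simp only [toTorus, torusRep]
  rw [mul_div_cancel_left₀ _ Real.two_pi_pos.ne']
  exact (AddCircle.equivIco (1 : ℝ) 0).symm_apply_apply (y i)

lemma toTorus_add (θ θ' : Fin d → ℝ) : toTorus (θ + θ') = toTorus θ + toTorus θ' := by
  ext i
  simp only [toTorus, Pi.add_apply, add_div]
  rfl

lemma IsPeriodic.torusRep_toTorus {Y : Type*} {h : (Fin d → ℝ) → Y} (hp : IsPeriodic h)
    (θ : Fin d → ℝ) : h (torusRep (toTorus θ)) = h θ := by
  obtain ⟨k, hk⟩ := exists_torusRep_toTorus θ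
  rw [hk, hp]

lemma isQuotientMap_toTorus : IsQuotientMap (toTorus (d := d)) := by
  have h1 : IsOpenQuotientMap (Pi.map fun (_ : Fin d) (x : ℝ) => (x : UnitAddCircle)) :=
    IsOpenQuotientMap.piMap fun _ => QuotientAddGroup.isOpenQuotientMap_mk
  have h2 : (toTorus (d := d)) = (Pi.map fun (_ : Fin d) (x : ℝ) => (x : UnitAddCircle)) ∘
      (Homeomorph.piCongrRight fun _ : Fin d =>
        Homeomorph.mulRight₀ (2 * Real.pi)⁻¹ (inv_ne_zero Real.two_pi_pos.ne')) := by
    ext θ i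
    simp [toTorus, div_eq_mul_inv]
  rw [h2]
  exact h1.isQuotientMap.comp (Homeomorph.isQuotientMap _)

lemma IsPeriodic.continuous_unroll {h : (Fin d → ℝ) → ℂ} (hp : IsPeriodic h) (hc : Continuous h) :
    Continuous fun y : UnitAddTorus (Fin d) => h (torusRep y) := by
  rw [isQuotientMap_toTorus.continuous_iff]
  exact hc.congr fun θ => (hp.torusRep_toTorus θ).symm

/-- Normalized Haar measure on the torus. -/
def torusMeasure (d : ℕ) : Measure (UnitAddTorus (Fin d)) :=
  Measure.pi fun _ => AddCircle.haarAddCircle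

instance : IsProbabilityMeasure (torusMeasure d) := by unfold torusMeasure; infer_instance

instance : (torusMeasure d).IsAddLeftInvariant := by unfold torusMeasure; infer_instance

/-- The Fourier coefficient of a periodic function, as an integral over the torus. -/
def torusCoeff (q : Fin d → ℤ) (h : (Fin d → ℝ) → ℂ) : ℂ :=
  ∫ y, UnitAddTorus.mFourier (-q) y * h (torusRep y) ∂(torusMeasure d)

lemma mFourier_toTorus (q : Fin d → ℤ) (θ : Fin d → ℝ) :
    UnitAddTorus.mFourier q (toTorus θ) = torusChar q θ := by
  simp only [UnitAddTorus.mFourier, ContinuousMap.coe_mk, toTorus, fourier_coe_apply, torusChar]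
  rw [← Complex.exp_sum]
  congr 1
  push_cast
  rw [Finset.mul_sum]
  refine Finset.sum_congr rfl fun i _ => ?_
  have : (Real.pi : ℂ) ≠ 0 := by exact_mod_cast Real.pi_ne_zero
  field_simp

lemma mFourier_eq (q : Fin d → ℤ) (y : UnitAddTorus (Fin d)) :
    UnitAddTorus.mFourier q y = torusChar q (torusRep y) := by
  rw [← mFourier_toTorus, toTorus_torusRep]

lemma integrable_torusCoeff (q : Fin d → ℤ) {h : (Fin d → ℝ) → ℂ} (hp : IsPeriodic h)
    (hc : Continuous h) :
    Integrable (fun y => UnitAddTorus.mFourier (-q) y * h (torusRep y)) (torusMeasure d) :=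
  ((UnitAddTorus.mFourier (-q)).continuous.mul (hp.continuous_unroll hc)).integrable_of_hasCompactSupport
    (HasCompactSupport.of_compactSpace _)

lemma torusCoeff_add (q : Fin d → ℤ) {h k : (Fin d → ℝ) → ℂ} (hp : IsPeriodic h)
    (hc : Continuous h) (kp : IsPeriodic k) (kc : Continuous k) :
    torusCoeff q (h + k) = torusCoeff q h + torusCoeff q k := by
  rw [torusCoeff, torusCoeff, torusCoeff, ← integral_add (integrable_torusCoeff q hp hc)
    (integrable_torusCoeff q kp kc)]
  simp only [Pi.add_apply, mul_add]

lemma torusCoeff_smul (q : Fin d → ℤ) (c : ℂ) (h : (Fin d → ℝ) → ℂ) :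
    torusCoeff q (c • h) = c * torusCoeff q h := by
  rw [torusCoeff, torusCoeff, ← integral_const_mul]
  simp only [Pi.smul_apply, smul_eq_mul]
  congr 1; ext y; ring

/-- Translation by `s` multiplies the coefficient of frequency `q` by `e^{i q·s}`, by invariance of
Haar measure. -/
lemma torusCoeff_translate (q : Fin d → ℤ) {h : (Fin d → ℝ) → ℂ} (hp : IsPeriodic h)
    (s : Fin d → ℝ) : torusCoeff q (fun θ => h (θ + s)) = torusChar q s * torusCoeff q h := by
  have h1 : ∀ y : UnitAddTorus (Fin d), UnitAddTorus.mFourier (-q) y * h (torusRep y + s) =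
      torusChar q s * (UnitAddTorus.mFourier (-q) (toTorus s + y) * h (torusRep (toTorus s + y))) := by
    intro y
    have e1 : toTorus s + y = toTorus (torusRep y + s) := by
      rw [toTorus_add, toTorus_torusRep, add_comm]
    rw [e1, hp.torusRep_toTorus, mFourier_toTorus, torusChar_add, mFourier_eq]
    have : torusChar q s * torusChar (-q) s = 1 := by rw [torusChar_mul]; simp
    linear_combination (-(torusChar (-q) (torusRep y)) * h (torusRep y + s)) * this
  rw [torusCoeff, torusCoeff]
  simp_rw [h1]
  rw [integral_const_mul, integral_add_left_eq_self
    (fun y => UnitAddTorus.mFourier (-q) y * h (torusRep y))]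

lemma isPeriodic_torusChar (q : Fin d → ℤ) : IsPeriodic (torusChar q) := by
  intro θ k
  simp only [torusChar]
  rw [Complex.exp_eq_exp_iff_exists_int]
  refine ⟨∑ i, q i * k i, ?_⟩
  push_cast
  simp only [mul_add, Finset.sum_add_distrib, Finset.mul_sum, Finset.sum_mul]
  congr 1
  exact Finset.sum_congr rfl fun i _ => by ring

lemma torusCoeff_torusChar (p q : Fin d → ℤ) :
    torusCoeff p (torusChar q) = if p = q then 1 else 0 := by
  split_ifs with h
  · subst h
    rw [torusCoeff]
    have : ∀ y : UnitAddTorus (Fin d),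
        UnitAddTorus.mFourier (-p) y * torusChar p (torusRep y) = 1 := by
      intro y
      rw [mFourier_eq, torusChar_mul]; simp
    simp [this]
  · obtain ⟨i, hi⟩ : ∃ i, p i ≠ q i := by
      by_contra hcon
      push Not at hcon
      exact h (funext hcon)
    have hne : ((p i : ℝ) - q i) ≠ 0 := sub_ne_zero.2 (by exact_mod_cast hi)
    -- The translation by `s` multiplies the character `q` by `e^{i q·s}` and its coefficient of
    -- frequency `p` by `e^{i p·s} = -e^{i q·s}`, so this coefficient is zero.
    set s : Fin d → ℝ := Pi.single i (Real.pi / ((p i : ℝ) - q i)) with hs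
    have h1 := torusCoeff_translate p (isPeriodic_torusChar q) s
    have h2 : (fun θ => torusChar q (θ + s)) = torusChar q s • torusChar q := by
      ext θ; simp [torusChar_add, mul_comm]
    rw [h2, torusCoeff_smul] at h1
    have h3 : torusChar p s = -torusChar q s := by
      have h4 : torusChar p s = torusChar (p - q) s * torusChar q s := by
        rw [torusChar_mul]; simp
      have h5 : torusChar (p - q) s = -1 := by
        simp only [torusChar, hs, Pi.single_apply]
        simp only [mul_ite, mul_zero, Finset.sum_ite_eq', Finset.mem_univ, if_true, Pi.sub_apply]
        rw [show (((p i - q i : ℤ) : ℝ) * (Real.pi / ((p i : ℝ) - q i))) = Real.pi by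
          push_cast; field_simp, mul_comm, Complex.exp_pi_mul_I]
      rw [h4, h5]; ring
    rw [h3] at h1
    have h6 : (2 * torusChar q s) * torusCoeff p (torusChar q) = 0 := by linear_combination h1
    exact (mul_eq_zero.1 h6).resolve_left (mul_ne_zero two_ne_zero (torusChar_ne_zero q s))

lemma IsPeriodic.sum {ι : Type*} (s : Finset ι) {f : ι → (Fin d → ℝ) → ℂ}
    (h : ∀ i ∈ s, IsPeriodic (f i)) : IsPeriodic (fun θ => ∑ i ∈ s, f i θ) := fun θ k =>
  Finset.sum_congr rfl fun i hi => h i hi θ k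

lemma torusCoeff_sum (Q : Finset (Fin d → ℤ)) (c : (Fin d → ℤ) → ℂ) (p : Fin d → ℤ) :
    torusCoeff p (fun θ => ∑ q ∈ Q, c q * torusChar q θ) = if p ∈ Q then c p else 0 := by
  classical
  have hper : ∀ q, IsPeriodic (fun θ => c q * torusChar q θ) := fun q θ k => by
    show c q * _ = c q * _
    rw [isPeriodic_torusChar q θ k]
  induction Q using Finset.induction_on with
  | empty => simp [torusCoeff]
  | insert q Q hq ih =>
    have : (fun θ => ∑ q ∈ insert q Q, c q * torusChar q θ) =
        (c q • torusChar q) + fun θ => ∑ q ∈ Q, c q * torusChar q θ := by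
      ext θ; simp [Finset.sum_insert hq]
    rw [this, torusCoeff_add _ (by exact hper q) (by fun_prop)
      (IsPeriodic.sum Q fun q _ => hper q) (by fun_prop), ih, torusCoeff_smul,
      torusCoeff_torusChar]
    by_cases h : p = q
    · subst h; simp [hq]
    · simp [h]

/-- A continuous periodic function with finitely many Fourier coefficients is a trigonometric
polynomial. -/
theorem isTrig_of_torusCoeff {h : (Fin d → ℝ) → ℂ} (hp : IsPeriodic h) (hc : Continuous h)
    (Q : Finset (Fin d → ℤ)) (hQ : ∀ q ∉ Q, torusCoeff q h = 0) : IsTrig Q h := by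
  set F : C(UnitAddTorus (Fin d), ℂ) := ⟨fun y => h (torusRep y), hp.continuous_unroll hc⟩ with hF
  have hcoef : ∀ q, UnitAddTorus.mFourierCoeff F q = torusCoeff q h := fun q => rfl
  have hsum : Summable (UnitAddTorus.mFourierCoeff F) :=
    (hasSum_sum_of_ne_finset_zero (L := SummationFilter.unconditional _) (s := Q)
      fun q hq => by rw [hcoef, hQ q hq]).summable
  refine ⟨fun q => torusCoeff q h, fun θ => ?_⟩
  have h1 := UnitAddTorus.hasSum_mFourier_series_apply_of_summable hsum (toTorus θ)
  have h2 := hasSum_sum_of_ne_finset_zero (L := SummationFilter.unconditional _) (s := Q)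
    (f := fun q => UnitAddTorus.mFourierCoeff F q • UnitAddTorus.mFourier q (toTorus θ))
    fun q hq => by rw [hcoef, hQ q hq, zero_smul]
  have h3 := h1.unique h2
  rw [hF, ContinuousMap.coe_mk, hp.torusRep_toTorus] at h3
  rw [h3]
  refine Finset.sum_congr rfl fun q _ => ?_
  rw [mFourier_toTorus, smul_eq_mul]
  rfl

lemma norm_torusCoeff_le (q : Fin d → ℤ) {h : (Fin d → ℝ) → ℂ} {C : ℝ}
    (hC : ∀ y, ‖h (torusRep y)‖ ≤ C) : ‖torusCoeff q h‖ ≤ C := by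
  have := norm_integral_le_of_norm_le_const (μ := torusMeasure d) (C := C)
    (f := fun y => UnitAddTorus.mFourier (-q) y * h (torusRep y))
    (Eventually.of_forall fun y => ?_)
  · simpa [torusCoeff] using this
  · rw [norm_mul, mFourier_eq]
    have : ‖torusChar (-q) (torusRep y)‖ = 1 := by
      rw [torusChar, mul_comm, Complex.norm_exp_ofReal_mul_I]
    rw [this, one_mul]
    exact hC y

lemma torusRep_mem (y : UnitAddTorus (Fin d)) :
    torusRep y ∈ Set.pi Set.univ fun _ : Fin d => Set.Icc (0 : ℝ) (2 * Real.pi) := by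
  intro i _
  have := (AddCircle.equivIco (1 : ℝ) 0 (y i)).2
  simp only [torusRep]
  constructor
  · exact mul_nonneg Real.two_pi_pos.le this.1
  · have h2 := this.2
    nlinarith [Real.two_pi_pos]

/-- The Fourier coefficients of a jointly analytic family have Taylor expansions in the
parameter. -/
theorem hasTaylor_torusCoeff {W : ℝ × (Fin d → ℝ) → ℝ} (hW : ∀ p, AnalyticAt ℝ W p)
    (hp : ∀ z, IsPeriodic fun θ => W (z, θ)) (q : Fin d → ℤ) :
    HasTaylor fun z => torusCoeff q fun θ => (W (z, θ) : ℂ) := by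
  -- The polynomial is the Taylor polynomial in `z` of `W`, taken under the integral over the
  -- torus; Taylor's remainder is uniform in `θ` by compactness.
  set e : ℝ × (Fin d → ℝ) := (1, 0) with he
  have hD : ∀ k p, AnalyticAt ℝ ((dirD e)^[k] W) p := fun k p => AnalyticAt.iterate_dirD (hW p) e k
  have hsl : ∀ k z θ, AnalyticAt ℝ (fun z : ℝ => (dirD e)^[k] W (z, θ)) z := fun k z θ =>
    AnalyticAt.fun_comp (f := fun z : ℝ => ((z, θ) : ℝ × (Fin d → ℝ))) (hD k _)
      (analyticAt_id.prod analyticAt_const)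
  have hit : ∀ k z θ, iteratedDeriv k (fun z => W (z, θ)) z = (dirD e)^[k] W (z, θ) := by
    intro k
    induction k with
    | zero => intro z θ; simp
    | succ k ih =>
      intro z θ
      rw [iteratedDeriv_succ, show iteratedDeriv k (fun z => W (z, θ)) =
        fun z => (dirD e)^[k] W (z, θ) from funext fun z => ih z θ, Function.iterate_succ_apply']
      have h1 : HasDerivAt (fun z : ℝ => ((z, θ) : ℝ × (Fin d → ℝ))) e z :=
        (hasDerivAt_id z).prodMk (hasDerivAt_const z θ)
      exact ((hD k (z, θ)).differentiableAt.hasFDerivAt.comp_hasDerivAt z h1).deriv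
  have hper : ∀ k z, IsPeriodic fun θ => ((dirD e)^[k] W (z, θ) : ℂ) := by
    intro k z θ m
    simp only
    rw [← hit, ← hit]
    congr 2
    ext z
    exact hp z θ m
  have hcont : ∀ k, Continuous ((dirD e)^[k] W) := fun k =>
    continuous_iff_continuousAt.2 fun p => (hD k p).continuousAt
  have hcθ : ∀ k z, Continuous fun θ => ((dirD e)^[k] W (z, θ) : ℂ) := fun k z =>
    Complex.continuous_ofReal.comp ((hcont k).comp (by fun_prop))
  intro n
  set K : Set (ℝ × (Fin d → ℝ)) := Set.Icc (0 : ℝ) 1 ×ˢ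
    Set.pi Set.univ fun _ : Fin d => Set.Icc (0 : ℝ) (2 * Real.pi)
  have hK : IsCompact K := isCompact_Icc.prod (isCompact_univ_pi fun _ => isCompact_Icc)
  obtain ⟨C, hC⟩ := hK.exists_bound_of_continuousOn (hcont (n + 1)).continuousOn
  set p : Polynomial ℂ := ∑ k ∈ Finset.range (n + 1), Polynomial.monomial k
    ((k.factorial : ℂ)⁻¹ * torusCoeff q fun θ => ((dirD e)^[k] W (0, θ) : ℂ)) with hpdef
  have hbound : ∀ z ∈ Set.Icc (0 : ℝ) 1,
      ‖(torusCoeff q fun θ => (W (z, θ) : ℂ)) - p.eval (z : ℂ)‖ ≤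
        C * z ^ (n + 1) / n.factorial := by
    intro z hz
    have hud : UniqueDiffOn ℝ (Set.Icc (0 : ℝ) 1) := uniqueDiffOn_Icc one_pos
    have hpoly : p.eval (z : ℂ) = torusCoeff q fun θ => ∑ k ∈ Finset.range (n + 1),
        ((k.factorial : ℂ)⁻¹ * (z : ℂ) ^ k) * ((dirD e)^[k] W (0, θ) : ℂ) := by
      have key : ∀ s : Finset ℕ, (torusCoeff q fun θ => ∑ k ∈ s,
          ((k.factorial : ℂ)⁻¹ * (z : ℂ) ^ k) * ((dirD e)^[k] W (0, θ) : ℂ)) =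
          ∑ k ∈ s, ((k.factorial : ℂ)⁻¹ * (z : ℂ) ^ k) *
            torusCoeff q fun θ => ((dirD e)^[k] W (0, θ) : ℂ) := by
        intro s
        induction s using Finset.induction_on with
        | empty => simp [torusCoeff]
        | insert k s hk ih =>
          have e1 : (fun θ => ∑ k ∈ insert k s,
              ((k.factorial : ℂ)⁻¹ * (z : ℂ) ^ k) * ((dirD e)^[k] W (0, θ) : ℂ)) =
              (((k.factorial : ℂ)⁻¹ * (z : ℂ) ^ k) • fun θ => ((dirD e)^[k] W (0, θ) : ℂ)) +
              fun θ => ∑ k ∈ s, ((k.factorial : ℂ)⁻¹ * (z : ℂ) ^ k) *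
                ((dirD e)^[k] W (0, θ) : ℂ) := by
            ext θ; simp [Finset.sum_insert hk]
          rw [e1, torusCoeff_add, torusCoeff_smul, ih, Finset.sum_insert hk]
          · intro θ m
            have := hper k 0 θ m
            simp only at this
            simp only [Pi.smul_apply, this]
          · exact (hcθ k 0).const_smul _
          · refine IsPeriodic.sum s fun k _ θ m => ?_
            have := hper k 0 θ m
            simp only at this
            simp only [this]
          · exact continuous_finsetSum _ fun k _ => continuous_const.mul (hcθ k 0)
      rw [key, hpdef, Polynomial.eval_finsetSum]
      refine Finset.sum_congr rfl fun k _ => ?_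
      rw [Polynomial.eval_monomial]; ring
    have hsub : (torusCoeff q fun θ => (W (z, θ) : ℂ)) - p.eval (z : ℂ) =
        torusCoeff q fun θ => (W (z, θ) : ℂ) - ∑ k ∈ Finset.range (n + 1),
          ((k.factorial : ℂ)⁻¹ * (z : ℂ) ^ k) * ((dirD e)^[k] W (0, θ) : ℂ) := by
      rw [hpoly]
      have e2 : ∀ h : (Fin d → ℝ) → ℂ, -torusCoeff q h = torusCoeff q ((-1 : ℂ) • h) := fun h => by
        rw [torusCoeff_smul]; ring
      rw [sub_eq_add_neg, e2, ← torusCoeff_add]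
      · congr 1; ext θ; simp [sub_eq_add_neg]
      · exact hper 0 z
      · exact hcθ 0 z
      · intro θ m
        simp only [Pi.smul_apply]
        congr 1
        refine Finset.sum_congr rfl fun k _ => ?_
        have := hper k 0 θ m
        simp only at this
        simp only [this]
      · exact (continuous_finsetSum _ fun k _ => continuous_const.mul (hcθ k 0)).const_smul (-1 : ℂ)
    rw [hsub]
    refine norm_torusCoeff_le q fun y => ?_
    set θ := torusRep y
    have hcd : ContDiff ℝ (n + 1) fun z => W (z, θ) :=
      contDiff_iff_contDiffAt.2 fun z =>
        (show AnalyticAt ℝ (fun z => W (z, θ)) z from hsl 0 z θ).contDiffAt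
    have hw : ∀ k ≤ n + 1, ∀ z ∈ Set.Icc (0 : ℝ) 1,
        iteratedDerivWithin k (fun z => W (z, θ)) (Set.Icc 0 1) z = (dirD e)^[k] W (z, θ) := by
      intro k hk z hz
      rw [iteratedDerivWithin_eq_iteratedDeriv hud
        (show AnalyticAt ℝ (fun z => W (z, θ)) z from hsl 0 z θ).contDiffAt hz, hit]
    have ht := taylor_mean_remainder_bound (f := fun z => W (z, θ)) (n := n) (C := C) zero_le_one
      hcd.contDiffOn hz (fun z hz => by
        rw [hw (n + 1) le_rfl z hz]
        exact hC (z, θ) ⟨hz, torusRep_mem y⟩)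
    rw [taylor_within_apply, sub_zero] at ht
    have e3 : (W (z, θ) : ℂ) - ∑ k ∈ Finset.range (n + 1),
        ((k.factorial : ℂ)⁻¹ * (z : ℂ) ^ k) * ((dirD e)^[k] W (0, θ) : ℂ) =
        ((W (z, θ) - ∑ k ∈ Finset.range (n + 1), ((k.factorial : ℝ)⁻¹ * z ^ k) •
          iteratedDerivWithin k (fun z => W (z, θ)) (Set.Icc 0 1) 0 : ℝ) : ℂ) := by
      push_cast
      congr 1
      refine Finset.sum_congr rfl fun k hk => ?_
      rw [hw k (Finset.mem_range.1 hk).le 0 ⟨le_rfl, zero_le_one⟩]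
      simp
    rw [e3, Complex.norm_real]
    exact ht
  refine ⟨p, IsBigO.of_bound (|C| / n.factorial) ?_⟩
  filter_upwards [Ioo_mem_nhdsGT one_pos] with z hz
  refine (hbound z ⟨hz.1.le, hz.2.le⟩).trans ?_
  rw [Real.norm_eq_abs, abs_of_nonneg (pow_nonneg hz.1.le n), div_mul_eq_mul_div]
  exact div_le_div_of_nonneg_right (mul_le_mul (le_abs_self C)
    (pow_le_pow_of_le_one hz.1.le hz.2.le (Nat.le_succ n)) (pow_nonneg hz.1.le _) (abs_nonneg C))
    (Nat.cast_nonneg _)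

end Fourier

/-! ### Functions transported by the linear flow -/

section Flow

variable {d : ℕ}

/-- The frequency `ω·q` of the mode `q` along the linear flow. -/
def flowFreq (ω : Fin d → ℝ) (q : Fin d → ℤ) : ℝ := ∑ i, (q i : ℝ) * ω i

lemma torusChar_smul (ω : Fin d → ℝ) (q : Fin d → ℤ) (t : ℝ) :
    torusChar q (t • ω) = expMono ((flowFreq ω q : ℂ) * Complex.I) 0 t := by
  simp only [torusChar, expMono, pow_zero, one_mul, Pi.smul_apply, smul_eq_mul, flowFreq]
  congr 1
  push_cast
  rw [Finset.mul_sum, Finset.sum_mul, Finset.sum_mul]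
  exact Finset.sum_congr rfl fun i _ => by ring

/-- Functions of `(t, θ)`, continuous and periodic in `θ`, whose Fourier modes `q` have, as
`t → -∞`, expansions in exponential polynomials that oscillate with the frequency `ω·q`. -/
def FlowClass (ω : Fin d → ℝ) : Submodule ℂ (ℝ → (Fin d → ℝ) → ℂ) where
  carrier := {h | (∀ t, Continuous (h t)) ∧ (∀ t, IsPeriodic (h t)) ∧
    ∀ q, (fun t => torusCoeff q (h (-t))) ∈ AsyExp {-(flowFreq ω q)}}
  add_mem' := by
    rintro h k ⟨h1, h2, h3⟩ ⟨k1, k2, k3⟩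
    refine ⟨fun t => (h1 t).add (k1 t), fun t θ m => congrArg₂ (· + ·) (h2 t θ m) (k2 t θ m),
      fun q => ?_⟩
    have := Submodule.add_mem _ (h3 q) (k3 q)
    convert this using 1
    ext t
    exact torusCoeff_add q (h2 _) (h1 _) (k2 _) (k1 _)
  zero_mem' := by
    refine ⟨fun t => continuous_const, fun t θ m => rfl, fun q => ?_⟩
    convert Submodule.zero_mem (AsyExp {-(flowFreq ω q)}) using 1
    ext t
    simp [torusCoeff]
  smul_mem' := by
    rintro c h ⟨h1, h2, h3⟩
    refine ⟨fun t => (h1 t).const_smul c, fun t θ m => congrArg (c • ·) (h2 t θ m), fun q => ?_⟩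
    convert Submodule.smul_mem _ c (h3 q) using 1
    ext t
    exact torusCoeff_smul q c _

variable {ω : Fin d → ℝ}

lemma FlowClass.time_mul_mem {c : ℝ → ℂ} (hc : c ∈ TwoSided ⊥) {h : ℝ → (Fin d → ℝ) → ℂ}
    (hh : h ∈ FlowClass ω) : (fun t _ => c t) * h ∈ FlowClass ω := by
  obtain ⟨h1, h2, h3⟩ := hh
  refine ⟨fun t => continuous_const.mul (h1 t), fun t θ m => congrArg (c t * ·) (h2 t θ m), fun q => ?_⟩
  have := AsyExp.mul_mem (Λ := ((⊥ : AddSubmonoid ℝ) : Set ℝ)) (Λ'' := {-(flowFreq ω q)})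
    (fun x hx y hy => ?_) hc.2.2 (h3 q)
  · convert this using 1
    ext t
    exact torusCoeff_smul q (c (-t)) _
  · have hx' : x = 0 := by simpa using hx
    simpa [hx'] using hy

/-- Analytic periodic functions evaluated along the flow `(z, θ) ↦ (e^{gt} z, θ + tω)`. -/
lemma flow_mem_flowClass {W : ℝ × (Fin d → ℝ) → ℝ} (hW : ∀ p, AnalyticAt ℝ W p)
    (hp : ∀ z, IsPeriodic fun θ => W (z, θ)) {g : ℝ} (hg : 0 < g) :
    (fun t θ => (W (Real.exp (g * t), θ + t • ω) : ℂ)) ∈ FlowClass ω := by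
  have hcont : Continuous W := continuous_iff_continuousAt.2 fun p => (hW p).continuousAt
  refine ⟨fun t => by fun_prop, fun t θ m => ?_, fun q => ?_⟩
  · have := hp (Real.exp (g * t)) (θ + t • ω) m
    simp only at this ⊢
    rw [← this]
    congr 3
    ext i
    simp; ring
  -- The translation by `-t ω` produces the oscillating factor, and what remains is the value at
  -- `z = e^{-g t}` of a function of `z` with Taylor expansions at `0`.
  · have h1 : ∀ t : ℝ, (torusCoeff q fun θ => (W (Real.exp (g * -t), θ + (-t) • ω) : ℂ)) =
        expMono (-(flowFreq ω q : ℂ) * Complex.I) 0 t *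
          torusCoeff q fun θ => (W (Real.exp (-(g * t)), θ) : ℂ) := by
      intro t
      rw [torusCoeff_translate q (h := fun θ => (W (Real.exp (g * -t), θ) : ℂ))
        (fun θ m => congrArg _ (hp _ θ m)), torusChar_smul, mul_neg]
      congr 1
      simp [expMono]
    simp_rw [h1]
    refine AsyExp.mul_mem (Λ := {-(flowFreq ω q)}) (Λ' := {0}) ?_
      (expMono_mem_asyExp 0 (by simp)) ((hasTaylor_torusCoeff hW hp q).mem_asyExp hg)
    rintro x hx y hy
    simp only [Set.mem_singleton_iff] at hx hy ⊢
    rw [hx, hy, add_zero]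

/-- Analytic families whose Taylor coefficients are in `FlowClass ω`. -/
def FlowFam (ω : Fin d → ℝ) : Set (Par d → ℝ) :=
  {F | AnalyticFam F ∧ ∀ n, coefC F n ∈ FlowClass ω}

lemma FlowFam.add {F G : Par d → ℝ} (hF : F ∈ FlowFam ω) (hG : G ∈ FlowFam ω) :
    F + G ∈ FlowFam ω :=
  ⟨hF.1.add hG.1, fun n => by
    rw [coefC_add hF.1 hG.1]; exact Submodule.add_mem _ (hF.2 n) (hG.2 n)⟩

lemma FlowFam.time_mul {M F : Par d → ℝ} (hM : M ∈ TimeFam d) (hF : F ∈ FlowFam ω) :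
    M * F ∈ FlowFam ω := by
  refine ⟨hM.1.mul hF.1, fun n => ?_⟩
  rw [coefC_mul hM.1 hF.1]
  refine Submodule.sum_mem _ fun x _ => ?_
  obtain ⟨c, hc, e⟩ := hM.2 x.1
  rw [e]
  exact FlowClass.time_mul_mem hc (hF.2 _)

lemma FlowFam.congr {F G : Par d → ℝ} (hF : F ∈ FlowFam ω)
    (h : ∃ ε₀ > 0, ∀ ε, |ε| < ε₀ → ∀ t θ, F (ε, t, θ) = G (ε, t, θ)) : G ∈ FlowFam ω := by
  refine ⟨hF.1.congr h, fun n => ?_⟩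
  rw [← coefC_congr (F := F) (fun t θ => ?_) n]
  · exact hF.2 n
  · obtain ⟨ε₀, h0, h⟩ := h
    have hop : IsOpen {ε : ℝ | |ε| < ε₀} := isOpen_lt (by fun_prop) continuous_const
    filter_upwards [hop.mem_nhds (by simpa using h0)] with ε hε
    exact h ε hε t θ

/-- Functions of `(ε, z, θ)` that are analytic for `|ε| < ε₀` and periodic in `θ`. -/
structure FlowGen (ε₀ : ℝ) (W : Par d → ℝ) : Prop where
  analytic : ∀ ε z θ, |ε| < ε₀ → AnalyticAt ℝ W (ε, z, θ)
  periodic : ∀ ε z, |ε| < ε₀ → IsPeriodic fun θ => W (ε, z, θ)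

variable {ε₀ : ℝ} {W : Par d → ℝ}

lemma FlowGen.dirD (hW : FlowGen ε₀ W) (v : Par d) : FlowGen ε₀ (dirD v W) := by
  refine ⟨fun ε z θ hε => AnalyticAt.dirD (hW.analytic ε z θ hε) v, fun ε z hε θ m => ?_⟩
  set a : Par d := (0, 0, fun i => 2 * Real.pi * (m i : ℝ)) with ha
  have hop : IsOpen {p : Par d | |p.1| < ε₀} := isOpen_lt (by fun_prop) continuous_const
  have h1 : (fun p => W (p + a)) =ᶠ[𝓝 (ε, z, θ)] W := by
    filter_upwards [hop.mem_nhds hε] with p hp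
    have := hW.periodic p.1 p.2.1 hp p.2.2 m
    simp only at this
    rw [← this]
    congr 1
    simp [ha, Prod.ext_iff]
    rfl
  have h2 := h1.fderiv_eq (𝕜 := ℝ)
  rw [fderiv_comp_add_right] at h2
  simp only [HomoclinicSplitting.dirD]
  rw [← h2]
  congr 2
  simp [ha]
  rfl

lemma FlowGen.z_mul (hW : FlowGen ε₀ W) : FlowGen ε₀ fun p => p.2.1 * W p :=
  ⟨fun ε z θ hε => (analyticAt_time _).mul (hW.analytic ε z θ hε),
    fun ε z hε θ m => congrArg _ (hW.periodic ε z hε θ m)⟩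

/-- The function `W` along the trajectory of `(1, θ)`. -/
def flowLift (γ : ℝ → ℝ) (ω : Fin d → ℝ) (W : Par d → ℝ) : Par d → ℝ :=
  fun p => W (p.1, Real.exp (γ p.1 * p.2.1), p.2.2 + p.2.1 • ω)

variable {γ : ℝ → ℝ}

lemma FlowGen.analyticAt_flowLift (hW : FlowGen ε₀ W) {ε : ℝ} (hε : |ε| < ε₀)
    (hγ : AnalyticAt ℝ γ ε) (t : ℝ) (θ : Fin d → ℝ) :
    AnalyticAt ℝ (flowLift γ ω W) (ε, t, θ) := by
  have h1 : AnalyticAt ℝ (fun p : Par d => γ p.1) (ε, t, θ) :=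
    AnalyticAt.fun_comp (g := γ) (f := fun p : Par d => p.1) (x := (ε, t, θ)) hγ (analyticAt_eps _)
  refine AnalyticAt.fun_comp (g := W)
    (f := fun p : Par d => ((p.1, Real.exp (γ p.1 * p.2.1), p.2.2 + p.2.1 • ω) : Par d))
    (x := (ε, t, θ)) (hW.analytic _ _ _ hε) ?_
  refine (analyticAt_eps _).prod ((h1.mul (analyticAt_time _)).rexp.prod
    ((analyticAt_theta _).add ((analyticAt_time _).smul analyticAt_const)))

lemma FlowGen.hasDerivAt_eps (hW : FlowGen ε₀ W) {ε : ℝ} (hε : |ε| < ε₀)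
    (hγ : AnalyticAt ℝ γ ε) (t : ℝ) (θ : Fin d → ℝ) :
    HasDerivAt (fun ε => flowLift γ ω W (ε, t, θ))
      (flowLift γ ω (HomoclinicSplitting.dirD dirEps W) (ε, t, θ) + deriv γ ε * t *
        flowLift γ ω (fun p => p.2.1 * HomoclinicSplitting.dirD dirTime W p) (ε, t, θ)) ε := by
  have h1 : HasDerivAt (fun ε => ((ε, Real.exp (γ ε * t), θ + t • ω) : Par d))
      (1, Real.exp (γ ε * t) * (deriv γ ε * t), 0) ε :=
    (hasDerivAt_id ε).prodMk (((hγ.differentiableAt.hasDerivAt.mul_const t).exp).prodMk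
      (hasDerivAt_const ε _))
  refine ((hW.analytic _ _ _ hε).differentiableAt.hasFDerivAt.comp_hasDerivAt ε h1).congr_deriv ?_
  have h2 : ((1, Real.exp (γ ε * t) * (deriv γ ε * t), 0) : Par d) =
      dirEps + (Real.exp (γ ε * t) * (deriv γ ε * t)) • (dirTime : Par d) := by
    simp [dirEps, dirTime]
  rw [h2, map_add, map_smul]
  simp only [flowLift, HomoclinicSplitting.dirD, smul_eq_mul]
  ring

lemma FlowGen.hasDerivAt_time (hW : FlowGen ε₀ W) {ε : ℝ} (hε : |ε| < ε₀) (t : ℝ)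
    (θ : Fin d → ℝ) :
    HasDerivAt (fun t => flowLift γ ω W (ε, t, θ))
      (γ ε * flowLift γ ω (fun p => p.2.1 * HomoclinicSplitting.dirD dirTime W p) (ε, t, θ) +
        flowLift γ ω (HomoclinicSplitting.dirD (0, 0, ω) W) (ε, t, θ)) t := by
  have h1 : HasDerivAt (fun t => ((ε, Real.exp (γ ε * t), θ + t • ω) : Par d))
      (0, Real.exp (γ ε * t) * (γ ε * 1), ω) t := by
    refine (hasDerivAt_const t ε).prodMk ((((hasDerivAt_id t).const_mul (γ ε)).exp).prodMk ?_)
    simpa using ((hasDerivAt_id t).smul_const ω).const_add θ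
  refine ((hW.analytic _ _ _ hε).differentiableAt.hasFDerivAt.comp_hasDerivAt t h1).congr_deriv ?_
  have h2 : ((0, Real.exp (γ ε * t) * (γ ε * 1), ω) : Par d) =
      (Real.exp (γ ε * t) * γ ε) • (dirTime : Par d) + (0, 0, ω) := by
    simp [dirTime]
  rw [h2, map_add, map_smul]
  simp only [flowLift, HomoclinicSplitting.dirD, smul_eq_mul]
  ring

/-- Families of the form `W(ε, e^{γ(ε)t}, θ + tω)` belong to `FlowFam ω`. -/
theorem FlowGen.flowLift_mem (h0 : 0 < ε₀) (hW : FlowGen ε₀ W) (hγ : AnalyticAt ℝ γ 0)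
    (hpos : 0 < γ 0) : flowLift γ ω W ∈ FlowFam ω := by
  have hA : ∀ W : Par d → ℝ, FlowGen ε₀ W → AnalyticFam (flowLift γ ω W) := fun W hW t θ =>
    hW.analyticAt_flowLift (by simpa using h0) hγ t θ
  refine ⟨hA W hW, fun n => ?_⟩
  have hm : (fun p : Par d => deriv γ p.1 * p.2.1) ∈ TimeFam d :=
    (TimeFam d).mul_mem (TimeFam.eps_mem hγ.deriv) TimeFam.time_mem
  -- The class of families `W(ε, e^{γ t}, θ + t ω)` is closed under `∂_ε` up to the factor
  -- `γ' t`: the derivative is the sum of the terms with `∂_ε W` and `γ' t z ∂_z W`.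
  refine coefC_mem_of_deriv (C := {F | ∃ W, FlowGen ε₀ W ∧ F = flowLift γ ω W}) (FlowClass ω)
    {s | ∃ c ∈ TwoSided ⊥, s = fun t _ => c t} ?_ n ?_ ?_ ?_ n le_rfl _ ⟨W, hW, rfl⟩
  · rintro _ ⟨c, hc, rfl⟩ x hx
    exact FlowClass.time_mul_mem hc hx
  · rintro _ ⟨W, hW, rfl⟩; exact hA W hW
  · rintro _ ⟨W, hW, rfl⟩
    rw [coefC_zero]
    have hs : |(0 : ℝ)| < ε₀ := by simpa using h0
    refine flow_mem_flowClass (W := fun p => W (0, p.1, p.2)) (fun p => ?_)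
      (fun z => hW.periodic 0 z hs) hpos
    exact AnalyticAt.fun_comp (g := W) (f := fun p : ℝ × (Fin d → ℝ) => ((0, p.1, p.2) : Par d))
      (x := p) (hW.analytic 0 p.1 p.2 hs) (analyticAt_const.prod (analyticAt_fst.prod analyticAt_snd))
  · rintro _ ⟨W, hW, rfl⟩
    refine ⟨2, ![flowLift γ ω (HomoclinicSplitting.dirD dirEps W),
      flowLift γ ω (fun p => p.2.1 * HomoclinicSplitting.dirD dirTime W p)],
      ![fun _ => 1, fun p => deriv γ p.1 * p.2.1], fun i => ?_, fun i => ?_, fun i n _ => ?_,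
      fun t θ => ?_⟩
    · fin_cases i
      · exact ⟨_, hW.dirD dirEps, rfl⟩
      · exact ⟨_, (hW.dirD dirTime).z_mul, rfl⟩
    · fin_cases i
      · exact AnalyticFam.const 1
      · exact hm.1
    · fin_cases i
      · exact ((TimeFam d).one_mem).2 n
      · exact hm.2 n
    · have hop : IsOpen {ε : ℝ | |ε| < ε₀} := isOpen_lt (by fun_prop) continuous_const
      filter_upwards [hop.mem_nhds (by simpa using h0), hγ.eventually_analyticAt] with ε hε hγε
      have h1 := hasDerivAt_slice_eps (hW.analyticAt_flowLift (ω := ω) hε hγε t θ).differentiableAt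
      rw [h1.unique (hW.hasDerivAt_eps hε hγε t θ)]
      simp [Fin.sum_univ_two]

lemma FlowGen.dirTime_flowLift_mem (h0 : 0 < ε₀) (hW : FlowGen ε₀ W)
    (hγ : ∀ ε, |ε| < ε₀ → AnalyticAt ℝ γ ε) (hpos : 0 < γ 0) :
    HomoclinicSplitting.dirD dirTime (flowLift γ ω W) ∈ FlowFam ω := by
  have hγ0 := hγ 0 (by simpa using h0)
  refine FlowFam.congr (FlowFam.add (FlowFam.time_mul (TimeFam.eps_mem hγ0)
    ((hW.dirD dirTime).z_mul.flowLift_mem h0 hγ0 hpos))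
    ((hW.dirD (0, 0, ω)).flowLift_mem h0 hγ0 hpos)) ⟨ε₀, h0, fun ε hε t θ => ?_⟩
  exact (hW.hasDerivAt_time hε t θ).unique (hasDerivAt_slice_time
    (hW.analyticAt_flowLift hε (hγ ε hε) t θ).differentiableAt)

/-- If the `t`-derivative of a function transported by a non-resonant flow is a trigonometric
polynomial in `θ`, so is the function: its remaining Fourier modes are constant in time, and at the
same time oscillate with a nonzero frequency as `t → -∞`. -/
theorem FlowClass.mem_trigClass (hω : ∀ q : Fin d → ℤ, q ≠ 0 → flowFreq ω q ≠ 0)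
    {N r : ℝ → (Fin d → ℝ) → ℂ} (hN : N ∈ FlowClass ω) (hr : r ∈ TrigClass d)
    (hd : ∀ t θ, HasDerivAt (fun t => N t θ) (r t θ) t) : N ∈ TrigClass d := by
  classical
  obtain ⟨Q, c, hc, he⟩ := TrigClass.exists_coeff hr
  choose C hC hCd _ using fun q => TwoSided.exists_primitive (hc q)
  -- `N` is `N 0` plus a trigonometric polynomial with the frequencies `Q` of its derivative.
  have h1 : ∀ t θ, N t θ = N 0 θ + ∑ q ∈ Q, (C q t - C q 0) * torusChar q θ := by
    intro t θ
    have hD : ∀ s, HasDerivAt (fun s => N s θ - ∑ q ∈ Q, (C q s - C q 0) * torusChar q θ) 0 s := by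
      intro s
      refine ((hd s θ).sub (HasDerivAt.fun_sum fun q _ =>
        ((hCd q s).sub_const (C q 0)).mul_const (torusChar q θ))).congr_deriv ?_
      rw [he, sub_self]
    have := is_const_of_deriv_eq_zero (fun s => (hD s).differentiableAt) (fun s => (hD s).deriv) t 0
    simp only [sub_self, zero_mul, Finset.sum_const_zero, sub_zero] at this
    rw [← this]; ring
  have hper : ∀ q : Fin d → ℤ, ∀ a : ℂ, IsPeriodic fun θ => a * torusChar q θ :=
    fun q a θ m => congrArg _ (isPeriodic_torusChar q θ m)
  -- A mode `q ∉ Q ∪ {0}` of `N` is constant in time, so it equals its constant term, which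
  -- vanishes because the exponents have imaginary part `-ω·q ≠ 0`.
  have h2 : ∀ q ∉ insert 0 Q, torusCoeff q (N 0) = 0 := by
    intro q hq
    rw [Finset.mem_insert, not_or] at hq
    have h3 : ∀ t, torusCoeff q (N t) = torusCoeff q (N 0) := by
      intro t
      have e1 : N t = N 0 + fun θ => ∑ q ∈ Q, (C q t - C q 0) * torusChar q θ := by
        ext θ; exact h1 t θ
      rw [e1, torusCoeff_add _ (hN.2.1 0) (hN.1 0) (IsPeriodic.sum Q fun q _ => hper q _)
        (by fun_prop), torusCoeff_sum, if_neg hq.2, add_zero]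
    have h4 := hN.2.2 q
    simp only [h3] at h4
    have h5 := AsyExp.hasConst_zero (Λ := {-(flowFreq ω q)})
      (by simpa using hω q hq.1) h4
    exact HasConst.unique (h := fun _ => 0) (fun t => hasDerivAt_const t _) continuous_const
      ⟨0, isBigO_zero _ _⟩ (HasConst.const _) h5
  obtain ⟨a, ha⟩ := isTrig_of_torusCoeff (hN.2.1 0) (hN.1 0) _ h2
  refine ⟨⟨insert 0 Q, fun t => ?_⟩, fun θ => TwoSided.primitive_mem (fun t => hd t θ) (hr.2 θ)⟩
  obtain ⟨b, hb⟩ := IsTrig.mono (Finset.subset_insert 0 Q)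
    (h := fun θ => ∑ q ∈ Q, (C q t - C q 0) * torusChar q θ) ⟨fun q => C q t - C q 0, fun θ => rfl⟩
  refine ⟨a + b, fun θ => ?_⟩
  rw [h1, ha, show ∑ q ∈ Q, (C q t - C q 0) * torusChar q θ = _ from hb θ,
    ← Finset.sum_add_distrib]
  exact Finset.sum_congr rfl fun q _ => by rw [Pi.add_apply]; ring

/-- Differentiation in `θ` removes the zero mode, so that as `t → -∞` the derivatives of functions
transported by a non-resonant flow have vanishing constant terms. -/
theorem FlowClass.pd_hasConst_zero (hω : ∀ q : Fin d → ℤ, q ≠ 0 → flowFreq ω q ≠ 0)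
    {F : ℝ → (Fin d → ℝ) → ℝ} (hN : (fun t θ => (F t θ : ℂ)) ∈ FlowClass ω)
    (hT : (fun t θ => (F t θ : ℂ)) ∈ TrigClass d) (b : Fin d) (θ : Fin d → ℝ) :
    HasConst (fun t => ((pd (F (-t)) b θ : ℝ) : ℂ)) 0 := by
  obtain ⟨⟨Q, hQ⟩, -⟩ := hT
  have h1 : ∀ t θ, (F (-t) θ : ℂ) =
      ∑ q ∈ Q, torusCoeff q (fun θ => (F (-t) θ : ℂ)) * torusChar q θ := by
    intro t θ
    obtain ⟨c, hc⟩ := hQ (-t)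
    have hc' : (fun θ => (F (-t) θ : ℂ)) = fun θ => ∑ q ∈ Q, c q * torusChar q θ := funext hc
    refine (hc θ).trans (Finset.sum_congr rfl fun q hq => ?_)
    rw [hc', torusCoeff_sum, if_pos hq]
  -- The mode `q` of the derivative has the factor `q b`, which is zero for `q = 0`; the other
  -- modes contain no real exponent.
  have h2 : (fun t => ((pd (F (-t)) b θ : ℝ) : ℂ)) = ∑ q ∈ Q, (Complex.I * q b * torusChar q θ) •
      fun t => torusCoeff q (fun θ => (F (-t) θ : ℂ)) := by
    ext t
    rw [TrigClass.pd_eq_sum Q _ (h1 t) b θ, Finset.sum_apply]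
    exact Finset.sum_congr rfl fun q _ => by simp only [Pi.smul_apply, smul_eq_mul]; ring
  rw [h2]
  refine AsyExp.hasConst_zero (Λ := {0}ᶜ) (by simp) (Submodule.sum_mem _ fun q _ => ?_)
  by_cases hq : q = 0
  · subst hq
    simp only [Pi.zero_apply, Int.cast_zero, mul_zero, zero_mul, zero_smul]
    exact Submodule.zero_mem _
  · refine Submodule.smul_mem _ _ (AsyExp.mono ?_ (hN.2.2 q))
    simpa using hω q hq

end Flow

/-! ### The linearized pendulum -/

section Kernel

/-- A function which is a smooth function of `e^{g t}` near `-∞` and of `e^{-g t}` near `+∞` has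
expansions with real exponents at both ends. -/
lemma HasTaylor.twoSided {h : ℝ → ℂ} {w₁ w₂ : ℝ → ℂ} (hc : Continuous h) {g : ℝ} (hg : 0 < g)
    (h1 : HasTaylor w₁) (h2 : HasTaylor w₂) (e1 : ∀ t, h t = w₁ (Real.exp (g * t)))
    (e2 : ∀ t, h t = w₂ (Real.exp (-(g * t)))) : h ∈ TwoSided ⊥ := by
  refine ⟨hc, ?_, ?_⟩
  · rw [show h = _ from funext e2]
    exact h2.mem_asyExp hg
  · rw [show (fun t => h (-t)) = _ from funext fun t => e1 (-t)]
    simp only [mul_neg]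
    exact h1.mem_asyExp hg

lemma analyticAt_arctan (x : ℝ) : AnalyticAt ℝ Real.arctan x :=
  ContDiffAt.analyticAt Real.contDiff_arctan.contDiffAt

/-- Analytic functions of the pendulum angle along the separatrix. -/
lemma comp_separatrix_mem {c : ℝ → ℂ} (hc : ∀ x, AnalyticAt ℝ c x) {g : ℝ} (hg : 0 < g) :
    (fun t => c (4 * Real.arctan (Real.exp (g * t)))) ∈ TwoSided ⊥ := by
  have h4 : ∀ z, AnalyticAt ℝ (fun z : ℝ => 4 * Real.arctan z) z := fun z =>
    analyticAt_const.mul (analyticAt_arctan z)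
  have hcc : Continuous c := continuous_iff_continuousAt.2 fun x => (hc x).continuousAt
  -- `arctan (1 / z) = π / 2 - arctan z` gives the expansion at `+∞`.
  refine HasTaylor.twoSided (w₁ := fun z => c (4 * Real.arctan z))
    (w₂ := fun z => c (2 * Real.pi - 4 * Real.arctan z)) ?_ hg ?_ ?_ (fun t => rfl) fun t => ?_
  · exact hcc.comp (continuous_const.mul (Real.continuous_arctan.comp (by fun_prop)))
  · exact AnalyticAt.hasTaylor (AnalyticAt.fun_comp (hc _) (h4 0))
  · exact AnalyticAt.hasTaylor (AnalyticAt.fun_comp (g := c) (hc _) (analyticAt_const.sub (h4 0)))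
  · rw [Real.exp_neg, Real.arctan_inv_of_pos (Real.exp_pos _)]
    congr 1; ring

lemma AnalyticAt.hasTaylor_ofReal {w : ℝ → ℝ} (hw : AnalyticAt ℝ w 0) :
    HasTaylor fun z => (w z : ℂ) :=
  AnalyticAt.hasTaylor ((Complex.ofRealCLM.analyticAt _).fun_comp hw)

variable {d : ℕ} {γ : ℝ → ℝ}

namespace TimeFam

lemma exp_mem (hγ : AnalyticAt ℝ γ 0) (σ : ℝ) :
    (fun p : Par d => Real.exp (σ * (γ p.1 * p.2.1))) ∈ TimeFam d := by
  refine TimeFam.comp_mem hγ {G | ∃ c : ℝ, G = fun s => c * Real.exp (σ * s)} ?_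
    (G := fun s => Real.exp (σ * s)) ⟨1, by simp⟩
  rintro _ ⟨c, rfl⟩
  refine ⟨fun x => ?_, ⟨c * σ, ?_⟩, ?_⟩
  · exact analyticAt_const.mul (analyticAt_const.mul analyticAt_id).rexp
  · ext s
    have h1 : HasDerivAt (fun s => c * Real.exp (σ * s)) _ s :=
      (((hasDerivAt_id s).const_mul σ).exp).const_mul c
    rw [h1.deriv]; simp; ring
  · have := Subalgebra.smul_mem (TwoSided ⊥)
      (TwoSided.expMono_mem (Λ := ⊥) (a := ((σ * γ 0 : ℝ) : ℂ)) 0 (by simp) (by simp)) (c : ℂ)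
    convert this using 1
    ext t
    simp [expMono, mul_assoc]

/-- `P` is the function `z / (z² + 1)` of `z = e^s` and also of `z = e^{-s}`, where `s = γ t`, and
functions of `s` with two such representations are closed under differentiation. -/
lemma kernelP_mem (hγ : AnalyticAt ℝ γ 0) (hpos : 0 < γ 0) :
    (fun p : Par d => UnstableManifold.kernelP (γ p.1) p.2.1) ∈ TimeFam d := by
  have hw : ∀ z, AnalyticAt ℝ (fun z : ℝ => z / (z ^ 2 + 1)) z := fun z =>
    analyticAt_id.div ((analyticAt_id.pow 2).add analyticAt_const) (by positivity)
  have := TimeFam.comp_mem (d := d) hγ {G | ∃ w₁ w₂ : ℝ → ℝ, (∀ z, AnalyticAt ℝ w₁ z) ∧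
    (∀ z, AnalyticAt ℝ w₂ z) ∧ G = (fun s => w₁ (Real.exp s)) ∧
    G = fun s => w₂ (Real.exp (-s))} ?_
    (G := fun s => Real.exp s / (Real.exp s ^ 2 + 1)) ⟨_, _, hw, hw, rfl, ?_⟩
  · convert this using 2 with p
    rw [UnstableManifold.kernelP, ← Real.exp_nat_mul]
    push_cast; ring_nf
  · rintro _ ⟨w₁, w₂, h1, h2, rfl, e⟩
    have hD : ∀ s, HasDerivAt (fun s => w₁ (Real.exp s)) (Real.exp s * deriv w₁ (Real.exp s)) s :=
      fun s => (((h1 _).differentiableAt.hasDerivAt).comp s (Real.hasDerivAt_exp s)).congr_deriv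
        (mul_comm _ _)
    refine ⟨fun x => AnalyticAt.fun_comp (h1 _) analyticAt_rexp,
      ⟨fun z => z * deriv w₁ z, fun z => -(z * deriv w₂ z), fun z => analyticAt_id.mul (h1 z).deriv,
        fun z => (analyticAt_id.mul (h2 z).deriv).neg, funext fun s => (hD s).deriv,
        funext fun s => ?_⟩, ?_⟩
    · rw [e]
      have : HasDerivAt (fun s => w₂ (Real.exp (-s))) (deriv w₂ (Real.exp (-s)) *
          (Real.exp (-s) * (-1))) s :=
        ((h2 _).differentiableAt.hasDerivAt).comp s ((hasDerivAt_id s).neg.exp)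
      rw [this.deriv]; ring
    · refine HasTaylor.twoSided ?_ hpos (AnalyticAt.hasTaylor_ofReal (h1 0))
        (AnalyticAt.hasTaylor_ofReal (h2 0)) (fun t => rfl) fun t => ?_
      · have : Continuous w₁ := continuous_iff_continuousAt.2 fun x => (h1 x).continuousAt
        fun_prop
      · exact congrArg _ (congrFun e _)
  · ext s
    rw [Real.exp_neg]
    have := (Real.exp_pos s).ne'
    field_simp
    ring

lemma kernelQ_mem (hγ : AnalyticAt ℝ γ 0) :
    (fun p : Par d => UnstableManifold.kernelQ (γ p.1) p.2.1) ∈ TimeFam d := by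
  have := (TimeFam d).sub_mem (exp_mem (d := d) hγ 1) (exp_mem hγ (-1))
  convert this using 1
  ext p
  simp only [UnstableManifold.kernelQ, Pi.sub_apply, mul_sub, ← Real.exp_add]
  ring_nf

end TimeFam

open UnstableManifold

/-- `P = 1 / (2 cosh γt)`, the velocity of the pendulum on the separatrix up to a factor. -/
lemma kernelP_eq (γ t : ℝ) : kernelP γ t = 1 / (2 * Real.cosh (γ * t)) := by
  have h1 : Real.exp (2 * γ * t) = Real.exp (γ * t) ^ 2 := by
    rw [← Real.exp_nat_mul]; push_cast; ring_nf
  rw [kernelP, Real.cosh_eq, Real.exp_neg, h1]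
  have := (Real.exp_pos (γ * t)).ne'
  field_simp

lemma kernelQ_eq (γ t : ℝ) : kernelQ γ t = 2 * Real.sinh (γ * t) := by
  rw [kernelQ, Real.sinh_eq, mul_sub, ← Real.exp_add]
  ring_nf

/-- The potential of the linearized pendulum is `γ² (1 - 2 / cosh² γt)`. -/
lemma cos_four_arctan (γ t : ℝ) :
    Real.cos (4 * Real.arctan (Real.exp (γ * t))) = 1 - 8 * kernelP γ t ^ 2 := by
  have h1 : Real.exp (2 * γ * t) = Real.exp (γ * t) ^ 2 := by
    rw [← Real.exp_nat_mul]; push_cast; ring_nf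
  rw [show 4 * Real.arctan (Real.exp (γ * t)) = 2 * (2 * Real.arctan (Real.exp (γ * t))) by ring,
    Real.cos_two_mul, Real.cos_two_mul, Real.cos_sq_arctan, kernelP, h1]
  have : Real.exp (γ * t) ^ 2 + 1 ≠ 0 := by positivity
  have : 1 + Real.exp (γ * t) ^ 2 ≠ 0 := by positivity
  field_simp
  ring

/-- The decaying solution of the linearized pendulum (for `α = 0`), or of the free rotators. -/
def solU (α : Fin (d + 1)) (γ t : ℝ) : ℝ := if α = 0 then kernelP γ t else 1

/-- The time derivative of `solU`. -/
def solU' (α : Fin (d + 1)) (γ t : ℝ) : ℝ :=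
  if α = 0 then -(γ * (kernelQ γ t * kernelP γ t ^ 2)) else 0

/-- The growing solution of the linearized pendulum (for `α = 0`), or of the free rotators,
normalized so that its Wronskian with `solU` is `1`. -/
def solV (α : Fin (d + 1)) (γ t : ℝ) : ℝ :=
  if α = 0 then 1 / (2 * γ) * kernelQ γ t + 2 * (t * kernelP γ t) else t

/-- The time derivative of `solV`. -/
def solV' (α : Fin (d + 1)) (γ t : ℝ) : ℝ :=
  if α = 0 then (1 / 2) * (Real.exp (1 * (γ * t)) + Real.exp (-1 * (γ * t))) + 2 * kernelP γ t -
    2 * (t * (γ * (kernelQ γ t * kernelP γ t ^ 2))) else 1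

/-- The potential `γ² cos Φ⁰(e^{γt})` of the linearized pendulum, and `0` for the rotators. -/
def solK (α : Fin (d + 1)) (γ t : ℝ) : ℝ :=
  if α = 0 then γ ^ 2 * Real.cos (4 * Real.arctan (Real.exp (γ * t))) else 0

lemma hasDerivAt_solU (α : Fin (d + 1)) (γ t : ℝ) : HasDerivAt (solU α γ) (solU' α γ t) t := by
  unfold solU solU'
  split_ifs with h
  · simp_rw [kernelP_eq, kernelQ_eq]
    have hc := (Real.cosh_pos (γ * t)).ne'
    have h1 : HasDerivAt (fun t => 2 * Real.cosh (γ * t)) (2 * (Real.sinh (γ * t) * (γ * 1))) t :=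
      (((hasDerivAt_id t).const_mul γ).cosh).const_mul 2
    refine ((hasDerivAt_const t (1 : ℝ)).div h1 (by positivity)).congr_deriv ?_
    field_simp
    ring
  · exact hasDerivAt_const t 1

lemma hasDerivAt_solU' (α : Fin (d + 1)) (γ t : ℝ) :
    HasDerivAt (solU' α γ) (solK α γ t * solU α γ t) t := by
  unfold solU solU' solK
  split_ifs with h
  · simp_rw [cos_four_arctan, kernelP_eq, kernelQ_eq]
    have hc := (Real.cosh_pos (γ * t)).ne'
    have hid : HasDerivAt (fun t => γ * t) (γ * 1) t := (hasDerivAt_id t).const_mul γ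
    have h1 : HasDerivAt (fun t => 2 * Real.cosh (γ * t)) (2 * (Real.sinh (γ * t) * (γ * 1))) t :=
      hid.cosh.const_mul 2
    have h2 := ((hasDerivAt_const t (1 : ℝ)).div h1 (by positivity)).pow 2
    refine (((hid.sinh.const_mul 2).mul h2).const_mul γ).neg.congr_deriv ?_
    have hs := Real.cosh_sq (γ * t)
    simp only [Pi.div_apply, Pi.pow_apply]
    generalize Real.cosh (γ * t) = c at hc hs
    generalize Real.sinh (γ * t) = s at hs
    simp only [Nat.add_one_sub_one, pow_one, Nat.cast_ofNat]
    field_simp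
    linear_combination (-8 * γ ^ 2) * hs
  · simpa using hasDerivAt_const t (0 : ℝ)

lemma hasDerivAt_solV {γ : ℝ} (hγ : γ ≠ 0) (α : Fin (d + 1)) (t : ℝ) :
    HasDerivAt (solV α γ) (solV' α γ t) t := by
  unfold solV solV'
  split_ifs with h
  · have hU := hasDerivAt_solU (0 : Fin (d + 1)) γ t
    rw [show solU (0 : Fin (d + 1)) γ = kernelP γ from funext fun t => if_pos rfl] at hU
    simp only [solU', if_true] at hU
    have hid : HasDerivAt (fun t => γ * t) (γ * 1) t := (hasDerivAt_id t).const_mul γ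
    have hQ : HasDerivAt (kernelQ γ) (2 * (Real.cosh (γ * t) * (γ * 1))) t := by
      rw [show kernelQ γ = _ from funext (kernelQ_eq γ)]
      exact hid.sinh.const_mul 2
    refine ((hQ.const_mul (1 / (2 * γ))).add
      (((hasDerivAt_id t).mul hU).const_mul 2)).congr_deriv ?_
    have : Real.exp (1 * (γ * t)) + Real.exp (-1 * (γ * t)) = 2 * Real.cosh (γ * t) := by
      rw [Real.cosh_eq, one_mul, neg_one_mul]; ring
    rw [this]
    simp only [id]
    field_simp
    ring
  · exact hasDerivAt_id t

lemma hasDerivAt_solV' {γ : ℝ} (hγ : γ ≠ 0) (α : Fin (d + 1)) (t : ℝ) :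
    HasDerivAt (solV' α γ) (solK α γ t * solV α γ t) t := by
  unfold solV solV' solK
  split_ifs with h
  · have hU := hasDerivAt_solU (0 : Fin (d + 1)) γ t
    have hU' := hasDerivAt_solU' (0 : Fin (d + 1)) γ t
    rw [show solU (0 : Fin (d + 1)) γ = kernelP γ from funext fun t => if_pos rfl] at hU
    rw [show solU' (0 : Fin (d + 1)) γ = fun t => -(γ * (kernelQ γ t * kernelP γ t ^ 2)) from
      funext fun t => if_pos rfl] at hU'
    simp only [solU, solU', solK, if_true] at hU hU'
    have hid : HasDerivAt (fun t => γ * t) (γ * 1) t := (hasDerivAt_id t).const_mul γ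
    have hC : (fun t => (1 / 2) * (Real.exp (1 * (γ * t)) + Real.exp (-1 * (γ * t)))) =
        fun t => Real.cosh (γ * t) := by
      ext t; rw [Real.cosh_eq, one_mul, neg_one_mul]; ring
    have h3 : HasDerivAt (fun t => (1 / 2) * (Real.exp (1 * (γ * t)) + Real.exp (-1 * (γ * t))))
        (Real.sinh (γ * t) * (γ * 1)) t := by rw [hC]; exact hid.cosh
    have h4 : HasDerivAt (fun t => γ * (kernelQ γ t * kernelP γ t ^ 2))
        (-(γ ^ 2 * Real.cos (4 * Real.arctan (Real.exp (γ * t))) * kernelP γ t)) t := by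
      simpa [Pi.neg_def] using hU'.neg
    refine ((h3.add (hU.const_mul 2)).sub
      (((hasDerivAt_id t).mul h4).const_mul 2)).congr_deriv ?_
    rw [cos_four_arctan, kernelP_eq, kernelQ_eq]
    have hc := (Real.cosh_pos (γ * t)).ne'
    simp only [id]
    field_simp
    ring
  · simpa using hasDerivAt_const t (1 : ℝ)

lemma wronskian_sol {γ : ℝ} (hγ : γ ≠ 0) (α : Fin (d + 1)) (t : ℝ) :
    solU α γ t * solV' α γ t - solU' α γ t * solV α γ t = 1 := by
  unfold solU solU' solV solV'
  split_ifs with h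
  · have : Real.exp (1 * (γ * t)) + Real.exp (-1 * (γ * t)) = 2 * Real.cosh (γ * t) := by
      rw [Real.cosh_eq, one_mul, neg_one_mul]; ring
    rw [this, kernelP_eq, kernelQ_eq]
    have hc := (Real.cosh_pos (γ * t)).ne'
    have hs' : Real.sinh (γ * t) ^ 2 = Real.cosh (γ * t) ^ 2 - 1 := by
      have := Real.cosh_sq (γ * t); linarith
    field_simp
    ring_nf
    simp only [hs']
    ring
  · simp

/-- `K(t, τ)` is diagonal, with entries `v(t) u(τ) - u(t) v(τ)`. -/
lemma kernel_apply (γ t τ : ℝ) (α β : Fin (d + 1)) : kernel d γ t τ α β =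
    if α = β then solV α γ t * solU α γ τ - solU α γ t * solV α γ τ else 0 := by
  have hpb : ∀ x y, pendulumBlock d x * pendulumBlock d y = pendulumBlock d (x * y) := by
    intro x y
    ext α β
    rw [Matrix.mul_apply, Finset.sum_eq_single 0]
    · simp only [pendulumBlock, Matrix.of_apply]
      by_cases hα : α = 0 <;> by_cases hβ : β = 0 <;> simp [hα, hβ]
    · intro b _ hb; simp [pendulumBlock, hb]
    · simp
  have hrb : rotatorBlock d * rotatorBlock d = rotatorBlock d := by
    ext α β
    rw [Matrix.mul_apply, Finset.sum_eq_single α]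
    · simp only [rotatorBlock, Matrix.of_apply]
      by_cases hα : α = 0 <;> simp [hα]
    · intro b _ hb; simp [rotatorBlock, hb.symm]
    · simp
  have h2 : Finset.Icc 1 2 = {1, 2} := by decide
  simp only [kernel, Finset.sum_range_succ, Finset.range_zero, Finset.sum_empty, h2,
    Finset.sum_pair (show (1 : ℕ) ≠ 2 by decide), Kij, Kbar, hpb, hrb, zero_add, pow_zero, one_smul,
    pow_one, Matrix.add_apply, Matrix.smul_apply, smul_eq_mul]
  simp only [pendulumBlock, rotatorBlock, Matrix.of_apply, solU, solV]
  by_cases h : α = β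
  · subst h
    by_cases h0 : α = 0
    · simp [h0]; ring
    · simp [h0]
  · rw [if_neg h]
    have : ¬ (α = 0 ∧ β = 0) := fun h' => h (h'.1.trans h'.2.symm)
    simp [h, this]

lemma TimeFam.solU_mem (hγ : AnalyticAt ℝ γ 0) (hpos : 0 < γ 0) (α : Fin (d + 1)) :
    (fun p : Par d => solU α (γ p.1) p.2.1) ∈ TimeFam d := by
  unfold solU
  split_ifs
  · exact TimeFam.kernelP_mem hγ hpos
  · exact (TimeFam d).one_mem

lemma TimeFam.solU'_mem (hγ : AnalyticAt ℝ γ 0) (hpos : 0 < γ 0) (α : Fin (d + 1)) :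
    (fun p : Par d => solU' α (γ p.1) p.2.1) ∈ TimeFam d := by
  unfold solU'
  split_ifs
  · exact (TimeFam d).neg_mem ((TimeFam d).mul_mem (TimeFam.eps_mem hγ)
      ((TimeFam d).mul_mem (TimeFam.kernelQ_mem hγ)
        ((TimeFam d).pow_mem (TimeFam.kernelP_mem hγ hpos) 2)))
  · exact (TimeFam d).zero_mem

lemma TimeFam.inv_two_mul_mem (hγ : AnalyticAt ℝ γ 0) (hpos : 0 < γ 0) :
    (fun p : Par d => 1 / (2 * γ p.1)) ∈ TimeFam d :=
  TimeFam.eps_mem (a := fun ε => 1 / (2 * γ ε))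
    (analyticAt_const.div (analyticAt_const.mul hγ) (by positivity))

lemma TimeFam.solV_mem (hγ : AnalyticAt ℝ γ 0) (hpos : 0 < γ 0) (α : Fin (d + 1)) :
    (fun p : Par d => solV α (γ p.1) p.2.1) ∈ TimeFam d := by
  unfold solV
  split_ifs
  · exact (TimeFam d).add_mem ((TimeFam d).mul_mem (TimeFam.inv_two_mul_mem hγ hpos)
      (TimeFam.kernelQ_mem hγ)) ((TimeFam d).mul_mem ((TimeFam d).algebraMap_mem 2)
        ((TimeFam d).mul_mem TimeFam.time_mem (TimeFam.kernelP_mem hγ hpos)))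
  · exact TimeFam.time_mem

lemma TimeFam.solV'_mem (hγ : AnalyticAt ℝ γ 0) (hpos : 0 < γ 0) (α : Fin (d + 1)) :
    (fun p : Par d => solV' α (γ p.1) p.2.1) ∈ TimeFam d := by
  unfold solV'
  split_ifs
  · exact (TimeFam d).sub_mem ((TimeFam d).add_mem ((TimeFam d).mul_mem
      ((TimeFam d).algebraMap_mem (1 / 2)) ((TimeFam d).add_mem (TimeFam.exp_mem hγ 1)
        (TimeFam.exp_mem hγ (-1)))) ((TimeFam d).mul_mem ((TimeFam d).algebraMap_mem 2)
        (TimeFam.kernelP_mem hγ hpos))) ((TimeFam d).mul_mem ((TimeFam d).algebraMap_mem 2)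
        ((TimeFam d).mul_mem TimeFam.time_mem ((TimeFam d).mul_mem (TimeFam.eps_mem hγ)
      ((TimeFam d).mul_mem (TimeFam.kernelQ_mem hγ)
        ((TimeFam d).pow_mem (TimeFam.kernelP_mem hγ hpos) 2)))))
  · exact (TimeFam d).one_mem

lemma TimeFam.solK_mem (hγ : AnalyticAt ℝ γ 0) (hpos : 0 < γ 0) (α : Fin (d + 1)) :
    (fun p : Par d => solK α (γ p.1) p.2.1) ∈ TimeFam d := by
  unfold solK
  split_ifs
  · simp_rw [cos_four_arctan]
    exact (TimeFam d).mul_mem ((TimeFam d).pow_mem (TimeFam.eps_mem hγ) 2)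
      ((TimeFam d).sub_mem (TimeFam d).one_mem ((TimeFam d).mul_mem ((TimeFam d).algebraMap_mem 8)
        ((TimeFam d).pow_mem (TimeFam.kernelP_mem hγ hpos) 2)))
  · exact (TimeFam d).zero_mem

end Kernel

/-! ### Potentials that are trigonometric polynomials in the rotator angles -/

section Potentials

lemma fderiv_eq_sum_pd {n : ℕ} (G : (Fin n → ℝ) → ℝ) (x w : Fin n → ℝ) :
    fderiv ℝ G x w = ∑ i, w i * pd G i x := by
  conv_lhs => rw [show w = ∑ i, w i • (Pi.single i 1 : Fin n → ℝ) by
    ext j; simp [Finset.sum_apply, Pi.single_apply]]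
  rw [map_sum]
  simp [pd]

/-- The chain rule in terms of partial derivatives. -/
lemma dirD_comp {V : Type*} [NormedAddCommGroup V] [NormedSpace ℝ V] {n : ℕ}
    {G : (Fin n → ℝ) → ℝ} {Y : Fin n → V → ℝ} {p : V}
    (hG : DifferentiableAt ℝ G fun i => Y i p) (hY : ∀ i, DifferentiableAt ℝ (Y i) p) (v : V) :
    dirD v (fun p => G fun i => Y i p) p = ∑ i, dirD v (Y i) p * pd G i fun i => Y i p := by
  have h1 : HasFDerivAt (fun p i => Y i p) (ContinuousLinearMap.pi fun i => fderiv ℝ (Y i) p) p :=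
    hasFDerivAt_pi.2 fun i => (hY i).hasFDerivAt
  rw [dirD, show (fun p => G fun i => Y i p) = G ∘ fun p i => Y i p from rfl,
    (hG.hasFDerivAt.comp p h1).fderiv, ContinuousLinearMap.comp_apply, fderiv_eq_sum_pd]
  rfl

variable {d : ℕ}

/-- Real-analytic functions of `(φ, ψ)` that are trigonometric polynomials in `ψ`. -/
structure TrigPot (G : (Fin (d + 1) → ℝ) → ℝ) : Prop where
  analytic : ∀ x, AnalyticAt ℝ G x
  trig : ∃ Q, ∀ x : ℝ, IsTrig Q fun ψ : Fin d → ℝ => (G (Fin.cons x ψ) : ℂ)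

lemma hasDerivAt_cons_zero (ψ : Fin d → ℝ) (x : ℝ) :
    HasDerivAt (fun x : ℝ => (Fin.cons x ψ : Fin (d + 1) → ℝ)) (Pi.single 0 1) x := by
  refine hasDerivAt_pi.2 fun i => ?_
  refine Fin.cases ?_ (fun i => ?_) i
  · simpa using hasDerivAt_id' x
  · simpa using hasDerivAt_const x (ψ i)

lemma pd_zero_cons {G : (Fin (d + 1) → ℝ) → ℝ} (hG : ∀ x, AnalyticAt ℝ G x) (x : ℝ)
    (ψ : Fin d → ℝ) :
    HasDerivAt (fun x : ℝ => G (Fin.cons x ψ)) (pd G 0 (Fin.cons x ψ)) x :=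
  (hG _).differentiableAt.hasFDerivAt.comp_hasDerivAt x (hasDerivAt_cons_zero ψ x)

lemma pd_succ_cons {G : (Fin (d + 1) → ℝ) → ℝ} (hG : ∀ x, AnalyticAt ℝ G x) (x : ℝ)
    (ψ : Fin d → ℝ) (i : Fin d) :
    pd (fun ψ : Fin d → ℝ => G (Fin.cons x ψ)) i ψ = pd G i.succ (Fin.cons x ψ) := by
  have h1 : HasFDerivAt (fun ψ : Fin d → ℝ => (Fin.cons x ψ : Fin (d + 1) → ℝ))
      (ContinuousLinearMap.pi (Fin.cons (0 : (Fin d → ℝ) →L[ℝ] ℝ) fun i : Fin d =>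
        (ContinuousLinearMap.proj i : (Fin d → ℝ) →L[ℝ] ℝ))) ψ := by
    refine hasFDerivAt_pi.2 fun i => ?_
    refine Fin.cases ?_ (fun i => ?_) i
    · simpa using hasFDerivAt_const x ψ
    · simp only [Fin.cons_succ]
      exact (ContinuousLinearMap.proj (R := ℝ) (φ := fun _ : Fin d => ℝ) i).hasFDerivAt
  have h2 := (hG (Fin.cons x ψ)).differentiableAt.hasFDerivAt.comp ψ h1
  rw [pd, show (fun ψ : Fin d → ℝ => G (Fin.cons x ψ)) = G ∘ fun ψ => Fin.cons x ψ from rfl,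
    h2.fderiv, pd, ContinuousLinearMap.comp_apply]
  congr 1
  ext j
  refine Fin.cases ?_ (fun j => ?_) j
  · simp
  · simp [Pi.single_apply]

lemma analyticAt_cons_zero {G : (Fin (d + 1) → ℝ) → ℝ} (hG : ∀ x, AnalyticAt ℝ G x)
    (ψ : Fin d → ℝ) (x : ℝ) : AnalyticAt ℝ (fun x : ℝ => G (Fin.cons x ψ)) x := by
  refine AnalyticAt.fun_comp (g := G) (f := fun x : ℝ => (Fin.cons x ψ : Fin (d + 1) → ℝ)) (hG _) ?_
  refine analyticAt_pi_iff.2 fun i => ?_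
  refine Fin.cases ?_ (fun i => ?_) i
  · simp only [Fin.cons_zero]
    exact analyticAt_id
  · simpa using analyticAt_const

namespace TrigPot

variable {G : (Fin (d + 1) → ℝ) → ℝ}

/-- The Fourier coefficients in `ψ` are analytic functions of the pendulum angle. -/
lemma exists_coeff (hG : TrigPot G) : ∃ (Q : Finset (Fin d → ℤ)) (c c' : (Fin d → ℤ) → ℝ → ℂ),
    (∀ q x, AnalyticAt ℝ (c q) x) ∧ (∀ q x, HasDerivAt (c q) (c' q x) x) ∧
    ∀ x ψ, (G (Fin.cons x ψ) : ℂ) = ∑ q ∈ Q, c q x * torusChar q ψ := by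
  obtain ⟨Q, hQ⟩ := hG.trig
  obtain ⟨α, hα⟩ := exists_sampling Q
  refine ⟨Q, fun q x => sampling (α q) fun ψ => (G (Fin.cons x ψ) : ℂ),
    fun q x => sampling (α q) fun ψ => (pd G 0 (Fin.cons x ψ) : ℂ), fun q x => ?_, fun q x => ?_,
    fun x ψ => ?_⟩
  · simp only [sampling, Finsupp.sum]
    refine Finset.analyticAt_fun_sum _ fun ψ _ => analyticAt_const.mul ?_
    exact (Complex.ofRealCLM.analyticAt _).fun_comp (analyticAt_cons_zero hG.analytic ψ x)
  · simp only [sampling, Finsupp.sum]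
    exact HasDerivAt.fun_sum fun ψ _ => ((pd_zero_cons hG.analytic x ψ).ofReal_comp).const_mul _
  · obtain ⟨c, hc⟩ := hQ x
    have hc' : (fun ψ => (G (Fin.cons x ψ) : ℂ)) = fun θ => ∑ q ∈ Q, c q * torusChar q θ := funext hc
    refine (hc ψ).trans (Finset.sum_congr rfl fun q hq => ?_)
    show _ = sampling (α q) (fun ψ => (G (Fin.cons x ψ) : ℂ)) * _
    rw [hc', hα c q hq]

/-- The class is closed under partial derivatives: `∂_φ` differentiates the coefficients, and
`∂_{ψ_i}` multiplies them by `i q_i`. -/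
lemma pd (hG : TrigPot G) (i : Fin (d + 1)) : TrigPot (HomoclinicSplitting.pd G i) := by
  refine ⟨fun x => AnalyticAt.dirD (hG.analytic x) _, ?_⟩
  obtain ⟨Q, c, c', -, hc', he⟩ := hG.exists_coeff
  refine ⟨Q, fun x => ?_⟩
  refine Fin.cases ?_ (fun i => ?_) i
  · refine ⟨fun q => c' q x, fun ψ => ?_⟩
    have h1 := (pd_zero_cons hG.analytic x ψ).ofReal_comp
    have h2 : HasDerivAt (fun x => ∑ q ∈ Q, c q x * torusChar q ψ)
        (∑ q ∈ Q, c' q x * torusChar q ψ) x :=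
      HasDerivAt.fun_sum fun q _ => (hc' q x).mul_const _
    simp only [he] at h1
    exact h1.unique h2
  · refine ⟨fun q => Complex.I * q i * c q x, fun ψ => ?_⟩
    show ((HomoclinicSplitting.pd G i.succ (Fin.cons x ψ) : ℝ) : ℂ) = _
    rw [← pd_succ_cons hG.analytic]
    exact TrigClass.pd_eq_sum Q _ (he x) i ψ

lemma of_angle {w : ℝ → ℝ} (hw : ∀ x, AnalyticAt ℝ w x) :
    TrigPot fun x : Fin (d + 1) → ℝ => w (x 0) :=
  ⟨fun x => AnalyticAt.fun_comp (g := w) (f := fun x : Fin (d + 1) → ℝ => x 0) (hw _)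
    ((ContinuousLinearMap.proj (R := ℝ) (φ := fun _ : Fin (d + 1) => ℝ) 0).analyticAt x),
    {0}, fun x => ⟨fun _ => w x, fun ψ => by simp⟩⟩

/-- The value of a potential along the unperturbed separatrix. -/
lemma separatrix_mem (hG : TrigPot G) (ω : Fin d → ℝ) {g : ℝ} (hg : 0 < g) :
    (fun t θ => (G (Fin.cons (4 * Real.arctan (Real.exp (g * t))) (θ + t • ω)) : ℂ)) ∈
      TrigClass d := by
  obtain ⟨Q, c, -, hc, -, he⟩ := hG.exists_coeff
  simp_rw [he]
  have : (fun t θ => ∑ q ∈ Q, c q (4 * Real.arctan (Real.exp (g * t))) *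
      torusChar q (θ + t • ω)) = ∑ q ∈ Q, (fun t _ => c q (4 * Real.arctan (Real.exp (g * t)))) *
      (fun t θ => torusChar q (θ + t • ω)) := by
    ext t θ; simp [Finset.sum_apply]
  rw [this]
  exact (TrigClass d).sum_mem fun q _ => (TrigClass d).mul_mem
    (TrigClass.of_time (TwoSided.mono bot_le (comp_separatrix_mem (hc q) hg)))
    (TrigClass.char_flow_mem ω q)

/-- Taylor coefficients of a potential evaluated along a family of curves, up to the order up to
which those of the curves are in `TrigClass`. -/
lemma coefC_comp_mem (hG : TrigPot G) {Y : Fin (d + 1) → Par d → ℝ} (hY : ∀ i, AnalyticFam (Y i))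
    (h0 : ∀ G, TrigPot G → coefC (fun p => G fun i => Y i p) 0 ∈ TrigClass d) (L : ℕ)
    (hL : ∀ i n, n < L → coefC (dirD dirEps (Y i)) n ∈ TrigClass d) :
    ∀ n ≤ L, coefC (fun p => G fun i => Y i p) n ∈ TrigClass d := by
  have hA : ∀ G : (Fin (d + 1) → ℝ) → ℝ, TrigPot G → AnalyticFam fun p => G fun i => Y i p := by
    intro G hG t θ
    exact AnalyticAt.fun_comp (g := G) (f := fun p i => Y i p) (x := (0, t, θ)) (hG.analytic _)
      (analyticAt_pi_iff.2 fun i => hY i t θ)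
  intro n hn
  refine coefC_mem_of_deriv (C := {F | ∃ G, TrigPot G ∧ F = fun p => G fun i => Y i p})
    (Subalgebra.toSubmodule (TrigClass d)) (TrigClass d)
    (fun s hs x hx => (TrigClass d).mul_mem hs hx) L ?_ ?_ ?_ n hn _ ⟨G, hG, rfl⟩
  · rintro _ ⟨G, hG, rfl⟩; exact hA G hG
  · rintro _ ⟨G, hG, rfl⟩; exact h0 G hG
  · rintro _ ⟨G, hG, rfl⟩
    refine ⟨d + 1, fun i p => HomoclinicSplitting.pd G i fun i => Y i p, fun i => dirD dirEps (Y i),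
      fun i => ⟨_, hG.pd i, rfl⟩, fun i => (hY i).dirD _, fun i n hn => hL i n hn, fun t θ => ?_⟩
    have hev : ∀ᶠ ε in 𝓝 (0 : ℝ), ∀ i, AnalyticAt ℝ (Y i) (ε, t, θ) :=
      eventually_all.2 fun i => (hY i).eventually t θ
    filter_upwards [hev] with ε hε
    exact dirD_comp (hG.analytic _).differentiableAt (fun i => (hε i).differentiableAt) _

end TrigPot

lemma coefC_dirEps {F : Par d → ℝ} (hF : AnalyticFam F) (n : ℕ) :
    coefC (dirD dirEps F) n = ((n : ℂ) + 1) • coefC F (n + 1) := by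
  ext t θ
  simp only [coefC, coef_dirEps hF, Pi.smul_apply, smul_eq_mul]
  push_cast; rfl

lemma analyticFam_eps (c : ℝ) : AnalyticFam fun p : Par d => p.1 * c := fun _ _ =>
  (analyticAt_eps _).mul analyticAt_const

lemma coefC_eps (c : ℝ) (n : ℕ) :
    coefC (fun p : Par d => p.1 * c) n = fun _ _ => if n = 1 then (c : ℂ) else 0 := by
  cases n with
  | zero => simp [coefC_zero]
  | succ n =>
    have h1 := coefC_dirEps (analyticFam_eps (d := d) c) n
    have h2 : coefC (dirD dirEps fun p : Par d => p.1 * c) n = coefC (fun _ => c) n := by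
      refine coefC_congr (fun t θ => Eventually.of_forall fun ε => ?_) n
      refine (hasDerivAt_slice_eps ?_).unique (hasDerivAt_mul_const c)
      exact ((analyticAt_eps _).mul analyticAt_const).differentiableAt
    rw [h2, coefC_const] at h1
    ext t θ
    have h3 := congrFun (congrFun h1 t) θ
    have h4 : ((n : ℂ) + 1) ≠ 0 := Nat.cast_add_one_ne_zero n
    simp only [Pi.smul_apply, smul_eq_mul] at h3
    by_cases hn : n = 0
    · subst hn; simpa using h3.symm
    · rw [if_neg hn] at h3
      simpa [hn, h4] using h3.symm

/-- Multiplication by a multiple of `ε` shifts the Taylor coefficients. -/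
lemma coefC_eps_mul {F : Par d → ℝ} (hF : AnalyticFam F) (c : ℝ) (n : ℕ) :
    coefC (fun p => p.1 * c * F p) (n + 1) = (c : ℂ) • coefC F n := by
  have h1 := coefC_mul (analyticFam_eps (d := d) c) hF (n + 1)
  rw [show (fun p : Par d => p.1 * c) * F = fun p => p.1 * c * F p from rfl] at h1
  rw [h1, Finset.sum_eq_single ((1, n) : ℕ × ℕ)]
  · ext t θ; simp [coefC_eps]
  · rintro ⟨i, j⟩ hij hne
    rw [Finset.HasAntidiagonal.mem_antidiagonal] at hij
    have : i ≠ 1 := by rintro rfl; exact hne (Prod.ext rfl (by simp only at hij ⊢; omega))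
    ext t θ; simp [coefC_eps, this]
  · intro h
    rw [Finset.HasAntidiagonal.mem_antidiagonal] at h
    omega

/-- At the first order at which the coefficient of `Φ` is not known to be in `TrigClass`, the
coefficient of `sin Φ` differs from that of `Φ`, multiplied by `cos Φ₀`, by a member of the class. -/
lemma coefC_sin_sub_mem {Φ : Par d → ℝ} (hΦ : AnalyticFam Φ) (L : ℕ)
    (hcos : ∀ n ≤ L, coefC (fun p => Real.cos (Φ p)) n ∈ TrigClass d)
    (hL : ∀ n, n < L → coefC (dirD dirEps Φ) n ∈ TrigClass d) :
    coefC (fun p => Real.sin (Φ p)) (L + 1) -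
      (fun t θ => (Real.cos (Φ (0, t, θ)) : ℂ)) * coefC Φ (L + 1) ∈ TrigClass d := by
  have hc : AnalyticFam fun p => Real.cos (Φ p) := fun t θ =>
    AnalyticAt.fun_comp (g := Real.cos) Real.analyticAt_cos (hΦ t θ)
  have hs : AnalyticFam fun p => Real.sin (Φ p) := fun t θ =>
    AnalyticAt.fun_comp (g := Real.sin) Real.analyticAt_sin (hΦ t θ)
  -- In `(sin Φ)' = Φ' cos Φ` only the term `cos Φ₀ · Φ_{L+1}` contains the coefficient of order
  -- `L + 1` of `Φ`; `R` collects the others.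
  have h1 : coefC (dirD dirEps fun p => Real.sin (Φ p)) L =
      coefC ((fun p => Real.cos (Φ p)) * dirD dirEps Φ) L := by
    refine coefC_congr (fun t θ => ?_) L
    filter_upwards [hΦ.eventually t θ, hs.eventually t θ] with ε h1 h2
    have h3 := hasDerivAt_slice_eps h2.differentiableAt
    exact h3.unique (hasDerivAt_slice_eps h1.differentiableAt).sin
  rw [coefC_mul hc (hΦ.dirD _), coefC_dirEps hs] at h1
  have h3 : ((0, L) : ℕ × ℕ) ∈ Finset.HasAntidiagonal.antidiagonal L := by
    rw [Finset.HasAntidiagonal.mem_antidiagonal, zero_add]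
  rw [← Finset.add_sum_erase _ _ h3] at h1
  have h4 : ((L : ℂ) + 1) ≠ 0 := Nat.cast_add_one_ne_zero L
  set R := ∑ x ∈ (Finset.HasAntidiagonal.antidiagonal L).erase (0, L),
    coefC (fun p => Real.cos (Φ p)) x.1 * coefC (dirD dirEps Φ) x.2 with hR
  have hRm : R ∈ TrigClass d := by
    rw [hR]
    refine (TrigClass d).sum_mem fun x hx => ?_
    rw [Finset.mem_erase, Finset.HasAntidiagonal.mem_antidiagonal] at hx
    refine (TrigClass d).mul_mem (hcos _ (by omega)) (hL _ ?_)
    by_contra hcon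
    exact hx.1 (Prod.ext (by omega) (by omega))
  clear_value R
  simp only [coefC_dirEps hΦ, coefC_zero] at h1
  have h5 : coefC (fun p => Real.sin (Φ p)) (L + 1) -
      (fun t θ => (Real.cos (Φ (0, t, θ)) : ℂ)) * coefC Φ (L + 1) = ((L : ℂ) + 1)⁻¹ • R := by
    ext t θ
    have := congrFun (congrFun h1 t) θ
    simp only [Pi.add_apply, Pi.mul_apply, Pi.smul_apply, Pi.sub_apply, smul_eq_mul] at this ⊢
    field_simp
    linear_combination this
  rw [h5]
  exact (TrigClass d).smul_mem hRm _

end Potentials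

/-! ### The perturbation expansion of the unstable manifold -/

section Perturbation

variable {d : ℕ} {S : ForcedPendulum d}

lemma ForcedPendulum.nonresonant (S : ForcedPendulum d) (q : Fin d → ℤ) (hq : q ≠ 0) :
    flowFreq S.ω q ≠ 0 := by
  obtain ⟨a, ν, ha, -, h⟩ := S.diophantine
  have h1 : 0 < ∑ i, |(q i : ℝ)| := by
    obtain ⟨i, hi⟩ : ∃ i, q i ≠ 0 := by
      by_contra hcon
      push Not at hcon
      exact hq (funext hcon)
    refine Finset.sum_pos' (fun _ _ => abs_nonneg _) ⟨i, Finset.mem_univ i, ?_⟩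
    exact abs_pos.2 (by exact_mod_cast hi)
  have h2 := h q hq
  have h3 : 0 < a * (∑ i, |(q i : ℝ)|) ^ (-ν) := mul_pos ha (Real.rpow_pos_of_pos h1 _)
  have h4 : flowFreq S.ω q = ∑ i, S.ω i * (q i : ℝ) := Finset.sum_congr rfl fun i _ => mul_comm _ _
  rw [h4]
  exact abs_pos.1 (h3.trans_le h2)

lemma ForcedPendulum.trigPot (S : ForcedPendulum d) : TrigPot S.f := by
  obtain ⟨Q, c, h⟩ := S.f_trigonometric
  exact ⟨fun x => S.f_analytic x trivial, Q, fun x => ⟨fun q => c q x, fun ψ => h x ψ⟩⟩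

namespace UnstableManifold

variable (U : UnstableManifold S)

lemma exists_radius : ∃ r > 0, r ≤ U.ε₀ ∧ ∀ ε, |ε| < r → 0 < U.γ ε := by
  have h0 : |(0 : ℝ)| < U.ε₀ := by simpa using U.ε₀_pos
  have h1 : ∀ᶠ ε in 𝓝 (0 : ℝ), 0 < U.γ ε :=
    (U.γ_analytic 0 h0).continuousAt.eventually (lt_mem_nhds (by rw [U.γ_zero]; exact S.g_pos))
  obtain ⟨r, hr, h⟩ := Metric.eventually_nhds_iff.1 h1
  exact ⟨min r U.ε₀, lt_min hr U.ε₀_pos, min_le_right _ _, fun ε hε =>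
    h (by rw [Real.dist_eq, sub_zero]; exact hε.trans_le (min_le_left _ _))⟩

/-- A radius within which the manifold is analytic and the exponent `γ(ε)` is positive. -/
def radius : ℝ := U.exists_radius.choose

lemma radius_pos : 0 < U.radius := U.exists_radius.choose_spec.1

lemma lt_of_lt_radius {ε : ℝ} (h : |ε| < U.radius) : |ε| < U.ε₀ :=
  h.trans_le U.exists_radius.choose_spec.2.1

lemma gamma_pos {ε : ℝ} (h : |ε| < U.radius) : 0 < U.γ ε :=
  U.exists_radius.choose_spec.2.2 ε h

lemma abs_zero_lt : |(0 : ℝ)| < U.ε₀ := by simpa using U.ε₀_pos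

lemma gamma_analytic : AnalyticAt ℝ U.γ 0 := U.γ_analytic 0 U.abs_zero_lt

lemma gamma_zero_pos : 0 < U.γ 0 := by rw [U.γ_zero]; exact S.g_pos

/-- The components of `X^u`. -/
def XFam (α : Fin (d + 1)) : Par d → ℝ := fun p => U.Xu p.1 p.2.1 p.2.2 α

/-- The components of the trajectory `X^u(t; θ) + (0, θ + ωt)`. -/
def YFam (α : Fin (d + 1)) : Par d → ℝ :=
  fun p => (U.Xu p.1 p.2.1 p.2.2 + Fin.cons 0 (p.2.2 + p.2.1 • S.ω) : Fin (d + 1) → ℝ) α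

lemma flowGen (α : Fin (d + 1)) : FlowGen U.ε₀ fun p => U.X p.1 p.2.1 p.2.2 α :=
  ⟨fun ε z θ hε => analyticAt_pi_iff.1 (U.X_analytic ε z θ hε) α,
    fun ε z hε θ k => congrFun (U.X_periodic ε z θ k hε) α⟩

lemma XFam_analyticAt (α : Fin (d + 1)) {ε : ℝ} (hε : |ε| < U.ε₀) (t : ℝ) (θ : Fin d → ℝ) :
    AnalyticAt ℝ (U.XFam α) (ε, t, θ) :=
  (U.flowGen α).analyticAt_flowLift hε (U.γ_analytic ε hε) t θ

lemma XFam_mem_flowFam (α : Fin (d + 1)) : U.XFam α ∈ FlowFam S.ω :=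
  (U.flowGen α).flowLift_mem U.ε₀_pos U.gamma_analytic U.gamma_zero_pos

lemma dirTime_XFam_mem_flowFam (α : Fin (d + 1)) : dirD dirTime (U.XFam α) ∈ FlowFam S.ω :=
  (U.flowGen α).dirTime_flowLift_mem U.ε₀_pos U.γ_analytic U.gamma_zero_pos

lemma XFam_analyticFam (α : Fin (d + 1)) : AnalyticFam (U.XFam α) := (U.XFam_mem_flowFam α).1

lemma shift_analyticAt (α : Fin (d + 1)) (p : Par d) :
    AnalyticAt ℝ (fun p : Par d => (Fin.cons 0 (p.2.2 + p.2.1 • S.ω) : Fin (d + 1) → ℝ) α) p := by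
  refine Fin.cases ?_ (fun i => ?_) α
  · simpa using analyticAt_const
  · have h1 : AnalyticAt ℝ (fun p : Par d => p.2.2 + p.2.1 • S.ω) p :=
      (analyticAt_theta p).add ((analyticAt_time p).smul analyticAt_const)
    exact analyticAt_pi_iff.1 h1 i

lemma YFam_analyticAt (α : Fin (d + 1)) {ε : ℝ} (hε : |ε| < U.ε₀) (t : ℝ) (θ : Fin d → ℝ) :
    AnalyticAt ℝ (U.YFam α) (ε, t, θ) :=
  (U.XFam_analyticAt α hε t θ).add (shift_analyticAt α _)

lemma YFam_analyticFam (α : Fin (d + 1)) : AnalyticFam (U.YFam α) := fun t θ =>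
  U.YFam_analyticAt α U.abs_zero_lt t θ

/-- Time derivative along the flow of a function of `(z, θ)`. -/
lemma hasDerivAt_flow {h : ℝ → (Fin d → ℝ) → (Fin (d + 1) → ℝ)} {c t : ℝ} {θ : Fin d → ℝ}
    (hh : DifferentiableAt ℝ (fun p : ℝ × (Fin d → ℝ) => h p.1 p.2)
      (Real.exp (c * t), θ + t • S.ω)) :
    HasDerivAt (fun t => h (Real.exp (c * t)) (θ + t • S.ω))
      (S.flowDeriv c h (Real.exp (c * t)) (θ + t • S.ω)) t := by
  have h1 : HasDerivAt (fun t => (Real.exp (c * t), θ + t • S.ω))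
      (c * Real.exp (c * t), S.ω) t := by
    have h2 : HasDerivAt (fun t => Real.exp (c * t)) (c * Real.exp (c * t)) t :=
      (((hasDerivAt_id t).const_mul c).exp).congr_deriv (by simp [mul_comm])
    refine h2.prodMk ?_
    simpa using ((hasDerivAt_id t).smul_const S.ω).const_add θ
  exact hh.hasFDerivAt.comp_hasDerivAt t h1

/-- The equations of motion in second-order form. -/
theorem exists_velocity {ε : ℝ} (hε : |ε| < U.ε₀) (θ : Fin d → ℝ) :
    ∃ V : ℝ → Fin (d + 1) → ℝ, ∀ t, HasDerivAt (fun t => U.Xu ε t θ) (V t) t ∧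
      HasDerivAt V (S.Omega ε (U.Xu ε t θ) (θ + t • S.ω)) t := by
  have hA : ∀ p, AnalyticAt ℝ (fun p : ℝ × (Fin d → ℝ) => U.X ε p.1 p.2) p := fun p =>
    AnalyticAt.fun_comp (g := fun p : Par d => U.X p.1 p.2.1 p.2.2)
      (f := fun p : ℝ × (Fin d → ℝ) => ((ε, p.1, p.2) : Par d)) (x := p)
      (U.X_analytic ε p.1 p.2 hε) (analyticAt_const.prod (analyticAt_fst.prod analyticAt_snd))
  refine ⟨fun t => S.flowDeriv (U.γ ε) (U.X ε) (Real.exp (U.γ ε * t)) (θ + t • S.ω), fun t =>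
    ⟨hasDerivAt_flow (hA _).differentiableAt, ?_⟩⟩
  refine (hasDerivAt_flow (h := S.flowDeriv (U.γ ε) (U.X ε)) ?_).congr_deriv
    (U.X_equation ε _ _ hε)
  have h1 : DifferentiableAt ℝ (fderiv ℝ fun p : ℝ × (Fin d → ℝ) => U.X ε p.1 p.2)
      (Real.exp (U.γ ε * t), θ + t • S.ω) := (hA _).fderiv.differentiableAt
  exact h1.clm_apply (by fun_prop)

lemma hasDerivAt_XFam (α : Fin (d + 1)) {ε : ℝ} (hε : |ε| < U.ε₀) (t : ℝ) (θ : Fin d → ℝ) :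
    HasDerivAt (fun t => U.XFam α (ε, t, θ)) (dirD dirTime (U.XFam α) (ε, t, θ)) t :=
  hasDerivAt_slice_time (U.XFam_analyticAt α hε t θ).differentiableAt

lemma hasDerivAt_dirTime_XFam (α : Fin (d + 1)) {ε : ℝ} (hε : |ε| < U.ε₀) (t : ℝ)
    (θ : Fin d → ℝ) : HasDerivAt (fun t => dirD dirTime (U.XFam α) (ε, t, θ))
      (S.Omega ε (U.Xu ε t θ) (θ + t • S.ω) α) t := by
  obtain ⟨V, hV⟩ := U.exists_velocity hε θ
  have h1 : (fun t => dirD dirTime (U.XFam α) (ε, t, θ)) = fun t => V t α := by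
    ext s
    exact (U.hasDerivAt_XFam α hε s θ).unique (hasDerivAt_pi.1 (hV s).1 α)
  rw [h1]
  exact hasDerivAt_pi.1 (hV t).2 α

/-! The inhomogeneous term of the linearized equation. -/

/-- The components of `𝔄^u`. -/
def AFam (α : Fin (d + 1)) : Par d → ℝ := fun p => U.Au p.1 p.2.1 p.2.2 α

/-- The components of the gradient `∂f(X^u + (0, θ + ωt))`. -/
def gradFam (α : Fin (d + 1)) : Par d → ℝ := fun p => pd S.f α fun β => U.YFam β p

lemma AFam_apply (α : Fin (d + 1)) (p : Par d) : U.AFam α p =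
    S.Omega p.1 (U.Xu p.1 p.2.1 p.2.2) (p.2.2 + p.2.1 • S.ω) α -
      solK α (U.γ p.1) p.2.1 * U.XFam α p := by
  simp only [AFam, Au, solK, XFam]
  split_ifs with h
  · rw [h]
  · rw [zero_mul]

lemma Omega_apply (α : Fin (d + 1)) (p : Par d) :
    S.Omega p.1 (U.Xu p.1 p.2.1 p.2.2) (p.2.2 + p.2.1 • S.ω) α =
      (if α = 0 then S.g ^ 2 * Real.sin (U.XFam 0 p) else 0) +
        p.1 * S.g ^ 2 * U.gradFam α p := rfl

lemma comp_YFam_analyticAt {G : (Fin (d + 1) → ℝ) → ℝ} (hG : ∀ x, AnalyticAt ℝ G x) {ε : ℝ}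
    (hε : |ε| < U.ε₀) (t : ℝ) (θ : Fin d → ℝ) :
    AnalyticAt ℝ (fun p => G fun β => U.YFam β p) (ε, t, θ) :=
  AnalyticAt.fun_comp (g := G) (f := fun p β => U.YFam β p) (x := (ε, t, θ)) (hG _)
    (analyticAt_pi_iff.2 fun i => U.YFam_analyticAt i hε t θ)

lemma comp_YFam_analyticFam {G : (Fin (d + 1) → ℝ) → ℝ} (hG : ∀ x, AnalyticAt ℝ G x) :
    AnalyticFam fun p => G fun β => U.YFam β p := fun t θ =>
  U.comp_YFam_analyticAt hG U.abs_zero_lt t θ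

lemma sin_XFam_analyticFam : AnalyticFam fun p => Real.sin (U.XFam 0 p) := fun t θ =>
  AnalyticAt.fun_comp (g := Real.sin) Real.analyticAt_sin (U.XFam_analyticFam 0 t θ)

lemma solK_mem (α : Fin (d + 1)) : (fun p : Par d => solK α (U.γ p.1) p.2.1) ∈ TimeFam d :=
  TimeFam.solK_mem U.gamma_analytic U.gamma_zero_pos α

lemma AFam_eq (α : Fin (d + 1)) : U.AFam α =
    ((fun _ => if α = 0 then S.g ^ 2 else 0) * (fun p => Real.sin (U.XFam 0 p)) +
      fun p => p.1 * S.g ^ 2 * U.gradFam α p) +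
      (fun p : Par d => -solK α (U.γ p.1) p.2.1) * U.XFam α := by
  ext p
  rw [AFam_apply, Omega_apply]
  simp only [Pi.add_apply, Pi.mul_apply]
  split_ifs <;> ring

lemma gradFam_analyticFam (α : Fin (d + 1)) : AnalyticFam (U.gradFam α) :=
  U.comp_YFam_analyticFam (S.trigPot.pd α).analytic

lemma eps_gradFam_analyticFam (α : Fin (d + 1)) :
    AnalyticFam fun p => p.1 * S.g ^ 2 * U.gradFam α p :=
  (analyticFam_eps _).mul (U.gradFam_analyticFam α)

lemma AFam_analyticFam (α : Fin (d + 1)) : AnalyticFam (U.AFam α) := by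
  rw [AFam_eq]
  exact (((AnalyticFam.const _).mul U.sin_XFam_analyticFam).add (U.eps_gradFam_analyticFam α)).add
    (AnalyticFam.mul ((TimeFam d).neg_mem (U.solK_mem α)).1 (U.XFam_analyticFam α))

lemma coefC_YFam_zero {G : (Fin (d + 1) → ℝ) → ℝ} (hG : TrigPot G) :
    coefC (fun p => G fun β => U.YFam β p) 0 ∈ TrigClass d := by
  rw [coefC_zero]
  convert hG.separatrix_mem S.ω U.gamma_zero_pos using 5 with t θ
  ext β
  simp only [YFam, Xu, U.X_zero, Pi.add_apply]
  refine Fin.cases ?_ (fun i => ?_) β <;> simp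

lemma coefC_XFam_zero (α : Fin (d + 1)) : coefC (U.XFam α) 0 ∈ TrigClass d := by
  rw [coefC_zero]
  refine Fin.cases ?_ (fun i => ?_) α
  · have := TrigClass.of_time (d := d) (TwoSided.mono bot_le
      (comp_separatrix_mem (c := fun x => (x : ℂ)) (fun x => Complex.ofRealCLM.analyticAt x)
        U.gamma_zero_pos))
    convert this using 4 with t θ
    simp [XFam, Xu, U.X_zero]
  · convert (TrigClass d).zero_mem using 1
    ext t θ
    simp [XFam, Xu, U.X_zero]

lemma coefC_dirEps_YFam (α : Fin (d + 1)) (n : ℕ) :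
    coefC (dirD dirEps (U.YFam α)) n = ((n : ℂ) + 1) • coefC (U.XFam α) (n + 1) := by
  rw [← coefC_dirEps (U.XFam_analyticFam α)]
  refine coefC_congr (fun t θ => ?_) n
  filter_upwards [(U.XFam_analyticFam α).eventually t θ, (U.YFam_analyticFam α).eventually t θ]
    with ε h1 h2
  exact (hasDerivAt_slice_eps h2.differentiableAt).unique
    ((hasDerivAt_slice_eps h1.differentiableAt).add_const
      ((Fin.cons 0 (θ + t • S.ω) : Fin (d + 1) → ℝ) α))

/-- The order `n` of a potential along the manifold is determined by the orders `≤ n` of the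
manifold. -/
lemma coefC_comp_YFam_mem {G : (Fin (d + 1) → ℝ) → ℝ} (hG : TrigPot G) (n : ℕ)
    (hX : ∀ α, ∀ m ≤ n, coefC (U.XFam α) m ∈ TrigClass d) :
    coefC (fun p => G fun β => U.YFam β p) n ∈ TrigClass d := by
  refine hG.coefC_comp_mem U.YFam_analyticFam (fun G hG => U.coefC_YFam_zero hG) n
    (fun i m hm => ?_) n le_rfl
  rw [coefC_dirEps_YFam]
  exact (TrigClass d).smul_mem (hX i _ hm) _

/-- The order `n` of `𝔄^u` only involves the orders `< n` of the manifold: its linear part at the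
unperturbed separatrix has been subtracted. -/
theorem coefC_AFam_mem (n : ℕ) (hX : ∀ α, ∀ m < n, coefC (U.XFam α) m ∈ TrigClass d)
    (α : Fin (d + 1)) : coefC (U.AFam α) n ∈ TrigClass d := by
  have hK := U.solK_mem α
  have hnK : (fun p : Par d => -solK α (U.γ p.1) p.2.1) ∈ TimeFam d := (TimeFam d).neg_mem hK
  have hsin : ∀ n, (∀ α, ∀ m ≤ n, coefC (U.XFam α) m ∈ TrigClass d) →
      ∀ w : ℝ → ℝ, (∀ x, AnalyticAt ℝ w x) → coefC (fun p => w (U.XFam 0 p)) n ∈ TrigClass d := by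
    intro n hX w hw
    have := U.coefC_comp_YFam_mem (TrigPot.of_angle hw) n hX
    simpa [YFam, XFam] using this
  rw [AFam_eq, coefC_add (((AnalyticFam.const _).mul U.sin_XFam_analyticFam).add
    (U.eps_gradFam_analyticFam α)) (AnalyticFam.mul hnK.1 (U.XFam_analyticFam α)),
    coefC_add ((AnalyticFam.const _).mul U.sin_XFam_analyticFam) (U.eps_gradFam_analyticFam α)]
  rw [coefC_mul (AnalyticFam.const _) U.sin_XFam_analyticFam,
    coefC_mul hnK.1 (U.XFam_analyticFam α)]
  -- At order `0` the manifold is the separatrix, and `ε ∂f` does not contribute.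
  cases n with
  | zero =>
    have h0 : ∀ α, ∀ m ≤ 0, coefC (U.XFam α) m ∈ TrigClass d := fun α m hm => by
      rw [Nat.le_zero.1 hm]; exact U.coefC_XFam_zero α
    simp only [Finset.Nat.antidiagonal_zero, Finset.sum_singleton]
    refine (TrigClass d).add_mem ((TrigClass d).add_mem ((TrigClass d).mul_mem ?_
      (hsin 0 h0 Real.sin fun _ => Real.analyticAt_sin)) ?_) ((TrigClass d).mul_mem
        ((TimeFam.le_trigFam hnK).2 0) (U.coefC_XFam_zero α))
    · exact ((TrigFam d).algebraMap_mem (if α = 0 then S.g ^ 2 else 0)).2 0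
    · convert (TrigClass d).zero_mem using 1
      rw [coefC_zero]
      ext t θ; simp
  | succ n =>
    have hX' : ∀ α, ∀ m ≤ n, coefC (U.XFam α) m ∈ TrigClass d :=
      fun α m hm => hX α m (Nat.lt_succ_of_le hm)
    have h0 : ((0, n + 1) : ℕ × ℕ) ∈ Finset.HasAntidiagonal.antidiagonal (n + 1) := by
      rw [Finset.HasAntidiagonal.mem_antidiagonal, zero_add]
    have hrest : ∀ x ∈ (Finset.HasAntidiagonal.antidiagonal (n + 1)).erase ((0, n + 1) : ℕ × ℕ),
        x.2 ≤ n := by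
      intro x hx
      rw [Finset.mem_erase, Finset.HasAntidiagonal.mem_antidiagonal] at hx
      by_contra hcon
      exact hx.1 (Prod.ext (by omega) (by omega))
    -- The terms of order `n + 1` in the manifold are isolated from the Cauchy products; the
    -- remainders `R₁` and `R₂` only involve orders `≤ n`.
    rw [coefC_eps_mul (U.gradFam_analyticFam α), ← Finset.add_sum_erase _ _ h0,
      ← Finset.add_sum_erase _ (fun x : ℕ × ℕ => coefC (fun p : Par d =>
        -solK α (U.γ p.1) p.2.1) x.1 * coefC (U.XFam α) x.2) h0]
    set R₁ := ∑ x ∈ (Finset.HasAntidiagonal.antidiagonal (n + 1)).erase ((0, n + 1) : ℕ × ℕ),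
      coefC (fun _ : Par d => if α = 0 then S.g ^ 2 else 0) x.1 *
        coefC (fun p => Real.sin (U.XFam 0 p)) x.2 with hR₁
    set R₂ := ∑ x ∈ (Finset.HasAntidiagonal.antidiagonal (n + 1)).erase ((0, n + 1) : ℕ × ℕ),
      coefC (fun p : Par d => -solK α (U.γ p.1) p.2.1) x.1 * coefC (U.XFam α) x.2 with hR₂
    have h1 : R₁ ∈ TrigClass d := by
      rw [hR₁]
      refine (TrigClass d).sum_mem fun x hx => (TrigClass d).mul_mem
        (((TrigFam d).algebraMap_mem (if α = 0 then S.g ^ 2 else 0)).2 _)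
        (hsin _ (fun α m hm => hX' α m (hm.trans (hrest x hx))) _ fun _ => Real.analyticAt_sin)
    have h2 : R₂ ∈ TrigClass d := by
      rw [hR₂]
      exact (TrigClass d).sum_mem fun x hx => (TrigClass d).mul_mem
        ((TimeFam.le_trigFam hnK).2 _) (hX' α _ (hrest x hx))
    have h3 : coefC (U.gradFam α) n ∈ TrigClass d :=
      U.coefC_comp_YFam_mem (S.trigPot.pd α) n hX'
    have h4 := coefC_sin_sub_mem (U.XFam_analyticFam 0) n
      (fun m hm => hsin m (fun α k hk => hX' α k (hk.trans hm)) _ fun _ => Real.analyticAt_cos)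
      (fun m hm => by
        rw [coefC_dirEps (U.XFam_analyticFam 0)]
        exact (TrigClass d).smul_mem (hX' 0 _ hm) _)
    clear_value R₁ R₂
    -- The isolated terms combine to `g² ((sin Φ)_{n+1} - cos Φ⁰ · Φ_{n+1})`, because `γ(0) = g`
    -- makes the potential at `ε = 0` equal to `g² cos Φ⁰`.
    have h5 : coefC (fun _ : Par d => if α = 0 then S.g ^ 2 else 0) 0 *
          coefC (fun p => Real.sin (U.XFam 0 p)) (n + 1) +
        coefC (fun p : Par d => -solK α (U.γ p.1) p.2.1) 0 * coefC (U.XFam α) (n + 1) =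
        (if α = 0 then ((S.g : ℂ) ^ 2) else 0) • (coefC (fun p => Real.sin (U.XFam 0 p)) (n + 1) -
          (fun t θ => (Real.cos (U.XFam 0 (0, t, θ)) : ℂ)) * coefC (U.XFam 0) (n + 1)) := by
      ext t θ
      simp only [coefC_zero, Pi.add_apply, Pi.mul_apply, Pi.smul_apply, Pi.sub_apply, smul_eq_mul]
      split_ifs with hα
      · subst hα
        simp only [solK, if_true, XFam, Xu, U.X_zero, U.γ_zero, Fin.cons_zero]
        push_cast; ring
      · simp [solK, hα]
    refine (congrArg (· ∈ TrigClass d) ?_).mp ((TrigClass d).add_mem ((TrigClass d).add_mem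
      ((TrigClass d).smul_mem h4 (if α = 0 then ((S.g : ℂ) ^ 2) else 0))
      ((TrigClass d).add_mem h1 h2)) ((TrigClass d).smul_mem h3 ((S.g ^ 2 : ℝ) : ℂ)))
    rw [← h5]
    abel

/-- `w` is, for every value of `γ`, a solution of the linearized equation of the component `α`, and
`w'` is its time derivative. -/
structure LinSol (α : Fin (d + 1)) (w w' : ℝ → ℝ → ℝ) : Prop where
  mem : (fun p : Par d => w (U.γ p.1) p.2.1) ∈ TimeFam d
  mem' : (fun p : Par d => w' (U.γ p.1) p.2.1) ∈ TimeFam d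
  hasDerivAt : ∀ γ t, 0 < γ → HasDerivAt (w γ) (w' γ t) t
  hasDerivAt' : ∀ γ t, 0 < γ → HasDerivAt (w' γ) (solK α γ t * w γ t) t

lemma linSolU (α : Fin (d + 1)) : U.LinSol α (solU α) (solU' α) :=
  ⟨TimeFam.solU_mem U.gamma_analytic U.gamma_zero_pos α,
    TimeFam.solU'_mem U.gamma_analytic U.gamma_zero_pos α,
    fun γ t _ => hasDerivAt_solU α γ t, fun γ t _ => hasDerivAt_solU' α γ t⟩

lemma linSolV (α : Fin (d + 1)) : U.LinSol α (solV α) (solV' α) :=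
  ⟨TimeFam.solV_mem U.gamma_analytic U.gamma_zero_pos α,
    TimeFam.solV'_mem U.gamma_analytic U.gamma_zero_pos α,
    fun _ t h => hasDerivAt_solV h.ne' α t, fun _ t h => hasDerivAt_solV' h.ne' α t⟩

/-- The Wronskian of `w` and the component `α` of `X^u`. -/
def wronFam (α : Fin (d + 1)) (w w' : ℝ → ℝ → ℝ) : Par d → ℝ :=
  (fun p => w (U.γ p.1) p.2.1) * dirD dirTime (U.XFam α) +
    (fun p => -w' (U.γ p.1) p.2.1) * U.XFam α

variable {U} {α : Fin (d + 1)} {w w' : ℝ → ℝ → ℝ}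

lemma LinSol.wronFam_mem_flowFam (hw : U.LinSol α w w') : U.wronFam α w w' ∈ FlowFam S.ω :=
  FlowFam.add (FlowFam.time_mul hw.mem (U.dirTime_XFam_mem_flowFam α))
    (FlowFam.time_mul ((TimeFam d).neg_mem hw.mem') (U.XFam_mem_flowFam α))

lemma LinSol.hasDerivAt_wronFam (hw : U.LinSol α w w') {ε : ℝ} (hε : |ε| < U.radius) (t : ℝ)
    (θ : Fin d → ℝ) : HasDerivAt (fun t => U.wronFam α w w' (ε, t, θ))
      (w (U.γ ε) t * U.AFam α (ε, t, θ)) t := by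
  have hε' := U.lt_of_lt_radius hε
  have h1 := ((hw.hasDerivAt (U.γ ε) t (U.gamma_pos hε)).mul
    (U.hasDerivAt_dirTime_XFam α hε' t θ)).add
    ((hw.hasDerivAt' (U.γ ε) t (U.gamma_pos hε)).neg.mul (U.hasDerivAt_XFam α hε' t θ))
  refine h1.congr_deriv ?_
  rw [AFam_apply, Pi.neg_apply]
  ring

lemma LinSol.dirTime_wronFam (hw : U.LinSol α w w') (n : ℕ) :
    coefC (dirD dirTime (U.wronFam α w w')) n =
      coefC ((fun p : Par d => w (U.γ p.1) p.2.1) * U.AFam α) n := by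
  refine coefC_congr (fun t θ => ?_) n
  have hop : IsOpen {ε : ℝ | |ε| < U.radius} := isOpen_lt (by fun_prop) continuous_const
  filter_upwards [hop.mem_nhds (by simpa using U.radius_pos),
    hw.wronFam_mem_flowFam.1.eventually t θ] with ε hε h1
  exact (hasDerivAt_slice_time h1.differentiableAt).unique (hw.hasDerivAt_wronFam hε t θ)

lemma hasDerivAt_coefC {F : Par d → ℝ} (hF : AnalyticFam F) (n : ℕ) (t : ℝ) (θ : Fin d → ℝ) :
    HasDerivAt (fun t => coefC F n t θ) (coefC (dirD dirTime F) n t θ) t :=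
  (hasDerivAt_coef hF n t θ).ofReal_comp

/-- The derivative `w 𝔄` of the Wronskian is a trigonometric polynomial at order `n`, hence so is
the Wronskian itself, as a function transported by the flow. -/
lemma LinSol.coefC_wronFam_mem (hw : U.LinSol α w w') (n : ℕ)
    (hA : ∀ m ≤ n, coefC (U.AFam α) m ∈ TrigClass d) :
    coefC (U.wronFam α w w') n ∈ TrigClass d := by
  refine FlowClass.mem_trigClass S.nonresonant (hw.wronFam_mem_flowFam.2 n)
    (r := coefC (dirD dirTime (U.wronFam α w w')) n) ?_
    (hasDerivAt_coefC hw.wronFam_mem_flowFam.1 n)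
  rw [hw.dirTime_wronFam, coefC_mul hw.mem.1 (U.AFam_analyticFam α)]
  refine (TrigClass d).sum_mem fun x hx => ?_
  rw [Finset.HasAntidiagonal.mem_antidiagonal] at hx
  exact (TrigClass d).mul_mem ((TimeFam.le_trigFam hw.mem).2 _) (hA _ (by omega))

variable (U)

/-- Variation of constants. -/
lemma XFam_eq_wronFam (α : Fin (d + 1)) {ε : ℝ} (hε : |ε| < U.radius) (t : ℝ) (θ : Fin d → ℝ) :
    U.XFam α (ε, t, θ) = solV α (U.γ ε) t * U.wronFam α (solU α) (solU' α) (ε, t, θ) +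
      -solU α (U.γ ε) t * U.wronFam α (solV α) (solV' α) (ε, t, θ) := by
  have := wronskian_sol (U.gamma_pos hε).ne' α t
  simp only [wronFam, Pi.add_apply, Pi.mul_apply]
  linear_combination (-(U.XFam α (ε, t, θ))) * this

/-- All Taylor coefficients of `X^u` are trigonometric polynomials in `θ` with two-sided expansions
in `t`. By induction on the order: the orders `< n` of `X^u` determine `𝔄^u` up to order `n`, hence
the Wronskians, and `X^u` is recovered by variation of constants. -/
theorem coefC_XFam_mem (n : ℕ) : ∀ α, coefC (U.XFam α) n ∈ TrigClass d := by
  induction n using Nat.strong_induction_on with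
  | _ n ih =>
    intro α
    have hA : ∀ m ≤ n, coefC (U.AFam α) m ∈ TrigClass d := fun m hm =>
      U.coefC_AFam_mem m (fun β k hk => ih k (hk.trans_le hm) β) α
    have hu := U.linSolU α
    have hv := U.linSolV α
    have hnu : (fun p : Par d => -solU α (U.γ p.1) p.2.1) ∈ TimeFam d := (TimeFam d).neg_mem hu.mem
    have h1 : coefC (U.XFam α) n = coefC
        ((fun p : Par d => solV α (U.γ p.1) p.2.1) * U.wronFam α (solU α) (solU' α) +
          (fun p : Par d => -solU α (U.γ p.1) p.2.1) * U.wronFam α (solV α) (solV' α)) n := by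
      refine coefC_congr (fun t θ => ?_) n
      have hop : IsOpen {ε : ℝ | |ε| < U.radius} := isOpen_lt (by fun_prop) continuous_const
      filter_upwards [hop.mem_nhds (by simpa using U.radius_pos)] with ε hε
      exact U.XFam_eq_wronFam α hε t θ
    have hNu := hu.wronFam_mem_flowFam.1
    have hNv := hv.wronFam_mem_flowFam.1
    rw [h1, coefC_add (hv.mem.1.mul hNu) (AnalyticFam.mul hnu.1 hNv),
      coefC_mul hv.mem.1 hNu, coefC_mul hnu.1 hNv]
    refine (TrigClass d).add_mem ?_ ?_ <;> refine (TrigClass d).sum_mem fun x hx => ?_ <;>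
      rw [Finset.HasAntidiagonal.mem_antidiagonal] at hx
    · exact (TrigClass d).mul_mem ((TimeFam.le_trigFam hv.mem).2 _)
        (hu.coefC_wronFam_mem _ fun m hm => hA m (by omega))
    · exact (TrigClass d).mul_mem ((TimeFam.le_trigFam hnu).2 _)
        (hv.coefC_wronFam_mem _ fun m hm => hA m (by omega))

lemma XFam_mem (α : Fin (d + 1)) : U.XFam α ∈ TrigFam d :=
  ⟨U.XFam_analyticFam α, fun n => U.coefC_XFam_mem n α⟩

lemma comp_YFam_mem {G : (Fin (d + 1) → ℝ) → ℝ} (hG : TrigPot G) :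
    (fun p => G fun β => U.YFam β p) ∈ TrigFam d :=
  ⟨U.comp_YFam_analyticFam hG.analytic, fun n =>
    U.coefC_comp_YFam_mem hG n fun α m _ => U.coefC_XFam_mem m α⟩

lemma AFam_mem (α : Fin (d + 1)) : U.AFam α ∈ TrigFam d :=
  ⟨U.AFam_analyticFam α, fun n => U.coefC_AFam_mem n (fun α m _ => U.coefC_XFam_mem m α) α⟩

lemma gradFam_mem (α : Fin (d + 1)) : U.gradFam α ∈ TrigFam d := U.comp_YFam_mem (S.trigPot.pd α)

variable {U}

lemma LinSol.wronFam_mem (hw : U.LinSol α w w') : U.wronFam α w w' ∈ TrigFam d :=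
  ⟨hw.wronFam_mem_flowFam.1, fun n => hw.coefC_wronFam_mem n fun m _ => (U.AFam_mem α).2 m⟩

/-- The `θ`-derivative of a family transported by the flow has no constant term as
`t → -∞`. -/
lemma hasConst_dirTheta {F : Par d → ℝ} (hF : F ∈ FlowFam S.ω) (hT : F ∈ TrigFam d) (b : Fin d)
    (n : ℕ) (θ : Fin d → ℝ) : HasConst (fun t => coefC (dirD (dirTheta b) F) n (-t) θ) 0 := by
  have := FlowClass.pd_hasConst_zero S.nonresonant (F := coef F n) (hF.2 n) (hT.2 n) b θ
  simp only [pd_coef hF.1] at this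
  exact this

variable (U)

lemma dirTime_XFam_mem (α : Fin (d + 1)) : dirD dirTime (U.XFam α) ∈ TrigFam d := by
  refine ⟨(U.XFam_analyticFam α).dirD _, fun n => ?_⟩
  refine FlowClass.mem_trigClass S.nonresonant ((U.dirTime_XFam_mem_flowFam α).2 n)
    (r := coefC (dirD dirTime (dirD dirTime (U.XFam α))) n) ?_
    (hasDerivAt_coefC (U.dirTime_XFam_mem_flowFam α).1 n)
  have h1 : (fun p : Par d => U.AFam α p + solK α (U.γ p.1) p.2.1 * U.XFam α p) ∈ TrigFam d :=
    (TrigFam d).add_mem (U.AFam_mem α)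
      ((TrigFam d).mul_mem (TimeFam.le_trigFam (U.solK_mem α)) (U.XFam_mem α))
  rw [coefC_congr (fun t θ => ?_) n]
  · exact h1.2 n
  · have hop : IsOpen {ε : ℝ | |ε| < U.ε₀} := isOpen_lt (by fun_prop) continuous_const
    filter_upwards [hop.mem_nhds U.abs_zero_lt] with ε hε
    have h2 := (hasDerivAt_slice_time (AnalyticAt.dirD
      (U.XFam_analyticAt α hε t θ) dirTime).differentiableAt).unique
      (U.hasDerivAt_dirTime_XFam α hε t θ)
    rw [h2, AFam_apply]
    ring

end UnstableManifold

end Perturbation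

/-! ### Symmetry and the homoclinic trajectory -/

section Symmetry

section Periodic

variable {n : ℕ}

lemma IsPeriodic.fderiv {F : (Fin n → ℝ) → ℝ} (hF : IsPeriodic F) : IsPeriodic (fderiv ℝ F) := by
  intro x k
  have h1 : (fun x => F (x + fun i => 2 * Real.pi * (k i : ℝ))) = F := funext fun x => hF x k
  have h2 := fderiv_comp_add_right (𝕜 := ℝ) (f := F) (x := x) (fun i => 2 * Real.pi * (k i : ℝ))
  rw [h1] at h2
  exact h2.symm

lemma IsPeriodic.pd {F : (Fin n → ℝ) → ℝ} (hF : IsPeriodic F) (i : Fin n) :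
    IsPeriodic (HomoclinicSplitting.pd F i) := fun x k =>
  congrArg (fun L : (Fin n → ℝ) →L[ℝ] ℝ => L (Pi.single i 1)) (hF.fderiv x k)

lemma pd_neg_arg {F G : (Fin n → ℝ) → ℝ} {c : ℝ} (h : ∀ x, F (-x) = c * G x)
    (hG : Differentiable ℝ G) (i : Fin n) (x : Fin n → ℝ) : pd F i (-x) = -(c * pd G i x) := by
  have h1 : HasFDerivAt (fun y => c * G (-y)) _ (-x) :=
    ((hG (- -x)).hasFDerivAt.comp (-x) (hasFDerivAt_id (-x)).neg).const_mul c
  rw [pd, show F = fun y => c * G (-y) from funext fun y => by rw [← h, neg_neg], h1.fderiv]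
  simp [pd]

/-- A periodic `C¹` function is globally Lipschitz. -/
lemma IsPeriodic.exists_lipschitzWith {F : (Fin n → ℝ) → ℝ} (hp : IsPeriodic F)
    (hF : ∀ x, AnalyticAt ℝ F x) : ∃ K, LipschitzWith K F := by
  have hc : Continuous (_root_.fderiv ℝ F) :=
    continuous_iff_continuousAt.2 fun x => (hF x).fderiv.continuousAt
  have hK : IsCompact (Set.pi Set.univ fun _ : Fin n => Set.Icc (0 : ℝ) (2 * Real.pi)) :=
    isCompact_univ_pi fun _ => isCompact_Icc
  obtain ⟨C, hC⟩ := hK.exists_bound_of_continuousOn hc.continuousOn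
  refine ⟨C.toNNReal, lipschitzWith_of_nnnorm_fderiv_le (𝕜 := ℝ)
    (fun x => (hF x).differentiableAt) fun x => ?_⟩
  rw [← hp.fderiv.torusRep_toTorus x]
  exact NNReal.le_toNNReal_of_coe_le (hC _ (torusRep_mem _))

end Periodic

variable {d : ℕ}

namespace ForcedPendulum

variable (S : ForcedPendulum d)

lemma pd_even (α : Fin (d + 1)) (x : Fin (d + 1) → ℝ) : pd S.f α (-x) = -pd S.f α x := by
  have := pd_neg_arg (F := S.f) (G := S.f) (c := 1) (fun x => by rw [S.f_even, one_mul])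
    (fun x => (S.f_analytic x trivial).differentiableAt) α x
  simpa using this

lemma hess_even (α β : Fin (d + 1)) (x : Fin (d + 1) → ℝ) :
    pd (pd S.f β) α (-x) = pd (pd S.f β) α x := by
  have := pd_neg_arg (F := pd S.f β) (G := pd S.f β) (c := -1)
    (fun x => by rw [S.pd_even, neg_one_mul])
    (fun x => ((S.trigPot.pd β).analytic x).differentiableAt) α x
  simpa using this

lemma hess_symm (α β : Fin (d + 1)) (x : Fin (d + 1) → ℝ) :
    pd (pd S.f β) α x = pd (pd S.f α) β x := dirD_comm (S.f_analytic x trivial) _ _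

/-- The point reflected by the symmetry differs from the opposite point by a period `2π` of the
pendulum angle. -/
lemma cons_two_pi_sub {F : (Fin (d + 1) → ℝ) → ℝ} (hF : IsPeriodic F) (X : Fin (d + 1) → ℝ)
    (θ : Fin d → ℝ) : F (Fin.cons (2 * Real.pi) 0 - X + Fin.cons 0 θ) =
      F (-(X + Fin.cons 0 (-θ))) := by
  rw [← hF (-(X + (Fin.cons 0 (-θ) : Fin (d + 1) → ℝ))) (Fin.cons 1 0)]
  congr 1
  ext i
  refine Fin.cases ?_ (fun i => ?_) i
  · simp; ring
  · simp; ring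

/-- The equations of motion are invariant under `(X, θ) ↦ ((2π, 0) - X, -θ)`. -/
lemma Omega_symm (ε : ℝ) (X : Fin (d + 1) → ℝ) (θ : Fin d → ℝ) :
    S.Omega ε (Fin.cons (2 * Real.pi) 0 - X) θ = -S.Omega ε X (-θ) := by
  ext α
  have h1 : IsPeriodic S.f := fun x k => S.f_periodic x k
  simp only [Omega, Pi.neg_apply]
  rw [cons_two_pi_sub (h1.pd α), S.pd_even]
  have h2 : Real.sin ((Fin.cons (2 * Real.pi) 0 - X : Fin (d + 1) → ℝ) 0) = -Real.sin (X 0) := by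
    simp [Real.sin_two_pi_sub]
  rw [h2]
  split_ifs <;> ring

/-- The force is globally Lipschitz in the position, because `∂f` is periodic. -/
lemma exists_lipschitzWith_Omega (ε : ℝ) :
    ∃ K, ∀ θ, LipschitzWith K fun X => S.Omega ε X θ := by
  have h1 : IsPeriodic S.f := fun x k => S.f_periodic x k
  choose K hK using fun α => (h1.pd α).exists_lipschitzWith (S.trigPot.pd α).analytic
  refine ⟨∑ α, (‖S.g ^ 2‖₊ + ‖ε * S.g ^ 2‖₊ * K α), fun θ X Y => ?_⟩
  rw [edist_pi_le_iff]
  intro α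
  have h2 : LipschitzWith ‖S.g ^ 2‖₊ fun X : Fin (d + 1) → ℝ =>
      if α = 0 then S.g ^ 2 * Real.sin (X 0) else 0 := by
    split_ifs
    · have h3 : LipschitzWith 1 Real.sin := by
        refine lipschitzWith_of_nnnorm_deriv_le Real.differentiable_sin fun x => ?_
        rw [Real.deriv_sin, ← NNReal.coe_le_coe]
        simpa using Real.abs_cos_le_one x
      have h4 := (lipschitzWith_smul (S.g ^ 2)).comp (h3.comp (LipschitzWith.eval (α := fun _ : Fin (d + 1) => ℝ) 0))
      simpa [Function.comp_def] using h4
    · exact LipschitzWith.const 0 |>.weaken zero_le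
  have h5 : LipschitzWith (‖ε * S.g ^ 2‖₊ * K α) fun X : Fin (d + 1) → ℝ =>
      ε * S.g ^ 2 * pd S.f α (X + Fin.cons 0 θ) := by
    have h4 := (lipschitzWith_smul (ε * S.g ^ 2)).comp ((hK α).comp
      (LipschitzWith.id.add (LipschitzWith.const (Fin.cons 0 θ : Fin (d + 1) → ℝ))))
    simpa [Function.comp_def] using h4
  refine (((h2.add h5).weaken ?_) X Y)
  exact Finset.single_le_sum (f := fun α => ‖S.g ^ 2‖₊ + ‖ε * S.g ^ 2‖₊ * K α)
    (fun _ _ => zero_le) (Finset.mem_univ α)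

end ForcedPendulum

variable {S : ForcedPendulum d}

namespace UnstableManifold

variable (U : UnstableManifold S)

/-- At `θ = 0` the stable and the unstable trajectories coincide: both solve the equations of
motion, with the same initial data. -/
theorem Xs_eq_Xu {ε : ℝ} (hε : |ε| < U.ε₀) (t : ℝ) : U.Xs ε t 0 = U.Xu ε t 0 := by
  obtain ⟨V, hV⟩ := U.exists_velocity hε 0
  obtain ⟨K, hK⟩ := S.exists_lipschitzWith_Omega ε
  set v : ℝ → (Fin (d + 1) → ℝ) × (Fin (d + 1) → ℝ) → (Fin (d + 1) → ℝ) × (Fin (d + 1) → ℝ) :=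
    fun t x => (x.2, S.Omega ε x.1 (0 + t • S.ω)) with hv
  have hlip : ∀ t, LipschitzOnWith (max 1 (K * 1)) (v t) Set.univ := fun t =>
    (LipschitzWith.prod_snd.prodMk ((hK (0 + t • S.ω)).comp LipschitzWith.prod_fst)).lipschitzOnWith
  have h1 : ∀ t, HasDerivAt (fun t => (U.Xu ε t 0, V t)) (v t (U.Xu ε t 0, V t)) t :=
    fun t => (hV t).1.prodMk (hV t).2
  have h2 : ∀ t, HasDerivAt (fun t => (U.Xs ε t 0, V (-t))) (v t (U.Xs ε t 0, V (-t))) t := by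
    intro t
    have hn : HasDerivAt (fun t : ℝ => -t) (-1) t := (hasDerivAt_id t).neg
    refine HasDerivAt.prodMk ?_ ?_
    · have h3 := ((hV (-t)).1.scomp t hn).const_sub
        (Fin.cons (2 * Real.pi) 0 : Fin (d + 1) → ℝ)
      simp only [neg_smul, one_smul, neg_neg] at h3
      refine h3.congr_of_eventuallyEq (Eventually.of_forall fun s => ?_)
      simp [Xs]
    · refine ((hV (-t)).2.scomp t hn).congr_deriv ?_
      simp only [Xs, neg_zero, neg_smul, one_smul]
      rw [S.Omega_symm]
      simp
  -- The initial data agree: `X(ε; 1, 0) = (π, 0)` is fixed by the symmetry, which preserves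
  -- velocities.
  have h3 := ODE_solution_unique_univ (s := fun _ => Set.univ) (t₀ := 0) hlip
    (fun t => ⟨h2 t, trivial⟩) (fun t => ⟨h1 t, trivial⟩) ?_
  · exact congrArg Prod.fst (congrFun h3 t)
  · have hn := U.X_normalized ε hε
    simp only [neg_zero, Xs, Xu, mul_zero, Real.exp_zero, zero_smul, add_zero, Prod.mk.injEq,
      and_true]
    rw [hn]
    ext i
    refine Fin.cases ?_ (fun i => ?_) i
    · simp; ring
    · simp

/-- The second derivatives of `f` along the unstable trajectories. -/
def hessFam (α β : Fin (d + 1)) : Par d → ℝ := fun p => pd (pd S.f β) α fun i => U.YFam i p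

/-- The analogue of `M^s` for the unstable trajectories. -/
def MuFam (α β : Fin (d + 1)) : Par d → ℝ := fun p =>
  (if α = 0 ∧ β = 0 then S.g ^ 2 * Real.cos (U.XFam 0 p) - solK (0 : Fin (d + 1)) (U.γ p.1) p.2.1
    else 0) + p.1 * S.g ^ 2 * U.hessFam α β p

lemma hessFam_mem (α β : Fin (d + 1)) : U.hessFam α β ∈ TrigFam d :=
  U.comp_YFam_mem ((S.trigPot.pd β).pd α)

lemma MuFam_mem (α β : Fin (d + 1)) : U.MuFam α β ∈ TrigFam d := by
  have h1 : (fun p => Real.cos (U.XFam 0 p)) ∈ TrigFam d := by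
    have := U.comp_YFam_mem (TrigPot.of_angle (d := d) (w := Real.cos) fun _ => Real.analyticAt_cos)
    simpa [YFam, XFam] using this
  have h2 : (fun p : Par d => p.1 * S.g ^ 2 * U.hessFam α β p) ∈ TrigFam d :=
    (TrigFam d).mul_mem (TimeFam.le_trigFam (TimeFam.eps_mem (a := fun ε => ε * S.g ^ 2)
      (analyticAt_id.mul analyticAt_const))) (U.hessFam_mem α β)
  unfold MuFam
  split_ifs
  · exact (TrigFam d).add_mem ((TrigFam d).sub_mem ((TrigFam d).mul_mem
      ((TrigFam d).algebraMap_mem (S.g ^ 2)) h1) (TimeFam.le_trigFam (U.solK_mem 0))) h2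
  · exact (TrigFam d).add_mem (TrigFam d).zero_mem h2

lemma solK_even (α : Fin (d + 1)) (γ t : ℝ) : solK α γ (-t) = solK α γ t := by
  unfold solK
  rw [cos_four_arctan, cos_four_arctan, kernelP_eq, kernelP_eq, mul_neg, Real.cosh_neg]

lemma hess_Xs (α β : Fin (d + 1)) (ε t : ℝ) (θ : Fin d → ℝ) :
    pd (pd S.f β) α (U.Xs ε t θ + Fin.cons 0 (θ + t • S.ω)) = U.hessFam α β (ε, -t, -θ) := by
  have h1 : IsPeriodic S.f := fun x k => S.f_periodic x k
  rw [Xs, ForcedPendulum.cons_two_pi_sub ((h1.pd β).pd α), S.hess_even]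
  simp only [hessFam, YFam]
  congr 1
  ext i
  simp only [neg_add, neg_smul]

lemma Ms_apply (ε t : ℝ) (θ : Fin d → ℝ) (α β : Fin (d + 1)) :
    U.Ms ε t θ α β = U.MuFam α β (ε, -t, -θ) := by
  simp only [Ms, MuFam, Matrix.of_apply, hess_Xs, solK_even]
  have : Real.cos (U.Xs ε t θ 0) = Real.cos (U.XFam 0 (ε, -t, -θ)) := by
    simp [Xs, XFam, Real.cos_two_pi_sub]
  rw [this]
  rfl

lemma fs_apply (ε t : ℝ) (θ : Fin d → ℝ) (a : Fin d) (β : Fin (d + 1)) :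
    U.fs ε t θ a β = U.hessFam a.succ β (ε, -t, -θ) := U.hess_Xs a.succ β ε t θ

lemma hessFam_even {ε : ℝ} (hε : |ε| < U.ε₀) (α β : Fin (d + 1)) (t : ℝ) :
    U.hessFam α β (ε, -t, 0) = U.hessFam α β (ε, t, 0) := by
  have h1 := U.hess_Xs α β ε t 0
  rw [U.Xs_eq_Xu hε, neg_zero] at h1
  rw [← h1]
  rfl

lemma MuFam_even {ε : ℝ} (hε : |ε| < U.ε₀) (α β : Fin (d + 1)) (t : ℝ) :
    U.MuFam α β (ε, -t, 0) = U.MuFam α β (ε, t, 0) := by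
  simp only [MuFam, U.hessFam_even hε, solK_even]
  have h1 : U.XFam 0 (ε, -t, 0) = 2 * Real.pi - U.XFam 0 (ε, t, 0) := by
    have := congrFun (U.Xs_eq_Xu hε t) 0
    simp only [Xs, Pi.sub_apply, Fin.cons_zero, neg_zero] at this
    simp only [XFam]
    linarith
  rw [h1, Real.cos_two_pi_sub]

/-- The variation in `θ` of the gradient of `f` along the trajectories. -/
lemma dirTheta_gradFam {ε : ℝ} (hε : |ε| < U.ε₀) (α : Fin (d + 1)) (b : Fin d) (t : ℝ)
    (θ : Fin d → ℝ) : dirD (dirTheta b) (U.gradFam α) (ε, t, θ) =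
      ∑ β, U.hessFam α β (ε, t, θ) * (dirD (dirTheta b) (U.XFam β) (ε, t, θ) +
        dirD (dirTheta b) (fun p : Par d =>
          (Fin.cons 0 (p.2.2 + p.2.1 • S.ω) : Fin (d + 1) → ℝ) β) (ε, t, θ)) := by
  show dirD (dirTheta b) (fun p => pd S.f α fun β => U.YFam β p) _ = _
  rw [dirD_comp (((S.trigPot.pd α).analytic _).differentiableAt)
    fun i => (U.YFam_analyticAt i hε t θ).differentiableAt]
  refine Finset.sum_congr rfl fun β _ => ?_
  have h1 : dirD (dirTheta b) (U.YFam β) (ε, t, θ) = dirD (dirTheta b) (U.XFam β) (ε, t, θ) +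
        dirD (dirTheta b) (fun p : Par d =>
          (Fin.cons 0 (p.2.2 + p.2.1 • S.ω) : Fin (d + 1) → ℝ) β) (ε, t, θ) := by
    have := fderiv_add (U.XFam_analyticAt β hε t θ).differentiableAt
      (shift_analyticAt (S := S) β (ε, t, θ)).differentiableAt
    exact congrArg (fun L : Par d →L[ℝ] ℝ => L (dirTheta b)) this
  rw [h1, hessFam, S.hess_symm, mul_comm]

lemma dirD_shift (β : Fin (d + 1)) (b : Fin d) (p : Par d) :
    dirD (dirTheta b) (fun p : Par d =>
      (Fin.cons 0 (p.2.2 + p.2.1 • S.ω) : Fin (d + 1) → ℝ) β) p =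
      (Fin.cons 0 (Pi.single b 1) : Fin (d + 1) → ℝ) β := by
  refine Fin.cases ?_ (fun i => ?_) β
  · simp [dirD]
  · simp only [Fin.cons_succ]
    have h1 : HasDerivAt (fun s : ℝ => (p.2.2 + s • (Pi.single b 1 : Fin d → ℝ) + p.2.1 • S.ω) i)
        ((Pi.single b 1 : Fin d → ℝ) i) 0 := by
      simp only [Pi.add_apply, Pi.smul_apply, smul_eq_mul]
      exact (((hasDerivAt_id' (0 : ℝ)).mul_const _).const_add _).add_const _ |>.congr_deriv (by simp)
    have h2 : DifferentiableAt ℝ (fun p : Par d => (p.2.2 + p.2.1 • S.ω) i) p := by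
      have := (shift_analyticAt (S := S) i.succ p).differentiableAt
      simpa using this
    have h3 : HasDerivAt (fun s : ℝ => p + s • (dirTheta b : Par d)) (dirTheta b) 0 := by
      simpa using ((hasDerivAt_id (0 : ℝ)).smul_const (dirTheta b : Par d)).const_add p
    have h2' : HasFDerivAt (fun p : Par d => (p.2.2 + p.2.1 • S.ω) i)
        (fderiv ℝ (fun p : Par d => (p.2.2 + p.2.1 • S.ω) i) p)
        ((fun s : ℝ => p + s • (dirTheta b : Par d)) 0) := by simpa using h2.hasFDerivAt
    refine (h2'.comp_hasDerivAt (0 : ℝ) h3).unique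
      (h1.congr_of_eventuallyEq (Eventually.of_forall fun s => ?_))
    simp [dirTheta]

/-- The variation in `θ` of `𝔄^u`. -/
lemma dirTheta_AFam {ε : ℝ} (hε : |ε| < U.radius) (α : Fin (d + 1)) (b : Fin d) (t : ℝ)
    (θ : Fin d → ℝ) : dirD (dirTheta b) (U.AFam α) (ε, t, θ) =
      (∑ β, U.MuFam α β (ε, t, θ) * dirD (dirTheta b) (U.XFam β) (ε, t, θ)) +
        ε * S.g ^ 2 * ∑ β, U.hessFam α β (ε, t, θ) *
          (Fin.cons 0 (Pi.single b 1) : Fin (d + 1) → ℝ) β := by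
  have hε' := U.lt_of_lt_radius hε
  have hX := fun β => (U.XFam_analyticAt β hε' t θ).differentiableAt
  have hsl := fun β => pd_slice_theta (hX β) b
  have hG : DifferentiableAt ℝ (U.gradFam α) (ε, t, θ) :=
    (U.comp_YFam_analyticAt (S.trigPot.pd α).analytic hε' t θ).differentiableAt
  have hGsl := pd_slice_theta hG b
  have hs : HasFDerivAt (fun θ => Real.sin (U.XFam 0 (ε, t, θ)))
      (Real.cos (U.XFam 0 (ε, t, θ)) • fderiv ℝ (fun θ => U.XFam 0 (ε, t, θ)) θ) θ :=
    (hsl 0).1.hasFDerivAt.sin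
  -- Only the `θ`-dependence is differentiated, so that no derivative of `γ` appears.
  have h1 : HasFDerivAt (fun θ => U.AFam α (ε, t, θ))
      (((if α = 0 then S.g ^ 2 else 0) • (Real.cos (U.XFam 0 (ε, t, θ)) •
        fderiv ℝ (fun θ => U.XFam 0 (ε, t, θ)) θ) +
        (ε * S.g ^ 2) • fderiv ℝ (fun θ => U.gradFam α (ε, t, θ)) θ) +
        (-solK α (U.γ ε) t) • fderiv ℝ (fun θ => U.XFam α (ε, t, θ)) θ) θ := by
    rw [AFam_eq]
    exact ((hs.const_mul (if α = 0 then S.g ^ 2 else 0)).add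
      (hGsl.1.hasFDerivAt.const_mul (ε * S.g ^ 2))).add
      ((hsl α).1.hasFDerivAt.const_mul (-solK α (U.γ ε) t))
  have hA : DifferentiableAt ℝ (U.AFam α) (ε, t, θ) := by
    have hγ : AnalyticAt ℝ (fun p : Par d => U.γ p.1) (ε, t, θ) :=
      AnalyticAt.fun_comp (g := U.γ) (f := fun p : Par d => p.1) (x := (ε, t, θ))
        (U.γ_analytic ε hε') (analyticAt_eps _)
    have hKd : DifferentiableAt ℝ (fun p : Par d => -solK α (U.γ p.1) p.2.1) (ε, t, θ) := by
      unfold solK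
      have h2 := hγ.differentiableAt
      have h3 : DifferentiableAt ℝ (fun p : Par d => p.2.1) (ε, t, θ) := by fun_prop
      split_ifs
      · exact ((h2.pow 2).mul (((h2.mul h3).exp.arctan.const_mul 4).cos)).neg
      · exact (differentiableAt_const _).neg
    rw [AFam_eq]
    have h4 : DifferentiableAt ℝ (fun p : Par d => p.1 * S.g ^ 2 * U.gradFam α p) (ε, t, θ) :=
      DifferentiableAt.mul (by fun_prop) hG
    exact (((differentiableAt_const _).mul (hX 0).sin).add h4).add (hKd.mul (hX α))
  rw [← (pd_slice_theta hA b).2, pd, h1.fderiv]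
  simp only [add_apply, smul_apply, smul_eq_mul]
  have hsl' : ∀ β, fderiv ℝ (fun θ => U.XFam β (ε, t, θ)) θ (Pi.single b 1) =
    dirD (dirTheta b) (U.XFam β) (ε, t, θ) := fun β => (hsl β).2
  rw [show fderiv ℝ (fun θ => U.gradFam α (ε, t, θ)) θ (Pi.single b 1) = _ from hGsl.2,
    U.dirTheta_gradFam hε']
  simp only [hsl', dirD_shift, MuFam, mul_add, add_mul, Finset.sum_add_distrib, Finset.mul_sum]
  have h5 : ∑ β, (if α = 0 ∧ β = 0 then S.g ^ 2 * Real.cos (U.XFam 0 (ε, t, θ)) -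
      solK (0 : Fin (d + 1)) (U.γ ε) t else 0) * dirD (dirTheta b) (U.XFam β) (ε, t, θ) =
      (if α = 0 then S.g ^ 2 else 0) * (Real.cos (U.XFam 0 (ε, t, θ)) *
        dirD (dirTheta b) (U.XFam 0) (ε, t, θ)) +
        -solK α (U.γ ε) t * dirD (dirTheta b) (U.XFam α) (ε, t, θ) := by
    rw [Finset.sum_eq_single 0]
    · by_cases hα : α = 0
      · subst hα; simp; ring
      · simp [hα, solK]
    · intro β _ hβ; simp [hβ]
    · simp
  rw [h5]
  have h6 : ∀ β, ε * S.g ^ 2 * (U.hessFam α β (ε, t, θ) *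
      dirD (dirTheta b) (U.XFam β) (ε, t, θ)) = ε * S.g ^ 2 * U.hessFam α β (ε, t, θ) *
      dirD (dirTheta b) (U.XFam β) (ε, t, θ) := fun β => by ring
  simp only [h6]
  ring

/-- The difference of the variations of the unstable and the stable trajectories in `θ`, on the
homoclinic trajectory. -/
def splitFam (α : Fin (d + 1)) (b : Fin d) : Par d → ℝ := fun p =>
  dirD (dirTheta b) (U.XFam α) p - dirD (dirTheta b) (U.XFam α) (p.1, -p.2.1, -p.2.2)

/-- On the homoclinic trajectory `M^s` and `f_{φφ}` are even in time, so the inhomogeneous terms of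
the two variational equations cancel in the difference. -/
lemma dirTheta_AFam_sub {ε : ℝ} (hε : |ε| < U.radius) (α : Fin (d + 1)) (b : Fin d) (t : ℝ) :
    dirD (dirTheta b) (U.AFam α) (ε, t, 0) - dirD (dirTheta b) (U.AFam α) (ε, -t, 0) =
      ∑ β, U.Ms ε t 0 α β * U.splitFam β b (ε, t, 0) := by
  have hε' := U.lt_of_lt_radius hε
  simp only [U.dirTheta_AFam hε, U.MuFam_even hε', U.hessFam_even hε', Ms_apply, neg_zero, splitFam,
    mul_sub, Finset.sum_sub_distrib]
  ring

lemma dirTheta_gradFam_sub {ε : ℝ} (hε : |ε| < U.radius) (a b : Fin d) (t : ℝ) :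
    dirD (dirTheta b) (U.gradFam a.succ) (ε, t, 0) -
      dirD (dirTheta b) (U.gradFam a.succ) (ε, -t, 0) =
      ∑ β, U.fs ε t 0 a β * U.splitFam β b (ε, t, 0) := by
  have hε' := U.lt_of_lt_radius hε
  simp only [U.dirTheta_gradFam hε', U.hessFam_even hε', fs_apply, neg_zero, splitFam, dirD_shift,
    mul_sub, mul_add, Finset.sum_sub_distrib, Finset.sum_add_distrib]
  ring

end UnstableManifold

end Symmetry

/-! ### Power series whose coefficients are functions of time -/

section TimeSeries

lemma finInt_zero (t : ℝ) : finInt t (0 : ℝ → ℂ) = 0 := by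
  have := finInt_smul (TwoSided.const_mem (Λ := ⊤) 0) 0 t
  rwa [zero_mul, zero_smul] at this

lemma finInt_neg {h : ℝ → ℂ} (hh : h ∈ TwoSided ⊤) (t : ℝ) : finInt t (-h) = -finInt t h := by
  have := finInt_smul hh (-1) t
  rwa [neg_one_smul, neg_one_mul] at this

lemma finInt_sum {ι : Type*} (s : Finset ι) (f : ι → ℝ → ℂ) (hf : ∀ i ∈ s, f i ∈ TwoSided ⊤)
    (t : ℝ) : finInt t (∑ i ∈ s, f i) = ∑ i ∈ s, finInt t (f i) := by
  classical
  induction s using Finset.induction_on with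
  | empty => simpa using finInt_zero t
  | insert i s hi ih =>
    rw [Finset.sum_insert hi, Finset.sum_insert hi, finInt_add (hf i (Finset.mem_insert_self i s))
      (Subalgebra.sum_mem _ fun j hj => hf j (Finset.mem_insert_of_mem hj)),
      ih fun j hj => hf j (Finset.mem_insert_of_mem hj)]

/-- Power series in `ε` whose coefficients are functions of `t`. -/
abbrev TSer : Type := PowerSeries (ℝ → ℂ)

/-- Power series in `ε` whose coefficients have expansions at both ends. -/
def TwoSidedSer : Subring TSer where
  carrier := {F | ∀ n, PowerSeries.coeff n F ∈ TwoSided ⊤}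
  mul_mem' := fun hF hG n => by
    rw [PowerSeries.coeff_mul]
    exact Subalgebra.sum_mem _ fun x _ => Subalgebra.mul_mem _ (hF _) (hG _)
  one_mem' := fun n => by
    rw [PowerSeries.coeff_one]
    split_ifs
    · exact Subalgebra.one_mem _
    · exact Subalgebra.zero_mem _
  add_mem' := fun hF hG n => by
    rw [map_add]; exact Subalgebra.add_mem _ (hF n) (hG n)
  zero_mem' := fun n => by rw [map_zero]; exact Subalgebra.zero_mem _
  neg_mem' := fun hF n => by rw [map_neg]; exact Subalgebra.neg_mem _ (hF n)

/-- The finite part of `∫_t^∞`, order by order. -/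
def psInt (F : TSer) : TSer := PowerSeries.mk fun n t => finInt t (PowerSeries.coeff n F)

/-- Power series whose coefficients do not depend on `t`. -/
def constSer (c : ℕ → ℂ) : TSer := PowerSeries.mk fun n _ => c n

lemma constSer_mem (c : ℕ → ℂ) : constSer c ∈ TwoSidedSer := fun n => by
  rw [constSer, PowerSeries.coeff_mk]
  exact TwoSided.const_mem _

lemma psInt_add {F G : TSer} (hF : F ∈ TwoSidedSer) (hG : G ∈ TwoSidedSer) :
    psInt (F + G) = psInt F + psInt G := by
  ext n t
  simp only [psInt, map_add, PowerSeries.coeff_mk, Pi.add_apply]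
  exact finInt_add (hF n) (hG n) t

lemma psInt_neg {F : TSer} (hF : F ∈ TwoSidedSer) : psInt (-F) = -psInt F := by
  ext n t
  simp only [psInt, map_neg, PowerSeries.coeff_mk, Pi.neg_apply]
  exact finInt_neg (hF n) t

lemma psInt_sum {ι : Type*} (s : Finset ι) (F : ι → TSer) (hF : ∀ i ∈ s, F i ∈ TwoSidedSer) :
    psInt (∑ i ∈ s, F i) = ∑ i ∈ s, psInt (F i) := by
  ext n t
  simp only [psInt, map_sum, PowerSeries.coeff_mk, Finset.sum_apply]
  exact finInt_sum s _ (fun i hi => hF i hi n) t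

lemma finInt_coeff_constSer_mul (c : ℕ → ℂ) {F : TSer} (hF : F ∈ TwoSidedSer) (n : ℕ) (t : ℝ) :
    finInt t (PowerSeries.coeff n (constSer c * F)) =
      ∑ x ∈ Finset.HasAntidiagonal.antidiagonal n, c x.1 * finInt t (PowerSeries.coeff x.2 F) := by
  have h1 : ∀ x : ℕ × ℕ, PowerSeries.coeff x.1 (constSer c) * PowerSeries.coeff x.2 F =
      c x.1 • PowerSeries.coeff x.2 F := by
    intro x; ext τ; simp [constSer]
  rw [PowerSeries.coeff_mul]
  simp_rw [h1]
  rw [finInt_sum _ _ fun x _ => Subalgebra.smul_mem _ (hF _) _]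
  exact Finset.sum_congr rfl fun x _ => finInt_smul (hF _) _ _

lemma psInt_mul_constSer (c : ℕ → ℂ) {F : TSer} (hF : F ∈ TwoSidedSer) :
    psInt (F * constSer c) = psInt F * constSer c := by
  rw [mul_comm F, mul_comm (psInt F)]
  ext n t
  rw [psInt, PowerSeries.coeff_mk, finInt_coeff_constSer_mul c hF, PowerSeries.coeff_mul,
    Finset.sum_apply]
  simp [constSer, psInt]

variable {d : ℕ}

/-- The Taylor series of a family at fixed `θ`. -/
def famSer (θ : Fin d → ℝ) (F : Par d → ℝ) : TSer := PowerSeries.mk fun n t => coefC F n t θ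

lemma famSer_add (θ : Fin d → ℝ) {F G : Par d → ℝ} (hF : AnalyticFam F) (hG : AnalyticFam G) :
    famSer θ (F + G) = famSer θ F + famSer θ G := by
  ext n t
  simp [famSer, coefC_add hF hG]

lemma famSer_mul (θ : Fin d → ℝ) {F G : Par d → ℝ} (hF : AnalyticFam F) (hG : AnalyticFam G) :
    famSer θ (F * G) = famSer θ F * famSer θ G := by
  ext n t
  simp [famSer, coefC_mul hF hG, PowerSeries.coeff_mul, Finset.sum_apply]

lemma famSer_const (θ : Fin d → ℝ) (c : ℝ) :
    famSer θ (fun _ => c) = PowerSeries.C (fun _ : ℝ => (c : ℂ)) := by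
  ext n t
  simp only [famSer, coefC_const, PowerSeries.coeff_mk, PowerSeries.coeff_C]
  split_ifs <;> rfl

lemma famSer_sub (θ : Fin d → ℝ) {F G : Par d → ℝ} (hF : AnalyticFam F) (hG : AnalyticFam G) :
    famSer θ (F - G) = famSer θ F - famSer θ G := by
  have h1 : famSer θ (F - G + G) = famSer θ (F - G) + famSer θ G :=
    famSer_add θ (fun t θ => (hF t θ).sub (hG t θ)) hG
  rw [sub_add_cancel] at h1
  rw [h1, add_sub_cancel_right]

lemma famSer_neg (θ : Fin d → ℝ) {F : Par d → ℝ} (hF : AnalyticFam F) :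
    famSer θ (-F) = -famSer θ F := by
  have h1 := famSer_add θ (fun t θ => (hF t θ).neg) hF
  rw [neg_add_cancel] at h1
  refine eq_neg_of_add_eq_zero_left (h1.symm.trans ((famSer_const θ 0).trans ?_))
  rw [show (fun _ : ℝ => ((0 : ℝ) : ℂ)) = 0 from funext fun _ => Complex.ofReal_zero, map_zero]

lemma famSer_sum {ι : Type*} (θ : Fin d → ℝ) (s : Finset ι) {F : ι → Par d → ℝ}
    (hF : ∀ i ∈ s, AnalyticFam (F i)) : famSer θ (∑ i ∈ s, F i) = ∑ i ∈ s, famSer θ (F i) := by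
  classical
  have key : AnalyticFam (∑ i ∈ s, F i) ∧ famSer θ (∑ i ∈ s, F i) = ∑ i ∈ s, famSer θ (F i) := by
    induction s using Finset.induction_on with
    | empty =>
      refine ⟨AnalyticFam.const 0, ?_⟩
      have := famSer_const θ 0
      rw [Finset.sum_empty, Finset.sum_empty]
      refine this.trans ?_
      ext n t
      simp only [Complex.ofReal_zero, PowerSeries.coeff_C, map_zero]
      split_ifs <;> rfl
    | insert i s hi ih =>
      obtain ⟨h1, h2⟩ := ih fun j hj => hF j (Finset.mem_insert_of_mem hj)
      have h3 := hF i (Finset.mem_insert_self i s)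
      rw [Finset.sum_insert hi, Finset.sum_insert hi]
      exact ⟨h3.add h1, by rw [famSer_add θ h3 h1, h2]⟩
  exact key.2

lemma famSer_congr (θ : Fin d → ℝ) {F G : Par d → ℝ}
    (h : ∀ t, ∀ᶠ ε in 𝓝 (0 : ℝ), F (ε, t, θ) = G (ε, t, θ)) : famSer θ F = famSer θ G := by
  ext n t
  simp only [famSer, PowerSeries.coeff_mk, coefC, coef]
  rw [taylorCoeff_congr (h t)]

lemma famSer_mem (θ : Fin d → ℝ) {F : Par d → ℝ} (hF : F ∈ TrigFam d) :
    famSer θ F ∈ TwoSidedSer := fun n => by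
  rw [famSer, PowerSeries.coeff_mk]
  exact (hF.2 n).2 θ

end TimeSeries

/-! ### Matrix-valued series and the operator `B` -/

section Slices

variable {d : ℕ} {m k n : Type}

/-- The coefficients of all entries are in `TrigClass`. -/
def TrigSer (h : Ser d m n) : Prop := ∀ ℓ a b, (fun t θ => h ℓ t θ a b) ∈ TrigClass d

/-- The entries at fixed `θ`, as power series. -/
def slice (θ : Fin d → ℝ) (h : Ser d m n) : Matrix m n TSer :=
  Matrix.of fun a b => PowerSeries.mk fun ℓ t => h ℓ t θ a b

lemma coeff_slice (θ : Fin d → ℝ) (h : Ser d m n) (a : m) (b : n) (ℓ : ℕ) (t : ℝ) :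
    PowerSeries.coeff ℓ (slice θ h a b) t = h ℓ t θ a b := by
  simp [slice]

lemma slice_series (θ : Fin d → ℝ) (F : ℝ → ℝ → (Fin d → ℝ) → Matrix m n ℝ) (a : m) (b : n) :
    slice θ (series F) a b = famSer θ fun p => F p.1 p.2.1 p.2.2 a b := rfl

lemma slice_mul [Fintype k] (θ : Fin d → ℝ) (A : Ser d m k) (B : Ser d k n) :
    slice θ (Ser.mul A B) = slice θ A * slice θ B := by
  ext a b ℓ t
  rw [coeff_slice, Matrix.mul_apply, map_sum, Finset.sum_apply, Ser.mul, cauchyMul,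
    Matrix.sum_apply]
  simp_rw [PowerSeries.coeff_mul, Finset.sum_apply, Pi.mul_apply, coeff_slice, Matrix.mul_apply]
  rw [Finset.sum_comm]

lemma TrigSer.slice_mem {h : Ser d m n} (hh : TrigSer h) (θ : Fin d → ℝ) (a : m) (b : n) :
    slice θ h a b ∈ TwoSidedSer := fun ℓ => by
  have : PowerSeries.coeff ℓ (slice θ h a b) = fun t => h ℓ t θ a b := by
    ext t; exact coeff_slice θ h a b ℓ t
  rw [this]
  exact (hh ℓ a b).2 θ

lemma TrigSer.mul [Fintype k] {A : Ser d m k} {B : Ser d k n} (hA : TrigSer A) (hB : TrigSer B) :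
    TrigSer (Ser.mul A B) := by
  intro ℓ a b
  have : (fun t θ => Ser.mul A B ℓ t θ a b) = ∑ x ∈ Finset.HasAntidiagonal.antidiagonal ℓ, ∑ j,
      (fun t θ => A x.1 t θ a j) * (fun t θ => B x.2 t θ j b) := by
    ext t θ
    simp [Ser.mul, cauchyMul, Matrix.sum_apply, Matrix.mul_apply, Finset.sum_apply]
  rw [this]
  exact Subalgebra.sum_mem _ fun x _ => Subalgebra.sum_mem _ fun j _ =>
    Subalgebra.mul_mem _ (hA _ _ _) (hB _ _ _)

lemma TrigSer.series {F : ℝ → ℝ → (Fin d → ℝ) → Matrix m n ℝ}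
    (hF : ∀ a b, (fun p : Par d => F p.1 p.2.1 p.2.2 a b) ∈ TrigFam d) :
    TrigSer (HomoclinicSplitting.series F) := fun ℓ a b => (hF a b).2 ℓ

lemma TrigSer.matRegIntegrable {h : Ser d m n} (hh : TrigSer h) (ℓ : ℕ) (t : ℝ) (θ : Fin d → ℝ) :
    MatRegIntegrable (Set.Ici t) (h ℓ) θ := fun a b => TrigClass.regIntegrable_Ici (hh ℓ a b) t θ

lemma TrigSer.lineRegIntegrable {h : Ser d m n} (hh : TrigSer h) (ℓ : ℕ) (θ : Fin d → ℝ) :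
    LineRegIntegrable (h ℓ) θ := fun t =>
  ⟨fun a b => TrigClass.regIntegrable_Iic (hh ℓ a b) t θ, hh.matRegIntegrable ℓ t θ⟩

lemma TrigSer.matRegIntegral_apply {h : Ser d m n} (hh : TrigSer h) (ℓ : ℕ) (t : ℝ)
    (θ : Fin d → ℝ) (a : m) (b : n) : matRegIntegral (Set.Ici t) (h ℓ) θ a b =
      finInt t (PowerSeries.coeff ℓ (slice θ h a b)) := by
  rw [matRegIntegral, Matrix.of_apply, TrigClass.regIntegral_Ici (hh ℓ a b)]
  congr 1
  ext τ
  rw [coeff_slice]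

variable {S : ForcedPendulum d}

namespace UnstableManifold

variable (U : UnstableManifold S)

/-- The Taylor series of the decaying solutions of the linearized equation. -/
def serU (θ : Fin d → ℝ) (α : Fin (d + 1)) : TSer := famSer θ fun p => solU α (U.γ p.1) p.2.1

/-- The Taylor series of the growing solutions of the linearized equation. -/
def serV (θ : Fin d → ℝ) (α : Fin (d + 1)) : TSer := famSer θ fun p => solV α (U.γ p.1) p.2.1

lemma serU_mem (θ : Fin d → ℝ) (α : Fin (d + 1)) : U.serU θ α ∈ TwoSidedSer :=
  famSer_mem θ (TimeFam.le_trigFam (U.linSolU α).mem)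

lemma serV_mem (θ : Fin d → ℝ) (α : Fin (d + 1)) : U.serV θ α ∈ TwoSidedSer :=
  famSer_mem θ (TimeFam.le_trigFam (U.linSolV α).mem)

lemma kernel_mem (t : ℝ) (α β : Fin (d + 1)) :
    (fun p : Par d => kernel d (U.γ p.1) t p.2.1 α β) ∈ TimeFam d := by
  simp_rw [kernel_apply]
  split_ifs
  · exact (TimeFam d).sub_mem ((TimeFam d).mul_mem (TimeFam.freeze (U.linSolV α).mem t)
      (U.linSolU α).mem) ((TimeFam d).mul_mem (TimeFam.freeze (U.linSolU α).mem t)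
      (U.linSolV α).mem)
  · exact (TimeFam d).zero_mem

/-- The Taylor coefficients of `solV` at the time `t`. -/
def constV (t : ℝ) (θ : Fin d → ℝ) (α : Fin (d + 1)) : TSer :=
  constSer fun n => PowerSeries.coeff n (U.serV θ α) t

/-- The Taylor coefficients of `solU` at the time `t`. -/
def constU (t : ℝ) (θ : Fin d → ℝ) (α : Fin (d + 1)) : TSer :=
  constSer fun n => PowerSeries.coeff n (U.serU θ α) t

/-- The expansion of `K(t, τ)` at fixed `t`, with the factors that depend on `t` as constant series.
-/
lemma slice_kernel (t : ℝ) (θ : Fin d → ℝ) (α β : Fin (d + 1)) :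
    slice θ (series fun ε τ (_ : Fin d → ℝ) => kernel d (U.γ ε) t τ) α β =
      if α = β then U.constV t θ α * U.serU θ α - U.constU t θ α * U.serV θ α else 0 := by
  rw [slice_series]
  have hu := U.linSolU α
  have hv := U.linSolV α
  split_ifs with h
  · have h1 : (fun p : Par d => kernel d (U.γ p.1) t p.2.1 α β) =
        (fun p : Par d => solV α (U.γ p.1) t) * (fun p : Par d => solU α (U.γ p.1) p.2.1) -
          (fun p : Par d => solU α (U.γ p.1) t) * (fun p : Par d => solV α (U.γ p.1) p.2.1) := by
      ext p
      rw [kernel_apply, if_pos h]; rfl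
    have hu' := (TimeFam.freeze hu.mem t).1
    have hv' := (TimeFam.freeze hv.mem t).1
    rw [h1, famSer_sub θ (AnalyticFam.mul hv' hu.mem.1) (AnalyticFam.mul hu' hv.mem.1),
      famSer_mul θ hv' hu.mem.1, famSer_mul θ hu' hv.mem.1]
    congr 2 <;>
    · ext n τ
      simp only [famSer, constV, constU, serU, serV, constSer, PowerSeries.coeff_mk]
      rfl
  · have h1 : (fun p : Par d => kernel d (U.γ p.1) t p.2.1 α β) = fun _ => 0 := by
      ext p; rw [kernel_apply, if_neg h]
    rw [h1, famSer_const]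
    ext n t
    simp only [Complex.ofReal_zero, PowerSeries.coeff_C, map_zero]
    split_ifs <;> rfl

lemma trigSer_kernelMul {h : Ser d (Fin (d + 1)) n} (hh : TrigSer h) (t : ℝ) :
    TrigSer (U.kernelMul t h) :=
  TrigSer.mul (TrigSer.series fun α β => TimeFam.le_trigFam (U.kernel_mem t α β)) hh

lemma slice_kernelMul (h : Ser d (Fin (d + 1)) n) (t : ℝ) (θ : Fin d → ℝ) (α : Fin (d + 1))
    (b : n) : slice θ (U.kernelMul t h) α b = U.constV t θ α * (U.serU θ α * slice θ h α b) -
      U.constU t θ α * (U.serV θ α * slice θ h α b) := by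
  rw [kernelMul, slice_mul, Matrix.mul_apply, Finset.sum_eq_single α]
  · rw [slice_kernel, if_pos rfl]; ring
  · intro β _ hβ
    rw [slice_kernel, if_neg hβ.symm, zero_mul]
  · simp

/-- The operator `B` acting on power series at fixed `θ`. -/
def Bop (θ : Fin d → ℝ) (H : Matrix (Fin (d + 1)) n TSer) : Matrix (Fin (d + 1)) n TSer :=
  Matrix.of fun α b => -(U.serV θ α * psInt (U.serU θ α * H α b) -
    U.serU θ α * psInt (U.serV θ α * H α b))

/-- `B` is local in `θ` and, by linearity of the regularized integral, the factors of the kernel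
depending on `t` can be taken out of the integral. -/
lemma slice_B {h : Ser d (Fin (d + 1)) n} (hh : TrigSer h) (θ : Fin d → ℝ) :
    slice θ (U.B h) = U.Bop θ (slice θ h) := by
  ext α b ℓ t
  have hu := TwoSidedSer.mul_mem (U.serU_mem θ α) (hh.slice_mem θ α b)
  have hv := TwoSidedSer.mul_mem (U.serV_mem θ α) (hh.slice_mem θ α b)
  have h1 : constSer (fun n => PowerSeries.coeff n (U.serV θ α) t) *
      (U.serU θ α * slice θ h α b) ∈ TwoSidedSer := TwoSidedSer.mul_mem (constSer_mem _) hu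
  have h2 : constSer (fun n => PowerSeries.coeff n (U.serU θ α) t) *
      (U.serV θ α * slice θ h α b) ∈ TwoSidedSer := TwoSidedSer.mul_mem (constSer_mem _) hv
  rw [coeff_slice, B, Matrix.neg_apply, (U.trigSer_kernelMul hh t).matRegIntegral_apply,
    slice_kernelMul, constV, constU, sub_eq_add_neg, map_add,
    finInt_add (h1 ℓ) (TwoSidedSer.neg_mem h2 ℓ), map_neg, finInt_neg (h2 ℓ),
    finInt_coeff_constSer_mul _ hu, finInt_coeff_constSer_mul _ hv]
  simp only [Bop, Matrix.of_apply, map_neg, map_sub, PowerSeries.coeff_mul, psInt,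
    PowerSeries.coeff_mk, Pi.neg_apply, Pi.sub_apply, Finset.sum_apply, Pi.mul_apply]
  ring

lemma trigClass_coeff_mul {h : Ser d (Fin (d + 1)) n} (hh : TrigSer h) {F : Par d → ℝ}
    (hF : F ∈ TrigFam d) (j : ℕ) (α : Fin (d + 1)) (b : n) :
    (fun t θ => PowerSeries.coeff j (famSer θ F * slice θ h α b) t) ∈ TrigClass d := by
  have : (fun t θ => PowerSeries.coeff j (famSer θ F * slice θ h α b) t) =
      ∑ x ∈ Finset.HasAntidiagonal.antidiagonal j, coefC F x.1 * fun t θ => h x.2 t θ α b := by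
    ext t θ
    simp [PowerSeries.coeff_mul, famSer, coeff_slice, Finset.sum_apply]
  rw [this]
  exact Subalgebra.sum_mem _ fun x _ => Subalgebra.mul_mem _ (hF.2 _) (hh _ _ _)

/-- `B` maps the class to itself, because finite parts of integrals over `[t, ∞)` do. -/
lemma trigSer_B {h : Ser d (Fin (d + 1)) n} (hh : TrigSer h) : TrigSer (U.B h) := by
  intro ℓ α b
  have hu := TimeFam.le_trigFam (U.linSolU α).mem
  have hv := TimeFam.le_trigFam (U.linSolV α).mem
  have : (fun t θ => U.B h ℓ t θ α b) = -∑ x ∈ Finset.HasAntidiagonal.antidiagonal ℓ,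
      (coefC (fun p : Par d => solV α (U.γ p.1) p.2.1) x.1 *
        (fun t θ => finInt t fun τ => PowerSeries.coeff x.2 (U.serU θ α * slice θ h α b) τ) -
      coefC (fun p : Par d => solU α (U.γ p.1) p.2.1) x.1 *
        (fun t θ => finInt t fun τ => PowerSeries.coeff x.2 (U.serV θ α * slice θ h α b) τ)) := by
    ext t θ
    rw [← coeff_slice θ (U.B h) α b ℓ t, U.slice_B hh]
    rw [Bop, Matrix.of_apply, map_neg, map_sub, PowerSeries.coeff_mul, PowerSeries.coeff_mul,
      ← Finset.sum_sub_distrib]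
    simp only [Pi.neg_apply, Finset.sum_apply, Pi.sub_apply, Pi.mul_apply, psInt,
      PowerSeries.coeff_mk, serU, serV]
    simp only [famSer, PowerSeries.coeff_mk]
  rw [this]
  exact Subalgebra.neg_mem _ (Subalgebra.sum_mem _ fun x _ => Subalgebra.sub_mem _
    (Subalgebra.mul_mem _ (hv.2 _) (TrigClass.finInt_mem (trigClass_coeff_mul hh hu _ _ _)))
    (Subalgebra.mul_mem _ (hu.2 _) (TrigClass.finInt_mem (trigClass_coeff_mul hh hv _ _ _))))

lemma Ms_mem (α β : Fin (d + 1)) : (fun p : Par d => U.Ms p.1 p.2.1 p.2.2 α β) ∈ TrigFam d := by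
  simp_rw [Ms_apply]
  exact TrigFam.reflect (U.MuFam_mem α β)

lemma fs_mem (a : Fin d) (β : Fin (d + 1)) :
    (fun p : Par d => U.fs p.1 p.2.1 p.2.2 a β) ∈ TrigFam d := by
  simp_rw [fs_apply]
  exact TrigFam.reflect (U.hessFam_mem a.succ β)

lemma trigSer_MsMul {h : Ser d (Fin (d + 1)) n} (hh : TrigSer h) : TrigSer (U.MsMul h) :=
  TrigSer.mul (TrigSer.series U.Ms_mem) hh

lemma neumannTerm_succ (h : Ser d (Fin (d + 1)) n) (l : ℕ) :
    U.neumannTerm h (l + 1) = U.B (U.MsMul (U.neumannTerm h l)) :=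
  Function.iterate_succ_apply' _ l h

lemma trigSer_neumannTerm {h : Ser d (Fin (d + 1)) n} (hh : TrigSer h) (l : ℕ) :
    TrigSer (U.neumannTerm h l) := by
  induction l with
  | zero => exact hh
  | succ l ih => rw [neumannTerm_succ]; exact U.trigSer_B (U.trigSer_MsMul ih)

lemma series_Ms_zero (t : ℝ) (θ : Fin d → ℝ) : series U.Ms 0 t θ = 0 := by
  ext α β
  simp only [series, Matrix.of_apply, taylorCoeff_zero, Ms_apply, MuFam, Matrix.zero_apply]
  have : U.XFam 0 (0, -t, -θ) = 4 * Real.arctan (Real.exp (U.γ 0 * -t)) := by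
    simp [XFam, Xu, U.X_zero]
  rw [this]
  simp [solK, U.γ_zero]

/-- `M^s = O(ε)`, so that the term `(B M^s)^l h` only contributes to the orders `≥ l`. -/
lemma neumannTerm_eq_zero (h : Ser d (Fin (d + 1)) n) (l : ℕ) :
    ∀ ℓ < l, ∀ t θ, U.neumannTerm h l ℓ t θ = 0 := by
  induction l with
  | zero => intro ℓ hℓ; omega
  | succ l ih =>
    intro ℓ hℓ t θ
    have h1 : ∀ ℓ < l + 1, ∀ t θ, U.MsMul (U.neumannTerm h l) ℓ t θ = 0 := by
      intro ℓ hℓ t θ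
      rw [MsMul, Ser.mul, cauchyMul]
      refine Finset.sum_eq_zero fun x hx => ?_
      rw [Finset.HasAntidiagonal.mem_antidiagonal] at hx
      rcases Nat.eq_zero_or_pos x.1 with h0 | h0
      · rw [h0, series_Ms_zero, Matrix.zero_mul]
      · rw [ih x.2 (by omega), Matrix.mul_zero]
    -- The kernel is a power series with nonnegative powers of `ε`, so multiplication by it
    -- preserves the order of vanishing.
    have h2 : U.kernelMul t (U.MsMul (U.neumannTerm h l)) ℓ = fun _ _ => 0 := by
      ext τ θ' : 2
      rw [kernelMul, Ser.mul, cauchyMul]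
      refine Finset.sum_eq_zero fun x hx => ?_
      rw [Finset.HasAntidiagonal.mem_antidiagonal] at hx
      rw [h1 x.2 (by omega), Matrix.mul_zero]
    rw [neumannTerm_succ, B, h2]
    ext α b
    rw [matRegIntegral, Matrix.neg_apply, Matrix.of_apply]
    have h3 : (fun (_ : ℝ) (_ : Fin d → ℝ) => (0 : Matrix (Fin (d + 1)) n ℂ) α b) ∈ TrigClass d :=
      (TrigClass d).zero_mem
    rw [TrigClass.regIntegral_Ici h3]
    exact neg_eq_zero.2 (finInt_zero t)

lemma trigSer_neumannSum {h : Ser d (Fin (d + 1)) n} (hh : TrigSer h) :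
    TrigSer (U.neumannSum h) := by
  intro ℓ a b
  have : (fun t θ => U.neumannSum h ℓ t θ a b) =
      ∑ l ∈ Finset.range (ℓ + 1), fun t θ => U.neumannTerm h l ℓ t θ a b := by
    ext t θ
    simp [neumannSum, Finset.sum_apply, Matrix.sum_apply]
  rw [this]
  exact Subalgebra.sum_mem _ fun l _ => U.trigSer_neumannTerm hh l ℓ a b

lemma trigSer_tailIntegrand {h : Ser d (Fin (d + 1)) n} (hh : TrigSer h) :
    TrigSer (U.tailIntegrand h) :=
  TrigSer.mul (TrigSer.series U.fs_mem) (U.trigSer_neumannSum hh)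

theorem neumannWellDefined {h : Ser d (Fin (d + 1)) n} (hh : TrigSer h) :
    U.NeumannWellDefined h :=
  ⟨fun l ℓ t θ => (U.trigSer_kernelMul (U.trigSer_MsMul
    (U.trigSer_neumannTerm hh l)) t).matRegIntegrable ℓ t θ,
    fun l ℓ t θ hℓ => U.neumannTerm_eq_zero h l ℓ hℓ t θ,
    fun ℓ t θ => (U.trigSer_tailIntegrand hh).matRegIntegrable ℓ t θ⟩

end UnstableManifold

end Slices

/-! ### Integrals over the whole line -/

section Line

/-- The finite part of `∫_{-∞}^∞`. -/
def finLine (h : ℝ → ℂ) : ℂ := finInt 0 (fun τ => h (-τ)) + finInt 0 h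

variable {h k : ℝ → ℂ}

lemma finLine_add (hh : h ∈ TwoSided ⊤) (hk : k ∈ TwoSided ⊤) :
    finLine (h + k) = finLine h + finLine k := by
  have := finInt_add (TwoSided.reflect hh) (TwoSided.reflect hk) 0
  simp only [finLine, finInt_add hh hk]
  rw [show (fun τ => (h + k) (-τ)) = (fun τ => h (-τ)) + fun τ => k (-τ) from rfl, this]
  ring

lemma finLine_smul (hh : h ∈ TwoSided ⊤) (c : ℂ) : finLine (c • h) = c * finLine h := by
  have := finInt_smul (TwoSided.reflect hh) c 0
  simp only [finLine, finInt_smul hh]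
  rw [show (fun τ => (c • h) (-τ)) = c • (fun τ => h (-τ)) from rfl, this]
  ring

lemma finLine_neg (hh : h ∈ TwoSided ⊤) : finLine (-h) = -finLine h := by
  have := finLine_smul hh (-1)
  rwa [neg_one_smul, neg_one_mul] at this

lemma finLine_sum {ι : Type*} (s : Finset ι) (f : ι → ℝ → ℂ) (hf : ∀ i ∈ s, f i ∈ TwoSided ⊤) :
    finLine (∑ i ∈ s, f i) = ∑ i ∈ s, finLine (f i) := by
  have h1 := finInt_sum s f hf 0
  have h2 := finInt_sum s (fun i τ => f i (-τ)) (fun i hi => TwoSided.reflect (hf i hi)) 0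
  rw [finLine, h1, show (fun τ => (∑ i ∈ s, f i) (-τ)) = ∑ i ∈ s, fun τ => f i (-τ) by
    ext τ; simp [Finset.sum_apply], h2, ← Finset.sum_add_distrib]
  rfl

/-- The finite part of `∫_{-∞}^∞` is the difference of the constants of a primitive at both
ends. -/
lemma finLine_eq_of_primitive {H : ℝ → ℂ} {c c' : ℂ} (hd : ∀ t, HasDerivAt H (h t) t)
    (hh : h ∈ TwoSided ⊤) (hH : HasConst H c) (hH' : HasConst (fun t => H (-t)) c') :
    finLine h = c - c' := by
  have h1 : ∀ t, HasDerivAt (fun t => -H (-t)) (h (-t)) t := fun t => by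
    exact ((hd (-t)).scomp t (hasDerivAt_neg t)).neg.congr_deriv (by simp)
  have h2 : HasConst (fun t => -H (-t)) (-c') := by
    obtain ⟨δ, hδ, e, he, h2⟩ := hH'
    exact ⟨δ, hδ, -e, Submodule.neg_mem _ he, h2.neg_left.congr_left fun t => by
      simp only [Pi.neg_apply]; ring⟩
  rw [finLine, finInt_eq_of_primitive hd hh hH,
    finInt_eq_of_primitive h1 (TwoSided.reflect hh) h2]
  simp only [neg_zero]
  ring

/-- The finite part of `∫_{-∞}^∞`, order by order, as a series which does not depend on `t`. -/
def psLine (F : TSer) : TSer := constSer fun n => finLine (PowerSeries.coeff n F)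

lemma psLine_add {F G : TSer} (hF : F ∈ TwoSidedSer) (hG : G ∈ TwoSidedSer) :
    psLine (F + G) = psLine F + psLine G := by
  ext n t
  simp only [psLine, constSer, map_add, PowerSeries.coeff_mk, Pi.add_apply]
  exact finLine_add (hF n) (hG n)

lemma psLine_neg {F : TSer} (hF : F ∈ TwoSidedSer) : psLine (-F) = -psLine F := by
  ext n t
  simp only [psLine, constSer, map_neg, PowerSeries.coeff_mk, Pi.neg_apply]
  exact finLine_neg (hF n)

lemma psLine_constSer_mul (c : ℕ → ℂ) {F : TSer} (hF : F ∈ TwoSidedSer) :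
    psLine (constSer c * F) = constSer c * psLine F := by
  have h1 : ∀ x : ℕ × ℕ, PowerSeries.coeff x.1 (constSer c) * PowerSeries.coeff x.2 F =
      c x.1 • PowerSeries.coeff x.2 F := by
    intro x; ext τ; simp [constSer]
  ext n t
  rw [psLine, constSer, PowerSeries.coeff_mk, PowerSeries.coeff_mul, PowerSeries.coeff_mul,
    Finset.sum_apply]
  simp_rw [h1]
  rw [finLine_sum _ _ fun x _ => Subalgebra.smul_mem _ (hF _) _]
  refine Finset.sum_congr rfl fun x _ => ?_
  rw [finLine_smul (hF _)]
  simp [constSer, psLine]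

variable {d : ℕ} {m n : Type}

lemma TrigSer.lineRegIntegral_apply {h : Ser d m n} (hh : TrigSer h) (ℓ : ℕ)
    (θ : Fin d → ℝ) (a : m) (b : n) : lineRegIntegral (h ℓ) θ a b =
      finLine (PowerSeries.coeff ℓ (slice θ h a b)) := by
  have h1 : (fun τ => h ℓ τ θ a b) = PowerSeries.coeff ℓ (slice θ h a b) := by
    ext τ; rw [coeff_slice]
  rw [lineRegIntegral, Matrix.add_apply, hh.matRegIntegral_apply, matRegIntegral, Matrix.of_apply,
    TrigClass.regIntegral_Iic (hh ℓ a b), neg_zero, finLine]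
  congr 2
  ext τ
  rw [← h1]

end Line

/-! ### Existence of the regularized integrals -/

section Existence

variable {d : ℕ}

lemma eventually_pd_slice {F : Par d → ℝ} (hF : AnalyticFam F) (b : Fin d) (t : ℝ)
    (θ : Fin d → ℝ) : dirD (dirTheta b) F =ᶠ[𝓝 (0, t, θ)]
      fun p => pd (fun θ' => F (p.1, p.2.1, θ')) b p.2.2 :=
  (hF t θ).eventually_analyticAt.mono fun _ hp => (pd_slice_theta hp.differentiableAt b).2.symm

lemma tendsto_slice_eps (t : ℝ) (θ : Fin d → ℝ) :
    Tendsto (fun ε : ℝ => ((ε, t, θ) : Par d)) (𝓝 0) (𝓝 (0, t, θ)) :=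
  (by fun_prop : Continuous fun ε : ℝ => ((ε, t, θ) : Par d)).tendsto 0

/-- Membership only depends on the family near `ε = 0`. -/
lemma TrigFam.congr_eventually {F G : Par d → ℝ} (hF : F ∈ TrigFam d)
    (h : ∀ t θ, F =ᶠ[𝓝 (0, t, θ)] G) : G ∈ TrigFam d := by
  refine ⟨fun t θ => (hF.1 t θ).congr (h t θ), fun n => ?_⟩
  rw [← coefC_congr (fun t θ => (tendsto_slice_eps t θ).eventually (h t θ)) n]
  exact hF.2 n

variable {S : ForcedPendulum d}

namespace UnstableManifold

variable (U : UnstableManifold S)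

lemma dThetaAu_mem (α : Fin (d + 1)) (b : Fin d) :
    (fun p : Par d => U.dThetaAu p.1 p.2.1 p.2.2 α b) ∈ TrigFam d :=
  TrigFam.congr_eventually (TrigFam.dirTheta (U.AFam_mem α) b)
    (eventually_pd_slice (U.AFam_analyticFam α) b)

lemma dThetaFu_mem (a b : Fin d) :
    (fun p : Par d => U.dThetaFu p.1 p.2.1 p.2.2 a b) ∈ TrigFam d :=
  TrigFam.congr_eventually (TrigFam.dirTheta (U.gradFam_mem a.succ) b)
    (eventually_pd_slice (U.gradFam_analyticFam a.succ) b)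

lemma trigSer_dThetaAu : TrigSer (series U.dThetaAu) := TrigSer.series U.dThetaAu_mem

lemma slice_dThetaAu (θ : Fin d → ℝ) (α : Fin (d + 1)) (b : Fin d) :
    slice θ (series U.dThetaAu) α b = famSer θ (dirD (dirTheta b) (U.AFam α)) := by
  rw [slice_series]
  exact (famSer_congr θ fun t => (tendsto_slice_eps t θ).eventually
    (eventually_pd_slice (U.AFam_analyticFam α) b t θ)).symm

lemma slice_dThetaFu (θ : Fin d → ℝ) (a b : Fin d) :
    slice θ (series U.dThetaFu) a b = famSer θ (dirD (dirTheta b) (U.gradFam a.succ)) := by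
  rw [slice_series]
  exact (famSer_congr θ fun t => (tendsto_slice_eps t θ).eventually
    (eventually_pd_slice (U.gradFam_analyticFam a.succ) b t θ)).symm

lemma trigSer_mainIntegrand : TrigSer U.mainIntegrand := by
  intro ℓ a b
  cases ℓ with
  | zero => exact (TrigClass d).zero_mem
  | succ ℓ => exact (TrigClass d).smul_mem (TrigSer.series U.dThetaFu_mem ℓ a b) _

lemma pendulumBlock_mem {F : Par d → ℝ} (hF : F ∈ TimeFam d) (α β : Fin (d + 1)) :
    (fun p : Par d => pendulumBlock d (F p) α β) ∈ TimeFam d := by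
  simp only [pendulumBlock, Matrix.of_apply]
  split_ifs
  · exact hF
  · exact (TimeFam d).zero_mem

lemma Kbar_mem {i j : ℕ} (hi : i ≤ 1) (hj : 1 ≤ j) (hj' : j ≤ 2) (α β : Fin (d + 1)) :
    (fun p : Par d => Kbar d (U.γ p.1) i j p.2.1 α β) ∈ TimeFam d := by
  have hP := TimeFam.kernelP_mem (d := d) U.gamma_analytic U.gamma_zero_pos
  have hQ := TimeFam.kernelQ_mem (d := d) U.gamma_analytic
  interval_cases i <;> interval_cases j
  · exact pendulumBlock_mem hP α β
  · exact pendulumBlock_mem hQ α β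
  · exact pendulumBlock_mem hP α β
  · exact (TimeFam d).algebraMap_mem (rotatorBlock d α β)

lemma Kij_mem {i j : ℕ} (hi : i ≤ 1) (hj : 1 ≤ j) (hj' : j ≤ 2) (α β : Fin (d + 1)) :
    (fun p : Par d => Kij d (U.γ p.1) i j p.2.1 α β) ∈ TimeFam d := by
  have hP := TimeFam.kernelP_mem (d := d) U.gamma_analytic U.gamma_zero_pos
  have hQ := TimeFam.kernelQ_mem (d := d) U.gamma_analytic
  have hI := TimeFam.inv_two_mul_mem (d := d) U.gamma_analytic U.gamma_zero_pos
  interval_cases i <;> interval_cases j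
  · exact pendulumBlock_mem ((TimeFam d).mul_mem hI hQ) α β
  · exact pendulumBlock_mem ((TimeFam d).mul_mem ((TimeFam d).neg_mem hI) hP) α β
  · exact pendulumBlock_mem ((TimeFam d).mul_mem ((TimeFam d).algebraMap_mem 2) hP) α β
  · exact (TimeFam d).algebraMap_mem (rotatorBlock d α β)

lemma trigSer_Kp {i j : ℕ} (hi : i ≤ 1) (hj : 1 ≤ j) (hj' : j ≤ 2) (p : ℕ) :
    TrigSer (U.Kp i j p) :=
  TrigSer.series fun α β => TimeFam.le_trigFam
    ((TimeFam d).mul_mem ((TimeFam d).pow_mem TimeFam.time_mem p) (U.Kij_mem hi hj hj' α β))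

lemma EpFam_mem {i j : ℕ} (hi : i ≤ 1) (hj : 1 ≤ j) (hj' : j ≤ 2) (p : ℕ) (α : Fin (d + 1))
    (b : Fin d) : (fun q : Par d => ((-q.2.1) ^ (i - p) •
      (Kbar d (U.γ q.1) i j q.2.1 * U.dThetaAu q.1 q.2.1 q.2.2)) α b) ∈ TrigFam d := by
  have h1 : ∀ β, (fun q : Par d => Kbar d (U.γ q.1) i j q.2.1 α β) *
      (fun q : Par d => U.dThetaAu q.1 q.2.1 q.2.2 β b) ∈ TrigFam d := fun β =>
    (TrigFam d).mul_mem (TimeFam.le_trigFam (U.Kbar_mem hi hj hj' α β)) (U.dThetaAu_mem β b)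
  have h2 := (TrigFam d).mul_mem (TimeFam.le_trigFam ((TimeFam d).pow_mem ((TimeFam d).neg_mem
    TimeFam.time_mem) (i - p))) ((TrigFam d).sum_mem (t := Finset.univ) fun β _ => h1 β)
  convert h2 using 1
  ext q
  simp [Matrix.mul_apply, Finset.sum_apply]

lemma trigSer_EpIntegrand {i j : ℕ} (hi : i ≤ 1) (hj : 1 ≤ j) (hj' : j ≤ 2) (p : ℕ) :
    TrigSer (U.EpIntegrand i j p) :=
  TrigSer.series fun α b => U.EpFam_mem hi hj hj' p α b

lemma trigSer_EIntegrand (t : ℝ) : TrigSer (U.EIntegrand t) :=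
  U.trigSer_kernelMul U.trigSer_dThetaAu t

/-- `ℰ = -(v ∫ u ∂_θ𝔄 - u ∫ v ∂_θ𝔄)` with integrals over the whole line, which do not depend on `t`.
-/
lemma slice_E (θ : Fin d → ℝ) (α : Fin (d + 1)) (b : Fin d) : slice θ U.E α b =
    -(U.serV θ α * psLine (U.serU θ α * slice θ (series U.dThetaAu) α b) -
      U.serU θ α * psLine (U.serV θ α * slice θ (series U.dThetaAu) α b)) := by
  have hA := U.trigSer_dThetaAu.slice_mem θ α b
  have hu := TwoSidedSer.mul_mem (U.serU_mem θ α) hA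
  have hv := TwoSidedSer.mul_mem (U.serV_mem θ α) hA
  ext ℓ t
  have h1 : U.constV t θ α * (U.serU θ α * slice θ (series U.dThetaAu) α b) ∈ TwoSidedSer :=
    TwoSidedSer.mul_mem (constSer_mem _) hu
  have h2 : U.constU t θ α * (U.serV θ α * slice θ (series U.dThetaAu) α b) ∈ TwoSidedSer :=
    TwoSidedSer.mul_mem (constSer_mem _) hv
  have key : psLine (U.constV t θ α * (U.serU θ α * slice θ (series U.dThetaAu) α b) -
      U.constU t θ α * (U.serV θ α * slice θ (series U.dThetaAu) α b)) =
      U.constV t θ α * psLine (U.serU θ α * slice θ (series U.dThetaAu) α b) -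
      U.constU t θ α * psLine (U.serV θ α * slice θ (series U.dThetaAu) α b) := by
    rw [sub_eq_add_neg, psLine_add h1 (TwoSidedSer.neg_mem h2), psLine_neg h2, constV, constU,
      psLine_constSer_mul _ hu, psLine_constSer_mul _ hv, sub_eq_add_neg]
  have key' := congrFun (congrArg (PowerSeries.coeff ℓ) key) t
  rw [coeff_slice, E, Matrix.neg_apply, (U.trigSer_EIntegrand t).lineRegIntegral_apply, EIntegrand,
    slice_kernelMul]
  rw [psLine, constSer, PowerSeries.coeff_mk] at key'
  rw [key']
  simp [constV, constU, constSer, psLine, PowerSeries.coeff_mul, Finset.sum_apply]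

lemma trigSer_E : TrigSer U.E := by
  intro ℓ α b
  have hu := TimeFam.le_trigFam (U.linSolU α).mem
  have hv := TimeFam.le_trigFam (U.linSolV α).mem
  have hline : ∀ {F : Par d → ℝ}, F ∈ TrigFam d → ∀ j, (fun (_ : ℝ) θ => finLine
      (PowerSeries.coeff j (famSer θ F * slice θ (series U.dThetaAu) α b))) ∈ TrigClass d := by
    intro F hF j
    have h1 := trigClass_coeff_mul U.trigSer_dThetaAu hF j α b
    exact (TrigClass d).add_mem (TrigClass.finInt_const_mem (TrigClass.reflectTime h1) 0)
      (TrigClass.finInt_const_mem h1 0)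
  have : (fun t θ => U.E ℓ t θ α b) = -∑ x ∈ Finset.HasAntidiagonal.antidiagonal ℓ,
      (coefC (fun p : Par d => solV α (U.γ p.1) p.2.1) x.1 * (fun _ θ => finLine
        (PowerSeries.coeff x.2 (U.serU θ α * slice θ (series U.dThetaAu) α b))) -
      coefC (fun p : Par d => solU α (U.γ p.1) p.2.1) x.1 * (fun _ θ => finLine
        (PowerSeries.coeff x.2 (U.serV θ α * slice θ (series U.dThetaAu) α b)))) := by
    ext t θ
    rw [← coeff_slice θ U.E α b ℓ t, U.slice_E, map_neg, map_sub, PowerSeries.coeff_mul,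
      PowerSeries.coeff_mul, ← Finset.sum_sub_distrib]
    simp only [Pi.neg_apply, Finset.sum_apply, Pi.sub_apply, Pi.mul_apply, psLine, constSer,
      PowerSeries.coeff_mk, serU, serV]
    simp only [famSer, PowerSeries.coeff_mk]
  rw [this]
  exact Subalgebra.neg_mem _ (Subalgebra.sum_mem _ fun x _ => Subalgebra.sub_mem _
    (Subalgebra.mul_mem _ (hv.2 _) (hline hu _)) (Subalgebra.mul_mem _ (hu.2 _) (hline hv _)))

end UnstableManifold

end Existence

/-! ### Variations in `θ` as series -/

section Reflection

/-- The time reversal of functions of `t`. -/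
def timeReversal : (ℝ → ℂ) →+* (ℝ → ℂ) where
  toFun f t := f (-t)
  map_one' := rfl
  map_mul' _ _ := rfl
  map_zero' := rfl
  map_add' _ _ := rfl

/-- The time reversal of power series whose coefficients are functions of `t`. -/
def psRefl : TSer →+* TSer := PowerSeries.map timeReversal

lemma coeff_psRefl (n : ℕ) (F : TSer) (t : ℝ) :
    PowerSeries.coeff n (psRefl F) t = PowerSeries.coeff n F (-t) := by
  rw [psRefl, PowerSeries.coeff_map]; rfl

lemma psRefl_mem {F : TSer} (hF : F ∈ TwoSidedSer) : psRefl F ∈ TwoSidedSer := fun n => by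
  have : PowerSeries.coeff n (psRefl F) = fun t => PowerSeries.coeff n F (-t) := by
    ext t; exact coeff_psRefl n F t
  rw [this]
  exact TwoSided.reflect (hF n)

end Reflection

section Variation

variable {d : ℕ}

/-- The Taylor coefficients of a family at all `θ` determine those of its `θ`-derivatives. -/
lemma famSer_dirTheta_congr {F G : Par d → ℝ} (hF : AnalyticFam F) (hG : AnalyticFam G)
    (h : ∀ n, coefC F n = coefC G n) (b : Fin d) (θ : Fin d → ℝ) :
    famSer θ (dirD (dirTheta b) F) = famSer θ (dirD (dirTheta b) G) := by
  have h1 : ∀ n t, coef F n t = coef G n t := fun n t => funext fun θ =>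
    Complex.ofReal_injective (congrFun (congrFun (h n) t) θ)
  ext n t
  simp only [famSer, PowerSeries.coeff_mk, coefC]
  rw [← pd_coef hF, ← pd_coef hG, h1]

/-- Factors independent of `θ` commute with `∂_θ`. -/
lemma famSer_dirTheta_time_mul {w F : Par d → ℝ} (hw : AnalyticFam w) (hF : AnalyticFam F)
    (hi : ∀ ε t θ θ', w (ε, t, θ) = w (ε, t, θ')) (b : Fin d) (θ : Fin d → ℝ) :
    famSer θ (dirD (dirTheta b) (w * F)) = famSer θ w * famSer θ (dirD (dirTheta b) F) := by
  rw [← famSer_mul θ hw (hF.dirD _)]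
  refine famSer_congr θ fun t => ?_
  filter_upwards [hw.eventually t θ, hF.eventually t θ] with ε h1 h2
  have h3 : dirD (dirTheta b) w (ε, t, θ) = 0 := by
    rw [← (pd_slice_theta h1.differentiableAt b).2,
      show (fun θ' => w (ε, t, θ')) = fun _ => w (ε, t, θ) from funext fun θ' => hi ε t θ' θ]
    simp [pd]
  rw [dirD_mul h1.differentiableAt h2.differentiableAt, h3, mul_zero, add_zero]
  rfl

lemma famSer_dirTheta_add {F G : Par d → ℝ} (hF : AnalyticFam F) (hG : AnalyticFam G)
    (b : Fin d) (θ : Fin d → ℝ) : famSer θ (dirD (dirTheta b) (F + G)) =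
      famSer θ (dirD (dirTheta b) F) + famSer θ (dirD (dirTheta b) G) := by
  rw [← famSer_add θ (hF.dirD _) (hG.dirD _)]
  refine famSer_congr θ fun t => ?_
  filter_upwards [hF.eventually t θ, hG.eventually t θ] with ε h1 h2
  simp only [dirD, Pi.add_apply]
  rw [fderiv_add h1.differentiableAt h2.differentiableAt]
  rfl

variable {S : ForcedPendulum d}

/-- `F` is a family transported by the flow with `∂_t F = w G` to all orders, where `w` does not
depend on `θ`. -/
structure FlowPrimitive (S : ForcedPendulum d) (F w G : Par d → ℝ) : Prop where
  flow : F ∈ FlowFam S.ω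
  trig : F ∈ TrigFam d
  time : w ∈ TimeFam d
  indep : ∀ ε t θ θ', w (ε, t, θ) = w (ε, t, θ')
  source : G ∈ TrigFam d
  deriv : ∀ n, coefC (dirD dirTime F) n = coefC (w * G) n

namespace FlowPrimitive

variable {F w G : Par d → ℝ}

lemma famSer_dirTime (h : FlowPrimitive S F w G) (b : Fin d) (θ : Fin d → ℝ) :
    famSer θ (dirD dirTime (dirD (dirTheta b) F)) =
    famSer θ w * famSer θ (dirD (dirTheta b) G) := by
  rw [← famSer_dirTheta_time_mul h.time.1 h.source.1 h.indep,
    ← famSer_dirTheta_congr (h.trig.1.dirD dirTime) (h.time.1.mul h.source.1) h.deriv]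
  exact famSer_congr θ fun t => (tendsto_slice_eps t θ).eventually
    (dirD_comm_eventually (h.trig.1 t θ) dirTime (dirTheta b))

lemma mul_mem (h : FlowPrimitive S F w G) (b : Fin d) (θ : Fin d → ℝ) :
    famSer θ w * famSer θ (dirD (dirTheta b) G) ∈ TwoSidedSer :=
  TwoSidedSer.mul_mem (famSer_mem θ (TimeFam.le_trigFam h.time))
    (famSer_mem θ (TrigFam.dirTheta h.source b))

lemma hasDerivAt (h : FlowPrimitive S F w G) (b : Fin d) (θ : Fin d → ℝ) (n : ℕ) (t : ℝ) :
    HasDerivAt (fun t => coefC (dirD (dirTheta b) F) n t θ)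
      (PowerSeries.coeff n (famSer θ w * famSer θ (dirD (dirTheta b) G)) t) t := by
  rw [← h.famSer_dirTime]
  simp only [famSer, PowerSeries.coeff_mk]
  exact UnstableManifold.hasDerivAt_coefC (h.trig.1.dirD _) n t θ

/-- Integration from the present to `+∞` of the source of a variation. The constant at `-∞`
vanishes, so that the constant at `+∞` is the integral over the whole line. -/
lemma psInt_mul (h : FlowPrimitive S F w G) (b : Fin d) (θ : Fin d → ℝ) :
    psInt (famSer θ w * famSer θ (dirD (dirTheta b) G)) =
    psLine (famSer θ w * famSer θ (dirD (dirTheta b) G)) - famSer θ (dirD (dirTheta b) F) := by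
  ext n t
  have h1 := UnstableManifold.hasConst_dirTheta h.flow h.trig b n θ
  obtain ⟨c, hc⟩ := AsyExp.exists_hasConst (((TrigFam.dirTheta h.trig b).2 n).2 θ).2.1
  rw [map_sub, Pi.sub_apply]
  simp only [psInt, psLine, constSer, PowerSeries.coeff_mk]
  rw [finLine_eq_of_primitive (h.hasDerivAt b θ n) (h.mul_mem b θ n) hc h1, sub_zero,
    finInt_eq_of_primitive (h.hasDerivAt b θ n) (h.mul_mem b θ n) hc]
  simp [famSer]

/-- Integration from `-∞` to the present of the source of a variation, after time reversal. -/
lemma psInt_refl_mul (h : FlowPrimitive S F w G) (b : Fin d) (θ : Fin d → ℝ) :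
    psInt (psRefl (famSer θ w * famSer θ (dirD (dirTheta b) G))) =
    psRefl (famSer θ (dirD (dirTheta b) F)) := by
  ext n t
  have h1 := UnstableManifold.hasConst_dirTheta h.flow h.trig b n θ
  have h2 : ∀ t, HasDerivAt (fun t => -coefC (dirD (dirTheta b) F) n (-t) θ)
      (PowerSeries.coeff n (psRefl (famSer θ w * famSer θ (dirD (dirTheta b) G))) t) t := fun t =>
    ((h.hasDerivAt b θ n (-t)).scomp t (hasDerivAt_neg t)).neg.congr_deriv (by
      rw [coeff_psRefl]; simp)
  have h3 : HasConst (fun t => -coefC (dirD (dirTheta b) F) n (-t) θ) 0 := by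
    obtain ⟨δ, hδ, e, he, h4⟩ := h1
    exact ⟨δ, hδ, -e, Submodule.neg_mem _ he, h4.neg_left.congr_left fun t => by
      simp only [Pi.neg_apply]; ring⟩
  rw [psInt, PowerSeries.coeff_mk, finInt_eq_of_primitive h2 (psRefl_mem (h.mul_mem b θ) n) h3,
    coeff_psRefl]
  simp [famSer]

/-- For an even weight, the difference of the source and its time reversal integrates to the
difference of `psInt_mul` and `psInt_refl_mul`. -/
lemma psInt_mul_sub_of_even (h : FlowPrimitive S F w G) (b : Fin d) (θ : Fin d → ℝ)
    (hw : psRefl (famSer θ w) = famSer θ w) :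
    psInt (famSer θ w * (famSer θ (dirD (dirTheta b) G) -
      psRefl (famSer θ (dirD (dirTheta b) G)))) =
    psLine (famSer θ w * famSer θ (dirD (dirTheta b) G)) -
      (famSer θ (dirD (dirTheta b) F) + psRefl (famSer θ (dirD (dirTheta b) F))) := by
  have hm := psRefl_mem (h.mul_mem b θ)
  have h1 := psInt_add (TwoSidedSer.neg_mem hm) (h.mul_mem b θ)
  rw [psInt_neg hm, h.psInt_refl_mul, h.psInt_mul, map_mul, hw] at h1
  rw [mul_sub, sub_eq_neg_add, h1]
  ring

/-- For an odd weight, the difference of the source and its time reversal integrates to the sum of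
`psInt_mul` and `psInt_refl_mul`. -/
lemma psInt_mul_sub_of_odd (h : FlowPrimitive S F w G) (b : Fin d) (θ : Fin d → ℝ)
    (hw : psRefl (famSer θ w) = -famSer θ w) :
    psInt (famSer θ w * (famSer θ (dirD (dirTheta b) G) -
      psRefl (famSer θ (dirD (dirTheta b) G)))) =
    psLine (famSer θ w * famSer θ (dirD (dirTheta b) G)) -
      (famSer θ (dirD (dirTheta b) F) - psRefl (famSer θ (dirD (dirTheta b) F))) := by
  have hm := psRefl_mem (h.mul_mem b θ)
  have h1 := psInt_add hm (h.mul_mem b θ)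
  rw [h.psInt_refl_mul, h.psInt_mul, map_mul, hw] at h1
  rw [mul_sub, sub_eq_neg_add, ← neg_mul, h1]
  ring

end FlowPrimitive

end Variation

/-! ### The equation for the variation of the splitting -/

section Splitting

variable {d : ℕ}

lemma psRefl_famSer_even {w : Par d → ℝ} (h : ∀ ε t, w (ε, -t, 0) = w (ε, t, 0)) :
    psRefl (famSer 0 w) = famSer 0 w := by
  ext n t
  rw [coeff_psRefl]
  simp only [famSer, PowerSeries.coeff_mk, coefC, coef, h]

lemma psRefl_famSer_eq (F : Par d → ℝ) :
    psRefl (famSer 0 F) = famSer 0 fun p => F (p.1, -p.2.1, -p.2.2) := by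
  ext n t
  rw [coeff_psRefl]
  simp only [famSer, PowerSeries.coeff_mk, coefC, coef, neg_zero]

lemma psRefl_famSer_odd {w : Par d → ℝ} (hw : AnalyticFam w)
    (h : ∀ ε t, w (ε, -t, 0) = -w (ε, t, 0)) : psRefl (famSer 0 w) = -famSer 0 w := by
  rw [psRefl_famSer_eq, ← famSer_neg 0 hw]
  exact famSer_congr 0 fun t => Eventually.of_forall fun ε => by simpa using h ε t

lemma solU_even (α : Fin (d + 1)) (γ t : ℝ) : solU α γ (-t) = solU α γ t := by
  unfold solU
  rw [kernelP_eq, kernelP_eq, mul_neg, Real.cosh_neg]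

lemma solV_odd (α : Fin (d + 1)) (γ t : ℝ) : solV α γ (-t) = -solV α γ t := by
  unfold solV
  simp only [kernelP_eq, kernelQ_eq, mul_neg, Real.cosh_neg, Real.sinh_neg]
  split_ifs <;> ring

variable {S : ForcedPendulum d}

/-- The series of multiplication by `λ = ε g²`. -/
def lamSer (S : ForcedPendulum d) : TSer := famSer (0 : Fin d → ℝ) fun p => p.1 * S.g ^ 2

namespace UnstableManifold

variable (U : UnstableManifold S)

lemma LinSol.flowPrimitive {U : UnstableManifold S} {α : Fin (d + 1)} {w w' : ℝ → ℝ → ℝ}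
    (hw : U.LinSol α w w') : FlowPrimitive S (U.wronFam α w w')
      (fun p => w (U.γ p.1) p.2.1) (U.AFam α) :=
  ⟨hw.wronFam_mem_flowFam, hw.wronFam_mem, hw.mem, fun _ _ _ _ => rfl, U.AFam_mem α,
    hw.dirTime_wronFam⟩

/-- The velocities of the rotators are primitives of `λ ∂_ψ f`. -/
lemma flowPrimitive_velocity (a : Fin d) : FlowPrimitive S (dirD dirTime (U.XFam a.succ))
    (fun p => p.1 * S.g ^ 2) (U.gradFam a.succ) := by
  refine ⟨U.dirTime_XFam_mem_flowFam a.succ, U.dirTime_XFam_mem a.succ,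
    TimeFam.eps_mem (a := fun ε => ε * S.g ^ 2) (by fun_prop), fun _ _ _ _ => rfl,
    U.gradFam_mem a.succ, fun n => coefC_congr (fun t θ => ?_) n⟩
  have hop : IsOpen {ε : ℝ | |ε| < U.ε₀} := isOpen_lt (by fun_prop) continuous_const
  filter_upwards [hop.mem_nhds U.abs_zero_lt] with ε hε
  rw [(hasDerivAt_slice_time (AnalyticAt.dirD (U.XFam_analyticAt a.succ hε t θ)
    dirTime).differentiableAt).unique (U.hasDerivAt_dirTime_XFam a.succ hε t θ)]
  have := U.Omega_apply a.succ (ε, t, θ)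
  simpa [Fin.succ_ne_zero] using this

lemma splitFam_mem (α : Fin (d + 1)) (b : Fin d) : U.splitFam α b ∈ TrigFam d :=
  (TrigFam d).sub_mem (TrigFam.dirTheta (U.XFam_mem α) b)
    (TrigFam.reflect (TrigFam.dirTheta (U.XFam_mem α) b))

/-- The Taylor series of `∂_θ(X^u - X^s)` on the homoclinic trajectory. -/
def splitSer : Matrix (Fin (d + 1)) (Fin d) TSer :=
  Matrix.of fun α b => famSer 0 (U.splitFam α b)

lemma splitSer_mem (α : Fin (d + 1)) (b : Fin d) : U.splitSer α b ∈ TwoSidedSer :=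
  famSer_mem 0 (U.splitFam_mem α b)

/-- Passage to series in an identity for `F(t) - F(-t)` on the homoclinic trajectory. -/
lemma famSer_sub_refl {m : Type*} [Fintype m] {F : Par d → ℝ} {M W : m → Par d → ℝ}
    (hF : AnalyticFam F) (hF' : AnalyticFam fun p => F (p.1, -p.2.1, -p.2.2))
    (hM : ∀ β, AnalyticFam (M β)) (hW : ∀ β, AnalyticFam (W β))
    (h : ∀ ε, |ε| < U.radius → ∀ t,
      F (ε, t, 0) - F (ε, -t, 0) = ∑ β, M β (ε, t, 0) * W β (ε, t, 0)) :
    famSer 0 F - psRefl (famSer 0 F) = ∑ β, famSer 0 (M β) * famSer 0 (W β) := by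
  rw [psRefl_famSer_eq, ← famSer_sub 0 hF hF']
  simp_rw [← famSer_mul 0 (hM _) (hW _)]
  rw [← famSer_sum 0 _ fun β _ => (hM β).mul (hW β)]
  refine famSer_congr 0 fun t => ?_
  have hop : IsOpen {ε : ℝ | |ε| < U.radius} := isOpen_lt (by fun_prop) continuous_const
  filter_upwards [hop.mem_nhds (by simpa using U.radius_pos)] with ε hε
  have := h ε hε t
  simp only [Pi.sub_apply, Finset.sum_apply, Pi.mul_apply, neg_zero]
  exact this

lemma source_sub_refl (α : Fin (d + 1)) (b : Fin d) :
    famSer 0 (dirD (dirTheta b) (U.AFam α)) - psRefl (famSer 0 (dirD (dirTheta b) (U.AFam α))) =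
      (slice 0 (series U.Ms) * U.splitSer) α b :=
  U.famSer_sub_refl ((U.AFam_analyticFam α).dirD _)
    (TrigFam.reflect (TrigFam.dirTheta (U.AFam_mem α) b)).1 (fun β => (U.Ms_mem α β).1)
    (fun β => (U.splitFam_mem β b).1) fun _ hε t => U.dirTheta_AFam_sub hε α b t

lemma grad_sub_refl (a b : Fin d) :
    famSer 0 (dirD (dirTheta b) (U.gradFam a.succ)) -
      psRefl (famSer 0 (dirD (dirTheta b) (U.gradFam a.succ))) =
      (slice 0 (series U.fs) * U.splitSer) a b :=
  U.famSer_sub_refl ((U.gradFam_analyticFam a.succ).dirD _)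
    (TrigFam.reflect (TrigFam.dirTheta (U.gradFam_mem a.succ) b)).1 (fun β => (U.fs_mem a β).1)
    (fun β => (U.splitFam_mem β b).1) fun _ hε t => U.dirTheta_gradFam_sub hε a b t

/-- Variation of constants: `∂_θ X^u = v N_u - u N_v`. -/
lemma famSer_dirTheta_XFam (α : Fin (d + 1)) (b : Fin d) :
    famSer 0 (dirD (dirTheta b) (U.XFam α)) =
      U.serV 0 α * famSer 0 (dirD (dirTheta b) (U.wronFam α (solU α) (solU' α))) -
        U.serU 0 α * famSer 0 (dirD (dirTheta b) (U.wronFam α (solV α) (solV' α))) := by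
  have hu := U.linSolU α
  have hv := U.linSolV α
  have hu' : (fun p : Par d => -solU α (U.γ p.1) p.2.1) ∈ TimeFam d := (TimeFam d).neg_mem hu.mem
  have hwu := hu.wronFam_mem.1
  have hwv := hv.wronFam_mem.1
  have h1 := AnalyticFam.mul hv.mem.1 hwu
  have h2 := AnalyticFam.mul hu'.1 hwv
  have hneg : famSer 0 (fun p : Par d => -solU α (U.γ p.1) p.2.1) = -U.serU 0 α :=
    famSer_neg 0 hu.mem.1
  rw [famSer_dirTheta_congr (U.XFam_analyticFam α) (h1.add h2) (fun n => ?_) b 0,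
    famSer_dirTheta_add h1 h2, famSer_dirTheta_time_mul hv.mem.1 hwu fun _ _ _ _ => rfl,
    famSer_dirTheta_time_mul hu'.1 hwv fun _ _ _ _ => rfl, hneg, neg_mul, ← sub_eq_add_neg]
  · rfl
  · refine coefC_congr (fun t θ => ?_) n
    have hop : IsOpen {ε : ℝ | |ε| < U.radius} := isOpen_lt (by fun_prop) continuous_const
    filter_upwards [hop.mem_nhds (by simpa using U.radius_pos)] with ε hε
    exact U.XFam_eq_wronFam α hε t θ

/-- The variation `W = ∂_θ(X^u - X^s)` of the homoclinic trajectory solves `W = -ℰ + B(M^s W)`. The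
stable part is the time reversal of `∂_θ X^u = v N_u - u N_v`, in which `u` is even and `v` is odd;
the integrals over the whole line that arise from `N_u` and `N_v` form `-ℰ`. -/
theorem splitSer_eq : U.splitSer = -slice 0 U.E + U.Bop 0 (slice 0 (series U.Ms) * U.splitSer) := by
  ext1 α b
  have hu := (U.linSolU α).flowPrimitive
  have hv := (U.linSolV α).flowPrimitive
  have hU : psRefl (U.serU 0 α) = U.serU 0 α := psRefl_famSer_even fun ε t => solU_even α _ t
  have hV : psRefl (U.serV 0 α) = -U.serV 0 α :=
    psRefl_famSer_odd hv.time.1 fun ε t => solV_odd α _ t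
  have h1 := hu.psInt_mul_sub_of_even b 0 hU
  have h2 := hv.psInt_mul_sub_of_odd b 0 hV
  rw [source_sub_refl] at h1 h2
  have h3 : U.splitSer α b = famSer 0 (dirD (dirTheta b) (U.XFam α)) -
      psRefl (famSer 0 (dirD (dirTheta b) (U.XFam α))) := by
    rw [psRefl_famSer_eq, ← famSer_sub 0 ((U.XFam_analyticFam α).dirD _)
      (TrigFam.reflect (TrigFam.dirTheta (U.XFam_mem α) b)).1]
    rfl
  rw [Matrix.add_apply, Matrix.neg_apply, U.slice_E, slice_dThetaAu, Bop, Matrix.of_apply]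
  change psInt (U.serU 0 α * _) = psLine (U.serU 0 α * _) - _ at h1
  change psInt (U.serV 0 α * _) = psLine (U.serV 0 α * _) - _ at h2
  rw [h1, h2, h3, famSer_dirTheta_XFam, map_sub, map_mul, map_mul, hU, hV]
  ring

end UnstableManifold

end Splitting

/-! ### The Neumann series as the solution of a fixed point equation -/

section Neumann

lemma X_pow_dvd_psInt {k : ℕ} {F : TSer} (h : PowerSeries.X ^ k ∣ F) :
    PowerSeries.X ^ k ∣ psInt F := by
  rw [PowerSeries.X_pow_dvd_iff] at h ⊢
  intro m hm
  ext t
  rw [psInt, PowerSeries.coeff_mk, h m hm]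
  exact finInt_zero t

variable {d : ℕ} {m n k : Type}

/-- Matrices of series which do not depend on `t`. -/
def constMat (C : ℕ → Matrix m n ℂ) : Matrix m n TSer :=
  Matrix.of fun a b => constSer fun ℓ => C ℓ a b

lemma constMat_mem (C : ℕ → Matrix m n ℂ) (a : m) (b : n) : constMat C a b ∈ TwoSidedSer :=
  constSer_mem fun ℓ => C ℓ a b

lemma mul_constMat_mem [Fintype k] {H : Matrix m k TSer} (hH : ∀ a b, H a b ∈ TwoSidedSer)
    (C : ℕ → Matrix k n ℂ) (a : m) (b : n) : (H * constMat C) a b ∈ TwoSidedSer := by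
  rw [Matrix.mul_apply]
  exact TwoSidedSer.sum_mem fun j _ => TwoSidedSer.mul_mem (hH a j) (constMat_mem C j b)

lemma coeff_mul_constMat [Fintype k] (H : Matrix m k TSer) (C : ℕ → Matrix k n ℂ) (a : m) (b : n)
    (ℓ : ℕ) (t : ℝ) : PowerSeries.coeff ℓ ((H * constMat C) a b) t =
      cauchyMul (fun r => Matrix.of fun a j => PowerSeries.coeff r (H a j) t) C ℓ a b := by
  simp only [Matrix.mul_apply, map_sum, Finset.sum_apply, PowerSeries.coeff_mul, cauchyMul,
    Matrix.sum_apply, constMat, constSer, Matrix.of_apply, Pi.mul_apply, PowerSeries.coeff_mk]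
  exact Finset.sum_comm

lemma psInt_mul_constMat [Fintype k] {H : Matrix m k TSer} (hH : ∀ a j, H a j ∈ TwoSidedSer)
    (C : ℕ → Matrix k n ℂ) (F : TSer) (hF : F ∈ TwoSidedSer) (a : m) (b : n) :
    psInt (F * (H * constMat C) a b) =
      (Matrix.of (fun a j => psInt (F * H a j)) * constMat C) a b := by
  have h1 : ∀ j, F * H a j ∈ TwoSidedSer := fun j => TwoSidedSer.mul_mem hF (hH a j)
  simp only [Matrix.mul_apply, Finset.mul_sum, Matrix.of_apply, constMat, ← mul_assoc]
  rw [psInt_sum _ _ fun j _ => TwoSidedSer.mul_mem (h1 j) (constSer_mem _)]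
  exact Finset.sum_congr rfl fun j _ => psInt_mul_constSer _ (h1 j)

variable {S : ForcedPendulum d}

namespace UnstableManifold

variable (U : UnstableManifold S)

/-- The operator `B M^s` on the homoclinic trajectory. -/
def BMop (H : Matrix (Fin (d + 1)) n TSer) : Matrix (Fin (d + 1)) n TSer :=
  U.Bop 0 (slice 0 (series U.Ms) * H)

lemma sliceMs_mul_mem {H : Matrix (Fin (d + 1)) n TSer} (hH : ∀ a b, H a b ∈ TwoSidedSer)
    (a : Fin (d + 1)) (b : n) : (slice 0 (series U.Ms) * H) a b ∈ TwoSidedSer := by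
  rw [Matrix.mul_apply]
  exact TwoSidedSer.sum_mem fun j _ =>
    TwoSidedSer.mul_mem ((TrigSer.series U.Ms_mem).slice_mem 0 a j) (hH j b)

lemma BMop_add {H K : Matrix (Fin (d + 1)) n TSer} (hH : ∀ a b, H a b ∈ TwoSidedSer)
    (hK : ∀ a b, K a b ∈ TwoSidedSer) : U.BMop (H + K) = U.BMop H + U.BMop K := by
  ext1 α b
  have h1 := U.sliceMs_mul_mem hH α b
  have h2 := U.sliceMs_mul_mem hK α b
  simp only [BMop, Bop, Matrix.of_apply, Matrix.mul_add, Matrix.add_apply, mul_add]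
  rw [psInt_add (TwoSidedSer.mul_mem (U.serU_mem 0 α) h1) (TwoSidedSer.mul_mem (U.serU_mem 0 α) h2),
    psInt_add (TwoSidedSer.mul_mem (U.serV_mem 0 α) h1) (TwoSidedSer.mul_mem (U.serV_mem 0 α) h2)]
  ring

lemma BMop_zero : U.BMop (0 : Matrix (Fin (d + 1)) n TSer) = 0 := by
  have h1 : ∀ a b, (0 : Matrix (Fin (d + 1)) n TSer) a b ∈ TwoSidedSer :=
    fun _ _ => TwoSidedSer.zero_mem
  have h2 := U.BMop_add h1 h1
  rwa [add_zero, left_eq_add] at h2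

lemma BMop_sub {H K : Matrix (Fin (d + 1)) n TSer} (hH : ∀ a b, H a b ∈ TwoSidedSer)
    (hK : ∀ a b, K a b ∈ TwoSidedSer) : U.BMop (H - K) = U.BMop H - U.BMop K := by
  have h1 : ∀ a b, (H - K) a b ∈ TwoSidedSer := fun a b => TwoSidedSer.sub_mem (hH a b) (hK a b)
  rw [eq_sub_iff_add_eq, ← U.BMop_add h1 hK, sub_add_cancel]

lemma BMop_mul_constMat [Fintype k] {H : Matrix (Fin (d + 1)) k TSer}
    (hH : ∀ a b, H a b ∈ TwoSidedSer) (C : ℕ → Matrix k n ℂ) :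
    U.BMop (H * constMat C) = U.BMop H * constMat C := by
  ext1 α b
  have h1 := U.sliceMs_mul_mem hH
  simp only [BMop, Bop, Matrix.of_apply]
  rw [← Matrix.mul_assoc, psInt_mul_constMat h1 C _ (U.serU_mem 0 α),
    psInt_mul_constMat h1 C _ (U.serV_mem 0 α)]
  simp only [Matrix.mul_apply, Matrix.of_apply, Finset.mul_sum, ← Finset.sum_sub_distrib,
    ← Finset.sum_neg_distrib]
  exact Finset.sum_congr rfl fun j _ => by ring

/-- Since `M^s = O(ε)`, the operator `B M^s` raises the order in `ε`. -/
lemma X_pow_dvd_BMop {l : ℕ} {H : Matrix (Fin (d + 1)) n TSer}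
    (hH : ∀ a b, PowerSeries.X ^ l ∣ H a b) (α : Fin (d + 1)) (b : n) :
    PowerSeries.X ^ (l + 1) ∣ U.BMop H α b := by
  have hM : ∀ α β, PowerSeries.X ∣ slice 0 (series U.Ms) α β := by
    intro α β
    rw [PowerSeries.X_dvd_iff, ← PowerSeries.coeff_zero_eq_constantCoeff_apply]
    ext t
    rw [coeff_slice, series_Ms_zero]
    rfl
  have h1 : PowerSeries.X ^ (l + 1) ∣ (slice 0 (series U.Ms) * H) α b := by
    rw [Matrix.mul_apply]
    refine Finset.dvd_sum fun j _ => ?_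
    rw [pow_succ']
    exact mul_dvd_mul (hM α j) (hH j b)
  refine (dvd_neg).2 (dvd_sub ?_ ?_)
  · exact (X_pow_dvd_psInt (h1.mul_left _)).mul_left _
  · exact (X_pow_dvd_psInt (h1.mul_left _)).mul_left _

lemma slice_neumannTerm_succ {h : Ser d (Fin (d + 1)) n} (hh : TrigSer h) (l : ℕ) :
    slice 0 (U.neumannTerm h (l + 1)) = U.BMop (slice 0 (U.neumannTerm h l)) := by
  rw [neumannTerm_succ, U.slice_B (U.trigSer_MsMul (U.trigSer_neumannTerm hh l)), MsMul, slice_mul]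
  rfl

/-- The partial sums of the Neumann series on the homoclinic trajectory. -/
def partialNeumann (h : Ser d (Fin (d + 1)) n) (L : ℕ) : Matrix (Fin (d + 1)) n TSer :=
  ∑ l ∈ Finset.range L, slice 0 (U.neumannTerm h l)

lemma partialNeumann_mem {h : Ser d (Fin (d + 1)) n} (hh : TrigSer h) (L : ℕ) (a : Fin (d + 1))
    (b : n) : U.partialNeumann h L a b ∈ TwoSidedSer := by
  rw [partialNeumann, Matrix.sum_apply]
  exact TwoSidedSer.sum_mem fun l _ => (U.trigSer_neumannTerm hh l).slice_mem 0 a b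

/-- The geometric recursion `S_{L+1} = h + B M^s S_L`. -/
lemma partialNeumann_succ {h : Ser d (Fin (d + 1)) n} (hh : TrigSer h) (L : ℕ) :
    U.partialNeumann h (L + 1) = slice 0 h + U.BMop (U.partialNeumann h L) := by
  induction L with
  | zero =>
    simp [partialNeumann, BMop_zero, neumannTerm]
  | succ L ih =>
    have h1 : U.partialNeumann h (L + 1) =
        U.partialNeumann h L + slice 0 (U.neumannTerm h L) := Finset.sum_range_succ _ _
    have h2 : U.partialNeumann h (L + 1 + 1) =
        U.partialNeumann h (L + 1) + slice 0 (U.neumannTerm h (L + 1)) := Finset.sum_range_succ _ _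
    conv_rhs => rw [h1, U.BMop_add (U.partialNeumann_mem hh L)
      ((U.trigSer_neumannTerm hh L).slice_mem 0), ← add_assoc, ← ih]
    rw [h2, U.slice_neumannTerm_succ hh]

lemma coeff_partialNeumann (h : Ser d (Fin (d + 1)) n) {L ℓ : ℕ} (hL : ℓ < L)
    (a : Fin (d + 1)) (b : n) : PowerSeries.coeff ℓ (U.partialNeumann h L a b) =
      PowerSeries.coeff ℓ (slice 0 (U.neumannSum h) a b) := by
  ext t
  rw [coeff_slice, partialNeumann, neumannSum, Matrix.sum_apply, map_sum, Finset.sum_apply,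
    Finset.sum_apply, Finset.sum_apply, Matrix.sum_apply]
  simp_rw [coeff_slice]
  symm
  refine Finset.sum_subset (Finset.range_mono hL) fun l _ hl => ?_
  rw [U.neumannTerm_eq_zero h l ℓ (by simpa using hl) t 0]
  rfl

lemma X_pow_dvd_neumann_sub (h : Ser d (Fin (d + 1)) n) (L : ℕ) (a : Fin (d + 1)) (b : n) :
    PowerSeries.X ^ L ∣ (slice 0 (U.neumannSum h) - U.partialNeumann h L) a b := by
  rw [PowerSeries.X_pow_dvd_iff]
  intro ℓ hℓ
  rw [Matrix.sub_apply, map_sub, U.coeff_partialNeumann h hℓ, sub_self]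

/-- The only solution of `Y = h + B M^s Y` is the Neumann series. -/
theorem eq_neumannSum_of_fixed {h : Ser d (Fin (d + 1)) n} (hh : TrigSer h)
    {Y : Matrix (Fin (d + 1)) n TSer} (hY : ∀ a b, Y a b ∈ TwoSidedSer)
    (hf : Y = slice 0 h + U.BMop Y) : Y = slice 0 (U.neumannSum h) := by
  -- Each application of the equation improves the agreement with the partial sums by one order.
  have key : ∀ L a b, PowerSeries.X ^ L ∣ (Y - U.partialNeumann h L) a b := by
    intro L
    induction L with
    | zero => intro a b; simp
    | succ L ih =>
      intro a b
      have h1 : Y - U.partialNeumann h (L + 1) = U.BMop (Y - U.partialNeumann h L) := by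
        rw [U.BMop_sub hY (U.partialNeumann_mem hh L), U.partialNeumann_succ hh]
        nth_rewrite 1 [hf]
        abel
      rw [h1]
      exact U.X_pow_dvd_BMop ih a b
  ext1 a b
  ext1 ℓ
  have h1 := PowerSeries.X_pow_dvd_iff.1 (key (ℓ + 1) a b) ℓ ℓ.lt_succ_self
  rw [Matrix.sub_apply, map_sub, sub_eq_zero] at h1
  rw [h1, U.coeff_partialNeumann h ℓ.lt_succ_self]

/-- The Neumann series solves the equation: modulo `ε^{ℓ+1}` it agrees with its partial sums, for
which the equation is the geometric recursion. -/
theorem neumannSum_fixed {h : Ser d (Fin (d + 1)) n} (hh : TrigSer h) :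
    slice 0 (U.neumannSum h) = slice 0 h + U.BMop (slice 0 (U.neumannSum h)) := by
  have hN := (U.trigSer_neumannSum hh).slice_mem 0
  rw [← sub_eq_zero]
  ext1 a b
  ext1 ℓ
  have h1 : slice 0 (U.neumannSum h) - (slice 0 h + U.BMop (slice 0 (U.neumannSum h))) =
      (slice 0 (U.neumannSum h) - U.partialNeumann h (ℓ + 1 + 1)) -
        U.BMop (slice 0 (U.neumannSum h) - U.partialNeumann h (ℓ + 1)) := by
    rw [U.BMop_sub hN (U.partialNeumann_mem hh (ℓ + 1)), U.partialNeumann_succ hh (ℓ + 1)]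
    abel
  have h2 := U.X_pow_dvd_BMop (U.X_pow_dvd_neumann_sub h (ℓ + 1)) a b
  have h3 := PowerSeries.X_pow_dvd_iff.1 (dvd_sub (U.X_pow_dvd_neumann_sub h (ℓ + 1 + 1) a b) h2)
    ℓ (by omega)
  rw [h1]
  exact h3

/-- On the homoclinic trajectory, `∂_θ(X^u - X^s) = -∑_l (B M^s)^l ℰ`. -/
theorem splitSer_eq_neumannSum : U.splitSer = -slice 0 (U.neumannSum U.E) := by
  rw [← U.eq_neumannSum_of_fixed U.trigSer_E (Y := -U.splitSer)
    (fun a b => TwoSidedSer.neg_mem (U.splitSer_mem a b)) ?_, neg_neg]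
  have h1 := U.BMop_sub (H := (0 : Matrix (Fin (d + 1)) (Fin d) TSer))
    (fun _ _ => TwoSidedSer.zero_mem) U.splitSer_mem
  rw [zero_sub, U.BMop_zero, zero_sub] at h1
  rw [h1]
  nth_rewrite 1 [U.splitSer_eq]
  rw [BMop, neg_add, neg_neg]

end UnstableManifold

end Neumann

/-! ### The expansions of the splitting matrix -/

section Expansion

variable {d : ℕ} {S : ForcedPendulum d}

lemma lamSer_eq : lamSer S = PowerSeries.X * PowerSeries.C (fun _ : ℝ => ((S.g ^ 2 : ℝ) : ℂ)) := by
  ext n t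
  rw [lamSer, famSer, PowerSeries.coeff_mk, coefC_eps, PowerSeries.coeff_mul_C,
    PowerSeries.coeff_X]
  split_ifs <;> simp

lemma coeff_lamSer_mul (F : TSer) (ℓ : ℕ) : PowerSeries.coeff ℓ (lamSer S * F) =
    lamMul S.g (fun r => PowerSeries.coeff r F) ℓ := by
  rw [lamSer_eq, mul_assoc]
  cases ℓ with
  | zero => rw [PowerSeries.coeff_zero_X_mul]; rfl
  | succ ℓ =>
    rw [PowerSeries.coeff_succ_X_mul, PowerSeries.coeff_C_mul]
    rfl

lemma coeff_psInt_lamSer_mul {F : TSer} (hF : F ∈ TwoSidedSer) (ℓ : ℕ) (t : ℝ) :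
    PowerSeries.coeff ℓ (psInt (lamSer S * F)) t =
      lamMul S.g (fun r => finInt t (PowerSeries.coeff r F)) ℓ := by
  rw [psInt, PowerSeries.coeff_mk, coeff_lamSer_mul]
  cases ℓ with
  | zero => exact finInt_zero t
  | succ ℓ => exact finInt_smul (hF ℓ) _ t

namespace UnstableManifold

variable (U : UnstableManifold S)

lemma slice_mainIntegrand (a b : Fin d) : slice 0 U.mainIntegrand a b =
    lamSer S * famSer 0 (dirD (dirTheta b) (U.gradFam a.succ)) := by
  rw [← slice_dThetaFu]
  ext ℓ t
  rw [coeff_slice, coeff_lamSer_mul, mainIntegrand]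
  cases ℓ with
  | zero => rfl
  | succ ℓ =>
    simp only [lamMul, Pi.smul_apply, Matrix.smul_apply, coeff_slice]

lemma mainIntegral_apply (ℓ : ℕ) (t : ℝ) (a b : Fin d) : U.mainIntegral ℓ a b =
    PowerSeries.coeff ℓ (psLine (lamSer S * famSer 0 (dirD (dirTheta b) (U.gradFam a.succ)))) t := by
  rw [mainIntegral, U.trigSer_mainIntegrand.lineRegIntegral_apply, slice_mainIntegrand, psLine,
    constSer, PowerSeries.coeff_mk]

lemma tailIntegral_apply {n : Type} {h : Ser d (Fin (d + 1)) n} (hh : TrigSer h) (ℓ : ℕ) (t : ℝ)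
    (a : Fin d) (b : n) : U.tailIntegral h ℓ t 0 a b = finInt t (PowerSeries.coeff ℓ
      ((slice 0 (series U.fs) * slice 0 (U.neumannSum h)) a b)) := by
  rw [tailIntegral, (U.trigSer_tailIntegrand hh).matRegIntegral_apply, tailIntegrand, slice_mul]

/-- The family `∂_θ Y^u_Ψ`. -/
def velFam (a b : Fin d) : Par d → ℝ := dirD (dirTheta b) (dirD dirTime (U.XFam a.succ))

lemma slicefs_mul_mem {n : Type} {h : Ser d (Fin (d + 1)) n} (hh : TrigSer h) (a : Fin d) (b : n) :
    (slice 0 (series U.fs) * slice 0 (U.neumannSum h)) a b ∈ TwoSidedSer := by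
  rw [← slice_mul]
  exact (U.trigSer_tailIntegrand hh).slice_mem 0 a b

/-- The variation of the velocities of the rotators is a primitive of `λ ∂_θ ∂_ψ f`. The difference
between this source and its time reversal is `λ f_{ψφ} W`, and `W = -∑_l (B M^s)^l ℰ`. -/
theorem coeff_velFam (ℓ : ℕ) (t : ℝ) (a b : Fin d) :
    PowerSeries.coeff ℓ (famSer 0 (U.velFam a b) + psRefl (famSer 0 (U.velFam a b))) t =
      U.neumannExpansion t ℓ a b := by
  have h1 := (U.flowPrimitive_velocity a).psInt_mul_sub_of_even b 0
    (psRefl_famSer_even fun _ _ => rfl)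
  have h2 := U.slicefs_mul_mem U.trigSer_E a b
  rw [grad_sub_refl, splitSer_eq_neumannSum, Matrix.mul_neg, Matrix.neg_apply, mul_neg, psInt_neg
    (TwoSidedSer.mul_mem (famSer_mem 0 (TimeFam.le_trigFam (U.flowPrimitive_velocity a).time)) h2),
    eq_sub_iff_add_eq, ← eq_sub_iff_add_eq', sub_neg_eq_add] at h1
  have h3 := congrFun (congrArg (PowerSeries.coeff ℓ) h1) t
  refine h3.trans ?_
  rw [map_add, Pi.add_apply]
  refine (congrArg₂ (· + ·) (U.mainIntegral_apply ℓ t a b).symm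
    (coeff_psInt_lamSer_mul h2 ℓ t)).trans ?_
  rw [neumannExpansion, Pi.add_apply, Matrix.add_apply]
  congr 1
  cases ℓ with
  | zero => rfl
  | succ ℓ =>
    simp only [lamMul, Matrix.smul_apply, U.tailIntegral_apply U.trigSer_E]

lemma Delta_apply {ε : ℝ} (hε : |ε| < U.ε₀) (t : ℝ) (θ : Fin d → ℝ) (a : Fin d) :
    U.Delta ε t θ a = dirD dirTime (U.XFam a.succ) (ε, t, θ) -
      dirD dirTime (U.XFam a.succ) (ε, -t, -θ) := by
  have h1 := U.hasDerivAt_XFam a.succ hε t θ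
  have h2 : HasDerivAt (fun s => U.Xs ε s θ a.succ)
      (dirD dirTime (U.XFam a.succ) (ε, -t, -θ)) t := by
    have h3 : (fun s => U.Xs ε s θ a.succ) = fun s => -U.XFam a.succ (ε, -s, -θ) := by
      ext s
      simp [Xs, XFam]
    rw [h3]
    exact ((U.hasDerivAt_XFam a.succ hε (-t) (-θ)).scomp t (hasDerivAt_neg t)).neg.congr_deriv
      (by simp)
  rw [Delta, h2.deriv]
  exact congrArg (· - _) h1.deriv

/-- `∂_θ Y^s_Ψ` at `θ = 0` is minus the time reversal of `∂_θ Y^u_Ψ`. -/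
lemma Upsilon_apply {ε : ℝ} (hε : |ε| < U.ε₀) (t : ℝ) (a b : Fin d) :
    U.Upsilon ε t a b = U.velFam a b (ε, t, 0) + U.velFam a b (ε, -t, 0) := by
  have hd : ∀ t θ, DifferentiableAt ℝ (dirD dirTime (U.XFam a.succ)) (ε, t, θ) := fun t θ =>
    (AnalyticAt.dirD (U.XFam_analyticAt a.succ hε t θ) dirTime).differentiableAt
  have h1 := pd_slice_theta (hd t 0) b
  have h2 := pd_slice_theta (hd (-t) 0) b
  have h3 := pd_neg_arg (F := fun θ => dirD dirTime (U.XFam a.succ) (ε, -t, -θ))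
    (G := fun θ => dirD dirTime (U.XFam a.succ) (ε, -t, θ)) (c := 1)
    (fun θ => by rw [neg_neg, one_mul]) (fun θ => (pd_slice_theta (hd (-t) θ) b).1) b 0
  rw [neg_zero, one_mul, h2.2] at h3
  have h4 : DifferentiableAt ℝ (fun θ => dirD dirTime (U.XFam a.succ) (ε, -t, -θ)) 0 := by
    have h5 := h2.1
    rw [← neg_zero] at h5
    exact DifferentiableAt.comp (f := fun θ : Fin d → ℝ => -θ) 0 h5 (by fun_prop)
  rw [Upsilon, Matrix.of_apply, show (fun θ => U.Delta ε t θ a) = _ from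
    funext fun θ => U.Delta_apply hε t θ a, pd, fderiv_fun_sub h1.1 h4, sub_apply]
  change pd _ b 0 - pd _ b 0 = _
  rw [h1.2, h3, sub_neg_eq_add]
  rfl

/-- A power series with the right coefficients is the expansion of the splitting matrix. -/
lemma isSplittingExpansion_of_coeff {t : ℝ} {A : ℕ → Matrix (Fin d) (Fin d) ℂ}
    (hA : ∀ ℓ, A ℓ = U.neumannExpansion t ℓ) : U.IsSplittingExpansion t A := by
  intro a b
  have hvel : AnalyticFam (U.velFam a b) := ((U.XFam_analyticFam a.succ).dirD _).dirD _
  have hev : (fun ε => U.Upsilon ε t a b) =ᶠ[𝓝 0]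
      fun ε => U.velFam a b (ε, t, 0) + U.velFam a b (ε, -t, 0) := by
    have hop : IsOpen {ε : ℝ | |ε| < U.ε₀} := isOpen_lt (by fun_prop) continuous_const
    filter_upwards [hop.mem_nhds U.abs_zero_lt] with ε hε
    exact U.Upsilon_apply hε t a b
  have han := ((hvel.slice t 0).add (hvel.slice (-t) 0)).congr hev.symm
  have hcoef : ∀ ℓ, ((taylorCoeff (fun ε => U.Upsilon ε t a b) ℓ : ℝ) : ℂ) = A ℓ a b := by
    intro ℓ
    rw [hA, ← U.coeff_velFam, taylorCoeff_congr hev, taylorCoeff_add (hvel.slice t 0)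
      (hvel.slice (-t) 0), map_add, Pi.add_apply, coeff_psRefl, Complex.ofReal_add]
    simp [famSer, coefC, coef]
  refine ⟨han, hcoef, ?_⟩
  simp_rw [← hcoef]
  exact isAsymptoticExpansion_taylor han

end UnstableManifold

end Expansion

/-! ### The factorized expansion -/

section Factorization

variable {d : ℕ} {m n k : Type}

/-- The triples `(i, p, j)` of the factorized expansion. -/
def kernelIdx : Finset (ℕ × ℕ × ℕ) :=
  {(0, 0, 1), (0, 0, 2), (1, 0, 1), (1, 0, 2), (1, 1, 1), (1, 1, 2)}

lemma sum_kernelIdx {V : Type*} [AddCommMonoid V] (f : ℕ → ℕ → ℕ → V) :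
    ∑ i ∈ Finset.range 2, ∑ p ∈ Finset.range (i + 1), ∑ j ∈ Finset.Icc 1 2, f i p j =
      ∑ x ∈ kernelIdx, f x.1 x.2.1 x.2.2 := by
  have h2 : Finset.Icc 1 2 = {1, 2} := by decide
  simp [kernelIdx, Finset.sum_range_succ, h2, add_assoc]

lemma mem_kernelIdx {x : ℕ × ℕ × ℕ} (hx : x ∈ kernelIdx) :
    x.1 ≤ 1 ∧ 1 ≤ x.2.2 ∧ x.2.2 ≤ 2 := by
  simp only [kernelIdx, Finset.mem_insert, Finset.mem_singleton] at hx
  rcases hx with rfl | rfl | rfl | rfl | rfl | rfl <;> simp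

/-- The powers of `t - τ` in the kernel expand into products of a function of `t` and a function
of `τ`. -/
lemma kernel_mul_eq_sum (γ t τ : ℝ) (D : Matrix (Fin (d + 1)) n ℝ) :
    UnstableManifold.kernel d γ t τ * D = ∑ x ∈ kernelIdx,
      (t ^ x.2.1 • UnstableManifold.Kij d γ x.1 x.2.2 t) *
        ((-τ) ^ (x.1 - x.2.1) • (UnstableManifold.Kbar d γ x.1 x.2.2 τ * D)) := by
  have h2 : Finset.Icc 1 2 = {1, 2} := by decide
  simp only [UnstableManifold.kernel, kernelIdx, Finset.sum_range_succ, Finset.range_zero,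
    Finset.sum_empty, h2, Finset.sum_pair (show (1 : ℕ) ≠ 2 by decide), Prod.mk.injEq,
    Finset.mem_insert, Finset.mem_singleton, Finset.sum_singleton, Finset.sum_insert, zero_ne_one,
    OfNat.one_ne_ofNat, and_false, or_false, not_false_eq_true, and_true, OfNat.ofNat_ne_one,
    zero_add, pow_zero, one_smul, pow_one, tsub_zero, tsub_self, Matrix.add_mul, Matrix.smul_mul,
    Matrix.mul_smul, sub_smul, neg_smul, Matrix.mul_assoc, Matrix.sub_mul]
  abel

lemma slice_series_mul [Fintype k] (θ : Fin d → ℝ) {F : ℝ → ℝ → (Fin d → ℝ) → Matrix m k ℝ}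
    {G : ℝ → ℝ → (Fin d → ℝ) → Matrix k n ℝ}
    (hF : ∀ a b, AnalyticFam fun p : Par d => F p.1 p.2.1 p.2.2 a b)
    (hG : ∀ a b, AnalyticFam fun p : Par d => G p.1 p.2.1 p.2.2 a b) :
    slice θ (series fun ε t θ => F ε t θ * G ε t θ) = slice θ (series F) * slice θ (series G) := by
  ext1 a b
  rw [Matrix.mul_apply, slice_series]
  simp_rw [slice_series, ← famSer_mul θ (hF _ _) (hG _ _)]
  rw [← famSer_sum θ _ fun j _ => (hF a j).mul (hG j b)]
  refine famSer_congr θ fun t => Eventually.of_forall fun ε => ?_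
  simp [Matrix.mul_apply, Finset.sum_apply]

lemma slice_series_sum {ι : Type*} (s : Finset ι) (θ : Fin d → ℝ)
    {F : ι → ℝ → ℝ → (Fin d → ℝ) → Matrix m n ℝ}
    (hF : ∀ i ∈ s, ∀ a b, AnalyticFam fun p : Par d => F i p.1 p.2.1 p.2.2 a b) :
    slice θ (series fun ε t θ => ∑ i ∈ s, F i ε t θ) = ∑ i ∈ s, slice θ (series (F i)) := by
  ext1 a b
  rw [Matrix.sum_apply, slice_series]
  simp_rw [slice_series]
  rw [← famSer_sum θ _ fun i hi => hF i hi a b]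
  refine famSer_congr θ fun t => Eventually.of_forall fun ε => ?_
  simp [Matrix.sum_apply, Finset.sum_apply]

lemma psLine_sum {ι : Type*} (s : Finset ι) (F : ι → TSer) (hF : ∀ i ∈ s, F i ∈ TwoSidedSer) :
    psLine (∑ i ∈ s, F i) = ∑ i ∈ s, psLine (F i) := by
  ext n t
  simp only [psLine, constSer, map_sum, PowerSeries.coeff_mk, Finset.sum_apply]
  exact finLine_sum s _ fun i hi => hF i hi n

variable {S : ForcedPendulum d}

namespace UnstableManifold

variable (U : UnstableManifold S)

/-- The separation of the variables `t` and `τ` in the integrand of `ℰ`, at the level of power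
series in `ε`. -/
lemma slice_EIntegrand (t : ℝ) : slice 0 (U.EIntegrand t) = ∑ x ∈ kernelIdx,
    constMat (fun ℓ => U.Kp x.1 x.2.2 x.2.1 ℓ t 0) *
      slice 0 (U.EpIntegrand x.1 x.2.2 x.2.1) := by
  have hK : ∀ x ∈ kernelIdx, ∀ α β, (fun p : Par d =>
      (t ^ x.2.1 • Kij d (U.γ p.1) x.1 x.2.2 t) α β) ∈ TimeFam d := fun x hx α β =>
    (TimeFam d).smul_mem (TimeFam.freeze
      (U.Kij_mem (mem_kernelIdx hx).1 (mem_kernelIdx hx).2.1 (mem_kernelIdx hx).2.2 α β) t) _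
  have hE : ∀ x ∈ kernelIdx, ∀ α b, AnalyticFam fun p : Par d => ((-p.2.1) ^ (x.1 - x.2.1) •
      (Kbar d (U.γ p.1) x.1 x.2.2 p.2.1 * U.dThetaAu p.1 p.2.1 p.2.2)) α b := fun x hx α b =>
    (U.EpFam_mem (mem_kernelIdx hx).1 (mem_kernelIdx hx).2.1 (mem_kernelIdx hx).2.2 x.2.1 α b).1
  rw [EIntegrand, kernelMul, slice_mul, ← slice_series_mul 0 (fun α β => (U.kernel_mem t α β).1)
    fun α b => (U.dThetaAu_mem α b).1]
  simp_rw [kernel_mul_eq_sum]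
  rw [slice_series_sum]
  · refine Finset.sum_congr rfl fun x hx => ?_
    rw [slice_series_mul (F := fun ε _ _ => t ^ x.2.1 • Kij d (U.γ ε) x.1 x.2.2 t) 0
      (fun α β => (hK x hx α β).1) (hE x hx)]
    rfl
  · intro x hx α b
    have h1 : AnalyticFam (∑ β, (fun p : Par d => (t ^ x.2.1 • Kij d (U.γ p.1) x.1 x.2.2 t) α β) *
        fun p : Par d => ((-p.2.1) ^ (x.1 - x.2.1) •
          (Kbar d (U.γ p.1) x.1 x.2.2 p.2.1 * U.dThetaAu p.1 p.2.1 p.2.2)) β b) := by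
      have h2 : ∀ β ∈ Finset.univ, _ ∈ TrigFam d := fun β _ => (TrigFam d).mul_mem
        (TimeFam.le_trigFam (hK x hx α β)) (U.EpFam_mem (mem_kernelIdx hx).1
          (mem_kernelIdx hx).2.1 (mem_kernelIdx hx).2.2 x.2.1 β b)
      exact ((TrigFam d).sum_mem h2).1
    convert h1 using 1
    ext p
    simp [Matrix.mul_apply, Finset.sum_apply]

/-- The separation of the variables `t` and `τ` in `ℰ` on the homoclinic trajectory. -/
lemma slice_E_eq_sum : slice 0 U.E = ∑ x ∈ kernelIdx,
    slice 0 (U.Kp x.1 x.2.2 x.2.1) * constMat (U.Ep x.1 x.2.2 x.2.1) := by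
  ext α b ℓ t
  have hm : ∀ x ∈ kernelIdx, TrigSer (U.EpIntegrand x.1 x.2.2 x.2.1) := fun x hx =>
    U.trigSer_EpIntegrand (mem_kernelIdx hx).1 (mem_kernelIdx hx).2.1 (mem_kernelIdx hx).2.2 _
  have h1 : psLine (slice 0 (U.EIntegrand t) α b) = ∑ x ∈ kernelIdx, ∑ β,
      constSer (fun ℓ => U.Kp x.1 x.2.2 x.2.1 ℓ t 0 α β) *
        psLine (slice 0 (U.EpIntegrand x.1 x.2.2 x.2.1) β b) := by
    rw [slice_EIntegrand, Matrix.sum_apply]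
    simp_rw [Matrix.mul_apply]
    have h2 : ∀ x ∈ kernelIdx, ∀ β, constMat (fun ℓ => U.Kp x.1 x.2.2 x.2.1 ℓ t 0) α β *
        slice 0 (U.EpIntegrand x.1 x.2.2 x.2.1) β b ∈ TwoSidedSer := fun x hx β =>
      TwoSidedSer.mul_mem (constMat_mem _ α β) ((hm x hx).slice_mem 0 β b)
    rw [psLine_sum _ _ fun x hx => TwoSidedSer.sum_mem fun β _ => h2 x hx β]
    refine Finset.sum_congr rfl fun x hx => ?_
    rw [psLine_sum _ _ fun β _ => h2 x hx β]
    exact Finset.sum_congr rfl fun β _ => psLine_constSer_mul _ ((hm x hx).slice_mem 0 β b)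
  have h3 : PowerSeries.coeff ℓ (slice 0 U.E α b) t =
      -PowerSeries.coeff ℓ (psLine (slice 0 (U.EIntegrand t) α b)) t := by
    rw [coeff_slice, E, Matrix.neg_apply, (U.trigSer_EIntegrand t).lineRegIntegral_apply, psLine,
      constSer, PowerSeries.coeff_mk]
  rw [h3, h1, Matrix.sum_apply, map_sum, map_sum, Finset.sum_apply, Finset.sum_apply,
    ← Finset.sum_neg_distrib]
  refine Finset.sum_congr rfl fun x hx => ?_
  rw [Matrix.mul_apply, map_sum, map_sum, Finset.sum_apply, Finset.sum_apply,
    ← Finset.sum_neg_distrib]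
  refine Finset.sum_congr rfl fun β _ => ?_
  rw [PowerSeries.coeff_mul, PowerSeries.coeff_mul, Finset.sum_apply, Finset.sum_apply,
    ← Finset.sum_neg_distrib]
  refine Finset.sum_congr rfl fun y _ => ?_
  rw [Pi.mul_apply, Pi.mul_apply, coeff_slice]
  simp only [constSer, constMat, psLine, PowerSeries.coeff_mk, Matrix.of_apply, Ep,
    Matrix.neg_apply, (hm x hx).lineRegIntegral_apply, mul_neg]

lemma BMop_sum {ι : Type*} (s : Finset ι) (H : ι → Matrix (Fin (d + 1)) n TSer)
    (hH : ∀ i ∈ s, ∀ a b, H i a b ∈ TwoSidedSer) :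
    U.BMop (∑ i ∈ s, H i) = ∑ i ∈ s, U.BMop (H i) := by
  classical
  induction s using Finset.induction_on with
  | empty => exact U.BMop_zero
  | insert i s hi ih =>
    rw [Finset.sum_insert hi, Finset.sum_insert hi, U.BMop_add
      (hH i (Finset.mem_insert_self i s)) (fun a b => ?_),
      ih fun j hj => hH j (Finset.mem_insert_of_mem hj)]
    rw [Matrix.sum_apply]
    exact TwoSidedSer.sum_mem fun j hj => hH j (Finset.mem_insert_of_mem hj) a b

/-- The Neumann series of `ℰ` factorizes on the homoclinic trajectory. -/
lemma slice_neumannSum_E : slice 0 (U.neumannSum U.E) = ∑ x ∈ kernelIdx,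
    slice 0 (U.neumannSum (U.Kp x.1 x.2.2 x.2.1)) * constMat (U.Ep x.1 x.2.2 x.2.1) := by
  have hK : ∀ x ∈ kernelIdx, TrigSer (U.Kp x.1 x.2.2 x.2.1) := fun x hx =>
    U.trigSer_Kp (mem_kernelIdx hx).1 (mem_kernelIdx hx).2.1 (mem_kernelIdx hx).2.2 _
  have hN : ∀ x ∈ kernelIdx, ∀ a b, slice 0 (U.neumannSum (U.Kp x.1 x.2.2 x.2.1)) a b ∈
      TwoSidedSer := fun x hx => (U.trigSer_neumannSum (hK x hx)).slice_mem 0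
  refine (U.eq_neumannSum_of_fixed U.trigSer_E (fun a b => ?_) ?_).symm
  · rw [Matrix.sum_apply]
    exact TwoSidedSer.sum_mem fun x hx => mul_constMat_mem (hN x hx) _ a b
  -- By uniqueness it suffices that the factorized sum solves the equation, which holds because
  -- `B M^s` commutes with multiplication by constant matrices.
  · rw [U.BMop_sum _ _ fun x hx => mul_constMat_mem (hN x hx) _, slice_E_eq_sum,
      ← Finset.sum_add_distrib]
    refine Finset.sum_congr rfl fun x hx => ?_
    rw [U.BMop_mul_constMat (hN x hx), ← Matrix.add_mul, ← U.neumannSum_fixed (hK x hx)]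

/-- The factors `ℰ_{ij}^p` do not depend on time and can be taken out of the tail integral. -/
theorem tailIntegral_E (ℓ : ℕ) (t : ℝ) : U.tailIntegral U.E ℓ t 0 =
    ∑ x ∈ kernelIdx, cauchyMul (U.c x.1 x.2.2 x.2.1 t) (U.Ep x.1 x.2.2 x.2.1) ℓ := by
  have hK : ∀ x ∈ kernelIdx, TrigSer (U.Kp x.1 x.2.2 x.2.1) := fun x hx =>
    U.trigSer_Kp (mem_kernelIdx hx).1 (mem_kernelIdx hx).2.1 (mem_kernelIdx hx).2.2 _
  ext a b
  have hm : ∀ x ∈ kernelIdx, ∀ a b, (slice 0 (series U.fs) *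
      slice 0 (U.neumannSum (U.Kp x.1 x.2.2 x.2.1))) a b ∈ TwoSidedSer := fun x hx =>
    U.slicefs_mul_mem (hK x hx)
  have h1 : psInt ((slice 0 (series U.fs) * slice 0 (U.neumannSum U.E)) a b) =
      ∑ x ∈ kernelIdx, (Matrix.of (fun a j => psInt ((slice 0 (series U.fs) *
        slice 0 (U.neumannSum (U.Kp x.1 x.2.2 x.2.1))) a j)) *
          constMat (U.Ep x.1 x.2.2 x.2.1)) a b := by
    rw [slice_neumannSum_E, Matrix.mul_sum, Matrix.sum_apply]
    simp_rw [← Matrix.mul_assoc]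
    rw [psInt_sum _ _ fun x hx => mul_constMat_mem (hm x hx) _ a b]
    refine Finset.sum_congr rfl fun x hx => ?_
    have := psInt_mul_constMat (hm x hx) (U.Ep x.1 x.2.2 x.2.1) 1 TwoSidedSer.one_mem a b
    simpa only [one_mul] using this
  have h2 := congrFun (congrArg (PowerSeries.coeff ℓ) h1) t
  rw [psInt, PowerSeries.coeff_mk] at h2
  rw [U.tailIntegral_apply U.trigSer_E, h2, map_sum, Finset.sum_apply, Matrix.sum_apply]
  refine Finset.sum_congr rfl fun x hx => ?_
  rw [coeff_mul_constMat]
  congr 2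
  ext r a j
  rw [c, U.tailIntegral_apply (hK x hx)]
  simp only [Matrix.of_apply, psInt, PowerSeries.coeff_mk]

lemma splittingExpansion_eq (t : ℝ) (ℓ : ℕ) :
    U.splittingExpansion t ℓ = U.neumannExpansion t ℓ := by
  rw [splittingExpansion, neumannExpansion, Pi.add_apply, Pi.add_apply, sum_kernelIdx
    fun i p j => cauchyMul (U.c i j p t) (U.Ep i j p)]
  congr 2
  ext1 ℓ
  rw [tailIntegral_E, Finset.sum_apply]

end UnstableManifold

end Factorization

end HomoclinicSplitting

end

theorem mainTheorem4 (d : ℕ) (S : HomoclinicSplitting.ForcedPendulum d)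
    (U : HomoclinicSplitting.UnstableManifold S) :
    (∀ ℓ θ, HomoclinicSplitting.LineRegIntegrable (U.mainIntegrand ℓ) θ) ∧
    (∀ i p j : ℕ, i ≤ 1 → p ≤ i → 1 ≤ j → j ≤ 2 →
      (∀ ℓ θ, HomoclinicSplitting.LineRegIntegrable (U.EpIntegrand i j p ℓ) θ) ∧
      U.NeumannWellDefined (U.Kp i j p)) ∧
    ((∀ t ℓ θ, HomoclinicSplitting.LineRegIntegrable (U.EIntegrand t ℓ) θ) ∧
      U.NeumannWellDefined U.E) ∧
    (∀ t : ℝ, U.IsSplittingExpansion t (U.neumannExpansion t)) ∧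
    (∀ t : ℝ, U.IsSplittingExpansion t (U.splittingExpansion t)) :=
  ⟨U.trigSer_mainIntegrand.lineRegIntegrable,
    fun _ p _ hi _ hj hj' => ⟨(U.trigSer_EpIntegrand hi hj hj' p).lineRegIntegrable,
      U.neumannWellDefined (U.trigSer_Kp hi hj hj' p)⟩,
    ⟨fun t => (U.trigSer_EIntegrand t).lineRegIntegrable, U.neumannWellDefined U.trigSer_E⟩,
    fun _ => U.isSplittingExpansion_of_coeff fun _ => rfl,
    fun t => U.isSplittingExpansion_of_coeff (U.splittingExpansion_eq t)⟩
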